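/- Let $(X,\Sigma,\mu)$ be a $\sigma$-finite measure space, let $D,N\in\mathbb{N}_0$, and let $\mathfrak{H}=\mathbb{C}^D\otimes\mathcal{F}$, where $\mathcal{F}=\bigoplus_{n\ge 0}S_nL^2(X)^{\otimes n}$ is the bosonic Fock space over $L^2(X)$ with vacuum $\Omega$, with creation and annihilation operators $a^*(h),a(h)$ for $h\in L^2(X)$ and second quantization $\mathrm{d}\Gamma(\omega)$. Assume that * $\omega:X\to\mathbb{R}$ is measurable and $\omega\ge m$ almost everywhere for some $m>0$; * $f_1,\dots,f_N:X\to\mathbb{C}$ are measurable and $g_j:=f_j/\omega\in L^2(X)$ for all $j$; * $K=K^*\in\mathbb{C}^{D\times D}$, and $B_1,\dots,B_N\in\mathbb{C}^{D\times D}$ satisfy $[B_j,B_{j'}]=0$ for all $j,j'$; * $(e_\ell)_\ell$ is an orthonormal basis of $L^2(X)$ contained in $\mathrm{Dom}(\omega)$, whose linear span is a form core of the multiplication operator $\omega$, i.e. for every $\varphi\in L^2(X)$ with $\omega^{1/2}\varphi\in L^2(X)$ and every $\varepsilon>0$ there is $\chi\in\mathrm{Span}\{e_\ell\}$ with $\|\omega^{1/2}(\varphi-\chi)\|<\varepsilon$;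 * for each $\Lambda\in\mathbb{N}$ and each $j$, $f_{j,\Lambda}\in L^2(X)$, and $f_{j,\Lambda}/\omega\to f_j/\omega$ in $L^2(X)$ as $\Lambda\to\infty$, for each $j$. The renormalized Hamiltonian $H$ is constructed as follows. Let $T=\mathrm{e}^{B}=\sum_{n\ge 0}B^n/n!$ (defined sector by sector) with $B=-\sum_jB_ja^*(g_j)$, let $\mathcal{D}$ be the span of the vectors $a^*(e_{\ell_1})\cdots a^*(e_{\ell_n})T(v\otimes\Omega)$ with $n\in\mathbb{N}_0$ and $v\in\mathbb{C}^D$, and let $\hat a_\ell=a(e_\ell)+\sum_jB_j\langle e_\ell,g_j\rangle$. These vectors lie in $\mathfrak{H}$, and $$H_0=\sum_{\ell,\ell'}\langle e_\ell,\omega e_{\ell'}\rangle\,\hat a_\ell^*\hat a_{\ell'}+K$$ is well-defined on $\mathcal{D}$ (the double series converges unconditionally in norm), densely defined, symmetric and bounded from below; $H$ is its Friedrichs extension, which is self-adjoint. Define $$H_\Lambda=K+\mathrm{d}\Gamma(\omega)+\sum_{j=1}^N\big(B_ja^*(f_{j,\Lambda})+B_j^*a(f_{j,\Lambda})\big),\qquad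 E_\Lambda=-\sum_{j,j'=1}^NB_j^*B_{j'}\int_X\frac{\overline{f_{j,\Lambda}}\,f_{j',\Lambda}}{\omega}\,\mathrm{d}\mu .$$ Then the operators $H_\Lambda-E_\Lambda$ are self-adjoint and converge to $H$ in the norm resolvent sense as $\Lambda\to\infty$: for every $z\in\mathbb{C}\setminus\mathbb{R}$, $\|(H_\Lambda-E_\Lambda-z)^{-1}-(H-z)^{-1}\|\to 0$. -/

import Mathlib

open MeasureTheory Filter Topology
open scoped InnerProductSpace ComplexConjugate

noncomputable section

namespace SpinBoson

/-! ### The Hilbert space `ℂ^d ⊗ 𝓕(L²(X, μ))`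

The `n`-boson sector `ℂ^d ⊗ S_n L²(X)^{⊗ n}` is realised as the space of permutation symmetric,
square integrable functions `X^n → ℂ^d`. -/

section Space

variable {X : Type*} [MeasurableSpace X]

/-- The spin space `ℂ^d`. -/
abbrev Spin (d : ℕ) : Type := EuclideanSpace ℂ (Fin d)

/-- The `n`-fold product measure on `X^n`. -/
abbrev powMeasure (μ : Measure X) (n : ℕ) : Measure (Fin n → X) := Measure.pi fun _ => μ

variable (μ : Measure X) [SigmaFinite μ]

theorem measurePreserving_perm (n : ℕ) (σ : Equiv.Perm (Fin n)) :
    MeasurePreserving (fun k : Fin n → X => k ∘ σ) (powMeasure μ n) (powMeasure μ n) := by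
  have h := measurePreserving_piCongrLeft (α := fun _ : Fin n => X) (fun _ => μ) σ.symm
  convert h using 1
  ext k i
  have := MeasurableEquiv.piCongrLeft_apply_apply (β := fun _ : Fin n => X) σ.symm k (σ i)
  simpa using this.symm

/-- Permutation symmetric functions in `L²(X^n; ℂ^d)`. -/
def Sector (d n : ℕ) : Submodule ℂ (Lp (Spin d) 2 (powMeasure μ n)) where
  carrier := {ψ | ∀ σ : Equiv.Perm (Fin n),
    Lp.compMeasurePreserving (fun k => k ∘ σ) (measurePreserving_perm μ n σ) ψ = ψ}
  zero_mem' σ := map_zero _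
  add_mem' ha hb σ := by rw [map_add, ha σ, hb σ]
  smul_mem' c ψ h σ := by
    have := (Lp.compMeasurePreservingₗ ℂ (fun k => k ∘ σ) (measurePreserving_perm μ n σ)
      (E := Spin d) (p := 2)).map_smul c ψ
    exact this.trans (congrArg (c • ·) (h σ))

theorem isClosed_sector (d n : ℕ) :
    IsClosed (Sector μ d n : Set (Lp (Spin d) 2 (powMeasure μ n))) := by
  have : (Sector μ d n : Set (Lp (Spin d) 2 (powMeasure μ n))) = ⋂ σ : Equiv.Perm (Fin n),
      {ψ | Lp.compMeasurePreserving (fun k => k ∘ σ) (measurePreserving_perm μ n σ) ψ = ψ} := by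
    ext ψ; rw [Set.mem_iInter]; rfl
  rw [this]
  exact isClosed_iInter fun σ =>
    isClosed_eq (Lp.isometry_compMeasurePreserving _).continuous continuous_id

instance instCompleteSpaceSector (d n : ℕ) : CompleteSpace (Sector μ d n) :=
  (isClosed_sector μ d n).completeSpace_coe

/-- Arbitrary sequences of `n`-boson components, without the condition of square summability. -/
abbrev Formal (d : ℕ) : Type _ := ∀ n, Sector μ d n

/-- The Hilbert space `ℂ^d ⊗ 𝓕`: the Hilbert sum of the `n`-boson sectors. -/
abbrev Fock (d : ℕ) : Type _ := lp (fun n => Sector μ d n) 2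

/-- The vector `v ⊗ Ω`, with `Ω` the vacuum. -/
def vacuum (d : ℕ) (v : Spin d) : Formal μ d :=
  Pi.single 0 ⟨MemLp.toLp (fun _ => v) (by
      have : IsFiniteMeasure (powMeasure μ 0) := by
        rw [powMeasure, Measure.pi_of_empty]; infer_instance
      exact memLp_const v), fun σ => by
    rw [Lp.toLp_compMeasurePreserving]; rfl⟩

end Space

/-! ### Operators acting sector by sector -/

section Formal

variable {X : Type*} [MeasurableSpace X] {μ : Measure X} [SigmaFinite μ] {d : ℕ}

/-- The matrix `M` acting on the spin variable, on the `n`-boson sector. -/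
def matSector (M : Matrix (Fin d) (Fin d) ℂ) (n : ℕ) : Sector μ d n →ₗ[ℂ] Sector μ d n :=
  ((((Matrix.toEuclideanCLM (n := Fin d) (𝕜 := ℂ) M).compLpL 2 (powMeasure μ n)) :
    Lp (Spin d) 2 (powMeasure μ n) →ₗ[ℂ] Lp (Spin d) 2 (powMeasure μ n))).restrict
    (fun ψ hψ σ => by
      set L := Matrix.toEuclideanCLM (n := Fin d) (𝕜 := ℂ) M
      have hσ := measurePreserving_perm μ n σ
      refine Lp.ext ?_
      refine (Lp.coeFn_compMeasurePreserving _ hσ).trans ?_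
      have h1 := L.coeFn_compLpL (p := 2) (μ := powMeasure μ n) ψ
      have h2 := hσ.quasiMeasurePreserving.ae_eq_comp h1
      refine h2.trans ?_
      have h3 := Lp.coeFn_compMeasurePreserving ψ hσ
      rw [hψ σ] at h3
      filter_upwards [h3, h1] with k hk hk1
      change L (ψ (k ∘ σ)) = (L.compLpL 2 (powMeasure μ n) ψ) k
      rw [hk1, hk]; rfl)

/-- The operator `M ⊗ 1`. -/
def mat (M : Matrix (Fin d) (Fin d) ℂ) : Formal μ d →ₗ[ℂ] Formal μ d :=
  LinearMap.pi fun n => (matSector M n).comp (LinearMap.proj n)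

theorem eLpNorm_tensorLeft (f : Lp ℂ 2 μ) {n : ℕ} (ψ : Lp (Spin d) 2 (powMeasure μ n)) :
    eLpNorm (fun p : X × (Fin n → X) => f p.1 • ψ p.2) 2 (μ.prod (powMeasure μ n))
      = eLpNorm f 2 μ * eLpNorm ψ 2 (powMeasure μ n) := by
  simp only [eLpNorm_eq_lintegral_rpow_enorm_toReal (p := 2) (by simp) (by simp), enorm_smul,
    ENNReal.toReal_ofNat]
  rw [← ENNReal.mul_rpow_of_nonneg _ _ (by norm_num)]
  congr 1
  rw [← lintegral_prod_mul]
  · simp only [ENNReal.mul_rpow_of_nonneg _ _ (zero_le_two (α := ℝ))]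
  · exact (Lp.aestronglyMeasurable f).enorm.pow_const _
  · exact (Lp.aestronglyMeasurable ψ).enorm.pow_const _

theorem memLp_tensorLeft (f : Lp ℂ 2 μ) {n : ℕ} (ψ : Lp (Spin d) 2 (powMeasure μ n)) :
    MemLp (fun p : X × (Fin n → X) => f p.1 • ψ p.2) 2 (μ.prod (powMeasure μ n)) :=
  ⟨(Lp.aestronglyMeasurable f).comp_fst.smul (Lp.aestronglyMeasurable ψ).comp_snd, by
    rw [eLpNorm_tensorLeft]
    exact ENNReal.mul_lt_top (Lp.eLpNorm_lt_top f) (Lp.eLpNorm_lt_top ψ)⟩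

/-- `ψ ↦ f ⊗ ψ`, as a function of `(x, k) ∈ X × X^n`. -/
def tensorLeft (f : Lp ℂ 2 μ) (n : ℕ) :
    Lp (Spin d) 2 (powMeasure μ n) →L[ℂ] Lp (Spin d) 2 (μ.prod (powMeasure μ n)) :=
  LinearMap.mkContinuous
    { toFun := fun ψ => (memLp_tensorLeft f ψ).toLp _
      map_add' := fun ψ φ => by
        rw [← MemLp.toLp_add]
        refine MemLp.toLp_congr _ _ ?_
        filter_upwards [Measure.quasiMeasurePreserving_snd.ae (Lp.coeFn_add ψ φ)] with p hp
        rw [hp, Pi.add_apply, smul_add, Pi.add_apply]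
      map_smul' := fun c ψ => by
        rw [RingHom.id_apply, ← MemLp.toLp_const_smul]
        refine MemLp.toLp_congr _ _ ?_
        filter_upwards [Measure.quasiMeasurePreserving_snd.ae (Lp.coeFn_smul c ψ)] with p hp
        rw [hp, Pi.smul_apply, smul_comm, Pi.smul_apply] }
    ‖f‖ fun ψ => by
      change ‖(memLp_tensorLeft f ψ).toLp _‖ ≤ _
      rw [Lp.norm_toLp, eLpNorm_tensorLeft, ENNReal.toReal_mul, Lp.norm_def, Lp.norm_def]

theorem measurePreserving_removeNth (n : ℕ) (i : Fin (n + 1)) :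
    MeasurePreserving (fun k : Fin (n + 1) → X => (k i, i.removeNth k))
      (powMeasure μ (n + 1)) (μ.prod (powMeasure μ n)) :=
  measurePreserving_piFinSuccAbove (fun _ => μ) i

/-- `ψ ↦ ((k₀, …, kₙ) ↦ f(kᵢ) ψ(k₀, …, kᵢ₋₁, kᵢ₊₁, …, kₙ))`. -/
def insertAt (f : Lp ℂ 2 μ) (n : ℕ) (i : Fin (n + 1)) :
    Lp (Spin d) 2 (powMeasure μ n) →L[ℂ] Lp (Spin d) 2 (powMeasure μ (n + 1)) :=
  (Lp.compMeasurePreservingₗᵢ ℂ _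
    (measurePreserving_removeNth n i)).toContinuousLinearMap.comp (tensorLeft f n)

theorem coeFn_insertAt (f : Lp ℂ 2 μ) (n : ℕ) (i : Fin (n + 1))
    (ψ : Lp (Spin d) 2 (powMeasure μ n)) :
    insertAt f n i ψ =ᵐ[powMeasure μ (n + 1)] fun k => f (k i) • ψ (i.removeNth k) := by
  have h := measurePreserving_removeNth (μ := μ) n i
  refine (Lp.coeFn_compMeasurePreserving (tensorLeft f n ψ) h).trans ?_
  exact h.quasiMeasurePreserving.ae_eq_comp (memLp_tensorLeft f ψ).coeFn_toLp

/-- The permutation of the remaining variables after removing the `i`-th one from `k ∘ σ`. -/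
theorem exists_removeNth_comp {X : Type*} {n : ℕ} (σ : Equiv.Perm (Fin (n + 1))) (i : Fin (n + 1)) :
    ∃ τ : Equiv.Perm (Fin n), ∀ k : Fin (n + 1) → X,
      i.removeNth (k ∘ σ) = (σ i).removeNth k ∘ τ := by
  refine ⟨((finSuccAboveEquiv i).trans (σ.subtypeEquiv fun a => by simp)).trans
    (finSuccAboveEquiv (σ i)).symm, fun k => ?_⟩
  funext a
  simp only [Fin.removeNth, Function.comp_apply, Equiv.trans_apply]
  congr 1
  have := congrArg Subtype.val ((finSuccAboveEquiv (σ i)).apply_symm_apply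
    ((σ.subtypeEquiv fun a => by simp) (finSuccAboveEquiv i a)))
  exact this.symm

/-- The creation operator `a^*(f)` from the `n`-boson to the `(n+1)`-boson sector:
`(a^*(f) ψ)(k₀, …, kₙ) = (n+1)^{-1/2} ∑ᵢ f(kᵢ) ψ(k₀, …, kᵢ₋₁, kᵢ₊₁, …, kₙ)`, that is,
`a^*(f) ψ = (n+1)^{1/2} S_{n+1} (f ⊗ ψ)`. -/
def creSector (f : Lp ℂ 2 μ) (n : ℕ) : Sector μ d n →L[ℂ] Sector μ d (n + 1) :=
  ((((Real.sqrt (n + 1))⁻¹ : ℝ) : ℂ) •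
    ((∑ i, insertAt f n i).comp (Sector μ d n).subtypeL)).codRestrict _ (fun ψ => by
      refine Submodule.smul_mem _ _ fun σ => ?_
      change Lp.compMeasurePreserving _ _ ((∑ i, insertAt f n i) ψ.1) = (∑ i, insertAt f n i) ψ.1
      rw [FunLike.coe_sum, Finset.sum_apply, map_sum]
      refine Fintype.sum_equiv σ _ _ fun i => ?_
      have hσ := measurePreserving_perm μ (n + 1) σ
      obtain ⟨τ, hτ⟩ := exists_removeNth_comp (X := X) σ i
      refine Lp.ext ?_
      refine (Lp.coeFn_compMeasurePreserving _ hσ).trans ?_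
      have h1 := hσ.quasiMeasurePreserving.ae_eq_comp
        (coeFn_insertAt f n i (ψ : Lp (Spin d) 2 (powMeasure μ n)))
      refine h1.trans (EventuallyEq.trans ?_ (coeFn_insertAt f n (σ i) _).symm)
      have h2 := Lp.coeFn_compMeasurePreserving (ψ : Lp (Spin d) 2 (powMeasure μ n))
        (measurePreserving_perm μ n τ)
      rw [ψ.2 τ] at h2
      have h3 := (Measure.quasiMeasurePreserving_snd.comp (measurePreserving_removeNth (μ := μ) n
        (σ i)).quasiMeasurePreserving).ae h2
      filter_upwards [h3] with k hk
      simp only [Function.comp_apply] at hk ⊢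
      rw [hk]
      exact congrArg (fun q => f (k (σ i)) • (ψ : Lp (Spin d) 2 (powMeasure μ n)) q) (hτ k))

/-- The creation operator `a^*(f)` (more precisely `1 ⊗ a^*(f)`). -/
def cre (f : Lp ℂ 2 μ) : Formal μ d →ₗ[ℂ] Formal μ d :=
  LinearMap.pi fun n => match n with
    | 0 => 0
    | n + 1 => (creSector (d := d) f n).toLinearMap.comp (LinearMap.proj n)

/-- The annihilation operator `a(f)`; from the `(n+1)`-boson to the `n`-boson sector it is the
adjoint of the (bounded) creation operator `a^*(f)` between these sectors. -/
def ann (f : Lp ℂ 2 μ) : Formal μ d →ₗ[ℂ] Formal μ d :=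
  LinearMap.pi fun n =>
    (ContinuousLinearMap.adjoint (creSector (d := d) f n)).toLinearMap.comp
      (LinearMap.proj (n + 1))

/-- The operator on the Hilbert space which acts as `L`, on its maximal domain
`{Ψ | ∑ₘ ‖(L Ψ)^(m)‖² < ∞}`. -/
def maxOp (L : Formal μ d →ₗ[ℂ] Formal μ d) : Fock μ d →ₗ.[ℂ] Fock μ d where
  domain :=
    { carrier := {Ψ | Memℓp (L (Ψ : Formal μ d)) 2}
      zero_mem' := by
        change Memℓp (L (0 : Formal μ d)) 2
        rw [map_zero]; exact zero_memℓp
      add_mem' := fun {Ψ Φ} hΨ hΦ => by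
        change Memℓp (L ((Ψ : Formal μ d) + (Φ : Formal μ d))) 2
        rw [map_add]; exact Memℓp.add hΨ hΦ
      smul_mem' := fun c Ψ hΨ => by
        change Memℓp (L (c • (Ψ : Formal μ d))) 2
        rw [map_smul]; exact Memℓp.const_smul hΨ c }
  toFun :=
    { toFun := fun Ψ => ⟨L (Ψ.1 : Formal μ d), Ψ.2⟩
      map_add' := fun Ψ Φ => Subtype.ext (L.map_add (Ψ.1 : Formal μ d) (Φ.1 : Formal μ d))
      map_smul' := fun c Ψ => Subtype.ext (L.map_smul c (Ψ.1 : Formal μ d)) }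

/-- The graph of `dΓ(ω)`:
`(dΓ(ω) Ψ)^(n)(k₁, …, kₙ) = (ω(k₁) + ⋯ + ω(kₙ)) Ψ^(n)(k₁, …, kₙ)` for almost every `k`. -/
def dGammaGraph (μ : Measure X) [SigmaFinite μ] (d : ℕ) (ω : X → ℝ) :
    Submodule ℂ (Fock μ d × Fock μ d) where
  carrier := {p | ∀ n, (p.2 n : Lp (Spin d) 2 (powMeasure μ n)) =ᵐ[powMeasure μ n]
    fun k => ((∑ i, ω (k i) : ℝ) : ℂ) • (p.1 n : Lp (Spin d) 2 (powMeasure μ n)) k}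
  zero_mem' n := by
    filter_upwards [Lp.coeFn_zero (Spin d) 2 (powMeasure μ n)] with k hk
    change (0 : Lp (Spin d) 2 (powMeasure μ n)) k = _ • (0 : Lp (Spin d) 2 (powMeasure μ n)) k
    rw [hk, Pi.zero_apply, smul_zero]
  add_mem' {p q} hp hq n := by
    filter_upwards [hp n, hq n,
      Lp.coeFn_add (p.1 n : Lp (Spin d) 2 (powMeasure μ n)) (q.1 n),
      Lp.coeFn_add (p.2 n : Lp (Spin d) 2 (powMeasure μ n)) (q.2 n)] with k h1 h2 h3 h4
    refine h4.trans ?_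
    rw [Pi.add_apply, h1, h2, ← smul_add]
    exact congrArg _ h3.symm
  smul_mem' c p hp n := by
    filter_upwards [hp n,
      Lp.coeFn_smul c (p.1 n : Lp (Spin d) 2 (powMeasure μ n)),
      Lp.coeFn_smul c (p.2 n : Lp (Spin d) 2 (powMeasure μ n))] with k h1 h3 h4
    refine h4.trans ?_
    rw [Pi.smul_apply, h1, smul_comm]
    exact congrArg _ h3.symm

/-- The second quantization `dΓ(ω)` (more precisely `1 ⊗ dΓ(ω)`) on its maximal domain. -/
def dGamma (μ : Measure X) [SigmaFinite μ] (d : ℕ) (ω : X → ℝ) : Fock μ d →ₗ.[ℂ] Fock μ d :=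
  (dGammaGraph μ d ω).toLinearPMap

theorem mem_dGamma_graph (ω : X → ℝ) (p : Fock μ d × Fock μ d) :
    p ∈ (dGamma μ d ω).graph ↔ p ∈ dGammaGraph μ d ω := by
  rw [dGamma, Submodule.toLinearPMap_graph_eq]
  rintro ⟨Ψ, Φ⟩ h (rfl : Ψ = 0)
  refine lp.ext (funext fun n => Subtype.ext (Lp.ext ?_))
  filter_upwards [h n, Lp.coeFn_zero (Spin d) 2 (powMeasure μ n)] with k hk h0
  refine hk.trans ?_
  change _ • (0 : Lp (Spin d) 2 (powMeasure μ n)) k = (0 : Lp (Spin d) 2 (powMeasure μ n)) k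
  rw [h0, Pi.zero_apply, smul_zero]

end Formal

/-! ### Hamiltonians -/

section Hamiltonians

variable {X : Type*} [MeasurableSpace X] {μ : Measure X} [SigmaFinite μ] {d N : ℕ}

/-- The regular spin–boson Hamiltonian
`K + dΓ(ω) + ∑ⱼ (Bⱼ a^*(fⱼ) + Bⱼ^* a(fⱼ))` with square integrable form factors. -/
def regularHamiltonian (ω : X → ℝ) (K : Matrix (Fin d) (Fin d) ℂ)
    (B : Fin N → Matrix (Fin d) (Fin d) ℂ) (f : Fin N → Lp ℂ 2 μ) : Fock μ d →ₗ.[ℂ] Fock μ d :=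
  maxOp (mat K) + dGamma μ d ω +
    ∑ j, (maxOp (mat (B j) ∘ₗ cre (f j)) + maxOp (mat (B j).conjTranspose ∘ₗ ann (f j)))

/-- The self-energy matrix `-∑_{j,j'} Bⱼ^* Bⱼ' ∫ conj(fⱼ) fⱼ' / ω`. -/
def selfEnergy (ω : X → ℝ) (B : Fin N → Matrix (Fin d) (Fin d) ℂ) (f : Fin N → Lp ℂ 2 μ) :
    Matrix (Fin d) (Fin d) ℂ :=
  -∑ j, ∑ j', (∫ k, conj (f j k) * f j' k / (ω k : ℂ) ∂μ) • ((B j).conjTranspose * B j')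

/-- `B = -∑ⱼ Bⱼ a^*(gⱼ)`, to be used with `gⱼ = fⱼ / ω`. -/
def dressingExponent (B : Fin N → Matrix (Fin d) (Fin d) ℂ) (g : Fin N → Lp ℂ 2 μ) :
    Module.End ℂ (Formal μ d) :=
  -∑ j, mat (B j) ∘ₗ cre (g j)

/-- The dressing operator `T = e^B = ∑ₙ Bⁿ / n!`, sector by sector. Since `B` creates exactly one
boson, only the terms with `n ≤ m` contribute to the `m`-boson sector. -/
def dressing (B : Fin N → Matrix (Fin d) (Fin d) ℂ) (g : Fin N → Lp ℂ 2 μ) :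
    Module.End ℂ (Formal μ d) :=
  LinearMap.pi fun m => ∑ n ∈ Finset.range (m + 1),
    ((n.factorial : ℂ)⁻¹) • (LinearMap.proj m ∘ₗ (dressingExponent B g) ^ n)

/-- The dressed test vector `a^*_{ℓ₁} ⋯ a^*_{ℓₙ} T (v ⊗ Ω)`, where `a^*_ℓ = a^*(e_ℓ)`. -/
def testVector {ι : Type*} (e : ι → Lp ℂ 2 μ) (B : Fin N → Matrix (Fin d) (Fin d) ℂ)
    (g : Fin N → Lp ℂ 2 μ) (l : List ι) (v : Spin d) : Formal μ d :=
  l.foldr (fun i Ψ => cre (e i) Ψ) (dressing B g (vacuum μ d v))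

/-- The test domain: the span of the dressed test vectors. -/
def testDomain {ι : Type*} (e : ι → Lp ℂ 2 μ) (B : Fin N → Matrix (Fin d) (Fin d) ℂ)
    (g : Fin N → Lp ℂ 2 μ) : Submodule ℂ (Fock μ d) :=
  Submodule.span ℂ {Ψ | ∃ (l : List ι) (v : Spin d), (Ψ : Formal μ d) = testVector e B g l v}

/-- The displaced annihilation operator `â(h) = a(h) + ∑ⱼ Bⱼ ⟨h, gⱼ⟩`. -/
def annHat (B : Fin N → Matrix (Fin d) (Fin d) ℂ) (g : Fin N → Lp ℂ 2 μ) (h : Lp ℂ 2 μ) :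
    Module.End ℂ (Formal μ d) :=
  ann h + ∑ j, ⟪h, g j⟫_ℂ • mat (μ := μ) (B j)

/-- The displaced creation operator `â(h)^* = a^*(h) + ∑ⱼ Bⱼ^* ⟨gⱼ, h⟩`. -/
def creHat (B : Fin N → Matrix (Fin d) (Fin d) ℂ) (g : Fin N → Lp ℂ 2 μ) (h : Lp ℂ 2 μ) :
    Module.End ℂ (Formal μ d) :=
  cre h + ∑ j, ⟪g j, h⟫_ℂ • mat (μ := μ) (B j).conjTranspose

/-- The graph of the operator `∑_{ℓ,ℓ'} ⟨e_ℓ, ω e_ℓ'⟩ â_ℓ^* â_ℓ' + K` on the test domain; every term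
of the double series has to lie in the Hilbert space, and the series has to converge
unconditionally in norm. -/
def testHamiltonianGraph {ι : Type*} (e : ι → Lp ℂ 2 μ) (ω : X → ℝ)
    (K : Matrix (Fin d) (Fin d) ℂ) (B : Fin N → Matrix (Fin d) (Fin d) ℂ)
    (g : Fin N → Lp ℂ 2 μ) : Submodule ℂ (Fock μ d × Fock μ d) where
  carrier := {p | p.1 ∈ testDomain e B g ∧ ∃ (t : ι × ι → Fock μ d) (S : Fock μ d),
    (∀ q : ι × ι, (t q : Formal μ d) =
      (∫ k, conj (e q.1 k) * ((ω k : ℂ) * e q.2 k) ∂μ) •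
        creHat B g (e q.1) (annHat B g (e q.2) (p.1 : Formal μ d))) ∧
    HasSum t S ∧ (p.2 : Formal μ d) = (S : Formal μ d) + mat K (p.1 : Formal μ d)}
  zero_mem' := by
    refine ⟨Submodule.zero_mem _, 0, 0, fun q => ?_, hasSum_zero, ?_⟩
    · change (0 : Formal μ d) = _ • creHat B g (e q.1) (annHat B g (e q.2) (0 : Formal μ d))
      rw [map_zero, map_zero, smul_zero]
    · change (0 : Formal μ d) = 0 + mat K (0 : Formal μ d)
      rw [map_zero, add_zero]
  add_mem' {p p'} hp hp' := by
    obtain ⟨h1, t, S, ht, hS, h2⟩ := hp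
    obtain ⟨h1', t', S', ht', hS', h2'⟩ := hp'
    refine ⟨Submodule.add_mem _ h1 h1', fun q => t q + t' q, S + S', fun q => ?_,
      hS.add hS', ?_⟩
    · change (t q : Formal μ d) + (t' q : Formal μ d) = _ • creHat B g (e q.1)
        (annHat B g (e q.2) ((p.1 : Formal μ d) + (p'.1 : Formal μ d)))
      rw [ht, ht', map_add, map_add, smul_add]
    · change (p.2 : Formal μ d) + (p'.2 : Formal μ d) = ((S : Formal μ d) + (S' : Formal μ d)) +
        mat K ((p.1 : Formal μ d) + (p'.1 : Formal μ d))
      rw [h2, h2', map_add]; abel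
  smul_mem' c p hp := by
    obtain ⟨h1, t, S, ht, hS, h2⟩ := hp
    refine ⟨Submodule.smul_mem _ c h1, fun q => c • t q, c • S, fun q => ?_,
      hS.const_smul c, ?_⟩
    · have h := congrArg (fun Θ : Formal μ d => c • Θ) (ht q)
      refine h.trans ((smul_comm _ _ _).trans (congrArg _ ?_))
      exact ((LinearMap.map_smul (creHat B g (e q.1)) c _).symm.trans
        (congrArg _ (LinearMap.map_smul (annHat B g (e q.2)) c (p.1 : Formal μ d)).symm))
    · have h := congrArg (fun Θ : Formal μ d => c • Θ) h2
      refine h.trans ((smul_add _ _ _).trans (congrArg _ ?_))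
      exact (LinearMap.map_smul (mat K) c (p.1 : Formal μ d)).symm

/-- The operator `∑_{ℓ,ℓ'} ⟨e_ℓ, ω e_ℓ'⟩ â_ℓ^* â_ℓ' + K` on the test domain. -/
def testHamiltonian {ι : Type*} (e : ι → Lp ℂ 2 μ) (ω : X → ℝ)
    (K : Matrix (Fin d) (Fin d) ℂ) (B : Fin N → Matrix (Fin d) (Fin d) ℂ)
    (g : Fin N → Lp ℂ 2 μ) : Fock μ d →ₗ.[ℂ] Fock μ d :=
  (testHamiltonianGraph e ω K B g).toLinearPMap

theorem mem_testHamiltonian_graph {ι : Type*} (e : ι → Lp ℂ 2 μ) (ω : X → ℝ)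
    (K : Matrix (Fin d) (Fin d) ℂ) (B : Fin N → Matrix (Fin d) (Fin d) ℂ)
    (g : Fin N → Lp ℂ 2 μ) (p : Fock μ d × Fock μ d) :
    p ∈ (testHamiltonian e ω K B g).graph ↔ p ∈ testHamiltonianGraph e ω K B g := by
  rw [testHamiltonian, Submodule.toLinearPMap_graph_eq]
  rintro ⟨Ψ, Φ⟩ ⟨-, t, S, ht, hS, h⟩ (rfl : Ψ = 0)
  have ht0 : t = 0 := by
    funext q
    refine lp.ext ((ht q).trans ?_)
    change _ • creHat B g (e q.1) (annHat B g (e q.2) (0 : Formal μ d)) = (0 : Formal μ d)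
    rw [map_zero, map_zero, smul_zero]
  subst ht0
  obtain rfl := hS.unique hasSum_zero
  refine lp.ext (h.trans ?_)
  change (0 : Formal μ d) + mat K (0 : Formal μ d) = (0 : Formal μ d)
  rw [map_zero, add_zero]

/-- The linear span of `e` is a form core of the multiplication operator by `ω`, for `ω` bounded
below by a positive constant: it is dense in the form domain of `ω` with respect to the norm
`φ ↦ ‖ω^{1/2} φ‖`. -/
def IsFormCore {ι : Type*} (e : ι → Lp ℂ 2 μ) (ω : X → ℝ) : Prop :=
  ∀ φ : Lp ℂ 2 μ, MemLp (fun k => (Real.sqrt (ω k) : ℂ) * φ k) 2 μ → ∀ ε : ℝ, 0 < ε →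
    ∃ χ ∈ Submodule.span ℂ (Set.range e),
      eLpNorm (fun k => (Real.sqrt (ω k) : ℂ) * (φ k - χ k)) 2 μ < ENNReal.ofReal ε

end Hamiltonians

/-! ### Unbounded operators -/

section Unbounded

variable {E : Type*} [NormedAddCommGroup E] [InnerProductSpace ℂ E]

/-- The form domain of a semi-bounded symmetric operator `S`: limits of sequences in the domain of
`S` which are Cauchy with respect to the quadratic form of `S`. -/
def formClosure (S : E →ₗ.[ℂ] E) : Set E :=
  {ψ | ∃ φ : ℕ → S.domain, Tendsto (fun n => (φ n : E)) atTop (𝓝 ψ) ∧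
    Tendsto (fun p : ℕ × ℕ => ⟪((φ p.1 - φ p.2 : S.domain) : E), S (φ p.1 - φ p.2)⟫_ℂ)
      atTop (𝓝 0)}

/-- `S` is a densely defined symmetric operator which is bounded from below, and `A` is its
Friedrichs extension, i.e. the restriction of the adjoint of `S` to its intersection with the form
domain of `S`. This determines `A` uniquely. -/
structure IsFriedrichsExtension (S A : E →ₗ.[ℂ] E) : Prop where
  dense : Dense (S.domain : Set E)
  symmetric : ∀ φ ψ : S.domain, ⟪S φ, (ψ : E)⟫_ℂ = ⟪(φ : E), S ψ⟫_ℂ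
  boundedBelow : ∃ c : ℝ, ∀ φ : S.domain, c * ‖(φ : E)‖ ^ 2 ≤ (⟪(φ : E), S φ⟫_ℂ).re
  mem_graph_iff : ∀ ψ η : E, (ψ, η) ∈ A.graph ↔
    ψ ∈ formClosure S ∧ ∀ φ : S.domain, ⟪S φ, ψ⟫_ℂ = ⟪(φ : E), η⟫_ℂ

/-- `R` is the bounded inverse of `A - z`. -/
structure IsResolvent (A : E →ₗ.[ℂ] E) (z : ℂ) (R : E →L[ℂ] E) : Prop where
  mem_domain : ∀ ψ, R ψ ∈ A.domain
  right_inv : ∀ ψ, A ⟨R ψ, mem_domain ψ⟩ - z • R ψ = ψ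
  left_inv : ∀ φ : A.domain, R (A φ - z • (φ : E)) = φ

/-- Convergence in norm resolvent sense: for all non-real `z`, the resolvents
`(Aₙ - z)⁻¹` and `(A - z)⁻¹` exist and the former converge to the latter in operator norm. -/
def NormResolventTendsto (A : ℕ → E →ₗ.[ℂ] E) (A' : E →ₗ.[ℂ] E) : Prop :=
  ∀ z : ℂ, z.im ≠ 0 → ∃ (R : ℕ → E →L[ℂ] E) (R' : E →L[ℂ] E),
    (∀ n, IsResolvent (A n) z (R n)) ∧ IsResolvent A' z R' ∧ Tendsto R atTop (𝓝 R')

end Unbounded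

end SpinBoson

end

open SpinBoson

open MeasureTheory Filter Topology
open scoped InnerProductSpace ComplexConjugate
noncomputable section
namespace SpinBoson

/-! ### Operators given by a bounded inverse -/

section ShiftedInverse

variable {E : Type*} [NormedAddCommGroup E] [InnerProductSpace ℂ E]

/-! Choose `c` with `K + c = M^* M`, `M` invertible, and put `g = f / ω`. Completing the square
turns the quadratic form of the cut-off operator with its self-energy subtracted, plus `c`, into `‖M
Ψ‖² + ∑ₐ ‖â(hₐ) Ψ‖²`, with `â(h) = a(h) + ∑ⱼ Bⱼ ⟨h, gⱼ⟩`, where `(hₐ)` is a family in `L²` with `∑ₐ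
|hₐ⟩⟨hₐ| = ω` in the sense of forms. Only `g` enters here, so the expression keeps its meaning when
`f` itself is not square integrable. The cut-off operators and the renormalized one thus belong to
one family of closed forms indexed by `g`, and the theorem says that the resolvents are norm
continuous in `g`.

For `hₐ` take `bandVec`: the functions `√ω e_ℓ` restricted to the sets `k ≤ ω < k + 1`. On each band
the multiplier is bounded, so Parseval's identity holds there for every `L²` function without domain
conditions, and unbounded statements follow by summing over the bands. The form domain is a Hilbert
space `FormDom`, the embedding `π` into Fock space is `formEmb`, and the inverse of the shifted
operator is `π π^*` (`formResolvent`).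

Continuity. The dressing `e^{B(c)}` is unbounded, but `U = e^{B(g' - r g)} r^N` with `0 < r < 1` is
bounded and satisfies `â_{g'}(h) U = r U â_g(h)` (`annHat_dressPow`, where the commutativity of the
`Bⱼ` is used). Hence `U` maps the form domain for `g` into the one for `g'`. Moreover `‖U - r^N‖² ≤
r⁻² (exp(σ² / (1 - r²)) - 1)`, where `σ` measures `g' - r g` (`fockBounded_dressPow_sub`). With `r =
1 - s` and `‖g' - g‖ ≤ s` one has `σ = O(s)` and `1 - r² ≥ s`, so the exponent is `O(s)`. The
remaining error `r^N - 1` is small on the form domain because `ω ≥ m > 0` lets the form control the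
boson number (`sum_number_le`). So `U` is almost a contraction of form norms and almost the identity
in Fock space, in both directions, and `norm_formResolvent_sub_le` converts this into closeness of
`π π^*` in norm.

Identification with the cut-off operators. For `ψ = π π^* η`, testing the form with cut-off products
of one boson functions determines the function `∑ᵢ ω(kᵢ) ψ(k)` in each sector; the number bound
makes the creation and annihilation terms square summable, so `ψ` lies in the domain of `dΓ(ω)` and
`A + c` sends `ψ` to `η`. A symmetric operator with such a right inverse is exactly `R⁻¹ - c`
(`hasShiftedInverse_of_isFormalAdjoint`), hence self-adjoint.

Identification with the Friedrichs extension. On the test domain the form agrees with that of `H₀ +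
c` (`inner_formDom_testHamiltonian`), so it remains to see that the test domain is dense in form
norm. For `g = 0` this follows from the form core hypothesis, replacing the factors of a product one
at a time. For general `g` the density is transported by `e^{B(g)} r^N`, which acts on an `n`-boson
vector as `r^n T`; composing the transports from `g` to `0` and back gives an operator close to
`r^N`, which excludes nonzero orthogonal vectors (`eq_zero_of_inner_transport`). -/

/-- `R` is the inverse of `A + c`. -/
def HasShiftedInverse (A : E →ₗ.[ℂ] E) (c : ℝ) (R : E →L[ℂ] E) : Prop :=
  ∀ ψ η : E, (ψ, η) ∈ A.graph ↔ ψ = R (η + (c : ℂ) • ψ)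

theorem HasShiftedInverse.mem_graph {A : E →ₗ.[ℂ] E} {c : ℝ} {R : E →L[ℂ] E}
    (h : HasShiftedInverse A c R) (φ : E) : (R φ, φ - (c : ℂ) • R φ) ∈ A.graph := by
  rw [h]; simp

/-- The operator `R⁻¹ - c` for an injective bounded operator `R`. -/
def ofShiftedInverse (R : E →L[ℂ] E) (c : ℝ) : E →ₗ.[ℂ] E :=
  (LinearMap.eqLocus (LinearMap.fst ℂ E E)
    (R.toLinearMap ∘ₗ (LinearMap.snd ℂ E E + (c : ℂ) • LinearMap.fst ℂ E E))).toLinearPMap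

/-- Injectivity of `R` is what makes the prescribed relation single valued, so that it is the graph
of an operator. -/
theorem hasShiftedInverse_ofShiftedInverse {R : E →L[ℂ] E} (hR : Function.Injective R) (c : ℝ) :
    HasShiftedInverse (ofShiftedInverse R c) c R := by
  intro ψ η
  rw [ofShiftedInverse, Submodule.toLinearPMap_graph_eq]
  · rfl
  · rintro ⟨ψ, η⟩ h (rfl : ψ = 0)
    have h' : (0 : E) = R (η + (c : ℂ) • 0) := h
    rw [smul_zero, add_zero] at h'
    exact hR (h'.symm.trans (map_zero R).symm)

variable [CompleteSpace E]

theorem dense_range_of_isSelfAdjoint {R : E →L[ℂ] E} (hsa : IsSelfAdjoint R)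
    (hinj : Function.Injective R) : DenseRange R := by
  have h : R.rangeᗮ = ⊥ := by
    rw [ContinuousLinearMap.orthogonal_range, ← ContinuousLinearMap.star_eq_adjoint, hsa.star_eq]
    exact LinearMap.ker_eq_bot.2 hinj
  have := (Submodule.topologicalClosure_eq_top_iff (K := R.range)).2 h
  exact (Submodule.dense_iff_topologicalClosure_eq_top.2 this)

/-- The graph of `A` consists of the pairs `(R φ, φ - c R φ)`. Pairing such an element with `(ψ, η)`
as in the definition of the adjoint gives `⟨φ, ψ - R(η + c ψ)⟩`, which vanishes for all `φ` exactly
when `(ψ, η)` is in the graph of `A`. -/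
theorem HasShiftedInverse.isSelfAdjoint {A : E →ₗ.[ℂ] E} {c : ℝ} {R : E →L[ℂ] E}
    (h : HasShiftedInverse A c R) (hsa : IsSelfAdjoint R) (hinj : Function.Injective R) :
    IsSelfAdjoint A := by
  have hd : Dense (A.domain : Set E) := by
    refine (dense_range_of_isSelfAdjoint hsa hinj).mono ?_
    rintro _ ⟨φ, rfl⟩
    exact LinearPMap.mem_domain_of_mem_graph (h.mem_graph φ)
  have hsym : ∀ x y, ⟪R x, y⟫_ℂ = ⟪x, R y⟫_ℂ := fun x y => hsa.isSymmetric x y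
  rw [LinearPMap.isSelfAdjoint_def]
  apply LinearPMap.eq_of_eq_graph
  rw [LinearPMap.adjoint_graph_eq_graph_adjoint hd]
  ext ⟨ψ, η⟩
  rw [Submodule.mem_adjoint_iff, h]
  have key : ∀ φ : E, ⟪φ - (c : ℂ) • R φ, ψ⟫_ℂ - ⟪R φ, η⟫_ℂ
      = ⟪φ, ψ - R (η + (c : ℂ) • ψ)⟫_ℂ := by
    intro φ
    simp only [inner_sub_left, inner_sub_right, inner_smul_left, inner_smul_right, map_add,
      map_smul, inner_add_right, hsym, Complex.conj_ofReal]
    ring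
  constructor
  · intro hψ
    have := fun φ => (key φ).symm.trans (hψ _ _ (h.mem_graph φ))
    exact sub_eq_zero.1 (inner_self_eq_zero.1 (this _))
  · intro hψ a b hab
    rw [h] at hab
    have hb : b = (b + (c : ℂ) • a) - (c : ℂ) • R (b + (c : ℂ) • a) := by rw [← hab]; simp
    have ha := hab
    generalize b + (c : ℂ) • a = φ at ha hb
    rw [ha, hb]
    exact (key φ).trans (by rw [← hψ, sub_self, inner_zero_right])

/-- The spectrum of a self-adjoint bounded operator is real, hence does not contain `w⁻¹`. -/
theorem isUnit_one_sub_smul {R : E →L[ℂ] E} (hsa : IsSelfAdjoint R) {w : ℂ} (hw : w.im ≠ 0) :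
    IsUnit (1 - w • R) := by
  have hw0 : w ≠ 0 := fun h => hw (by simp [h])
  by_contra hcon
  have : w⁻¹ ∈ spectrum ℂ R := by
    rw [spectrum.mem_iff]
    intro hu
    apply hcon
    have := hu.smul (Units.mk0 w hw0)
    convert this using 1
    rw [Units.smul_def, Units.val_mk0, smul_sub, Algebra.algebraMap_eq_smul_one, smul_smul,
      mul_inv_cancel₀ hw0, one_smul]
  have h2 := hsa.mem_spectrum_eq_re this
  have h3 : (w⁻¹).im = 0 := by rw [h2]; simp
  rw [Complex.inv_im] at h3
  have : Complex.normSq w ≠ 0 := by simpa using hw0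
  field_simp at h3
  exact hw (by simpa using h3)

/-- On the domain, `A - z = R⁻¹ - (z + c) = (1 - (z + c) R) R⁻¹`, whose inverse is `R (1 - (z + c)
R)⁻¹`. -/
theorem HasShiftedInverse.isResolvent {A : E →ₗ.[ℂ] E} {c : ℝ} {R : E →L[ℂ] E}
    (h : HasShiftedInverse A c R) {z : ℂ} (hu : IsUnit (1 - (z + c) • R)) :
    IsResolvent A z (R * Ring.inverse (1 - (z + c) • R)) := by
  set Q := Ring.inverse (1 - (z + c) • R) with hQ
  have h1 : (1 - (z + c) • R) * Q = 1 := Ring.mul_inverse_cancel _ hu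
  have h2 : Q * (1 - (z + c) • R) = 1 := Ring.inverse_mul_cancel _ hu
  have h1' : ∀ ψ, Q ψ - (z + c) • R (Q ψ) = ψ := fun ψ => by
    simpa using congrArg (fun L : E →L[ℂ] E => L ψ) h1
  have h2' : ∀ ψ, Q (ψ - (z + c) • R ψ) = ψ := fun ψ => by
    have := congrArg (fun L : E →L[ℂ] E => L ψ) h2
    exact this
  have hg : ∀ ψ, (R (Q ψ), Q ψ - (c : ℂ) • R (Q ψ)) ∈ A.graph := fun ψ => h.mem_graph _
  have hm : ∀ ψ, (R * Q) ψ ∈ A.domain := fun ψ => LinearPMap.mem_domain_of_mem_graph (hg ψ)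
  refine ⟨hm, fun ψ => ?_, fun φ => ?_⟩
  · obtain ⟨y, hy1, hy2⟩ := (LinearPMap.mem_graph_iff _).1 (hg ψ)
    have : (⟨(R * Q) ψ, hm ψ⟩ : A.domain) = y := Subtype.ext hy1.symm
    rw [this, hy2]
    change Q ψ - (c : ℂ) • R (Q ψ) - z • R (Q ψ) = ψ
    conv_rhs => rw [← h1' ψ]
    rw [add_smul]; abel
  · have hφ := (h _ _).1 (LinearPMap.mem_graph A φ)
    set ζ := A φ + (c : ℂ) • (φ : E) with hζ
    have : A φ - z • (φ : E) = ζ - (z + c) • R ζ := by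
      rw [← hφ, hζ, add_smul]; abel
    change R (Q (A φ - z • (φ : E))) = φ
    rw [this, h2', ← hφ]

/-- With one shift `c` for all operators, the resolvent at `z` is a norm continuous function of `R`,
because inversion is continuous at units. It therefore suffices to treat the single real point `-c`.
-/
theorem normResolventTendsto_of_hasShiftedInverse {A : ℕ → E →ₗ.[ℂ] E} {A' : E →ₗ.[ℂ] E} {c : ℝ}
    {R : ℕ → E →L[ℂ] E} {R' : E →L[ℂ] E} (h : ∀ n, HasShiftedInverse (A n) c (R n))
    (h' : HasShiftedInverse A' c R') (hR : ∀ n, IsSelfAdjoint (R n)) (hR' : IsSelfAdjoint R')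
    (hlim : Tendsto R atTop (𝓝 R')) : NormResolventTendsto A A' := by
  intro z hz
  have hz' : (z + c).im ≠ 0 := by simpa using hz
  refine ⟨_, _, fun n => (h n).isResolvent (isUnit_one_sub_smul (hR n) hz'),
    h'.isResolvent (isUnit_one_sub_smul hR' hz'), ?_⟩
  refine hlim.mul ?_
  obtain ⟨u, hu⟩ := isUnit_one_sub_smul hR' hz'
  have hc := NormedRing.inverse_continuousAt u
  rw [hu] at hc
  exact hc.tendsto.comp (tendsto_const_nhds.sub (hlim.const_smul _))

end ShiftedInverse

/-! ### Resolvents of closed forms -/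

section FormResolvent

variable {E V W : Type*} [NormedAddCommGroup E] [InnerProductSpace ℂ E] [CompleteSpace E]
  [NormedAddCommGroup V] [InnerProductSpace ℂ V] [CompleteSpace V]
  [NormedAddCommGroup W] [InnerProductSpace ℂ W] [CompleteSpace W]

open ContinuousLinearMap (adjoint adjoint_inner_left adjoint_inner_right)

/-- The inverse of the operator associated with a closed form: `V` is the form domain with the form
inner product and `π` its embedding. -/
def formResolvent (π : V →L[ℂ] E) : E →L[ℂ] E := π ∘L adjoint π

theorem formResolvent_isSelfAdjoint (π : V →L[ℂ] E) : IsSelfAdjoint (formResolvent π) := by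
  rw [IsSelfAdjoint, formResolvent, ContinuousLinearMap.star_eq_adjoint,
    ContinuousLinearMap.adjoint_comp, ContinuousLinearMap.adjoint_adjoint]

theorem inner_formResolvent_self (π : V →L[ℂ] E) (φ : E) :
    ⟪formResolvent π φ, φ⟫_ℂ = ((‖adjoint π φ‖ ^ 2 : ℝ) : ℂ) := by
  change ⟪π (adjoint π φ), φ⟫_ℂ = _
  rw [← adjoint_inner_right, inner_self_eq_norm_sq_to_K]
  simp

/-- If `π π^* φ = 0` then `‖π^* φ‖² = ⟨π π^* φ, φ⟩ = 0`, so `φ` is orthogonal to the range of `π`.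
-/
theorem formResolvent_injective {π : V →L[ℂ] E} (hd : DenseRange π) :
    Function.Injective (formResolvent π) := by
  refine (injective_iff_map_eq_zero _).2 fun φ hφ => ?_
  have h := inner_formResolvent_self π φ
  rw [hφ, inner_zero_left] at h
  have h0 : adjoint π φ = 0 := by
    have : ‖adjoint π φ‖ ^ 2 = 0 := by exact_mod_cast h.symm
    simpa using this
  refine hd.eq_zero_of_inner_left ℂ ?_
  intro x
  rw [← adjoint_inner_left, h0, inner_zero_left]

/-- For `x = π^* φ` one has `‖x‖² = ⟨φ, π x⟩ = ⟨φ, π x - ρ y⟩ + ⟨ρ^* φ, y⟩`; estimate both terms and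
divide by `‖x‖`. -/
theorem norm_adjoint_le_of_approx {π : V →L[ℂ] E} {ρ : W →L[ℂ] E} {ε : ℝ} (hε : 0 ≤ ε)
    (h : ∀ x : V, ∃ y : W, ‖y‖ ≤ (1 + ε) * ‖x‖ ∧ ‖π x - ρ y‖ ≤ ε * ‖x‖) (φ : E) :
    ‖adjoint π φ‖ ≤ (1 + ε) * ‖adjoint ρ φ‖ + ε * ‖φ‖ := by
  set x := adjoint π φ with hx
  obtain ⟨y, hy1, hy2⟩ := h x
  rcases (norm_nonneg x).eq_or_lt with h0 | h0
  · rw [← h0]; positivity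
  · have h1 : ‖x‖ ^ 2 = (⟪φ, π x - ρ y⟫_ℂ + ⟪adjoint ρ φ, y⟫_ℂ).re := by
      rw [adjoint_inner_left, ← inner_add_right, sub_add_cancel, ← adjoint_inner_left, ← hx,
        inner_self_eq_norm_sq_to_K]
      norm_cast
    have h2 : ‖x‖ ^ 2 ≤ ‖φ‖ * (ε * ‖x‖) + ‖adjoint ρ φ‖ * ((1 + ε) * ‖x‖) := by
      rw [h1]
      refine (Complex.re_le_norm _).trans ((norm_add_le _ _).trans (add_le_add ?_ ?_))
      · exact (norm_inner_le_norm _ _).trans (mul_le_mul_of_nonneg_left hy2 (norm_nonneg _))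
      · exact (norm_inner_le_norm _ _).trans (mul_le_mul_of_nonneg_left hy1 (norm_nonneg _))
    refine le_of_mul_le_mul_right ?_ h0
    calc ‖x‖ * ‖x‖ = ‖x‖ ^ 2 := by ring
      _ ≤ _ := h2
      _ = _ := by ring

/-- The difference is self-adjoint, so its norm is the supremum of its Rayleigh quotients, and these
are differences `‖π^* φ‖² - ‖ρ^* φ‖²`. The two approximation hypotheses bound this difference from
above and from below. -/
theorem norm_formResolvent_sub_le {π : V →L[ℂ] E} {ρ : W →L[ℂ] E} {ε P : ℝ} (hε : 0 ≤ ε)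
    (hπ : ‖π‖ ≤ P) (hρ : ‖ρ‖ ≤ P)
    (h : ∀ x : V, ∃ y : W, ‖y‖ ≤ (1 + ε) * ‖x‖ ∧ ‖π x - ρ y‖ ≤ ε * ‖x‖)
    (h' : ∀ y : W, ∃ x : V, ‖x‖ ≤ (1 + ε) * ‖y‖ ∧ ‖ρ y - π x‖ ≤ ε * ‖y‖) :
    ‖formResolvent π - formResolvent ρ‖ ≤ 2 * P * (P + 1) * ε := by
  have hP : 0 ≤ P := (norm_nonneg _).trans hπ
  have hsa : IsSelfAdjoint (formResolvent π - formResolvent ρ) :=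
    (formResolvent_isSelfAdjoint π).sub (formResolvent_isSelfAdjoint ρ)
  rw [ContinuousLinearMap.norm_eq_iSup_rayleighQuotient _ hsa.isSymmetric]
  refine ciSup_le fun φ => ?_
  rw [ContinuousLinearMap.rayleighQuotient, ContinuousLinearMap.reApplyInnerSelf_apply]
  rcases eq_or_ne φ 0 with rfl | hφ
  · simp; positivity
  have hφ' : 0 < ‖φ‖ := norm_pos_iff.2 hφ
  rw [abs_div, abs_of_pos (by positivity : 0 < ‖φ‖ ^ 2), div_le_iff₀ (by positivity)]
  have hval : RCLike.re ⟪(formResolvent π - formResolvent ρ) φ, φ⟫_ℂ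
      = ‖adjoint π φ‖ ^ 2 - ‖adjoint ρ φ‖ ^ 2 := by
    rw [sub_apply, inner_sub_left, inner_formResolvent_self,
      inner_formResolvent_self, ← Complex.ofReal_sub]
    rfl
  rw [hval]
  have a1 : ‖adjoint π φ‖ ≤ P * ‖φ‖ := (adjoint π).le_of_opNorm_le (by simpa using hπ) φ
  have a2 : ‖adjoint ρ φ‖ ≤ P * ‖φ‖ := (adjoint ρ).le_of_opNorm_le (by simpa using hρ) φ
  have b1 := norm_adjoint_le_of_approx hε h φ
  have b2 := norm_adjoint_le_of_approx hε h' φ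
  have n1 := norm_nonneg (adjoint π φ)
  have n2 := norm_nonneg (adjoint ρ φ)
  generalize ‖adjoint π φ‖ = a at *
  generalize ‖adjoint ρ φ‖ = b at *
  -- `b1` and `b2` give `|a - b| ≤ ε max(a, b) + ε ‖φ‖`, and both `a` and `b` are at most `P ‖φ‖`.
  have hd : |a - b| ≤ (P + 1) * ε * ‖φ‖ := by
    rw [abs_le]
    constructor <;> nlinarith [mul_le_mul_of_nonneg_left a1 hε, mul_le_mul_of_nonneg_left a2 hε]
  have hs : |a + b| ≤ 2 * P * ‖φ‖ := by rw [abs_of_nonneg (by positivity)]; linarith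
  calc |a ^ 2 - b ^ 2| = |a + b| * |a - b| := by rw [← abs_mul]; congr 1; ring
    _ ≤ (2 * P * ‖φ‖) * ((P + 1) * ε * ‖φ‖) :=
      mul_le_mul hs hd (abs_nonneg _) (by positivity)
    _ = _ := by ring

/-- The operator associated with a closed form is the Friedrichs extension of its restriction to a
form core. -/
theorem isFriedrichsExtension_of_form {π : V →L[ℂ] E} {S : E →ₗ.[ℂ] E} {c : ℝ}
    (Θ : S.domain →ₗ[ℂ] V) (hΘ : ∀ φ, π (Θ φ) = φ)
    (hS : ∀ (x : V) (φ : S.domain), ⟪x, Θ φ⟫_ℂ = ⟪π x, S φ + (c : ℂ) • (φ : E)⟫_ℂ)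
    (hdense : DenseRange Θ) (hπ : DenseRange π) {A : E →ₗ.[ℂ] E}
    (hA : HasShiftedInverse A c (formResolvent π)) : IsFriedrichsExtension S A := by
  have hform : ∀ φ ψ : S.domain, ⟪(φ : E), S ψ⟫_ℂ
      = ⟪Θ φ, Θ ψ⟫_ℂ - (c : ℂ) * ⟪(φ : E), (ψ : E)⟫_ℂ := by
    intro φ ψ
    rw [hS, hΘ, inner_add_right, inner_smul_right]; ring
  -- The form of `S` plus `c ‖·‖²` is `‖Θ ·‖²`. For sequences convergent in `E`, being Cauchy for
  -- the form therefore means that the images under `Θ` are Cauchy in the complete space `V`;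
  -- density of the range of `Θ` makes every element of `V` such a limit.
  have hclosure : formClosure S = Set.range π := by
    ext ψ
    constructor
    · rintro ⟨φ, hφ, hq⟩
      have hc : CauchySeq fun n => Θ (φ n) := by
        have hdiff : Tendsto (fun p : ℕ × ℕ => ((φ p.1 - φ p.2 : S.domain) : E)) atTop (𝓝 0) := by
          have h1 := (hφ.comp tendsto_fst).sub (hφ.comp (tendsto_snd (f := (atTop : Filter ℕ))
            (g := (atTop : Filter ℕ))))
          rw [sub_self, prod_atTop_atTop_eq] at h1
          exact h1
        have h2 : Tendsto (fun p : ℕ × ℕ => ⟪((φ p.1 - φ p.2 : S.domain) : E),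
            S (φ p.1 - φ p.2)⟫_ℂ + (c : ℂ) * ⟪((φ p.1 - φ p.2 : S.domain) : E),
            ((φ p.1 - φ p.2 : S.domain) : E)⟫_ℂ) atTop (𝓝 0) := by
          have := hq.add ((hdiff.inner hdiff).const_mul (c : ℂ))
          simpa using this
        have h3 : Tendsto (fun p : ℕ × ℕ => ‖Θ (φ p.1) - Θ (φ p.2)‖) atTop (𝓝 0) := by
          have h4 := (h2.norm.sqrt)
          simp only [norm_zero, Real.sqrt_zero] at h4
          refine h4.congr fun p => ?_
          rw [hform, sub_add_cancel, inner_self_eq_norm_sq_to_K, ← map_sub]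
          simp
        rw [cauchySeq_iff_tendsto_dist_atTop_0]
        simpa only [dist_eq_norm] using h3
      obtain ⟨x, hx⟩ := cauchySeq_tendsto_of_complete hc
      refine ⟨x, tendsto_nhds_unique ((π.continuous.tendsto x).comp hx) ?_⟩
      simpa only [Function.comp_def, hΘ] using hφ
    · rintro ⟨x, rfl⟩
      obtain ⟨u, hu, hux⟩ := mem_closure_iff_seq_limit.1 (hdense x)
      choose φ hφ using hu
      have hφ' : (fun n => Θ (φ n)) = u := funext hφ
      have h1 : Tendsto (fun n => (φ n : E)) atTop (𝓝 (π x)) := by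
        have := (π.continuous.tendsto x).comp hux
        rw [← hφ'] at this
        simpa only [Function.comp_def, hΘ] using this
      refine ⟨φ, h1, ?_⟩
      have hd1 : Tendsto (fun p : ℕ × ℕ => ((φ p.1 - φ p.2 : S.domain) : E)) atTop (𝓝 0) := by
        have h1 := (h1.comp tendsto_fst).sub (h1.comp (tendsto_snd (f := (atTop : Filter ℕ))
          (g := (atTop : Filter ℕ))))
        rw [sub_self, prod_atTop_atTop_eq] at h1
        exact h1
      have hd2 : Tendsto (fun p : ℕ × ℕ => Θ (φ p.1 - φ p.2)) atTop (𝓝 0) := by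
        have h1 := (hux.comp tendsto_fst).sub (hux.comp (tendsto_snd (f := (atTop : Filter ℕ))
          (g := (atTop : Filter ℕ))))
        rw [sub_self, prod_atTop_atTop_eq, ← hφ'] at h1
        refine h1.congr fun p => ?_
        rw [map_sub]; rfl
      have := (hd2.inner hd2).sub ((hd1.inner hd1).const_mul (c : ℂ))
      simp only [inner_zero_left, mul_zero, sub_zero] at this
      exact this.congr fun p => (hform _ _).symm
  refine ⟨?_, ?_, ⟨-c, ?_⟩, ?_⟩
  · have h1 := hπ.comp hdense π.continuous
    refine h1.mono ?_
    rintro _ ⟨φ, rfl⟩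
    simp only [Function.comp_apply, hΘ]
    exact φ.2
  · intro φ ψ
    have h1 := hform φ ψ
    have h2 := congrArg conj (hform ψ φ)
    rw [map_sub, map_mul, inner_conj_symm, inner_conj_symm, inner_conj_symm,
      Complex.conj_ofReal] at h2
    rw [h1, h2]
  · intro φ
    rw [hform, inner_self_eq_norm_sq_to_K, inner_self_eq_norm_sq_to_K]
    have : (((‖Θ φ‖ : ℝ) : ℂ) ^ 2 - (c : ℂ) * ((‖(φ : E)‖ : ℝ) : ℂ) ^ 2).re
        = ‖Θ φ‖ ^ 2 - c * ‖(φ : E)‖ ^ 2 := by norm_cast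
    refine le_trans ?_ this.ge
    nlinarith [sq_nonneg ‖Θ φ‖]
  · intro ψ η
    rw [hA, hclosure]
    have hkey : ∀ (φ : S.domain) (x : V), ⟪S φ + (c : ℂ) • (φ : E), π x⟫_ℂ = ⟪Θ φ, x⟫_ℂ := by
      intro φ x
      rw [← inner_conj_symm, ← hS, inner_conj_symm]
    have hadj : ∀ (φ : S.domain) (ζ : E), ⟪Θ φ, adjoint π ζ⟫_ℂ = ⟪(φ : E), ζ⟫_ℂ := by
      intro φ ζ
      rw [adjoint_inner_right, hΘ]
    have hcc : ∀ φ : S.domain, ⟪(c : ℂ) • (φ : E), ψ⟫_ℂ = ⟪(φ : E), (c : ℂ) • ψ⟫_ℂ := by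
      intro φ
      rw [inner_smul_left, inner_smul_right, Complex.conj_ofReal]
    constructor
    · intro h
      refine ⟨⟨adjoint π (η + (c : ℂ) • ψ), h.symm⟩, fun φ => ?_⟩
      have h1 := hkey φ (adjoint π (η + (c : ℂ) • ψ))
      rw [hadj, show π (adjoint π (η + (c : ℂ) • ψ)) = ψ from h.symm, inner_add_left,
        inner_add_right, hcc] at h1
      exact add_right_cancel h1
    · rintro ⟨⟨x, rfl⟩, h⟩
      -- The weak equation gives equality of the inner products with all `Θ φ`, and these are dense
      -- in `V`.
      have hx : x = adjoint π (η + (c : ℂ) • π x) := by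
        refine hdense.eq_of_inner_right ℂ ?_
        intro φ
        rw [hadj, ← hkey, inner_add_left, h, inner_add_right, hcc]
      exact congrArg π hx

end FormResolvent

/-! ### Multiplication operators and tensor products in `L²` -/

section Multiplier

/-- A bounded measurable real function. -/
structure Multiplier (α : Type*) [MeasurableSpace α] where
  toFun : α → ℝ
  measurable' : Measurable toFun
  bound : ℝ
  abs_le' : ∀ x, |toFun x| ≤ bound

namespace Multiplier

variable {α β : Type*} [MeasurableSpace α] [MeasurableSpace β]

instance : CoeFun (Multiplier α) fun _ => α → ℝ := ⟨toFun⟩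

/-- Composition with a measurable map. -/
def comp (w : Multiplier β) (f : α → β) (hf : Measurable f) : Multiplier α :=
  ⟨fun x => w (f x), w.measurable'.comp hf, w.bound, fun _ => w.abs_le' _⟩

variable {E : Type*} [NormedAddCommGroup E] [InnerProductSpace ℂ E] {ν : Measure α}

theorem memLp_smul (w : Multiplier α) (F : Lp E 2 ν) :
    MemLp (fun x => (w x : ℂ) • F x) 2 ν := by
  refine MemLp.of_le_mul (c := w.bound) (Lp.memLp F) ?_ ?_
  · exact (Complex.measurable_ofReal.comp w.measurable').aestronglyMeasurable.smul
      (Lp.aestronglyMeasurable F)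
  · refine .of_forall fun x => ?_
    rw [norm_smul, Complex.norm_real, Real.norm_eq_abs]
    exact mul_le_mul_of_nonneg_right (w.abs_le' x) (norm_nonneg _)

/-- The multiplication operator. -/
def op (w : Multiplier α) (E : Type*) [NormedAddCommGroup E] [InnerProductSpace ℂ E]
    (ν : Measure α) : Lp E 2 ν →L[ℂ] Lp E 2 ν :=
  LinearMap.mkContinuous
    { toFun := fun F => (w.memLp_smul F).toLp _
      map_add' := fun F G => by
        rw [← MemLp.toLp_add]
        refine MemLp.toLp_congr _ _ ?_
        filter_upwards [Lp.coeFn_add F G] with x hx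
        rw [hx, Pi.add_apply, smul_add, Pi.add_apply]
      map_smul' := fun c F => by
        rw [RingHom.id_apply, ← MemLp.toLp_const_smul]
        refine MemLp.toLp_congr _ _ ?_
        filter_upwards [Lp.coeFn_smul c F] with x hx
        rw [hx, Pi.smul_apply, smul_comm, Pi.smul_apply] }
    w.bound fun F => by
      refine Lp.norm_le_mul_norm_of_ae_le_mul ?_
      filter_upwards [(w.memLp_smul F).coeFn_toLp] with x hx
      refine (congrArg norm hx).trans_le ?_
      rw [norm_smul, Complex.norm_real, Real.norm_eq_abs]
      exact mul_le_mul_of_nonneg_right (w.abs_le' x) (norm_nonneg _)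

theorem coeFn_op (w : Multiplier α) (F : Lp E 2 ν) :
    w.op E ν F =ᵐ[ν] fun x => (w x : ℂ) • F x := (w.memLp_smul F).coeFn_toLp

theorem inner_op_left (w : Multiplier α) (F G : Lp E 2 ν) :
    ⟪w.op E ν F, G⟫_ℂ = ⟪F, w.op E ν G⟫_ℂ := by
  rw [L2.inner_def, L2.inner_def]
  refine integral_congr_ae ?_
  filter_upwards [w.coeFn_op F, w.coeFn_op G] with x h1 h2
  rw [h1, h2, inner_smul_left, inner_smul_right, Complex.conj_ofReal]

theorem inner_op_op (w v u : Multiplier α) (h : ∀ᵐ x ∂ν, u x = w x * v x) (F G : Lp E 2 ν) :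
    ⟪w.op E ν F, v.op E ν G⟫_ℂ = ⟪F, u.op E ν G⟫_ℂ := by
  rw [L2.inner_def, L2.inner_def]
  refine integral_congr_ae ?_
  filter_upwards [w.coeFn_op F, v.coeFn_op G, u.coeFn_op G, h] with x h1 h2 h3 h4
  rw [h1, h2, h3, inner_smul_left, inner_smul_right, inner_smul_right, Complex.conj_ofReal, h4]
  push_cast; ring

theorem op_eq_of_ae (w : Multiplier α) (F G : Lp E 2 ν)
    (h : G =ᵐ[ν] fun x => (w x : ℂ) • F x) : w.op E ν F = G :=
  Lp.ext ((w.coeFn_op F).trans h.symm)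

end Multiplier

end Multiplier

/-! ### Totality of tensor products and insertion of a variable -/

section Tensor

variable {X : Type*} [MeasurableSpace X] {μ : Measure X} [SigmaFinite μ] {d : ℕ}

theorem inner_compMeasurePreserving {α β E : Type*} [MeasurableSpace α] [MeasurableSpace β]
    [NormedAddCommGroup E] [InnerProductSpace ℂ E] {ν : Measure α} {ν' : Measure β} {f : α → β}
    (hf : MeasurePreserving f ν ν') (F G : Lp E 2 ν') :
    ⟪Lp.compMeasurePreserving f hf F, Lp.compMeasurePreserving f hf G⟫_ℂ = ⟪F, G⟫_ℂ :=
  LinearIsometry.inner_map_map (𝕜 := ℂ) (E := Lp E 2 ν') (E' := Lp E 2 ν)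
    (Lp.compMeasurePreservingₗᵢ ℂ f hf) F G

theorem inner_tensorLeft (f f' : Lp ℂ 2 μ) {n : ℕ} (ψ ψ' : Lp (Spin d) 2 (powMeasure μ n)) :
    ⟪tensorLeft f n ψ, tensorLeft f' n ψ'⟫_ℂ = ⟪f, f'⟫_ℂ * ⟪ψ, ψ'⟫_ℂ := by
  rw [L2.inner_def, L2.inner_def, L2.inner_def, ← integral_prod_mul]
  refine integral_congr_ae ?_
  filter_upwards [(memLp_tensorLeft f ψ).coeFn_toLp, (memLp_tensorLeft f' ψ').coeFn_toLp]
    with p h1 h2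
  change ⟪(memLp_tensorLeft f ψ).toLp _ p, (memLp_tensorLeft f' ψ').toLp _ p⟫_ℂ = _
  rw [h1, h2, inner_smul_left, inner_smul_right, RCLike.inner_apply]
  ring

/-- Against a constant vector, the integral over a rectangle is the inner product with the tensor
product of two indicator functions. -/
theorem setIntegral_rect_eq_zero {n : ℕ} (F : Lp (Spin d) 2 (μ.prod (powMeasure μ n)))
    (hF : ∀ f ψ, ⟪tensorLeft f n ψ, F⟫_ℂ = 0) {s : Set X} {t : Set (Fin n → X)}
    (hs : MeasurableSet s) (ht : MeasurableSet t) (hμs : μ s ≠ ⊤) (hμt : powMeasure μ n t ≠ ⊤) :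
    ∫ p in s ×ˢ t, F p ∂(μ.prod (powMeasure μ n)) = 0 := by
  have hst : (μ.prod (powMeasure μ n)) (s ×ˢ t) ≠ ⊤ := by
    rw [Measure.prod_prod]; exact ENNReal.mul_ne_top hμs hμt
  refine ext_inner_left ℂ fun c => ?_
  rw [inner_zero_right, ← L2.inner_indicatorConstLp_eq_inner_setIntegral ℂ (hs.prod ht) hst c F]
  rw [← hF (indicatorConstLp 2 hs hμs 1) (indicatorConstLp 2 ht hμt c)]
  congr 1
  refine Lp.ext (indicatorConstLp_coeFn.trans ?_)
  refine EventuallyEq.trans ?_ (memLp_tensorLeft _ _).coeFn_toLp.symm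
  filter_upwards [Measure.quasiMeasurePreserving_fst.ae
      (indicatorConstLp_coeFn (p := 2) (hs := hs) (hμs := hμs) (c := (1 : ℂ))),
    Measure.quasiMeasurePreserving_snd.ae
      (indicatorConstLp_coeFn (p := 2) (hs := ht) (hμs := hμt) (c := c))] with p h1 h2
  rw [h1, h2]
  by_cases hp1 : p.1 ∈ s <;> by_cases hp2 : p.2 ∈ t <;> simp [Set.indicator, hp1, hp2]

/-- Tensor products are total in `L²(X × Xⁿ)`. -/
theorem eq_zero_of_inner_tensorLeft {n : ℕ} (F : Lp (Spin d) 2 (μ.prod (powMeasure μ n)))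
    (hF : ∀ f ψ, ⟪tensorLeft f n ψ, F⟫_ℂ = 0) : F = 0 := by
  set S := spanningSets μ
  set S' := spanningSets (powMeasure μ n)
  have hSm : ∀ i j, MeasurableSet (S i ×ˢ S' j) := fun i j =>
    (measurableSet_spanningSets μ i).prod (measurableSet_spanningSets _ j)
  have hSf : ∀ i j, (μ.prod (powMeasure μ n)) (S i ×ˢ S' j) < ⊤ := fun i j => by
    rw [Measure.prod_prod]
    exact ENNReal.mul_lt_top (measure_spanningSets_lt_top μ i) (measure_spanningSets_lt_top _ j)
  -- On a rectangle of finite measure `F` is integrable, and rectangles form a generating π-system.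
  -- By Dynkin's lemma all integrals of `F` over measurable subsets vanish. Such rectangles exhaust
  -- the product.
  have key : ∀ i j, ∀ᵐ p ∂((μ.prod (powMeasure μ n)).restrict (S i ×ˢ S' j)), F p = 0 := by
    intro i j
    have hfin : IsFiniteMeasure ((μ.prod (powMeasure μ n)).restrict (S i ×ˢ S' j)) :=
      ⟨by rw [Measure.restrict_apply_univ]; exact hSf i j⟩
    have hint : Integrable F ((μ.prod (powMeasure μ n)).restrict (S i ×ˢ S' j)) :=
      ((Lp.memLp F).restrict _).integrable (by norm_num)
    refine Integrable.ae_eq_zero_of_forall_setIntegral_eq_zero hint fun s hs _ => ?_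
    induction s, hs using MeasurableSpace.induction_on_inter generateFrom_prod.symm
      isPiSystem_prod with
    | empty => simp
    | basic t ht =>
      obtain ⟨a, ha, b, hb, rfl⟩ := ht
      have ha : MeasurableSet a := ha
      have hb : MeasurableSet b := hb
      rw [Measure.restrict_restrict (ha.prod hb), Set.prod_inter_prod]
      refine setIntegral_rect_eq_zero F hF (ha.inter (measurableSet_spanningSets μ i))
        (hb.inter (measurableSet_spanningSets _ j)) ?_ ?_
      · exact ((measure_mono Set.inter_subset_right).trans_lt
          (measure_spanningSets_lt_top μ i)).ne
      · exact ((measure_mono Set.inter_subset_right).trans_lt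
          (measure_spanningSets_lt_top _ j)).ne
    | compl t ht ih =>
      have h1 := integral_add_compl ht hint
      rw [ih (measure_lt_top _ _), zero_add] at h1
      rw [h1]
      exact setIntegral_rect_eq_zero F hF (measurableSet_spanningSets μ i)
        (measurableSet_spanningSets _ j) (measure_spanningSets_lt_top μ i).ne
        (measure_spanningSets_lt_top _ j).ne
    | iUnion f hd hm ih =>
      have := hasSum_integral_iUnion hm hd hint.integrableOn
      refine this.unique ?_
      simp only [ih _ (measure_lt_top _ _)]
      exact hasSum_zero
  refine Lp.ext ?_
  have h2 : ∀ᵐ p ∂(μ.prod (powMeasure μ n)), ∀ i j, p ∈ S i ×ˢ S' j → F p = 0 := by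
    refine ae_all_iff.2 fun i => ae_all_iff.2 fun j => ?_
    exact (ae_restrict_iff' (hSm i j)).1 (key i j)
  filter_upwards [h2, Lp.coeFn_zero (Spin d) 2 (μ.prod (powMeasure μ n))] with p hp h0
  rw [h0, Pi.zero_apply]
  have h1 : p.1 ∈ ⋃ i, S i := by rw [iUnion_spanningSets]; trivial
  have h1' : p.2 ∈ ⋃ i, S' i := by rw [iUnion_spanningSets]; trivial
  obtain ⟨i, hi⟩ := Set.mem_iUnion.1 h1
  obtain ⟨j, hj⟩ := Set.mem_iUnion.1 h1'
  exact hp i j ⟨hi, hj⟩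

theorem inner_insertAt (f f' : Lp ℂ 2 μ) {n : ℕ} (i : Fin (n + 1))
    (ψ ψ' : Lp (Spin d) 2 (powMeasure μ n)) :
    ⟪insertAt f n i ψ, insertAt f' n i ψ'⟫_ℂ = ⟪f, f'⟫_ℂ * ⟪ψ, ψ'⟫_ℂ := by
  rw [← inner_tensorLeft]
  exact inner_compMeasurePreserving (measurePreserving_removeNth n i) _ _

/-- Tensor products are total in `L²(Xⁿ⁺¹)`. -/
theorem eq_zero_of_inner_insertAt {n : ℕ} (i : Fin (n + 1))
    (F : Lp (Spin d) 2 (powMeasure μ (n + 1)))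
    (hF : ∀ f ψ, ⟪insertAt f n i ψ, F⟫_ℂ = 0) : F = 0 := by
  have hm := measurePreserving_piFinSuccAbove (fun _ : Fin (n + 1) => μ) i
  have hm' := hm.symm
  set G := Lp.compMeasurePreserving _ hm' F with hG
  have hFG : Lp.compMeasurePreserving _ (measurePreserving_removeNth (μ := μ) n i) G = F := by
    refine Lp.ext ?_
    refine (Lp.coeFn_compMeasurePreserving G (measurePreserving_removeNth n i)).trans ?_
    have := (measurePreserving_removeNth (μ := μ) n i).quasiMeasurePreserving.ae_eq_comp
      (Lp.coeFn_compMeasurePreserving F hm')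
    refine this.trans (.of_forall fun k => ?_)
    exact congrArg F ((MeasurableEquiv.piFinSuccAbove (fun _ : Fin (n + 1) => X) i).symm_apply_apply k)
  have hG0 : G = 0 := by
    refine eq_zero_of_inner_tensorLeft G fun f ψ => ?_
    rw [← hF f ψ]
    conv_rhs => rw [← hFG]
    exact (inner_compMeasurePreserving (measurePreserving_removeNth n i) _ _).symm
  rw [← hFG, hG0, map_zero]

theorem insertAt_add (f f' : Lp ℂ 2 μ) {n : ℕ} (i : Fin (n + 1))
    (ψ : Lp (Spin d) 2 (powMeasure μ n)) :
    insertAt (f + f') n i ψ = insertAt f n i ψ + insertAt f' n i ψ := by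
  refine Lp.ext ?_
  have h := (Measure.quasiMeasurePreserving_fst.comp
    (measurePreserving_removeNth (μ := μ) n i).quasiMeasurePreserving).ae (Lp.coeFn_add f f')
  filter_upwards [h, coeFn_insertAt (f + f') n i ψ, coeFn_insertAt f n i ψ,
    coeFn_insertAt f' n i ψ, Lp.coeFn_add (insertAt f n i ψ) (insertAt f' n i ψ)]
    with k h1 h2 h3 h4 h5
  simp only [Function.comp_apply, Pi.add_apply] at h1
  rw [h2, h5, Pi.add_apply, h3, h4, h1, add_smul]

theorem insertAt_smul (c : ℂ) (f : Lp ℂ 2 μ) {n : ℕ} (i : Fin (n + 1))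
    (ψ : Lp (Spin d) 2 (powMeasure μ n)) :
    insertAt (c • f) n i ψ = c • insertAt f n i ψ := by
  refine Lp.ext ?_
  have h := (Measure.quasiMeasurePreserving_fst.comp
    (measurePreserving_removeNth (μ := μ) n i).quasiMeasurePreserving).ae (Lp.coeFn_smul c f)
  filter_upwards [h, coeFn_insertAt (c • f) n i ψ, coeFn_insertAt f n i ψ,
    Lp.coeFn_smul c (insertAt f n i ψ)] with k h1 h2 h3 h5
  simp only [Function.comp_apply, Pi.smul_apply, smul_eq_mul] at h1
  rw [h2, h5, Pi.smul_apply, h3, h1, mul_smul]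

theorem norm_insertAt (f : Lp ℂ 2 μ) {n : ℕ} (i : Fin (n + 1))
    (ψ : Lp (Spin d) 2 (powMeasure μ n)) : ‖insertAt f n i ψ‖ = ‖f‖ * ‖ψ‖ := by
  have h := inner_insertAt f f i ψ ψ
  simp only [inner_self_eq_norm_sq_to_K] at h
  have h' : ‖insertAt f n i ψ‖ ^ 2 = (‖f‖ * ‖ψ‖) ^ 2 := by
    rw [mul_pow]; exact_mod_cast h
  exact (sq_eq_sq₀ (norm_nonneg _) (by positivity)).1 h'

theorem insertAt_op (w : Multiplier X) (f : Lp ℂ 2 μ) {n : ℕ} (i : Fin (n + 1))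
    (ψ : Lp (Spin d) 2 (powMeasure μ n)) :
    insertAt (w.op ℂ μ f) n i ψ
      = (w.comp (fun k : Fin (n + 1) → X => k i) (measurable_pi_apply i)).op _ _
        (insertAt f n i ψ) := by
  symm
  refine Multiplier.op_eq_of_ae _ _ _ ?_
  have h := (Measure.quasiMeasurePreserving_fst.comp
    (measurePreserving_removeNth (μ := μ) n i).quasiMeasurePreserving).ae (w.coeFn_op f)
  filter_upwards [h, coeFn_insertAt (w.op ℂ μ f) n i ψ, coeFn_insertAt f n i ψ] with k h1 h2 h3
  simp only [Function.comp_apply] at h1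
  rw [h2, h3, h1, smul_eq_mul, mul_smul]
  rfl

/-- Insertions into different slots commute. Slot `i` of the shorter tuple becomes slot `i + 1`
after a variable has been put in front. -/
theorem insertAt_succ_insertAt_zero (f u : Lp ℂ 2 μ) {n : ℕ} (i : Fin (n + 1))
    (χ : Lp (Spin d) 2 (powMeasure μ n)) :
    insertAt f (n + 1) i.succ (insertAt u n 0 χ) = insertAt u (n + 1) 0 (insertAt f n i χ) := by
  refine Lp.ext ?_
  have h1 := (Measure.quasiMeasurePreserving_snd.comp
    (measurePreserving_removeNth (μ := μ) (n + 1) i.succ).quasiMeasurePreserving).ae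
      (coeFn_insertAt u n 0 χ)
  have h2 := (Measure.quasiMeasurePreserving_snd.comp
    (measurePreserving_removeNth (μ := μ) (n + 1) 0).quasiMeasurePreserving).ae
      (coeFn_insertAt f n i χ)
  filter_upwards [h1, h2, coeFn_insertAt f (n + 1) i.succ (insertAt u n 0 χ),
    coeFn_insertAt u (n + 1) 0 (insertAt f n i χ)] with k h1 h2 h3 h4
  simp only [Function.comp_apply] at h1 h2
  rw [h3, h4, h1, h2, smul_smul, smul_smul, mul_comm]
  have e1 : Fin.removeNth i.succ k 0 = k 0 := by simp [Fin.removeNth]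
  have e2 : Fin.removeNth 0 k i = k i.succ := by simp [Fin.removeNth]
  have e3 : Fin.removeNth 0 (Fin.removeNth i.succ k) = Fin.removeNth i (Fin.removeNth 0 k) := by
    funext a; simp [Fin.removeNth]
  rw [e1, e2, e3]

end Tensor

/-! Instances which are slow to synthesize. -/

local instance instAddCommGroupSector {X : Type*} [MeasurableSpace X] {μ : Measure X} [SigmaFinite μ] {d n : ℕ} :
    AddCommGroup (Sector μ d n) := inferInstance

local instance instAddCommMonoidSector {X : Type*} [MeasurableSpace X] {μ : Measure X} [SigmaFinite μ] {d n : ℕ} :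
    AddCommMonoid (Sector μ d n) := inferInstance

local instance instModuleSector {X : Type*} [MeasurableSpace X] {μ : Measure X} [SigmaFinite μ] {d n : ℕ} :
    Module ℂ (Sector μ d n) := inferInstance

local instance instNormedAddCommGroupSector {X : Type*} [MeasurableSpace X] {μ : Measure X} [SigmaFinite μ] {d n : ℕ} :
    NormedAddCommGroup (Sector μ d n) := inferInstance

local instance instInnerProductSpaceSector {X : Type*} [MeasurableSpace X] {μ : Measure X} [SigmaFinite μ] {d n : ℕ} :
    InnerProductSpace ℂ (Sector μ d n) := inferInstance

local instance instAddCommGroupFormal {X : Type*} [MeasurableSpace X] {μ : Measure X} [SigmaFinite μ] {d : ℕ} :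
    AddCommGroup (Formal μ d) := inferInstance

local instance instAddCommMonoidFormal {X : Type*} [MeasurableSpace X] {μ : Measure X} [SigmaFinite μ] {d : ℕ} :
    AddCommMonoid (Formal μ d) := inferInstance

local instance instModuleFormal {X : Type*} [MeasurableSpace X] {μ : Measure X} [SigmaFinite μ] {d : ℕ} :
    Module ℂ (Formal μ d) := inferInstance

local instance instNormedAddCommGroupFock {X : Type*} [MeasurableSpace X] {μ : Measure X} [SigmaFinite μ] {d : ℕ} :
    NormedAddCommGroup (Fock μ d) := inferInstance

local instance instInnerProductSpaceFock {X : Type*} [MeasurableSpace X] {μ : Measure X} [SigmaFinite μ] {d : ℕ} :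
    InnerProductSpace ℂ (Fock μ d) := inferInstance

local instance instAddCommGroupFock {X : Type*} [MeasurableSpace X] {μ : Measure X} [SigmaFinite μ] {d : ℕ} :
    AddCommGroup (Fock μ d) := inferInstance

local instance instAddCommMonoidFock {X : Type*} [MeasurableSpace X] {μ : Measure X} [SigmaFinite μ] {d : ℕ} :
    AddCommMonoid (Fock μ d) := inferInstance

local instance instModuleFock {X : Type*} [MeasurableSpace X] {μ : Measure X} [SigmaFinite μ] {d : ℕ} :
    Module ℂ (Fock μ d) := inferInstance

local instance instTopologicalSpaceFock {X : Type*} [MeasurableSpace X] {μ : Measure X} [SigmaFinite μ] {d : ℕ} :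
    TopologicalSpace (Fock μ d) := inferInstance

/-! ### Creation and annihilation operators on the sectors -/

section Sectors

variable {X : Type*} [MeasurableSpace X] {μ : Measure X} [SigmaFinite μ] {d : ℕ}

open ContinuousLinearMap (adjoint adjoint_inner_left adjoint_inner_right)

theorem sector_inner_smul_right {n : ℕ} (c : ℂ) (φ ψ : Sector μ d n) :
    ⟪φ, c • ψ⟫_ℂ = c * ⟪φ, ψ⟫_ℂ := inner_smul_right φ ψ c

theorem sector_inner_smul_left {n : ℕ} (c : ℂ) (φ ψ : Sector μ d n) :
    ⟪c • φ, ψ⟫_ℂ = conj c * ⟪φ, ψ⟫_ℂ := inner_smul_left φ ψ c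

theorem sector_norm_smul {n : ℕ} (c : ℂ) (φ : Sector μ d n) : ‖c • φ‖ = ‖c‖ * ‖φ‖ :=
  norm_smul c φ

theorem sector_perm_eq {n : ℕ} (Φ : Sector μ d n) (σ : Equiv.Perm (Fin n)) :
    Lp.compMeasurePreserving (fun k => k ∘ σ) (measurePreserving_perm μ n σ)
      (Φ : Lp (Spin d) 2 (powMeasure μ n)) = Φ := Φ.2 σ

theorem compPerm_insertAt (f : Lp ℂ 2 μ) (n : ℕ) (i : Fin (n + 1)) (σ : Equiv.Perm (Fin (n + 1)))
    (τ : Equiv.Perm (Fin n))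
    (hτ : ∀ k : Fin (n + 1) → X, i.removeNth (k ∘ σ) = (σ i).removeNth k ∘ τ)
    (χ : Lp (Spin d) 2 (powMeasure μ n)) :
    Lp.compMeasurePreserving (fun k => k ∘ σ) (measurePreserving_perm μ (n + 1) σ)
      (insertAt f n i χ) = insertAt f n (σ i)
        (Lp.compMeasurePreserving (fun k => k ∘ τ) (measurePreserving_perm μ n τ) χ) := by
  have hσ := measurePreserving_perm μ (n + 1) σ
  refine Lp.ext ?_
  refine (Lp.coeFn_compMeasurePreserving _ hσ).trans ?_
  have h1 := hσ.quasiMeasurePreserving.ae_eq_comp (coeFn_insertAt f n i χ)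
  refine h1.trans (EventuallyEq.trans ?_ (coeFn_insertAt f n (σ i) _).symm)
  have h2 := Lp.coeFn_compMeasurePreserving χ (measurePreserving_perm μ n τ)
  have h3 := (Measure.quasiMeasurePreserving_snd.comp (measurePreserving_removeNth (μ := μ) n
    (σ i)).quasiMeasurePreserving).ae h2
  filter_upwards [h3] with k hk
  simp only [Function.comp_apply] at hk ⊢
  rw [hk]
  exact congrArg (fun q => f (k (σ i)) • χ q) (hτ k)

/-- The transposition of `i` and `0` moves the inserted variable to the front without changing the
symmetric vectors. Thus the `n + 1` terms of `a^*(f)` contribute equally against a symmetric vector,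
which leaves a factor `√(n + 1)`. -/
theorem inner_insertAt_sector (f : Lp ℂ 2 μ) {n : ℕ} (i : Fin (n + 1)) (ψ : Sector μ d n)
    (Φ : Sector μ d (n + 1)) :
    ⟪insertAt f n i (ψ : Lp (Spin d) 2 (powMeasure μ n)),
        (Φ : Lp (Spin d) 2 (powMeasure μ (n + 1)))⟫_ℂ
      = ⟪insertAt f n 0 (ψ : Lp (Spin d) 2 (powMeasure μ n)),
        (Φ : Lp (Spin d) 2 (powMeasure μ (n + 1)))⟫_ℂ := by
  obtain ⟨τ, hτ⟩ := exists_removeNth_comp (X := X) (Equiv.swap i 0) i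
  have h := compPerm_insertAt f n i (Equiv.swap i 0) τ hτ (ψ : Lp (Spin d) 2 (powMeasure μ n))
  rw [sector_perm_eq ψ, Equiv.swap_apply_left] at h
  rw [← h]
  conv_rhs => rw [← sector_perm_eq Φ (Equiv.swap i 0)]
  rw [inner_compMeasurePreserving]

theorem coe_creSector (f : Lp ℂ 2 μ) (n : ℕ) (ψ : Sector μ d n) :
    (creSector f n ψ : Lp (Spin d) 2 (powMeasure μ (n + 1)))
      = (((Real.sqrt (n + 1))⁻¹ : ℝ) : ℂ) •
        ∑ i, insertAt f n i (ψ : Lp (Spin d) 2 (powMeasure μ n)) := by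
  simp [creSector]

theorem sqrt_succ_ne_zero (n : ℕ) : ((Real.sqrt ((n : ℝ) + 1) : ℝ) : ℂ) ≠ 0 := by
  have : (0 : ℝ) < (n : ℝ) + 1 := by positivity
  exact_mod_cast (Real.sqrt_pos.2 this).ne'

theorem sqrt_succ_mul_self (n : ℕ) :
    ((Real.sqrt ((n : ℝ) + 1) : ℝ) : ℂ) * ((Real.sqrt ((n : ℝ) + 1) : ℝ) : ℂ) = (n : ℂ) + 1 := by
  have : (0 : ℝ) ≤ (n : ℝ) + 1 := by positivity
  rw [← Complex.ofReal_mul, Real.mul_self_sqrt this]; push_cast; ring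

theorem inner_creSector_left (f : Lp ℂ 2 μ) (n : ℕ) (ψ : Sector μ d n) (Φ : Sector μ d (n + 1)) :
    ⟪creSector f n ψ, Φ⟫_ℂ = (Real.sqrt (n + 1) : ℂ) *
      ⟪insertAt f n 0 (ψ : Lp (Spin d) 2 (powMeasure μ n)),
        (Φ : Lp (Spin d) 2 (powMeasure μ (n + 1)))⟫_ℂ := by
  rw [Submodule.coe_inner, coe_creSector, inner_smul_left, sum_inner]
  simp only [inner_insertAt_sector]
  rw [Finset.sum_const, Finset.card_univ, Fintype.card_fin, nsmul_eq_mul, Complex.conj_ofReal,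
    ← mul_assoc]
  congr 1
  push_cast
  rw [← sqrt_succ_mul_self, inv_mul_cancel_left₀ (sqrt_succ_ne_zero n)]

/-- The annihilation operator from the `(n+1)`-boson to the `n`-boson sector. -/
def annSector (f : Lp ℂ 2 μ) (n : ℕ) : Sector μ d (n + 1) →L[ℂ] Sector μ d n :=
  adjoint (creSector f n)

theorem ann_apply (f : Lp ℂ 2 μ) (Ψ : Formal μ d) (n : ℕ) :
    ann f Ψ n = annSector f n (Ψ (n + 1)) := rfl

theorem cre_apply_succ (f : Lp ℂ 2 μ) (Ψ : Formal μ d) (n : ℕ) :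
    cre f Ψ (n + 1) = creSector f n (Ψ n) := rfl

theorem cre_apply_zero (f : Lp ℂ 2 μ) (Ψ : Formal μ d) : cre f Ψ 0 = 0 := rfl

theorem insertAt_zero_perm (h : Lp ℂ 2 μ) (n : ℕ) (τ : Equiv.Perm (Fin n))
    (χ : Lp (Spin d) 2 (powMeasure μ n)) (Φ : Sector μ d (n + 1)) :
    ⟪insertAt h n 0 (Lp.compMeasurePreserving (fun k => k ∘ τ) (measurePreserving_perm μ n τ) χ),
        (Φ : Lp (Spin d) 2 (powMeasure μ (n + 1)))⟫_ℂ
      = ⟪insertAt h n 0 χ, (Φ : Lp (Spin d) 2 (powMeasure μ (n + 1)))⟫_ℂ := by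
  -- `σ` acts as `τ` on the last `n` variables and fixes the inserted one.
  set σ : Equiv.Perm (Fin (n + 1)) := Equiv.Perm.decomposeFin.symm (0, τ) with hσ
  have h0 : σ 0 = 0 := by simp [hσ]
  have h1 : ∀ a : Fin n, σ a.succ = (τ a).succ := fun a => by simp [hσ]
  have := compPerm_insertAt h n 0 σ τ (fun k => by
    funext a
    simp only [h0, Fin.removeNth, Function.comp_apply, Fin.zero_succAbove, h1]) χ
  rw [h0] at this
  rw [← this]
  conv_lhs => rw [← sector_perm_eq Φ σ]
  rw [inner_compMeasurePreserving]

/-- The formula `a(h) Φ = √(n + 1) ⟨h, Φ⟩`, with the scalar product in the first variable. The point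
to check is that the partial scalar product of a symmetric function is symmetric in the remaining
variables. -/
theorem coe_annSector (h : Lp ℂ 2 μ) (n : ℕ) (Φ : Sector μ d (n + 1)) :
    (annSector h n Φ : Lp (Spin d) 2 (powMeasure μ n)) = (Real.sqrt (n + 1) : ℂ) •
      adjoint (insertAt h n 0) (Φ : Lp (Spin d) 2 (powMeasure μ (n + 1))) := by
  have hmem : adjoint (insertAt h n 0) (Φ : Lp (Spin d) 2 (powMeasure μ (n + 1)))
      ∈ Sector μ d n := by
    intro τ
    refine ext_inner_left ℂ fun χ => ?_
    set P := Lp.compMeasurePreserving (E := Spin d) (p := 2) (fun k => k ∘ τ)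
      (measurePreserving_perm μ n τ)
    set P' := Lp.compMeasurePreserving (E := Spin d) (p := 2) (fun k => k ∘ τ.symm)
      (measurePreserving_perm μ n τ.symm)
    have hP : P (P' χ) = χ := by
      refine Lp.ext ?_
      refine (Lp.coeFn_compMeasurePreserving _ (measurePreserving_perm μ n τ)).trans ?_
      have := (measurePreserving_perm μ n τ).quasiMeasurePreserving.ae_eq_comp
        (Lp.coeFn_compMeasurePreserving χ (measurePreserving_perm μ n τ.symm))
      refine this.trans (.of_forall fun k => ?_)
      simp [Function.comp_assoc]
    conv_lhs => rw [← hP]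
    rw [inner_compMeasurePreserving, adjoint_inner_right, adjoint_inner_right,
      insertAt_zero_perm]
  have h2 : annSector h n Φ = (Real.sqrt (n + 1) : ℂ) • (⟨_, hmem⟩ : Sector μ d n) := by
    refine ext_inner_left ℂ fun ψ => ?_
    rw [annSector, adjoint_inner_right, inner_creSector_left, sector_inner_smul_right,
      Submodule.coe_inner, adjoint_inner_right]
  rw [h2]; rfl

/-- All partial scalar products in the first variable vanish, and tensor products are total. This
turns identities in a sector into identities with one boson less and drives the inductions below. -/
theorem eq_zero_of_annSector {n : ℕ} {Φ : Sector μ d (n + 1)}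
    (h : ∀ u : Lp ℂ 2 μ, annSector u n Φ = 0) : Φ = 0 := by
  refine Subtype.ext (eq_zero_of_inner_insertAt 0 _ fun u χ => ?_)
  have h1 := congrArg (Subtype.val) (h u)
  rw [coe_annSector] at h1
  have h2 : adjoint (insertAt u n 0) (Φ : Lp (Spin d) 2 (powMeasure μ (n + 1))) = 0 :=
    (smul_eq_zero.1 h1).resolve_left (sqrt_succ_ne_zero n)
  rw [← adjoint_inner_right, h2, inner_zero_right]

/-- Contracting the first variable with `h` does not interfere with a function inserted at a later
slot. The identity is checked against tensors, where it becomes the commutation of two insertions.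
-/
theorem inner_insertAt_zero_insertAt_succ (h f : Lp ℂ 2 μ) {n : ℕ} (i : Fin (n + 1))
    (χ ψ : Lp (Spin d) 2 (powMeasure μ (n + 1))) :
    ⟪insertAt h (n + 1) 0 χ, insertAt f (n + 1) i.succ ψ⟫_ℂ
      = ⟪χ, insertAt f n i (adjoint (insertAt h n 0) ψ)⟫_ℂ := by
  rw [← adjoint_inner_left, ← adjoint_inner_left, adjoint_inner_right]
  rw [← sub_eq_zero, ← inner_sub_left]
  suffices h0 : adjoint (insertAt f (n + 1) i.succ) (insertAt h (n + 1) 0 χ)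
      - insertAt h n 0 (adjoint (insertAt f n i) χ) = 0 by rw [h0, inner_zero_left]
  refine eq_zero_of_inner_insertAt 0 _ fun u θ => ?_
  rw [inner_sub_right, adjoint_inner_right, insertAt_succ_insertAt_zero, inner_insertAt,
    inner_insertAt, adjoint_inner_right, sub_self]

/-- The canonical commutation relations. -/
theorem ann_cre (h f : Lp ℂ 2 μ) (Ψ : Formal μ d) :
    ann h (cre f Ψ) = ⟪h, f⟫_ℂ • Ψ + cre f (ann h Ψ) := by
  funext n
  refine ext_inner_left ℂ fun Φ => ?_
  have h0 : ∀ i : Fin (n + 1), ∀ c : ℂ, (Real.sqrt (n + 1) : ℂ) *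
      ((((Real.sqrt (n + 1))⁻¹ : ℝ) : ℂ) * c) = c := fun _ c => by
    rw [← mul_assoc]
    push_cast
    rw [mul_inv_cancel₀ (sqrt_succ_ne_zero n), one_mul]
  -- In the sum defining `a^*(f)`, slot `0` is contracted with `h` and gives `⟨h, f⟩`; the other
  -- slots give `a^*(f) a(h)`.
  rw [ann_apply, cre_apply_succ, annSector, adjoint_inner_right, inner_creSector_left,
    coe_creSector, inner_smul_right, h0 0, inner_sum, Fin.sum_univ_succ, inner_insertAt,
    Pi.add_apply, inner_add_right, Pi.smul_apply, sector_inner_smul_right, Submodule.coe_inner]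
  congr 1
  cases n with
  | zero => simp [cre_apply_zero]
  | succ n =>
    simp only [inner_insertAt_zero_insertAt_succ]
    rw [cre_apply_succ, ann_apply, Submodule.coe_inner, coe_creSector, coe_annSector,
      inner_smul_right, inner_sum]
    simp only [map_smul, inner_smul_right, ← Finset.mul_sum]
    rw [← mul_assoc]
    push_cast
    rw [inv_mul_cancel₀ (sqrt_succ_ne_zero n), one_mul]

/-- Induction on the boson number: by the commutation relations, every `a(u)` maps the difference of
the two sides to a difference of the same kind one sector lower. In the zero-boson sector both sides
vanish. -/
theorem cre_comm (f f' : Lp ℂ 2 μ) (Ψ : Formal μ d) : cre f (cre f' Ψ) = cre f' (cre f Ψ) := by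
  funext n
  induction n generalizing Ψ with
  | zero => rfl
  | succ n ih =>
    rw [← sub_eq_zero]
    refine eq_zero_of_annSector fun u => ?_
    rw [map_sub, ← ann_apply, ← ann_apply, sub_eq_zero]
    simp only [ann_cre, map_add, map_smul, Pi.add_apply, Pi.smul_apply, ih (ann u Ψ)]
    abel

theorem creSector_add (f f' : Lp ℂ 2 μ) (n : ℕ) (ψ : Sector μ d n) :
    creSector (f + f') n ψ = creSector f n ψ + creSector f' n ψ := by
  refine Subtype.ext ?_
  rw [Submodule.coe_add, coe_creSector, coe_creSector, coe_creSector, ← smul_add,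
    ← Finset.sum_add_distrib]
  simp only [insertAt_add]

theorem creSector_smul (c : ℂ) (f : Lp ℂ 2 μ) (n : ℕ) (ψ : Sector μ d n) :
    creSector (c • f) n ψ = c • creSector f n ψ := by
  refine Subtype.ext ?_
  rw [Submodule.coe_smul, coe_creSector, coe_creSector, smul_comm c, Finset.smul_sum]
  simp only [insertAt_smul, Finset.smul_sum]

theorem cre_add (f f' : Lp ℂ 2 μ) (Ψ : Formal μ d) : cre (f + f') Ψ = cre f Ψ + cre f' Ψ := by
  funext n
  cases n with
  | zero => exact (add_zero _).symm
  | succ n => exact creSector_add f f' n _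

theorem cre_smul (c : ℂ) (f : Lp ℂ 2 μ) (Ψ : Formal μ d) : cre (c • f) Ψ = c • cre f Ψ := by
  funext n
  cases n with
  | zero => exact (smul_zero (A := Sector μ d 0) c).symm
  | succ n => exact creSector_smul c f n _

theorem annSector_smul (c : ℂ) (f : Lp ℂ 2 μ) (n : ℕ) (ψ : Sector μ d (n + 1)) :
    annSector (c • f) n ψ = conj c • annSector f n ψ := by
  refine ext_inner_left ℂ fun φ => ?_
  simp only [annSector, adjoint_inner_right, sector_inner_smul_right, creSector_smul,
    sector_inner_smul_left]

theorem ann_smul (c : ℂ) (f : Lp ℂ 2 μ) (Ψ : Formal μ d) : ann (c • f) Ψ = conj c • ann f Ψ :=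
  funext fun _ => annSector_smul _ _ _ _

theorem norm_creSector_le (f : Lp ℂ 2 μ) (n : ℕ) (ψ : Sector μ d n) :
    ‖creSector f n ψ‖ ≤ Real.sqrt (n + 1) * ‖f‖ * ‖ψ‖ := by
  rw [Submodule.coe_norm, coe_creSector, norm_smul]
  have h1 : ‖∑ i, insertAt f n i (ψ : Lp (Spin d) 2 (powMeasure μ n))‖
      ≤ ((n : ℝ) + 1) * (‖f‖ * ‖ψ‖) := by
    refine (norm_sum_le _ _).trans ?_
    simp [norm_insertAt]
  have h2 : (0 : ℝ) < Real.sqrt (n + 1) := Real.sqrt_pos.2 (by positivity)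
  rw [Complex.norm_real, norm_inv, Real.norm_of_nonneg h2.le, inv_mul_le_iff₀ h2]
  refine h1.trans (le_of_eq ?_)
  have h3 : Real.sqrt (n + 1) * Real.sqrt (n + 1) = (n : ℝ) + 1 :=
    Real.mul_self_sqrt (by positivity)
  rw [show Real.sqrt (n + 1) * (Real.sqrt (n + 1) * ‖f‖ * ‖ψ‖)
    = Real.sqrt (n + 1) * Real.sqrt (n + 1) * (‖f‖ * ‖ψ‖) by ring, h3]

theorem norm_annSector_le (f : Lp ℂ 2 μ) (n : ℕ) (ψ : Sector μ d (n + 1)) :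
    ‖annSector f n ψ‖ ≤ Real.sqrt (n + 1) * ‖f‖ * ‖ψ‖ := by
  refine (annSector f n).le_of_opNorm_le ?_ ψ
  rw [annSector, LinearIsometryEquiv.norm_map]
  exact ContinuousLinearMap.opNorm_le_bound _ (by positivity) (norm_creSector_le f n)

end Sectors

/-! ### Matrices acting on the spin variable -/

section Matrices

variable {X : Type*} [MeasurableSpace X] {μ : Measure X} [SigmaFinite μ] {d : ℕ}

open ContinuousLinearMap (adjoint adjoint_inner_left adjoint_inner_right)

/-- The operator norm of a matrix. -/
def matNorm (M : Matrix (Fin d) (Fin d) ℂ) : ℝ :=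
  ‖Matrix.toEuclideanCLM (n := Fin d) (𝕜 := ℂ) M‖

theorem matNorm_nonneg (M : Matrix (Fin d) (Fin d) ℂ) : 0 ≤ matNorm M := norm_nonneg _

theorem coe_matSector (M : Matrix (Fin d) (Fin d) ℂ) (n : ℕ) (ψ : Sector μ d n) :
    (matSector M n ψ : Lp (Spin d) 2 (powMeasure μ n))
      = (Matrix.toEuclideanCLM (n := Fin d) (𝕜 := ℂ) M).compLpL 2 (powMeasure μ n) ψ := rfl

theorem coeFn_matSector (M : Matrix (Fin d) (Fin d) ℂ) (n : ℕ) (ψ : Sector μ d n) :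
    (matSector M n ψ : Lp (Spin d) 2 (powMeasure μ n)) =ᵐ[powMeasure μ n]
      fun k => Matrix.toEuclideanCLM (n := Fin d) (𝕜 := ℂ) M
        ((ψ : Lp (Spin d) 2 (powMeasure μ n)) k) := by
  rw [coe_matSector]
  exact ContinuousLinearMap.coeFn_compLpL _ _

theorem norm_matSector_le (M : Matrix (Fin d) (Fin d) ℂ) (n : ℕ) (ψ : Sector μ d n) :
    ‖matSector M n ψ‖ ≤ matNorm M * ‖ψ‖ :=
  ContinuousLinearMap.norm_compLp_le _ _

theorem inner_matSector_left (M : Matrix (Fin d) (Fin d) ℂ) (n : ℕ) (φ ψ : Sector μ d n) :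
    ⟪matSector M n φ, ψ⟫_ℂ = ⟪φ, matSector M.conjTranspose n ψ⟫_ℂ := by
  rw [Submodule.coe_inner, Submodule.coe_inner, L2.inner_def, L2.inner_def]
  refine integral_congr_ae ?_
  filter_upwards [coeFn_matSector M n φ, coeFn_matSector M.conjTranspose n ψ] with k h1 h2
  rw [h1, h2, ← Matrix.star_eq_conjTranspose, map_star, ContinuousLinearMap.star_eq_adjoint,
    adjoint_inner_right]

theorem matSector_mul (M M' : Matrix (Fin d) (Fin d) ℂ) (n : ℕ) (ψ : Sector μ d n) :
    matSector (M * M') n ψ = matSector M n (matSector M' n ψ) := by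
  refine Subtype.ext (Lp.ext ?_)
  filter_upwards [coeFn_matSector (M * M') n ψ, coeFn_matSector M n (matSector M' n ψ),
    coeFn_matSector M' n ψ] with k h1 h2 h3
  rw [h1, h2, h3, map_mul]; rfl

theorem matSector_one (n : ℕ) (ψ : Sector μ d n) : matSector 1 n ψ = ψ := by
  refine Subtype.ext (Lp.ext ?_)
  filter_upwards [coeFn_matSector 1 n ψ] with k h1
  rw [h1, map_one]; rfl

theorem matSector_add (M M' : Matrix (Fin d) (Fin d) ℂ) (n : ℕ) (ψ : Sector μ d n) :
    matSector (M + M') n ψ = matSector M n ψ + matSector M' n ψ := by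
  refine Subtype.ext (Lp.ext ?_)
  filter_upwards [coeFn_matSector (M + M') n ψ, coeFn_matSector M n ψ, coeFn_matSector M' n ψ,
    Lp.coeFn_add (matSector M n ψ : Lp (Spin d) 2 (powMeasure μ n)) (matSector M' n ψ)]
    with k h1 h2 h3 h4
  rw [h1]
  refine Eq.trans ?_ h4.symm
  rw [Pi.add_apply, h2, h3, map_add]; rfl

theorem matSector_smul (c : ℂ) (M : Matrix (Fin d) (Fin d) ℂ) (n : ℕ) (ψ : Sector μ d n) :
    matSector (c • M) n ψ = c • matSector M n ψ := by
  refine Subtype.ext (Lp.ext ?_)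
  filter_upwards [coeFn_matSector (c • M) n ψ, coeFn_matSector M n ψ,
    Lp.coeFn_smul c (matSector M n ψ : Lp (Spin d) 2 (powMeasure μ n))] with k h1 h2 h4
  rw [h1]
  refine Eq.trans ?_ h4.symm
  rw [Pi.smul_apply, h2, map_smul]; rfl

theorem matSector_creSector (M : Matrix (Fin d) (Fin d) ℂ) (f : Lp ℂ 2 μ) (n : ℕ)
    (ψ : Sector μ d n) :
    matSector M (n + 1) (creSector f n ψ) = creSector f n (matSector M n ψ) := by
  refine Subtype.ext ?_
  rw [coe_matSector, coe_creSector, coe_creSector, map_smul, map_sum]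
  congr 1
  refine Finset.sum_congr rfl fun i _ => Lp.ext ?_
  have h := (Measure.quasiMeasurePreserving_snd.comp (measurePreserving_removeNth (μ := μ) n
    i).quasiMeasurePreserving).ae (coeFn_matSector M n ψ)
  filter_upwards [ContinuousLinearMap.coeFn_compLpL (p := 2) (μ := powMeasure μ (n + 1))
      (Matrix.toEuclideanCLM (n := Fin d) (𝕜 := ℂ) M)
      (insertAt f n i (ψ : Lp (Spin d) 2 (powMeasure μ n))),
    coeFn_insertAt f n i (ψ : Lp (Spin d) 2 (powMeasure μ n)),
    coeFn_insertAt f n i (matSector M n ψ : Lp (Spin d) 2 (powMeasure μ n)), h] with k h1 h2 h3 h4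
  simp only [Function.comp_apply] at h4
  rw [h1, h2, h3, h4, map_smul]

theorem mat_apply (M : Matrix (Fin d) (Fin d) ℂ) (Ψ : Formal μ d) (n : ℕ) :
    mat M Ψ n = matSector M n (Ψ n) := rfl

theorem mat_cre (M : Matrix (Fin d) (Fin d) ℂ) (f : Lp ℂ 2 μ) (Ψ : Formal μ d) :
    mat M (cre f Ψ) = cre f (mat M Ψ) := by
  funext n
  cases n with
  | zero => exact map_zero (matSector M 0)
  | succ n => exact matSector_creSector M f n _

theorem matSector_annSector (M : Matrix (Fin d) (Fin d) ℂ) (f : Lp ℂ 2 μ) (n : ℕ)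
    (ψ : Sector μ d (n + 1)) :
    matSector M n (annSector f n ψ) = annSector f n (matSector M (n + 1) ψ) := by
  refine ext_inner_left ℂ fun φ => ?_
  have h := inner_matSector_left M.conjTranspose n φ (annSector f n ψ)
  have h' := inner_matSector_left M.conjTranspose (n + 1) (creSector f n φ) ψ
  rw [Matrix.conjTranspose_conjTranspose] at h h'
  rw [← h, annSector, adjoint_inner_right, adjoint_inner_right, ← h', matSector_creSector]

theorem mat_ann (M : Matrix (Fin d) (Fin d) ℂ) (f : Lp ℂ 2 μ) (Ψ : Formal μ d) :
    mat M (ann f Ψ) = ann f (mat M Ψ) :=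
  funext fun n => matSector_annSector M f n _

theorem mat_mul (M M' : Matrix (Fin d) (Fin d) ℂ) (Ψ : Formal μ d) :
    mat (M * M') Ψ = mat M (mat M' Ψ) := funext fun n => matSector_mul M M' n _

theorem mat_one (Ψ : Formal μ d) : mat 1 Ψ = Ψ := funext fun n => matSector_one n _

theorem mat_add (M M' : Matrix (Fin d) (Fin d) ℂ) (Ψ : Formal μ d) :
    mat (M + M') Ψ = mat M Ψ + mat M' Ψ := funext fun n => matSector_add M M' n _

theorem mat_smul (c : ℂ) (M : Matrix (Fin d) (Fin d) ℂ) (Ψ : Formal μ d) :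
    mat (c • M) Ψ = c • mat M Ψ := funext fun n => matSector_smul c M n _

end Matrices

attribute [irreducible] matNorm

/-! ### The dressing operator, sector by sector -/

section Dressing

variable {X : Type*} [MeasurableSpace X] {μ : Measure X} [SigmaFinite μ] {d N : ℕ}

/-- An operator which creates exactly one boson. -/
structure RaisesByOne (L : Module.End ℂ (Formal μ d)) : Prop where
  apply_zero : ∀ Ψ, L Ψ 0 = 0
  apply_succ : ∀ Ψ n, Ψ n = 0 → L Ψ (n + 1) = 0

/-- Each application raises the lowest occupied sector by one. This is why all exponential series
below are finite in each sector. -/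
theorem RaisesByOne.pow_apply_eq_zero {L : Module.End ℂ (Formal μ d)} (hL : RaisesByOne L)
    {Ψ : Formal μ d} {k : ℕ} (hΨ : ∀ j < k, Ψ j = 0) (n : ℕ) : ∀ j < n + k, (L ^ n) Ψ j = 0 := by
  induction n with
  | zero => simpa using hΨ
  | succ n ih =>
    intro j hj
    rw [pow_succ', Module.End.mul_apply]
    cases j with
    | zero => exact hL.apply_zero _
    | succ j => exact hL.apply_succ _ _ (ih j (by omega))

theorem RaisesByOne.pow_apply_of_lt {L : Module.End ℂ (Formal μ d)} (hL : RaisesByOne L)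
    (Ψ : Formal μ d) {n j : ℕ} (h : j < n) : (L ^ n) Ψ j = 0 :=
  hL.pow_apply_eq_zero (k := 0) (by simp) n j (by simpa using h)

theorem RaisesByOne.pow_apply_congr {L : Module.End ℂ (Formal μ d)} (hL : RaisesByOne L)
    {Ψ Φ : Formal μ d} {m : ℕ} (h : ∀ j ≤ m, Ψ j = Φ j) (n : ℕ) : (L ^ n) Ψ m = (L ^ n) Φ m := by
  rw [← sub_eq_zero, ← Pi.sub_apply, ← map_sub]
  exact hL.pow_apply_eq_zero (k := m + 1) (fun j hj => sub_eq_zero.2 (h j (by omega))) n m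
    (by omega)

theorem dressingExponent_apply (B : Fin N → Matrix (Fin d) (Fin d) ℂ) (g : Fin N → Lp ℂ 2 μ)
    (Ψ : Formal μ d) : dressingExponent B g Ψ = -∑ j, mat (B j) (cre (g j) Ψ) := by
  simp [dressingExponent]

theorem raisesByOne_dressingExponent (B : Fin N → Matrix (Fin d) (Fin d) ℂ)
    (g : Fin N → Lp ℂ 2 μ) : RaisesByOne (dressingExponent B g) := by
  constructor
  · intro Ψ
    rw [dressingExponent_apply, Pi.neg_apply, Finset.sum_apply]
    simp [mat_apply, cre_apply_zero]
  · intro Ψ n hn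
    rw [dressingExponent_apply, Pi.neg_apply, Finset.sum_apply]
    simp [mat_apply, cre_apply_succ, hn]

theorem dressing_apply (B : Fin N → Matrix (Fin d) (Fin d) ℂ) (g : Fin N → Lp ℂ 2 μ)
    (Ψ : Formal μ d) (m : ℕ) : dressing B g Ψ m = ∑ n ∈ Finset.range (m + 1),
      ((n.factorial : ℂ)⁻¹) • ((dressingExponent B g) ^ n) Ψ m := by
  simp [dressing]

/-- Terms with more than `m` creation operators do not reach sector `m`, so one truncation `K` may
be used for several sectors at once. -/
theorem dressing_apply_of_le (B : Fin N → Matrix (Fin d) (Fin d) ℂ) (g : Fin N → Lp ℂ 2 μ)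
    (Ψ : Formal μ d) {m K : ℕ} (h : m ≤ K) : dressing B g Ψ m
      = (∑ n ∈ Finset.range (K + 1), ((n.factorial : ℂ)⁻¹) •
        ((dressingExponent B g) ^ n) Ψ : Formal μ d) m := by
  rw [dressing_apply, Finset.sum_apply]
  refine Finset.sum_subset (Finset.range_mono (by omega)) fun n _ hn => ?_
  rw [Finset.mem_range, not_lt] at hn
  rw [(raisesByOne_dressingExponent B g).pow_apply_of_lt Ψ (by omega), smul_zero]

theorem mat_comm {M M' : Matrix (Fin d) (Fin d) ℂ} (h : Commute M M') (Ψ : Formal μ d) :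
    mat M (mat M' Ψ) = mat M' (mat M Ψ) := by
  rw [← mat_mul, h.eq, mat_mul]

theorem commute_cre_dressingExponent (B : Fin N → Matrix (Fin d) (Fin d) ℂ)
    (g : Fin N → Lp ℂ 2 μ) (f : Lp ℂ 2 μ) :
    Commute (cre f : Module.End ℂ (Formal μ d)) (dressingExponent B g) := by
  refine LinearMap.ext fun Ψ => ?_
  simp only [Module.End.mul_apply, dressingExponent_apply, map_neg, map_sum, ← mat_cre,
    cre_comm f]

theorem commute_mat_dressingExponent {B : Fin N → Matrix (Fin d) (Fin d) ℂ}
    {M : Matrix (Fin d) (Fin d) ℂ} (h : ∀ j, Commute M (B j)) (g : Fin N → Lp ℂ 2 μ) :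
    Commute (mat M : Module.End ℂ (Formal μ d)) (dressingExponent B g) := by
  refine LinearMap.ext fun Ψ => ?_
  simp only [Module.End.mul_apply, dressingExponent_apply, map_neg, map_sum, ← mat_cre,
    mat_comm (h _)]

theorem commute_dressingExponent {B : Fin N → Matrix (Fin d) (Fin d) ℂ}
    (hB : ∀ j j', Commute (B j) (B j')) (g g' : Fin N → Lp ℂ 2 μ) :
    Commute (dressingExponent (μ := μ) B g) (dressingExponent B g') := by
  have h : ∀ j, Commute (mat (B j) * cre (g j) : Module.End ℂ (Formal μ d))
      (dressingExponent B g') := fun j =>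
    (commute_mat_dressingExponent (hB j) g').mul_left (commute_cre_dressingExponent B g' (g j))
  exact (Commute.sum_left _ _ _ fun j _ => h j).neg_left

theorem dressingExponent_add (B : Fin N → Matrix (Fin d) (Fin d) ℂ) (g g' : Fin N → Lp ℂ 2 μ) :
    dressingExponent B (g + g') = dressingExponent (μ := μ) B g + dressingExponent B g' := by
  refine LinearMap.ext fun Ψ => ?_
  rw [LinearMap.add_apply]
  simp only [dressingExponent_apply, Pi.add_apply, cre_add, map_add, Finset.sum_add_distrib,
    neg_add]

/-- `B(g)` and `B(g')` commute, so `e^{B(g)} e^{B(g')} = e^{B(g + g')}`. In a fixed sector the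
square of indices and the triangle of the binomial expansion differ only by vanishing terms. -/
theorem dressing_comp {B : Fin N → Matrix (Fin d) (Fin d) ℂ}
    (hB : ∀ j j', Commute (B j) (B j')) (g g' : Fin N → Lp ℂ 2 μ) (Ψ : Formal μ d) :
    dressing B g (dressing B g' Ψ) = dressing B (g + g') Ψ := by
  funext m
  set C := dressingExponent B g
  set C' := dressingExponent B g'
  have hC : RaisesByOne C := raisesByOne_dressingExponent B g
  have hC' : RaisesByOne C' := raisesByOne_dressingExponent B g'
  set F : ℕ → ℕ → Sector μ d m := fun n k =>
    ((n.factorial : ℂ)⁻¹ * (k.factorial : ℂ)⁻¹) • (C ^ n) ((C' ^ k) Ψ) m with hF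
  have hF0 : ∀ n k, m < n + k → F n k = 0 := by
    intro n k h
    simp only [hF]
    rw [hC.pow_apply_eq_zero (k := k) (fun j hj => hC'.pow_apply_of_lt Ψ hj) n m h, smul_zero]
  have lhs : dressing B g (dressing B g' Ψ) m
      = ∑ n ∈ Finset.range (m + 1), ∑ k ∈ Finset.range (m + 1), F n k := by
    rw [dressing_apply]
    refine Finset.sum_congr rfl fun n _ => ?_
    rw [hC.pow_apply_congr (fun j hj => dressing_apply_of_le B g' Ψ hj) n, map_sum,
      Finset.sum_apply, Finset.smul_sum]
    refine Finset.sum_congr rfl fun k _ => ?_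
    rw [map_smul, Pi.smul_apply, smul_smul]
  have rhs : dressing B (g + g') Ψ m
      = ∑ n ∈ Finset.range (m + 1), ∑ k ∈ Finset.range (n + 1), F k (n - k) := by
    rw [dressing_apply, dressingExponent_add]
    refine Finset.sum_congr rfl fun n _ => ?_
    rw [(commute_dressingExponent hB g g').add_pow',
      Finset.Nat.sum_antidiagonal_eq_sum_range_succ_mk, LinearMap.sum_apply, Finset.sum_apply,
      Finset.smul_sum]
    refine Finset.sum_congr rfl fun k hk => ?_
    have hk : k ≤ n := by rw [Finset.mem_range] at hk; omega
    rw [LinearMap.smul_apply, Pi.smul_apply, ← Nat.cast_smul_eq_nsmul ℂ, smul_smul]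
    simp only [hF]
    congr 1
    rw [Nat.cast_choose ℂ hk]
    have h1 : (n.factorial : ℂ) ≠ 0 := by exact_mod_cast n.factorial_ne_zero
    have h2 : (k.factorial : ℂ) ≠ 0 := by exact_mod_cast k.factorial_ne_zero
    have h3 : ((n - k).factorial : ℂ) ≠ 0 := by exact_mod_cast (n - k).factorial_ne_zero
    field_simp
  rw [lhs, rhs, Finset.sum_range_diag_flip]
  refine Finset.sum_congr rfl fun n hn => (Finset.sum_subset (Finset.range_mono (by omega))
    fun k _ hk => hF0 n k ?_).symm
  rw [Finset.mem_range] at hn hk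
  omega

theorem cre_dressing (B : Fin N → Matrix (Fin d) (Fin d) ℂ) (g : Fin N → Lp ℂ 2 μ) (f : Lp ℂ 2 μ)
    (Ψ : Formal μ d) : cre f (dressing B g Ψ) = dressing B g (cre f Ψ) := by
  funext m
  cases m with
  | zero =>
    rw [cre_apply_zero, dressing_apply]
    simp [cre_apply_zero]
  | succ m =>
    rw [cre_apply_succ, dressing_apply_of_le B g Ψ m.le_succ, ← cre_apply_succ, map_sum,
      dressing_apply, Finset.sum_apply]
    refine Finset.sum_congr rfl fun n _ => ?_
    rw [map_smul, Pi.smul_apply]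
    congr 1
    have := ((commute_cre_dressingExponent B g f).pow_right n).eq
    exact congrArg (fun L : Module.End ℂ (Formal μ d) => L Ψ (m + 1)) this

theorem mat_dressing {B : Fin N → Matrix (Fin d) (Fin d) ℂ} {M : Matrix (Fin d) (Fin d) ℂ}
    (h : ∀ j, Commute M (B j)) (g : Fin N → Lp ℂ 2 μ) (Ψ : Formal μ d) :
    mat M (dressing B g Ψ) = dressing B g (mat M Ψ) := by
  funext m
  rw [mat_apply, dressing_apply, dressing_apply, map_sum]
  refine Finset.sum_congr rfl fun n _ => ?_
  rw [map_smul]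
  congr 1
  have := ((commute_mat_dressingExponent h g).pow_right n).eq
  exact congrArg (fun L : Module.End ℂ (Formal μ d) => L Ψ m) this

/-- The displacement `∑ⱼ ⟨h, cⱼ⟩ Bⱼ` of the annihilation operator. -/
def shift (B : Fin N → Matrix (Fin d) (Fin d) ℂ) (c : Fin N → Lp ℂ 2 μ) (h : Lp ℂ 2 μ) :
    Module.End ℂ (Formal μ d) := ∑ j, ⟪h, c j⟫_ℂ • mat (μ := μ) (B j)

theorem shift_apply (B : Fin N → Matrix (Fin d) (Fin d) ℂ) (c : Fin N → Lp ℂ 2 μ) (h : Lp ℂ 2 μ)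
    (Ψ : Formal μ d) : shift B c h Ψ = ∑ j, ⟪h, c j⟫_ℂ • mat (B j) Ψ := by
  simp [shift]

theorem annHat_eq (B : Fin N → Matrix (Fin d) (Fin d) ℂ) (c : Fin N → Lp ℂ 2 μ) (h : Lp ℂ 2 μ)
    (Ψ : Formal μ d) : annHat B c h Ψ = ann h Ψ + shift B c h Ψ := rfl

theorem commute_shift_dressingExponent {B : Fin N → Matrix (Fin d) (Fin d) ℂ}
    (hB : ∀ j j', Commute (B j) (B j')) (c g : Fin N → Lp ℂ 2 μ) (h : Lp ℂ 2 μ) :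
    Commute (shift B c h) (dressingExponent B g) :=
  Commute.sum_left _ _ _ fun j _ => (commute_mat_dressingExponent (hB j) g).smul_left _

theorem ann_dressingExponent (B : Fin N → Matrix (Fin d) (Fin d) ℂ) (c : Fin N → Lp ℂ 2 μ)
    (h : Lp ℂ 2 μ) (Ψ : Formal μ d) :
    ann h (dressingExponent B c Ψ) = dressingExponent B c (ann h Ψ) - shift B c h Ψ := by
  rw [dressingExponent_apply, dressingExponent_apply, shift_apply, map_neg, map_sum]
  simp only [← mat_ann, ann_cre, map_add, map_smul, Finset.sum_add_distrib]
  abel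

/-- The commutator of `a(h)` with `B(c)` is `-shift B c h`, which itself commutes with `B(c)`; each
of the `n + 1` factors contributes it once. -/
theorem ann_dressingExponent_pow {B : Fin N → Matrix (Fin d) (Fin d) ℂ}
    (hB : ∀ j j', Commute (B j) (B j')) (c : Fin N → Lp ℂ 2 μ)
    (h : Lp ℂ 2 μ) (n : ℕ) (Ψ : Formal μ d) :
    ann h ((dressingExponent B c ^ (n + 1)) Ψ) = (dressingExponent B c ^ (n + 1)) (ann h Ψ)
      - ((n : ℂ) + 1) • shift B c h ((dressingExponent B c ^ n) Ψ) := by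
  induction n with
  | zero => simp [ann_dressingExponent]
  | succ n ih =>
    rw [pow_succ' _ (n + 1), Module.End.mul_apply, ann_dressingExponent, ih, map_sub, map_smul]
    have hc := LinearMap.congr_fun (commute_shift_dressingExponent hB c c h).eq
      ((dressingExponent B c ^ n) Ψ)
    rw [Module.End.mul_apply, Module.End.mul_apply, ← Module.End.mul_apply (dressingExponent B c)
      (dressingExponent B c ^ n), ← pow_succ'] at hc
    rw [← hc, Module.End.mul_apply]
    push_cast
    module

/-- Pulling `a(h)` through `e^{B(c)}` displaces it by the commutator with `B(c)`. The factor `n + 1`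
from the power cancels against the factorial and shifts the series by one, so it is compared with
the truncation one step longer. -/
theorem ann_dressing {B : Fin N → Matrix (Fin d) (Fin d) ℂ}
    (hB : ∀ j j', Commute (B j) (B j')) (c : Fin N → Lp ℂ 2 μ) (h : Lp ℂ 2 μ) (Ψ : Formal μ d) :
    ann h (dressing B c Ψ) = dressing B c (ann h Ψ) - dressing B c (shift B c h Ψ) := by
  funext m
  rw [ann_apply, dressing_apply_of_le B c Ψ le_rfl, ← ann_apply, map_sum, Finset.sum_apply,
    Finset.sum_range_succ', Pi.sub_apply, dressing_apply_of_le B c (ann h Ψ) m.le_succ,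
    Finset.sum_apply, Finset.sum_range_succ' _ (m + 1), dressing_apply]
  have h1 : ∀ n, (ann h (((n + 1).factorial : ℂ)⁻¹ • (dressingExponent B c ^ (n + 1)) Ψ)) m
      = (((n + 1).factorial : ℂ)⁻¹ • (dressingExponent B c ^ (n + 1)) (ann h Ψ)) m
        - ((n.factorial : ℂ)⁻¹) • (dressingExponent B c ^ n) (shift B c h Ψ) m := by
    intro n
    rw [map_smul, ann_dressingExponent_pow hB, smul_sub, smul_smul, Pi.sub_apply]
    congr 1
    rw [Pi.smul_apply]
    have hc := LinearMap.congr_fun ((commute_shift_dressingExponent hB c c h).pow_right n).eq Ψ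
    rw [Module.End.mul_apply, Module.End.mul_apply] at hc
    rw [hc]
    congr 1
    have h2 : (n.factorial : ℂ) ≠ 0 := by exact_mod_cast n.factorial_ne_zero
    have h3 : (n : ℂ) + 1 ≠ 0 := by exact_mod_cast n.succ_ne_zero
    rw [Nat.factorial_succ]
    push_cast
    field_simp
  simp only [h1, Finset.sum_sub_distrib]
  simp
  abel

/-- The operator `r ^ N`, where `N` is the number operator. -/
def numPow (r : ℝ) : Module.End ℂ (Formal μ d) :=
  LinearMap.pi fun n => ((r : ℂ) ^ n) • LinearMap.proj n

theorem numPow_apply (r : ℝ) (Ψ : Formal μ d) (n : ℕ) : numPow r Ψ n = ((r : ℂ) ^ n) • Ψ n := rfl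

theorem ann_numPow (r : ℝ) (h : Lp ℂ 2 μ) (Ψ : Formal μ d) :
    ann h (numPow r Ψ) = numPow r ((r : ℂ) • ann h Ψ) := by
  funext n
  rw [ann_apply, numPow_apply, numPow_apply, map_smul, Pi.smul_apply, ann_apply, smul_smul,
    pow_succ]

theorem mat_numPow (r : ℝ) (M : Matrix (Fin d) (Fin d) ℂ) (Ψ : Formal μ d) :
    mat M (numPow r Ψ) = numPow r (mat M Ψ) := by
  funext n
  rw [mat_apply, numPow_apply, numPow_apply, map_smul, mat_apply]

theorem numPow_cre (r : ℝ) (f : Lp ℂ 2 μ) (Ψ : Formal μ d) :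
    numPow r (cre f Ψ) = cre ((r : ℂ) • f) (numPow r Ψ) := by
  funext n
  cases n with
  | zero => rw [numPow_apply, cre_apply_zero, smul_zero, cre_apply_zero]
  | succ n =>
    rw [numPow_apply, cre_apply_succ, cre_apply_succ, numPow_apply, map_smul, creSector_smul,
      smul_smul, pow_succ]

/-- Each creation operator contributes one factor `r` when `r^N` passes it, which rescales the form
factors. -/
theorem numPow_dressing (B : Fin N → Matrix (Fin d) (Fin d) ℂ) (g : Fin N → Lp ℂ 2 μ) (r : ℝ)
    (Ψ : Formal μ d) :
    numPow r (dressing B g Ψ) = dressing B ((r : ℂ) • g) (numPow r Ψ) := by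
  have h1 : ∀ Ψ : Formal μ d, numPow r (dressingExponent B g Ψ)
      = dressingExponent B ((r : ℂ) • g) (numPow r Ψ) := by
    intro Ψ
    simp only [dressingExponent_apply, map_neg, map_sum, ← mat_numPow, numPow_cre, Pi.smul_apply]
  have h2 : ∀ (n : ℕ) (Ψ : Formal μ d), numPow r ((dressingExponent B g ^ n) Ψ)
      = (dressingExponent B ((r : ℂ) • g) ^ n) (numPow r Ψ) := by
    intro n
    induction n with
    | zero => intro Ψ; rfl
    | succ n ih =>
      intro Ψ
      rw [pow_succ', pow_succ', Module.End.mul_apply, Module.End.mul_apply, h1, ih]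
  funext m
  rw [numPow_apply, dressing_apply, dressing_apply, Finset.smul_sum]
  refine Finset.sum_congr rfl fun n _ => ?_
  rw [← h2, numPow_apply, smul_comm]

/-- The operator `e^{B(c)} r^N`. -/
def dressPow (B : Fin N → Matrix (Fin d) (Fin d) ℂ) (c : Fin N → Lp ℂ 2 μ) (r : ℝ) :
    Module.End ℂ (Formal μ d) := dressing B c * numPow r

theorem dressPow_apply (B : Fin N → Matrix (Fin d) (Fin d) ℂ) (c : Fin N → Lp ℂ 2 μ) (r : ℝ)
    (Ψ : Formal μ d) : dressPow B c r Ψ = dressing B c (numPow r Ψ) := rfl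

/-- The operator `e^{B(g' - r g)} r^N` intertwines the displaced annihilation operators. -/
theorem annHat_dressPow {B : Fin N → Matrix (Fin d) (Fin d) ℂ}
    (hB : ∀ j j', Commute (B j) (B j')) (g g' : Fin N → Lp ℂ 2 μ) (r : ℝ) (h : Lp ℂ 2 μ)
    (Ψ : Formal μ d) : annHat B g' h (dressPow B (g' - (r : ℂ) • g) r Ψ)
      = (r : ℂ) • dressPow B (g' - (r : ℂ) • g) r (annHat B g h Ψ) := by
  set c := g' - (r : ℂ) • g
  have h1 : ∀ Φ : Formal μ d, shift B g' h (dressing B c Φ) = dressing B c (shift B g' h Φ) := by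
    intro Φ
    simp only [shift_apply, map_sum, map_smul, mat_dressing (hB _)]
  have h2 : ∀ Φ : Formal μ d, shift B c h Φ = shift B g' h Φ - (r : ℂ) • shift B g h Φ := by
    intro Φ
    simp only [shift_apply, c, Pi.sub_apply, Pi.smul_apply, inner_sub_right, inner_smul_right,
      sub_smul, Finset.sum_sub_distrib, Finset.smul_sum, smul_smul]
  have h3 : ∀ Φ : Formal μ d, shift B g h (numPow r Φ) = numPow r (shift B g h Φ) := by
    intro Φ
    simp only [shift_apply, map_sum, map_smul, mat_numPow]
  rw [dressPow_apply, annHat_eq, ann_dressing hB, h1, h2, ann_numPow, dressPow_apply, annHat_eq,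
    map_sub, map_smul, h3]
  simp only [map_add, map_smul, smul_add]
  abel

/-- Passing `r^N` through the inner dressing rescales `c'` to `r c'`, after which the exponents add.
-/
theorem dressPow_comp {B : Fin N → Matrix (Fin d) (Fin d) ℂ}
    (hB : ∀ j j', Commute (B j) (B j')) (c c' : Fin N → Lp ℂ 2 μ) (r r' : ℝ) (Ψ : Formal μ d) :
    dressPow B c r (dressPow B c' r' Ψ) = dressPow B (c + (r : ℂ) • c') (r * r') Ψ := by
  rw [dressPow_apply, dressPow_apply, numPow_dressing, dressing_comp hB, dressPow_apply]
  congr 1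
  funext n
  rw [numPow_apply, numPow_apply, numPow_apply, smul_smul]
  push_cast
  rw [mul_pow]

end Dressing

/-! ### Bounded operators on the Fock space -/

section Bounded

theorem memℓp_two_iff {ι : Type*} {E : ι → Type*} [∀ i, NormedAddCommGroup (E i)]
    {f : ∀ i, E i} : Memℓp f 2 ↔ Summable fun i => ‖f i‖ ^ 2 := by
  rw [memℓp_gen_iff (by simp)]
  simp

theorem lp_hasSum_norm_sq {ι : Type*} {E : ι → Type*} [∀ i, NormedAddCommGroup (E i)]
    (f : lp E 2) : HasSum (fun i => ‖f i‖ ^ 2) (‖f‖ ^ 2) := by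
  have h := lp.hasSum_norm (p := 2) (by simp) f
  simpa using h

theorem lp_norm_le_of_sum_le {ι : Type*} {E : ι → Type*} [∀ i, NormedAddCommGroup (E i)]
    (f : lp E 2) {C : ℝ} (hC : 0 ≤ C) (h : ∀ s : Finset ι, ∑ i ∈ s, ‖f i‖ ^ 2 ≤ C ^ 2) :
    ‖f‖ ≤ C :=
  (sq_le_sq₀ (norm_nonneg _) hC).1 (hasSum_le_of_sum_le (lp_hasSum_norm_sq f) h)

theorem lp_sum_norm_sq_le {ι : Type*} {E : ι → Type*} [∀ i, NormedAddCommGroup (E i)]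
    (f : lp E 2) (s : Finset ι) : ∑ i ∈ s, ‖f i‖ ^ 2 ≤ ‖f‖ ^ 2 :=
  sum_le_hasSum s (fun _ _ => by positivity) (lp_hasSum_norm_sq f)

variable {X : Type*} [MeasurableSpace X] {μ : Measure X} [SigmaFinite μ] {d N : ℕ}

/-- The sector-wise operator `L` is bounded by `C` on the Fock space. -/
def FockBounded (L : Module.End ℂ (Formal μ d)) (C : ℝ) : Prop :=
  ∀ Ψ : Fock μ d, ∃ Φ : Fock μ d, (Φ : Formal μ d) = L Ψ ∧ ‖Φ‖ ≤ C * ‖Ψ‖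

/-- The bounded operator on the Fock space acting as `L`. -/
def fockOp (L : Module.End ℂ (Formal μ d)) {C : ℝ} (h : FockBounded L C) :
    Fock μ d →L[ℂ] Fock μ d :=
  LinearMap.mkContinuous
    { toFun := fun Ψ => (h Ψ).choose
      map_add' := fun Ψ Φ => lp.ext (by
        have e : ((Ψ + Φ : Fock μ d) : Formal μ d) = (Ψ : Formal μ d) + (Φ : Formal μ d) := rfl
        rw [(h (Ψ + Φ)).choose_spec.1, e, map_add, lp.coeFn_add, (h Ψ).choose_spec.1,
          (h Φ).choose_spec.1])
      map_smul' := fun c Ψ => lp.ext (by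
        have e : ((c • Ψ : Fock μ d) : Formal μ d) = c • (Ψ : Formal μ d) := rfl
        have e' : (((RingHom.id ℂ) c • (h Ψ).choose : Fock μ d) : Formal μ d)
          = c • ((h Ψ).choose : Formal μ d) := rfl
        rw [(h (c • Ψ)).choose_spec.1, e, map_smul, e', (h Ψ).choose_spec.1]) }
    C fun Ψ => (h Ψ).choose_spec.2

theorem coe_fockOp {L : Module.End ℂ (Formal μ d)} {C : ℝ} (h : FockBounded L C) (Ψ : Fock μ d) :
    (fockOp L h Ψ : Formal μ d) = L Ψ := (h Ψ).choose_spec.1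

theorem FockBounded.norm_le {L : Module.End ℂ (Formal μ d)} {C : ℝ} (h : FockBounded L C)
    {Ψ Φ : Fock μ d} (hΦ : (Φ : Formal μ d) = L Ψ) : ‖Φ‖ ≤ C * ‖Ψ‖ := by
  obtain ⟨Φ', h1, h2⟩ := h Ψ
  have : Φ = Φ' := lp.ext (hΦ.trans h1.symm)
  rwa [this]

theorem FockBounded.add {L L' : Module.End ℂ (Formal μ d)} {C C' : ℝ} (h : FockBounded L C)
    (h' : FockBounded L' C') : FockBounded (L + L') (C + C') := by
  intro Ψ
  obtain ⟨Φ, h1, h2⟩ := h Ψ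
  obtain ⟨Φ', h1', h2'⟩ := h' Ψ
  refine ⟨Φ + Φ', ?_, (norm_add_le _ _).trans ?_⟩
  · rw [lp.coeFn_add, h1, h1', LinearMap.add_apply]
  · rw [add_mul]; exact add_le_add h2 h2'

/-- The estimate is asked for every truncation `K`. It is adapted to operators whose output in a
sector depends only on that sector and lower ones, and it needs no summability in advance. -/
theorem fockBounded_of_sum_range_le {L : Module.End ℂ (Formal μ d)} {C : ℝ} (hC : 0 ≤ C)
    (h : ∀ (Ψ : Formal μ d) (K : ℕ), ∑ m ∈ Finset.range K, ‖L Ψ m‖ ^ 2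
      ≤ C ^ 2 * ∑ m ∈ Finset.range K, ‖Ψ m‖ ^ 2) : FockBounded L C := by
  intro Ψ
  have hb : ∀ K, ∑ m ∈ Finset.range K, ‖L (Ψ : Formal μ d) m‖ ^ 2 ≤ (C * ‖Ψ‖) ^ 2 := fun K => by
    rw [mul_pow]
    exact (h Ψ K).trans (mul_le_mul_of_nonneg_left (lp_sum_norm_sq_le Ψ _) (sq_nonneg C))
  have hm : Memℓp (L (Ψ : Formal μ d)) 2 :=
    memℓp_two_iff.2 (summable_of_sum_range_le (fun _ => by positivity) hb)
  refine ⟨⟨_, hm⟩, rfl, lp_norm_le_of_sum_le _ (by positivity) fun s => ?_⟩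
  obtain ⟨K, hK⟩ := s.exists_nat_subset_range
  exact (Finset.sum_le_sum_of_subset_of_nonneg hK fun _ _ _ => by positivity).trans (hb K)

theorem fockBounded_of_norm_apply_le {L : Module.End ℂ (Formal μ d)} {C : ℝ} (hC : 0 ≤ C)
    (h : ∀ (Ψ : Formal μ d) (m : ℕ), ‖L Ψ m‖ ≤ C * ‖Ψ m‖) : FockBounded L C := by
  refine fockBounded_of_sum_range_le hC fun Ψ K => ?_
  rw [Finset.mul_sum]
  refine Finset.sum_le_sum fun m _ => ?_
  rw [← mul_pow]
  exact pow_le_pow_left₀ (norm_nonneg _) (h Ψ m) 2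

theorem fockBounded_mat (M : Matrix (Fin d) (Fin d) ℂ) :
    FockBounded (mat (μ := μ) M) (matNorm M) :=
  fockBounded_of_norm_apply_le (matNorm_nonneg M) fun Ψ m => norm_matSector_le M m _

theorem norm_numPow_apply (r : ℝ) (Ψ : Formal μ d) (m : ℕ) :
    ‖numPow r Ψ m‖ = |r| ^ m * ‖Ψ m‖ := by
  rw [numPow_apply, sector_norm_smul, norm_pow, Complex.norm_real, Real.norm_eq_abs]

theorem fockBounded_numPow {r : ℝ} (hr : r ∈ Set.Ioo (0 : ℝ) 1) :
    FockBounded (numPow (μ := μ) (d := d) r) 1 :=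
  fockBounded_of_norm_apply_le zero_le_one fun Ψ m => by
    rw [norm_numPow_apply, abs_of_pos hr.1]
    exact mul_le_mul_of_nonneg_right (pow_le_one₀ hr.1.le hr.2.le) (norm_nonneg _)

/-- A bound for the form factors entering the dressing exponent. -/
def expNorm (B : Fin N → Matrix (Fin d) (Fin d) ℂ) (c : Fin N → Lp ℂ 2 μ) : ℝ :=
  ∑ j, matNorm (B j) * ‖c j‖

theorem expNorm_nonneg (B : Fin N → Matrix (Fin d) (Fin d) ℂ) (c : Fin N → Lp ℂ 2 μ) :
    0 ≤ expNorm B c :=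
  Finset.sum_nonneg fun j _ => mul_nonneg (matNorm_nonneg _) (norm_nonneg _)

theorem norm_dressingExponent_apply_le (B : Fin N → Matrix (Fin d) (Fin d) ℂ)
    (c : Fin N → Lp ℂ 2 μ) (Ψ : Formal μ d) (n : ℕ) :
    ‖dressingExponent B c Ψ (n + 1)‖ ≤ expNorm B c * Real.sqrt (n + 1) * ‖Ψ n‖ := by
  rw [dressingExponent_apply, Pi.neg_apply, norm_neg, Finset.sum_apply, expNorm, Finset.sum_mul,
    Finset.sum_mul]
  refine (norm_sum_le _ _).trans (Finset.sum_le_sum fun j _ => ?_)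
  rw [mat_apply, cre_apply_succ]
  refine (norm_matSector_le _ _ _).trans ?_
  calc matNorm (B j) * ‖creSector (c j) n (Ψ n)‖
      ≤ matNorm (B j) * (Real.sqrt (n + 1) * ‖c j‖ * ‖Ψ n‖) :=
        mul_le_mul_of_nonneg_left (norm_creSector_le _ _ _) (matNorm_nonneg _)
    _ = _ := by ring

/-- The product of the factors `√(j + 1), …, √(j + k)` from the successive creation operators. -/
theorem norm_dressingExponent_pow_apply_le (B : Fin N → Matrix (Fin d) (Fin d) ℂ)
    (c : Fin N → Lp ℂ 2 μ) (Ψ : Formal μ d) (j k : ℕ) :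
    ‖(dressingExponent B c ^ k) Ψ (j + k)‖
      ≤ expNorm B c ^ k * Real.sqrt ((j + k).factorial / j.factorial) * ‖Ψ j‖ := by
  induction k with
  | zero =>
    have : (j.factorial : ℝ) ≠ 0 := by exact_mod_cast j.factorial_ne_zero
    simp [div_self this]
  | succ k ih =>
    rw [pow_succ', Module.End.mul_apply]
    refine (norm_dressingExponent_apply_le B c _ (j + k)).trans ?_
    refine (mul_le_mul_of_nonneg_left ih (mul_nonneg (expNorm_nonneg B c)
      (Real.sqrt_nonneg _))).trans (le_of_eq ?_)
    have : Real.sqrt (((j + (k + 1)).factorial : ℝ) / j.factorial)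
        = Real.sqrt (((j + k : ℕ) : ℝ) + 1) * Real.sqrt ((j + k).factorial / j.factorial) := by
      rw [← Real.sqrt_mul (by positivity), ← add_assoc, Nat.factorial_succ]
      push_cast
      rw [mul_div_assoc]
    rw [this, pow_succ]
    ring

/-- The bound for `(e^{B(c)} - 1) r^N`. -/
def dressBound (σ r : ℝ) : ℝ := Real.sqrt (r⁻¹ ^ 2 * (Real.exp (σ ^ 2 / (1 - r ^ 2)) - 1))

theorem dressBound_nonneg (σ r : ℝ) : 0 ≤ dressBound σ r := Real.sqrt_nonneg _

/-- Partial sums of the negative binomial series `∑ₖ C(j + k, k) x^k = (1 - x)^{-(j + 1)}`. -/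
theorem sum_choose_mul_pow_le {x : ℝ} (h0 : 0 ≤ x) (h1 : x < 1) (j K : ℕ) :
    ∑ k ∈ Finset.range K, ((j + k).choose k : ℝ) * x ^ k ≤ 1 / (1 - x) ^ (j + 1) := by
  have hx : ‖x‖ < 1 := by rwa [Real.norm_of_nonneg h0]
  rw [← tsum_choose_mul_geometric_of_norm_lt_one j hx]
  have hs := summable_choose_mul_geometric_of_norm_lt_one j hx
  refine (le_of_eq ?_).trans (hs.sum_le_tsum (Finset.range K) fun k _ => by positivity)
  refine Finset.sum_congr rfl fun k _ => ?_
  rw [add_comm k j, Nat.choose_symm_add]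

/-- Summing first over `k` at fixed `j = m - k`, the negative binomial series at `x = 1 - r²` gives
at most `r^{-2(j + 1)}`. The weight `r^{2j}` cancels all of it except `r⁻²`. -/
theorem sum_diag_choose_le {r : ℝ} (hr : r ∈ Set.Ioo (0 : ℝ) 1) (y : ℕ → ℝ) (hy : ∀ j, 0 ≤ y j)
    (K : ℕ) : ∑ m ∈ Finset.range K, ∑ k ∈ Finset.range (m + 1),
      (((m - k) + k).choose k : ℝ) * (1 - r ^ 2) ^ k * ((r ^ 2) ^ (m - k) * y (m - k))
      ≤ r⁻¹ ^ 2 * ∑ j ∈ Finset.range K, y j := by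
  have hr2 : 0 < r ^ 2 := pow_pos hr.1 2
  have hr3 : r ^ 2 < 1 := by nlinarith [hr.1, hr.2]
  set F : ℕ → ℕ → ℝ := fun k j =>
    ((j + k).choose k : ℝ) * (1 - r ^ 2) ^ k * ((r ^ 2) ^ j * y j) with hF
  have hF0 : ∀ k j, 0 ≤ F k j := fun k j => by
    have : 0 ≤ 1 - r ^ 2 := by linarith
    have := hy j
    positivity
  calc _ = ∑ m ∈ Finset.range K, ∑ k ∈ Finset.range (m + 1), F k (m - k) := rfl
    _ = ∑ k ∈ Finset.range K, ∑ j ∈ Finset.range (K - k), F k j :=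
      Finset.sum_range_diag_flip K F
    _ ≤ ∑ k ∈ Finset.range K, ∑ j ∈ Finset.range K, F k j :=
      Finset.sum_le_sum fun k _ => Finset.sum_le_sum_of_subset_of_nonneg
        (Finset.range_mono (by omega)) fun j _ _ => hF0 k j
    _ = ∑ j ∈ Finset.range K, ∑ k ∈ Finset.range K, F k j := Finset.sum_comm
    _ ≤ ∑ j ∈ Finset.range K, r⁻¹ ^ 2 * y j := by
      refine Finset.sum_le_sum fun j _ => ?_
      have h1 := sum_choose_mul_pow_le (x := 1 - r ^ 2) (by linarith) (by linarith) j K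
      simp only [hF, ← Finset.sum_mul]
      rw [sub_sub_cancel] at h1
      refine (mul_le_mul_of_nonneg_right h1 (mul_nonneg (by positivity) (hy j))).trans
        (le_of_eq ?_)
      have := hr.1.ne'
      rw [pow_succ]
      field_simp
    _ = _ := (Finset.mul_sum _ _ _).symm

/-- Cauchy–Schwarz in the number `k ≥ 1` of created bosons, after inserting `(1 - r²)^k` and its
inverse. One factor sums to at most `exp(σ² / (1 - r²)) - 1`; the other retains the binomial weights
that become summable over `m`. -/
theorem norm_dressPow_sub_apply_sq_le (B : Fin N → Matrix (Fin d) (Fin d) ℂ)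
    (c : Fin N → Lp ℂ 2 μ) {r : ℝ} (hr : r ∈ Set.Ioo (0 : ℝ) 1) (Ψ : Formal μ d) (y : ℕ → ℝ)
    (hy : ∀ j, y j = ‖Ψ j‖ ^ 2) (m : ℕ) :
    ‖dressPow B c r Ψ m - numPow r Ψ m‖ ^ 2 ≤ (Real.exp (expNorm B c ^ 2 / (1 - r ^ 2)) - 1) *
      ∑ k ∈ Finset.range (m + 1), (((m - k) + k).choose k : ℝ) * (1 - r ^ 2) ^ k *
        ((r ^ 2) ^ (m - k) * y (m - k)) := by
  have hr3 : 0 < 1 - r ^ 2 := by nlinarith [hr.1, hr.2]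
  set σ := expNorm B c
  set a := σ ^ 2 / (1 - r ^ 2) with ha
  have ha0 : 0 ≤ a := by positivity
  set A : ℕ → ℝ := fun k => a ^ k / k.factorial
  set F : ℕ → ℝ := fun k => (((m - k) + k).choose k : ℝ) * (1 - r ^ 2) ^ k *
    ((r ^ 2) ^ (m - k) * y (m - k))
  have hA : ∀ k, 0 ≤ A k := fun k => by positivity
  have hF : ∀ k, 0 ≤ F k := fun k => by
    have : 0 ≤ y (m - k) := by rw [hy]; positivity
    positivity
  -- With `j = m - k`, the square of the bound is `(a^k / k!) · C(j + k, k) (1 - r²)^k r^{2j} ‖Ψ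
  -- j‖²`, where `a = σ² / (1 - r²)`.
  have hterm : ∀ k ∈ Finset.Ico 1 (m + 1),
      ‖((k.factorial : ℂ)⁻¹) • (dressingExponent B c ^ k) (numPow r Ψ) m‖
        ≤ Real.sqrt (A k) * Real.sqrt (F k) := by
    intro k hk
    rw [Finset.mem_Ico] at hk
    obtain ⟨j, rfl⟩ : ∃ j, m = j + k := ⟨m - k, by omega⟩
    rw [sector_norm_smul, norm_inv, Complex.norm_natCast, ← Real.sqrt_mul (hA k)]
    refine Real.le_sqrt_of_sq_le ?_
    have h1 := norm_dressingExponent_pow_apply_le B c (numPow r Ψ) j k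
    rw [norm_numPow_apply, abs_of_pos hr.1] at h1
    have h2 : ((k.factorial : ℝ)⁻¹ * ‖(dressingExponent B c ^ k) (numPow r Ψ) (j + k)‖) ^ 2
        ≤ ((k.factorial : ℝ)⁻¹ * (σ ^ k * Real.sqrt ((j + k).factorial / j.factorial) *
          (r ^ j * ‖Ψ j‖))) ^ 2 :=
      pow_le_pow_left₀ (by positivity) (mul_le_mul_of_nonneg_left h1 (by positivity)) 2
    refine h2.trans (le_of_eq ?_)
    rw [mul_pow, mul_pow, mul_pow, Real.sq_sqrt (by positivity)]
    simp only [A, F, Nat.add_sub_cancel]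
    have hc : (((j + k).choose k : ℕ) : ℝ) = (j + k).factorial / (k.factorial * j.factorial) := by
      rw [Nat.cast_choose ℝ (Nat.le_add_left k j), Nat.add_sub_cancel]
    rw [hc, ha, div_pow, mul_pow, hy]
    have h3 : (k.factorial : ℝ) ≠ 0 := by exact_mod_cast k.factorial_ne_zero
    have h4 : (j.factorial : ℝ) ≠ 0 := by exact_mod_cast j.factorial_ne_zero
    have h5 : (1 - r ^ 2) ^ k ≠ 0 := (pow_pos hr3 k).ne'
    field_simp
    ring
  have hdecomp : dressPow B c r Ψ m - numPow r Ψ m = ∑ k ∈ Finset.Ico 1 (m + 1),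
      ((k.factorial : ℂ)⁻¹) • (dressingExponent B c ^ k) (numPow r Ψ) m := by
    rw [dressPow_apply, dressing_apply, Finset.range_eq_Ico,
      Finset.sum_eq_sum_Ico_succ_bot (by omega)]
    simp
  have hsum : ‖dressPow B c r Ψ m - numPow r Ψ m‖ ≤ Real.sqrt (∑ k ∈ Finset.Ico 1 (m + 1), A k) *
      Real.sqrt (∑ k ∈ Finset.Ico 1 (m + 1), F k) := by
    rw [hdecomp]
    exact (norm_sum_le _ _).trans ((Finset.sum_le_sum hterm).trans
      (Real.sum_sqrt_mul_sqrt_le _ hA hF))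
  have hAs : ∑ k ∈ Finset.Ico 1 (m + 1), A k ≤ Real.exp a - 1 := by
    have h1 := Real.sum_le_exp_of_nonneg ha0 (m + 1)
    rw [Finset.range_eq_Ico, Finset.sum_eq_sum_Ico_succ_bot (by omega)] at h1
    simp only [pow_zero, Nat.factorial_zero, Nat.cast_one, div_one, zero_add] at h1
    linarith
  have hFs : ∑ k ∈ Finset.Ico 1 (m + 1), F k ≤ ∑ k ∈ Finset.range (m + 1), F k := by
    refine Finset.sum_le_sum_of_subset_of_nonneg ?_ fun k _ _ => hF k
    rw [Finset.range_eq_Ico]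
    exact Finset.Ico_subset_Ico_left (by omega)
  calc _ ≤ (Real.sqrt (∑ k ∈ Finset.Ico 1 (m + 1), A k) *
        Real.sqrt (∑ k ∈ Finset.Ico 1 (m + 1), F k)) ^ 2 :=
      pow_le_pow_left₀ (norm_nonneg _) hsum 2
    _ = (∑ k ∈ Finset.Ico 1 (m + 1), A k) * ∑ k ∈ Finset.Ico 1 (m + 1), F k := by
      rw [mul_pow, Real.sq_sqrt (Finset.sum_nonneg fun k _ => hA k),
        Real.sq_sqrt (Finset.sum_nonneg fun k _ => hF k)]
    _ ≤ _ := mul_le_mul hAs hFs (Finset.sum_nonneg fun k _ => hF k)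
      ((Finset.sum_nonneg fun k _ => hA k).trans hAs)

/-- The factor `r^N` compensates the growth of `e^{B(c)}` with the boson number. The bound tends to
zero with `σ² / (1 - r²)`, so `c` need only be small compared with `√(1 - r²)`. -/
theorem fockBounded_dressPow_sub (B : Fin N → Matrix (Fin d) (Fin d) ℂ)
    (c : Fin N → Lp ℂ 2 μ) {r : ℝ} (hr : r ∈ Set.Ioo (0 : ℝ) 1) :
    FockBounded (dressPow B c r - numPow r) (dressBound (expNorm B c) r) := by
  refine fockBounded_of_sum_range_le (dressBound_nonneg _ _) fun Ψ K => ?_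
  have hr3 : 0 < 1 - r ^ 2 := by nlinarith [hr.1, hr.2]
  have he : 0 ≤ Real.exp (expNorm B c ^ 2 / (1 - r ^ 2)) - 1 := by
    have := Real.add_one_le_exp (expNorm B c ^ 2 / (1 - r ^ 2))
    have : 0 ≤ expNorm B c ^ 2 / (1 - r ^ 2) := by positivity
    linarith
  rw [dressBound, Real.sq_sqrt (by positivity)]
  refine (Finset.sum_le_sum fun m _ => norm_dressPow_sub_apply_sq_le B c hr Ψ _
    (fun _ => rfl) m).trans ?_
  rw [← Finset.mul_sum]
  refine (mul_le_mul_of_nonneg_left (sum_diag_choose_le hr (fun j => ‖Ψ j‖ ^ 2)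
    (fun _ => by positivity) K) he).trans (le_of_eq ?_)
  ring

theorem fockBounded_dressPow (B : Fin N → Matrix (Fin d) (Fin d) ℂ)
    (c : Fin N → Lp ℂ 2 μ) {r : ℝ} (hr : r ∈ Set.Ioo (0 : ℝ) 1) :
    FockBounded (dressPow B c r) (1 + dressBound (expNorm B c) r) := by
  have h := (fockBounded_numPow (μ := μ) (d := d) hr).add (fockBounded_dressPow_sub B c hr)
  rwa [add_sub_cancel] at h

end Bounded

attribute [irreducible] expNorm dressBound fockOp

/-! ### The form domain as a Hilbert space -/

section FormSpace

variable {X : Type*} [MeasurableSpace X] {μ : Measure X} [SigmaFinite μ] {d N : ℕ} {α : Type*}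

/-- The projection onto the `n`-boson sector. -/
def fockEval (n : ℕ) : Fock μ d →L[ℂ] Sector μ d n :=
  LinearMap.mkContinuous
    { toFun := fun Ψ => Ψ n
      map_add' := fun _ _ => rfl
      map_smul' := fun _ _ => rfl } 1 fun Ψ => by
    rw [one_mul]; exact lp.norm_apply_le_norm (by simp) Ψ n

theorem annHat_apply (B : Fin N → Matrix (Fin d) (Fin d) ℂ) (g : Fin N → Lp ℂ 2 μ) (h : Lp ℂ 2 μ)
    (Ψ : Formal μ d) (n : ℕ) : annHat B g h Ψ n
      = annSector h n (Ψ (n + 1)) + ∑ j, ⟪h, g j⟫_ℂ • matSector (B j) n (Ψ n) := by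
  rw [annHat_eq, shift_apply, Pi.add_apply, Finset.sum_apply]
  rfl

theorem norm_annHat_apply_le (B : Fin N → Matrix (Fin d) (Fin d) ℂ) (g : Fin N → Lp ℂ 2 μ)
    (h : Lp ℂ 2 μ) (Ψ : Formal μ d) (n : ℕ) : ‖annHat B g h Ψ n‖
      ≤ Real.sqrt (n + 1) * ‖h‖ * ‖Ψ (n + 1)‖ + (∑ j, ‖⟪h, g j⟫_ℂ‖ * matNorm (B j)) * ‖Ψ n‖ := by
  rw [annHat_apply]
  refine (norm_add_le _ _).trans (add_le_add (norm_annSector_le h n _) ?_)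
  rw [Finset.sum_mul]
  refine (norm_sum_le _ _).trans (Finset.sum_le_sum fun j _ => ?_)
  rw [sector_norm_smul, mul_assoc]
  exact mul_le_mul_of_nonneg_left (norm_matSector_le (B j) n (Ψ n)) (norm_nonneg _)

/-- The `n`-boson component of the displaced annihilation operator. -/
def annHatEval (B : Fin N → Matrix (Fin d) (Fin d) ℂ) (g : Fin N → Lp ℂ 2 μ) (h : Lp ℂ 2 μ)
    (n : ℕ) : Fock μ d →L[ℂ] Sector μ d n :=
  LinearMap.mkContinuous
    { toFun := fun Ψ => annHat B g h (Ψ : Formal μ d) n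
      map_add' := fun Ψ Φ => congrFun (map_add (annHat B g h) (Ψ : Formal μ d) (Φ : Formal μ d)) n
      map_smul' := fun c Ψ => congrFun ((annHat B g h).map_smul c (Ψ : Formal μ d)) n }
    (Real.sqrt (n + 1) * ‖h‖ + ∑ j, ‖⟪h, g j⟫_ℂ‖ * matNorm (B j)) fun Ψ => by
      rw [add_mul]
      refine (norm_annHat_apply_le B g h (Ψ : Formal μ d) n).trans (add_le_add ?_ ?_)
      · exact mul_le_mul_of_nonneg_left (lp.norm_apply_le_norm (by simp) Ψ (n + 1)) (by positivity)
      · exact mul_le_mul_of_nonneg_left (lp.norm_apply_le_norm (by simp) Ψ n)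
          (Finset.sum_nonneg fun j _ => mul_nonneg (norm_nonneg _) (matNorm_nonneg _))

theorem annHatEval_apply (B : Fin N → Matrix (Fin d) (Fin d) ℂ) (g : Fin N → Lp ℂ 2 μ)
    (h : Lp ℂ 2 μ) (n : ℕ) (Ψ : Fock μ d) :
    annHatEval B g h n Ψ = annHat B g h (Ψ : Formal μ d) n := rfl

/-- The operator `M ⊗ 1` on the Fock space. -/
def matL (M : Matrix (Fin d) (Fin d) ℂ) : Fock μ d →L[ℂ] Fock μ d := fockOp (mat M) (fockBounded_mat M)

theorem coe_matL (M : Matrix (Fin d) (Fin d) ℂ) (Ψ : Fock μ d) :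
    (matL M Ψ : Formal μ d) = mat M Ψ := coe_fockOp _ _

theorem norm_matL_le (M : Matrix (Fin d) (Fin d) ℂ) (Ψ : Fock μ d) :
    ‖matL M Ψ‖ ≤ matNorm M * ‖Ψ‖ := (fockBounded_mat M).norm_le (coe_matL M Ψ)

theorem matL_matL {M M' : Matrix (Fin d) (Fin d) ℂ} (h : M * M' = 1) (Ψ : Fock μ d) :
    matL M (matL M' Ψ) = Ψ := by
  refine lp.ext ?_
  rw [coe_matL, coe_matL, ← mat_mul, h, mat_one]

theorem inner_matL_left (M : Matrix (Fin d) (Fin d) ℂ) (Ψ Φ : Fock μ d) :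
    ⟪matL M Ψ, Φ⟫_ℂ = ⟪Ψ, matL M.conjTranspose Φ⟫_ℂ := by
  rw [lp.inner_eq_tsum, lp.inner_eq_tsum]
  refine tsum_congr fun n => ?_
  rw [coe_matL, coe_matL]
  exact inner_matSector_left M n _ _

/-- Sequences of Fock space vectors. -/
abbrev FockSeq (μ : Measure X) [SigmaFinite μ] (d : ℕ) (α : Type*) : Type _ :=
  lp (fun _ : α => Fock μ d) 2

/-- The form domain of `∑ₐ â(hₐ)^* â(hₐ) + M^* M`, consisting of the pairs
`(M Ψ, (â(hₐ) Ψ)ₐ)`; `M'` is the inverse of `M`. -/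
def formSpace (B : Fin N → Matrix (Fin d) (Fin d) ℂ) (M' : Matrix (Fin d) (Fin d) ℂ)
    (h : α → Lp ℂ 2 μ) (g : Fin N → Lp ℂ 2 μ) :
    Submodule ℂ (WithLp 2 (Fock μ d × FockSeq μ d α)) where
  carrier := {x | ∀ a, (x.snd a : Formal μ d) = annHat B g (h a) (matL M' x.fst : Fock μ d)}
  zero_mem' a := by
    change (0 : Formal μ d) = annHat B g (h a) ((matL M' 0 : Fock μ d) : Formal μ d)
    rw [map_zero]; exact (map_zero (annHat B g (h a))).symm
  add_mem' {x y} hx hy a := by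
    change (x.snd a : Formal μ d) + (y.snd a : Formal μ d)
      = annHat B g (h a) ((matL M' (x.fst + y.fst) : Fock μ d) : Formal μ d)
    rw [map_add, hx, hy]
    exact (map_add (annHat B g (h a)) _ _).symm
  smul_mem' c x hx a := by
    change c • (x.snd a : Formal μ d)
      = annHat B g (h a) ((matL M' (c • x.fst) : Fock μ d) : Formal μ d)
    rw [map_smul, hx]
    exact ((annHat B g (h a)).map_smul c _).symm

variable {B : Fin N → Matrix (Fin d) (Fin d) ℂ} {M M' : Matrix (Fin d) (Fin d) ℂ}
  {h : α → Lp ℂ 2 μ} {g : Fin N → Lp ℂ 2 μ}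

/-- Each component of `â(h) Ψ` involves only two sectors of `Ψ` and so depends continuously on `Ψ`;
the defining condition is an intersection of closed ones. This is the closedness of the form. -/
theorem isClosed_formSpace : 
    IsClosed (formSpace B M' h g : Set (WithLp 2 (Fock μ d × FockSeq μ d α))) := by
  have : (formSpace B M' h g : Set (WithLp 2 (Fock μ d × FockSeq μ d α)))
      = ⋂ (a : α) (n : ℕ), {x | fockEval n (x.snd a)
        = annHatEval B g (h a) n (matL M' x.fst)} := by
    ext x
    simp only [Set.mem_iInter, Set.mem_ofPred_eq, annHatEval_apply]
    exact ⟨fun hx a n => congrFun (hx a) n, fun hx a => funext fun n => hx a n⟩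
  rw [this]
  refine isClosed_iInter fun a => isClosed_iInter fun n => isClosed_eq ?_ ?_
  · refine (fockEval n).continuous.comp ?_
    have h1 : Continuous fun f : FockSeq μ d α => f a :=
      (LipschitzWith.of_dist_le_mul (K := 1) fun f f' => by
        rw [dist_eq_norm, dist_eq_norm, NNReal.coe_one, one_mul]
        exact lp.norm_apply_le_norm (by simp) (f - f') a).continuous
    exact h1.comp (WithLp.prod_continuous_ofLp 2 _ _).snd
  · exact (annHatEval B g (h a) n).continuous.comp ((matL M').continuous.comp
      (WithLp.prod_continuous_ofLp 2 _ _).fst)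

variable (B M' h g) in
/-- The form domain of `∑ₐ â(hₐ)^* â(hₐ) + M^* M` as a Hilbert space. -/
def FormDom : Type _ := formSpace B M' h g

instance : NormedAddCommGroup (FormDom B M' h g) :=
  inferInstanceAs (NormedAddCommGroup (formSpace B M' h g))

instance : InnerProductSpace ℂ (FormDom B M' h g) :=
  inferInstanceAs (InnerProductSpace ℂ (formSpace B M' h g))

instance : CompleteSpace (FormDom B M' h g) := isClosed_formSpace.completeSpace_coe

/-- The component `M Ψ` of an element of the form domain. -/
def FormDom.fst (x : FormDom B M' h g) : Fock μ d := WithLp.fst x.1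

/-- The component `(â(hₐ) Ψ)ₐ` of an element of the form domain. -/
def FormDom.snd (x : FormDom B M' h g) : FockSeq μ d α := WithLp.snd x.1

theorem FormDom.norm_sq (x : FormDom B M' h g) : ‖x‖ ^ 2 = ‖x.fst‖ ^ 2 + ‖x.snd‖ ^ 2 :=
  WithLp.prod_norm_sq_eq_of_L2 x.1

theorem FormDom.norm_fst_le (x : FormDom B M' h g) : ‖x.fst‖ ≤ ‖x‖ := by
  refine (sq_le_sq₀ (norm_nonneg _) (norm_nonneg _)).1 ?_
  rw [x.norm_sq]; linarith [sq_nonneg ‖x.snd‖]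

theorem FormDom.norm_snd_le (x : FormDom B M' h g) : ‖x.snd‖ ≤ ‖x‖ := by
  refine (sq_le_sq₀ (norm_nonneg _) (norm_nonneg _)).1 ?_
  rw [x.norm_sq]; linarith [sq_nonneg ‖x.fst‖]

theorem FormDom.inner_def (x y : FormDom B M' h g) :
    ⟪x, y⟫_ℂ = ⟪x.fst, y.fst⟫_ℂ + ∑' a, ⟪x.snd a, y.snd a⟫_ℂ :=
  (WithLp.prod_inner_apply x.1 y.1).trans (congrArg _ (lp.inner_eq_tsum _ _))

variable (B M' h g) in
/-- The embedding of the form domain into the Fock space. -/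
def formEmb : FormDom B M' h g →L[ℂ] Fock μ d :=
  LinearMap.mkContinuous
    { toFun := fun x => matL M' x.fst
      map_add' := fun x y => map_add (matL M') x.fst y.fst
      map_smul' := fun c x => map_smul (matL M') c x.fst } (matNorm M') fun x =>
    (norm_matL_le _ _).trans (mul_le_mul_of_nonneg_left x.norm_fst_le (matNorm_nonneg _))

theorem formEmb_apply (x : FormDom B M' h g) : formEmb B M' h g x = matL M' x.fst := rfl

theorem FormDom.coe_snd (x : FormDom B M' h g) (a : α) :
    (x.snd a : Formal μ d) = annHat B g (h a) (formEmb B M' h g x : Fock μ d) := x.2 a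

theorem FormDom.fst_eq (hM : M * M' = 1) (x : FormDom B M' h g) :
    x.fst = matL M (formEmb B M' h g x) := by
  rw [formEmb_apply, matL_matL hM]

theorem norm_formEmb_apply_le (x : FormDom B M' h g) :
    ‖formEmb B M' h g x‖ ≤ matNorm M' * ‖x‖ :=
  (norm_matL_le _ _).trans (mul_le_mul_of_nonneg_left x.norm_fst_le (matNorm_nonneg _))

theorem norm_formEmb_le : ‖formEmb B M' h g‖ ≤ matNorm M' :=
  ContinuousLinearMap.opNorm_le_bound _ (matNorm_nonneg _) norm_formEmb_apply_le

/-- The vector `Ψ` determines both `M Ψ` and all `â(hₐ) Ψ`, so the embedding is injective.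
Identities in the form domain can therefore be checked in Fock space. -/
theorem FormDom.ext_formEmb {x y : FormDom B M' h g} (hM : M * M' = 1)
    (hxy : formEmb B M' h g x = formEmb B M' h g y) : x = y := by
  have h1 : x.fst = y.fst := by rw [x.fst_eq hM, y.fst_eq hM, hxy]
  have h2 : x.snd = y.snd := by
    refine lp.ext (funext fun a => lp.ext ?_)
    rw [x.coe_snd, y.coe_snd, hxy]
  exact Subtype.ext ((WithLp.ofLp_injective 2) (Prod.ext h1 h2))

/-- The element of the form domain given by a vector `Ψ`. -/
theorem exists_formDom (hM' : M' * M = 1) {Ψ : Fock μ d} (t : FockSeq μ d α)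
    (ht : ∀ a, (t a : Formal μ d) = annHat B g (h a) Ψ) :
    ∃ x : FormDom B M' h g, formEmb B M' h g x = Ψ ∧ x.fst = matL M Ψ ∧ x.snd = t := by
  refine ⟨⟨WithLp.toLp 2 (matL M Ψ, t), fun a => ?_⟩, matL_matL hM' Ψ, rfl, rfl⟩
  change (t a : Formal μ d) = annHat B g (h a) (matL M' (matL M Ψ) : Fock μ d)
  rw [matL_matL hM', ht]

theorem exists_formDom_of_summable (hM' : M' * M = 1) {Ψ : Fock μ d} (t : α → Fock μ d)
    (ht : ∀ a, (t a : Formal μ d) = annHat B g (h a) Ψ) (hs : Summable fun a => ‖t a‖ ^ 2) :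
    ∃ x : FormDom B M' h g, formEmb B M' h g x = Ψ ∧ x.fst = matL M Ψ ∧ ∀ a, x.snd a = t a := by
  obtain ⟨x, h1, h2, h3⟩ := exists_formDom (B := B) (h := h) (g := g) hM'
    (⟨t, memℓp_two_iff.2 hs⟩ : FockSeq μ d α) ht
  exact ⟨x, h1, h2, fun a => by rw [h3]⟩

end FormSpace

attribute [irreducible] FormDom FormDom.fst FormDom.snd formEmb

/-! ### Frames for multiplication operators -/

section Band

variable {α : Type*} [MeasurableSpace α] {W : α → ℝ}

open Classical in
/-- The function `√W` restricted to the set where `k ≤ W < k + 1`. -/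
def band (W : α → ℝ) (hW : Measurable W) (k : ℕ) : Multiplier α where
  toFun x := if (k : ℝ) ≤ W x ∧ W x < k + 1 then Real.sqrt (W x) else 0
  measurable' := Measurable.ite
    ((measurableSet_le measurable_const hW).inter (measurableSet_lt hW measurable_const))
    hW.sqrt measurable_const
  bound := Real.sqrt (k + 1)
  abs_le' x := by
    split_ifs with h
    · rw [abs_of_nonneg (Real.sqrt_nonneg _)]; exact Real.sqrt_le_sqrt h.2.le
    · simp

open Classical in
/-- The indicator function of the set where `W < R`. -/
def cut (W : α → ℝ) (hW : Measurable W) (R : ℕ) : Multiplier α where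
  toFun x := if W x < R then 1 else 0
  measurable' := Measurable.ite (measurableSet_lt hW measurable_const)
    measurable_const measurable_const
  bound := 1
  abs_le' x := by split_ifs <;> simp

open Classical in
/-- The function `W` restricted to the set where `0 ≤ W < R`. -/
def cutMul (W : α → ℝ) (hW : Measurable W) (R : ℕ) : Multiplier α where
  toFun x := if 0 ≤ W x ∧ W x < R then W x else 0
  measurable' := Measurable.ite
    ((measurableSet_le measurable_const hW).inter (measurableSet_lt hW measurable_const))
    hW measurable_const
  bound := R
  abs_le' x := by
    split_ifs with h
    · rw [abs_of_nonneg h.1]; exact h.2.le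
    · simp

theorem cutMul_succ (hW : Measurable W) (R : ℕ) (x : α) :
    cutMul W hW (R + 1) x = cutMul W hW R x + band W hW R x * band W hW R x := by
  change (if 0 ≤ W x ∧ W x < (R + 1 : ℕ) then W x else 0)
    = (if 0 ≤ W x ∧ W x < R then W x else 0)
      + (if (R : ℝ) ≤ W x ∧ W x < R + 1 then Real.sqrt (W x) else 0)
      * (if (R : ℝ) ≤ W x ∧ W x < R + 1 then Real.sqrt (W x) else 0)
  have hR : (0 : ℝ) ≤ R := R.cast_nonneg
  push_cast
  by_cases h0 : 0 ≤ W x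
  · rcases lt_or_ge (W x) R with h1 | h1
    · rw [if_pos ⟨h0, by linarith⟩, if_pos ⟨h0, h1⟩, if_neg (fun h => absurd h.1 (not_le.2 h1))]
      simp
    · rw [if_neg (show ¬ (0 ≤ W x ∧ W x < R) from fun h => absurd h.2 (not_lt.2 h1)), zero_add]
      by_cases h2 : W x < R + 1
      · rw [if_pos ⟨h0, h2⟩, if_pos ⟨h1, h2⟩, Real.mul_self_sqrt h0]
      · rw [if_neg (fun h => h2 h.2), if_neg (fun h => h2 h.2)]; simp
  · rw [if_neg (fun h => h0 h.1), if_neg (fun h => h0 h.1),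
      if_neg (fun h => h0 (hR.trans h.1))]
    simp

theorem cutMul_zero (hW : Measurable W) (x : α) : cutMul W hW 0 x = 0 := by
  refine if_neg fun h => ?_
  have := h.2
  rw [Nat.cast_zero] at this
  linarith [h.1]

theorem cutMul_eq (hW : Measurable W) (R : ℕ) {x : α} (hx : 0 ≤ W x) :
    cutMul W hW R x = cut W hW R x * W x := by
  change (if 0 ≤ W x ∧ W x < R then W x else 0) = (if W x < R then (1 : ℝ) else 0) * W x
  by_cases h : W x < R
  · rw [if_pos ⟨hx, h⟩, if_pos h, one_mul]
  · rw [if_neg fun h' => h h'.2, if_neg h, zero_mul]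

theorem cut_mul_self (hW : Measurable W) (R : ℕ) (x : α) :
    cut W hW R x * cut W hW R x = cut W hW R x := by
  change (if W x < R then (1 : ℝ) else 0) * (if W x < R then (1 : ℝ) else 0) = if W x < R then 1 else 0
  split_ifs <;> simp

theorem cut_eventually (hW : Measurable W) (x : α) : ∀ᶠ R : ℕ in atTop, cut W hW R x = 1 := by
  obtain ⟨n, hn⟩ := exists_nat_gt (W x)
  filter_upwards [eventually_ge_atTop n] with R hR
  exact if_pos (hn.trans_le (Nat.cast_le.2 hR))

variable {E : Type*} [NormedAddCommGroup E] [InnerProductSpace ℂ E] {ν : Measure α}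

theorem inner_self_eq_ofReal (x : E) : ⟪x, x⟫_ℂ = ((‖x‖ ^ 2 : ℝ) : ℂ) := by
  rw [inner_self_eq_norm_sq_to_K]; push_cast; rfl

/-- Multiplication by functions of modulus at most one which converge pointwise to one converges
strongly to the identity. -/
theorem Multiplier.tendsto_op {w : ℕ → Multiplier α} (h1 : ∀ R x, |w R x| ≤ 1)
    (hw : ∀ᵐ x ∂ν, Tendsto (fun R => w R x) atTop (𝓝 1)) (F : Lp E 2 ν) :
    Tendsto (fun R => (w R).op E ν F) atTop (𝓝 F) := by
  rw [tendsto_iff_norm_sub_tendsto_zero]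
  have key : ∀ R, ‖(w R).op E ν F - F‖ ^ 2 = ∫ x, (w R x - 1) ^ 2 * ‖F x‖ ^ 2 ∂ν := fun R => by
    have h := L2.inner_def (𝕜 := ℂ) ((w R).op E ν F - F) ((w R).op E ν F - F)
    rw [inner_self_eq_ofReal] at h
    have h' : ∫ x, ⟪((w R).op E ν F - F) x, ((w R).op E ν F - F) x⟫_ℂ ∂ν
        = ∫ x, (((w R x - 1) ^ 2 * ‖F x‖ ^ 2 : ℝ) : ℂ) ∂ν := by
      refine integral_congr_ae ?_
      filter_upwards [(w R).coeFn_op F, Lp.coeFn_sub ((w R).op E ν F) F] with x h2 h3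
      rw [h3, Pi.sub_apply, h2, inner_self_eq_ofReal]
      have : (w R x : ℂ) • F x - F x = ((w R x - 1 : ℝ) : ℂ) • F x := by
        push_cast; rw [sub_smul, one_smul]
      rw [this, norm_smul, Complex.norm_real, mul_pow, Real.norm_eq_abs, sq_abs]
    rw [h', integral_complex_ofReal] at h
    exact_mod_cast h
  have hlim : Tendsto (fun R => ∫ x, (w R x - 1) ^ 2 * ‖F x‖ ^ 2 ∂ν) atTop
      (𝓝 (∫ _ : α, (0 : ℝ) ∂ν)) := by
    refine tendsto_integral_of_dominated_convergence (fun x => 4 * ‖F x‖ ^ 2) (fun R => ?_) ?_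
      (fun R => .of_forall fun x => ?_) ?_
    · exact (((w R).measurable'.sub_const 1).pow_const 2).aestronglyMeasurable.mul
        ((Lp.aestronglyMeasurable F).norm.pow 2)
    · exact ((Lp.memLp F).integrable_norm_pow (by norm_num)).const_mul 4
    · rw [Real.norm_eq_abs, abs_of_nonneg (by positivity)]
      refine mul_le_mul_of_nonneg_right ?_ (by positivity)
      have := abs_le.1 (h1 R x)
      nlinarith
    · filter_upwards [hw] with x hx
      have : Tendsto (fun R => (w R x - 1) ^ 2 * ‖F x‖ ^ 2) atTop
          (𝓝 ((1 - 1) ^ 2 * ‖F x‖ ^ 2)) := ((hx.sub_const 1).pow 2).mul_const _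
      simpa using this
  rw [integral_zero] at hlim
  have := hlim.sqrt
  rw [Real.sqrt_zero] at this
  refine this.congr fun R => ?_
  rw [← key, Real.sqrt_sq (norm_nonneg _)]

theorem tendsto_cut_op (hW : Measurable W) (F : Lp E 2 ν) :
    Tendsto (fun R => (cut W hW R).op E ν F) atTop (𝓝 F) :=
  Multiplier.tendsto_op (fun R x => (cut W hW R).abs_le' x)
    (.of_forall fun x => tendsto_const_nhds.congr' (EventuallyEq.symm (cut_eventually hW x))) F

/-- The squares of the first `R` band functions telescope to `W` restricted to `0 ≤ W < R`. -/
theorem sum_inner_band (hW : Measurable W) (F G : Lp E 2 ν) (R : ℕ) :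
    ∑ k ∈ Finset.range R, ⟪(band W hW k).op E ν F, (band W hW k).op E ν G⟫_ℂ
      = ⟪F, (cutMul W hW R).op E ν G⟫_ℂ := by
  induction R with
  | zero =>
    have : (cutMul W hW 0).op E ν G = 0 := Multiplier.op_eq_of_ae _ _ _ (by
      filter_upwards [Lp.coeFn_zero E 2 ν] with x hx
      rw [hx, cutMul_zero]; simp)
    rw [this]; simp
  | succ R ih =>
    rw [Finset.sum_range_succ, ih, Multiplier.inner_op_op (band W hW R) (band W hW R)
      ⟨fun x => band W hW R x * band W hW R x, (band W hW R).measurable'.mul (band W hW R).measurable',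
        (band W hW R).bound * (band W hW R).bound, fun x => by
          rw [abs_mul]
          exact mul_le_mul ((band W hW R).abs_le' x) ((band W hW R).abs_le' x) (abs_nonneg _)
            ((abs_nonneg _).trans ((band W hW R).abs_le' x))⟩ (.of_forall fun x => rfl),
      ← inner_add_right]
    congr 1
    symm
    refine Multiplier.op_eq_of_ae _ _ _ ?_
    refine (Lp.coeFn_add _ _).trans ?_
    filter_upwards [(cutMul W hW R).coeFn_op G, Multiplier.coeFn_op
      ⟨fun x => band W hW R x * band W hW R x, (band W hW R).measurable'.mul (band W hW R).measurable',
        (band W hW R).bound * (band W hW R).bound, fun x => by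
          rw [abs_mul]
          exact mul_le_mul ((band W hW R).abs_le' x) ((band W hW R).abs_le' x) (abs_nonneg _)
            ((abs_nonneg _).trans ((band W hW R).abs_le' x))⟩ G] with x h1 h2
    rw [Pi.add_apply, h1, h2, cutMul_succ, Complex.ofReal_add, add_smul]

theorem norm_cut_op_le (hW : Measurable W) (F : Lp E 2 ν) (R : ℕ) :
    ‖(cut W hW R).op E ν F‖ ≤ ‖F‖ := by
  refine Lp.norm_le_norm_of_ae_le ?_
  filter_upwards [(cut W hW R).coeFn_op F] with x hx
  rw [hx, norm_smul, Complex.norm_real]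
  exact mul_le_of_le_one_left (norm_nonneg _) ((cut W hW R).abs_le' x)

/-- The partial sums equal the inner products of `1_{W < R} H` with `G`, which converge to `⟨H, G⟩`.
Only `F` has to lie in the domain of `W`; `G` is arbitrary. -/
theorem eq_inner_of_hasSum_band (hW : Measurable W) (hpos : ∀ᵐ x ∂ν, 0 ≤ W x) {F G H : Lp E 2 ν}
    (hH : H =ᵐ[ν] fun x => (W x : ℂ) • F x) {s : ℂ}
    (hs : HasSum (fun k => ⟪(band W hW k).op E ν F, (band W hW k).op E ν G⟫_ℂ) s) :
    s = ⟪H, G⟫_ℂ := by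
  refine tendsto_nhds_unique hs.tendsto_sum_nat ?_
  have h1 : ∀ R, ∑ k ∈ Finset.range R, ⟪(band W hW k).op E ν F, (band W hW k).op E ν G⟫_ℂ
      = ⟪(cut W hW R).op E ν H, G⟫_ℂ := fun R => by
    rw [sum_inner_band, ← Multiplier.inner_op_left]
    congr 1
    refine Multiplier.op_eq_of_ae _ _ _ (((cut W hW R).coeFn_op H).trans ?_)
    filter_upwards [hH, hpos] with x hx h0
    rw [hx, cutMul_eq hW R h0, smul_smul]; push_cast; rfl
  simp only [h1]
  exact (tendsto_cut_op hW H).inner tendsto_const_nhds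

/-- On `W < R` the lower bound `m ≤ W` applies to the partial sum over the first `R` bands; then let
`R` tend to infinity. Nothing is assumed about the domain of `W`. -/
theorem norm_sq_le_of_hasSum_band (hW : Measurable W) {m : ℝ} (hm : 0 ≤ m)
    (hpos : ∀ᵐ x ∂ν, m ≤ W x) {F : Lp E 2 ν} {s : ℝ}
    (hs : HasSum (fun k => ‖(band W hW k).op E ν F‖ ^ 2) s) : m * ‖F‖ ^ 2 ≤ s := by
  have h1 : ∀ R, m * ‖(cut W hW R).op E ν F‖ ^ 2 ≤ s := fun R => by
    refine le_trans ?_ (sum_le_hasSum (Finset.range R) (fun _ _ => sq_nonneg _) hs)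
    have h2 := sum_inner_band hW F F R
    have h3 : ((∑ k ∈ Finset.range R, ‖(band W hW k).op E ν F‖ ^ 2 : ℝ) : ℂ)
        = ⟪F, (cutMul W hW R).op E ν F⟫_ℂ := by
      rw [← h2, Complex.ofReal_sum]
      exact Finset.sum_congr rfl fun k _ => (inner_self_eq_ofReal _).symm
    have h4 : ((m * ‖(cut W hW R).op E ν F‖ ^ 2 : ℝ) : ℂ)
        = (m : ℂ) * ⟪F, (cut W hW R).op E ν F⟫_ℂ := by
      rw [← Multiplier.inner_op_op (cut W hW R) (cut W hW R) (cut W hW R)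
        (.of_forall fun x => (cut_mul_self hW R x).symm), inner_self_eq_ofReal, Complex.ofReal_mul]
    have h5 : ∀ w : Multiplier α, (⟪F, w.op E ν F⟫_ℂ) = ((∫ x, w x * ‖F x‖ ^ 2 ∂ν : ℝ) : ℂ) := by
      intro w
      rw [L2.inner_def, ← integral_complex_ofReal]
      refine integral_congr_ae ?_
      filter_upwards [w.coeFn_op F] with x hx
      rw [hx, inner_smul_right, inner_self_eq_ofReal, Complex.ofReal_mul]
    have h6 : ∀ w : Multiplier α, Integrable (fun x => w x * ‖F x‖ ^ 2) ν := fun w =>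
      ((Lp.memLp F).integrable_norm_pow (p := 2) (by norm_num)).bdd_mul
        w.measurable'.aestronglyMeasurable (.of_forall w.abs_le')
    rw [h5] at h3 h4
    have h3' : ∑ k ∈ Finset.range R, ‖(band W hW k).op E ν F‖ ^ 2
      = ∫ x, cutMul W hW R x * ‖F x‖ ^ 2 ∂ν := by exact_mod_cast h3
    have h4' : m * ‖(cut W hW R).op E ν F‖ ^ 2
      = m * ∫ x, cut W hW R x * ‖F x‖ ^ 2 ∂ν := by exact_mod_cast h4
    rw [h3', h4', ← integral_const_mul]
    refine integral_mono_ae ((h6 _).const_mul m) (h6 _) ?_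
    filter_upwards [hpos] with x hx
    have : m * cut W hW R x ≤ cutMul W hW R x := by
      rw [cutMul_eq hW R (hm.trans hx), mul_comm]
      refine mul_le_mul_of_nonneg_left hx ?_
      rw [← cut_mul_self]; exact mul_self_nonneg _
    change m * (cut W hW R x * ‖F x‖ ^ 2) ≤ cutMul W hW R x * ‖F x‖ ^ 2
    rw [← mul_assoc]
    exact mul_le_mul_of_nonneg_right this (sq_nonneg _)
  exact le_of_tendsto (((tendsto_cut_op hW F).norm.pow 2).const_mul m) (.of_forall h1)

theorem sum_norm_sq_band_le (hW : Measurable W) (hpos : ∀ᵐ x ∂ν, 0 ≤ W x) {F G : Lp E 2 ν}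
    (hG : G =ᵐ[ν] fun x => (Real.sqrt (W x) : ℂ) • F x) (R : ℕ) :
    ∑ k ∈ Finset.range R, ‖(band W hW k).op E ν F‖ ^ 2 ≤ ‖G‖ ^ 2 := by
  have h2 := sum_inner_band hW F F R
  have h3 : ((∑ k ∈ Finset.range R, ‖(band W hW k).op E ν F‖ ^ 2 : ℝ) : ℂ)
      = ⟪F, (cutMul W hW R).op E ν F⟫_ℂ := by
    rw [← h2, Complex.ofReal_sum]
    exact Finset.sum_congr rfl fun k _ => (inner_self_eq_ofReal _).symm
  have h4 : ⟪F, (cutMul W hW R).op E ν F⟫_ℂ = ⟪(cut W hW R).op E ν G, (cut W hW R).op E ν G⟫_ℂ := by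
    rw [L2.inner_def, L2.inner_def]
    refine integral_congr_ae ?_
    filter_upwards [(cutMul W hW R).coeFn_op F, (cut W hW R).coeFn_op G, hG, hpos] with x h5 h6 h7 h0
    rw [h5, h6, h7, cutMul_eq hW R h0, inner_smul_right, inner_smul_left, inner_smul_left,
      inner_smul_right, inner_smul_right, Complex.conj_ofReal, Complex.conj_ofReal]
    have : ((W x : ℝ) : ℂ) = (Real.sqrt (W x) : ℂ) * (Real.sqrt (W x) : ℂ) := by
      rw [← Complex.ofReal_mul, Real.mul_self_sqrt h0]
    have h8 := congrArg (fun t : ℝ => (t : ℂ)) (cut_mul_self hW R x)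
    simp only [Complex.ofReal_mul] at h8
    rw [Complex.ofReal_mul, this]
    linear_combination (-(Real.sqrt (W x) : ℂ) ^ 2 * ⟪F x, F x⟫_ℂ) * h8
  rw [h4, inner_self_eq_ofReal] at h3
  have h5 : ∑ k ∈ Finset.range R, ‖(band W hW k).op E ν F‖ ^ 2 = ‖(cut W hW R).op E ν G‖ ^ 2 := by
    exact_mod_cast h3
  rw [h5]
  exact pow_le_pow_left₀ (norm_nonneg _) (norm_cut_op_le hW G R) 2

end Band

/-! ### Frame identities in one variable of a several-variable function -/

section Frame

variable {X : Type*} [MeasurableSpace X] {μ : Measure X} [SigmaFinite μ] {d N : ℕ} {ι : Type*}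

open ContinuousLinearMap in
theorem adjoint_insertAt_insertAt (f f' : Lp ℂ 2 μ) {n : ℕ} (i : Fin (n + 1))
    (ψ : Lp (Spin d) 2 (powMeasure μ n)) :
    adjoint (insertAt f n i) (insertAt f' n i ψ) = ⟪f, f'⟫_ℂ • ψ := by
  refine ext_inner_left ℂ fun v => ?_
  rw [adjoint_inner_right, inner_insertAt, inner_smul_right]

/-- Parseval's identity in one of the variables. -/
theorem hasSum_inner_adjoint_insertAt (e : HilbertBasis ι ℂ (Lp ℂ 2 μ)) {n : ℕ} (i : Fin (n + 1))
    (F G : Lp (Spin d) 2 (powMeasure μ (n + 1))) :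
    HasSum (fun l => ⟪ContinuousLinearMap.adjoint (insertAt (e l) n i) F,
      ContinuousLinearMap.adjoint (insertAt (e l) n i) G⟫_ℂ) ⟪F, G⟫_ℂ := by
  classical
  -- The insertions of the `e l` at slot `i` are isometries with orthogonal and jointly total
  -- ranges, so `L²(Xⁿ⁺¹)` is their Hilbert sum. The coordinates are the adjoints, and Parseval's
  -- identity is the formula for the inner product of a Hilbert sum.
  set V : ι → Lp (Spin d) 2 (powMeasure μ n) →ₗᵢ[ℂ] Lp (Spin d) 2 (powMeasure μ (n + 1)) :=
    fun l => ⟨(insertAt (e l) n i).toLinearMap, fun ψ => by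
      change ‖insertAt (e l) n i ψ‖ = ‖ψ‖
      rw [norm_insertAt, e.orthonormal.1 l, one_mul]⟩ with hV
  have horth : OrthogonalFamily ℂ (fun _ : ι => Lp (Spin d) 2 (powMeasure μ n)) V := by
    intro l l' hl ψ ψ'
    change ⟪insertAt (e l) n i ψ, insertAt (e l') n i ψ'⟫_ℂ = 0
    rw [inner_insertAt, e.orthonormal.2 hl, zero_mul]
  have hsum : IsHilbertSum ℂ (fun _ : ι => Lp (Spin d) 2 (powMeasure μ n)) V := by
    refine IsHilbertSum.mk horth ?_
    rw [top_le_iff, Submodule.topologicalClosure_eq_top_iff, Submodule.eq_bot_iff]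
    intro H hH
    rw [Submodule.mem_orthogonal] at hH
    refine eq_zero_of_inner_insertAt i H fun f ψ => ?_
    have hf := e.hasSum_repr f
    have hz : ∀ l, ⟪insertAt (e l) n i ψ, H⟫_ℂ = 0 := fun l =>
      hH _ (Submodule.mem_iSup_of_mem l ⟨ψ, rfl⟩)
    let A : Lp ℂ 2 μ →L[ℂ] Lp (Spin d) 2 (powMeasure μ (n + 1)) := LinearMap.mkContinuous
      { toFun := fun f => insertAt f n i ψ
        map_add' := fun f f' => insertAt_add f f' i ψ
        map_smul' := fun c f => insertAt_smul c f i ψ } ‖ψ‖ fun f => by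
          change ‖insertAt f n i ψ‖ ≤ _
          rw [norm_insertAt, mul_comm]
    have h1 := hf.mapL A
    have h2 := h1.mapL (innerSL ℂ H)
    have h3 : ∀ l, innerSL ℂ H (A (e.repr f l • e l)) = 0 := fun l => by
      rw [map_smul, map_smul]
      change _ • ⟪H, insertAt (e l) n i ψ⟫_ℂ = 0
      rw [← inner_conj_symm, hz]; simp
    simp only [h3] at h2
    have h4 : ⟪H, insertAt f n i ψ⟫_ℂ = 0 := h2.unique hasSum_zero
    rw [← inner_conj_symm, h4, map_zero]
  have hcoord : ∀ (F : Lp (Spin d) 2 (powMeasure μ (n + 1))) l,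
      hsum.linearIsometryEquiv F l = ContinuousLinearMap.adjoint (insertAt (e l) n i) F := by
    intro F l
    refine ext_inner_right ℂ fun v => ?_
    rw [ContinuousLinearMap.adjoint_inner_left]
    have h1 := hsum.linearIsometryEquiv_symm_apply_single (i := l) v
    have h2 : insertAt (e l) n i v = hsum.linearIsometryEquiv.symm (lp.single 2 l v) := h1.symm
    rw [h2, ← hsum.linearIsometryEquiv.inner_map_map, LinearIsometryEquiv.apply_symm_apply,
      lp.inner_single_right]
  have := lp.hasSum_inner (𝕜 := ℂ) (hsum.linearIsometryEquiv F) (hsum.linearIsometryEquiv G)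
  rw [LinearIsometryEquiv.inner_map_map] at this
  simpa only [hcoord] using this

/-- The vectors `√ω 1_{k ≤ ω < k + 1} e_l`, which form a frame for multiplication by `ω`. -/
def bandVec (ω : X → ℝ) (hω : Measurable ω) (e : ι → Lp ℂ 2 μ) (a : ℕ × ι) : Lp ℂ 2 μ :=
  (band ω hω a.1).op ℂ μ (e a.2)

/-- The multiplier in `bandVec` moves over to the variable being contracted, which leaves a
contraction with a basis vector. -/
theorem adjoint_insertAt_bandVec {ω : X → ℝ} (hω : Measurable ω) (e : ι → Lp ℂ 2 μ) (a : ℕ × ι)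
    {n : ℕ} (F : Lp (Spin d) 2 (powMeasure μ (n + 1))) :
    ContinuousLinearMap.adjoint (insertAt (bandVec ω hω e a) n 0) F
      = ContinuousLinearMap.adjoint (insertAt (e a.2) n 0)
        ((band (fun k : Fin (n + 1) → X => ω (k 0)) (hω.comp (measurable_pi_apply 0)) a.1).op _ _
          F) := by
  refine ext_inner_left ℂ fun v => ?_
  rw [ContinuousLinearMap.adjoint_inner_right, ContinuousLinearMap.adjoint_inner_right,
    ← Multiplier.inner_op_left, bandVec, insertAt_op]
  rfl

theorem ae_coord {p : X → Prop} (hp : ∀ᵐ x ∂μ, p x) (n : ℕ) (i : Fin (n + 1)) :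
    ∀ᵐ k ∂powMeasure μ (n + 1), p (k i) :=
  (Measure.quasiMeasurePreserving_fst.comp
    (measurePreserving_removeNth (μ := μ) n i).quasiMeasurePreserving).ae hp

/-- Summation over the basis index at a fixed band is Parseval's identity for the two functions
restricted to that band. -/
theorem hasSum_band_of_hasSum_frame {ω : X → ℝ} (hω : Measurable ω)
    (e : HilbertBasis ι ℂ (Lp ℂ 2 μ)) {n : ℕ} {F G : Lp (Spin d) 2 (powMeasure μ (n + 1))} {s : ℂ}
    (hs : HasSum (fun a => ⟪ContinuousLinearMap.adjoint (insertAt (bandVec ω hω e a) n 0) F,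
      ContinuousLinearMap.adjoint (insertAt (bandVec ω hω e a) n 0) G⟫_ℂ) s) :
    HasSum (fun k =>
      ⟪(band (fun k : Fin (n + 1) → X => ω (k 0)) (hω.comp (measurable_pi_apply 0)) k).op _ _ F,
        (band (fun k : Fin (n + 1) → X => ω (k 0)) (hω.comp (measurable_pi_apply 0)) k).op _ _ G⟫_ℂ)
      s := by
  refine hs.prod_fiberwise fun k => ?_
  simp only [adjoint_insertAt_bandVec]
  exact hasSum_inner_adjoint_insertAt e 0 _ _

/-- The form sense of `∑ₐ |hₐ⟩⟨hₐ| = ω` in the first variable. Summability is a hypothesis because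
`G` need not be in the form domain of `ω(k₀)`; in the applications it comes from membership in
`FormDom`. -/
theorem tsum_frame {ω : X → ℝ} (hω : Measurable ω) (hpos : ∀ᵐ x ∂μ, 0 ≤ ω x)
    (e : HilbertBasis ι ℂ (Lp ℂ 2 μ)) {n : ℕ} {F G H : Lp (Spin d) 2 (powMeasure μ (n + 1))}
    (hH : H =ᵐ[powMeasure μ (n + 1)] fun k => (ω (k 0) : ℂ) • F k)
    (hs : Summable (fun a => ⟪ContinuousLinearMap.adjoint (insertAt (bandVec ω hω e a) n 0) F,
      ContinuousLinearMap.adjoint (insertAt (bandVec ω hω e a) n 0) G⟫_ℂ)) :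
    ∑' a, ⟪ContinuousLinearMap.adjoint (insertAt (bandVec ω hω e a) n 0) F,
      ContinuousLinearMap.adjoint (insertAt (bandVec ω hω e a) n 0) G⟫_ℂ = ⟪H, G⟫_ℂ :=
  eq_inner_of_hasSum_band _ (ae_coord hpos n 0) hH (hasSum_band_of_hasSum_frame hω e hs.hasSum)

theorem norm_sq_le_tsum_frame {ω : X → ℝ} (hω : Measurable ω) {m : ℝ} (hm : 0 ≤ m)
    (hpos : ∀ᵐ x ∂μ, m ≤ ω x) (e : HilbertBasis ι ℂ (Lp ℂ 2 μ)) {n : ℕ}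
    {F : Lp (Spin d) 2 (powMeasure μ (n + 1))} {s : ℝ}
    (hs : HasSum (fun a =>
      ‖ContinuousLinearMap.adjoint (insertAt (bandVec ω hω e a) n 0) F‖ ^ 2) s) :
    m * ‖F‖ ^ 2 ≤ s := by
  refine norm_sq_le_of_hasSum_band (hω.comp (measurable_pi_apply 0)) hm (ae_coord hpos n 0) (F := F) ?_
  have h1 : HasSum (fun a => ⟪ContinuousLinearMap.adjoint (insertAt (bandVec ω hω e a) n 0) F,
      ContinuousLinearMap.adjoint (insertAt (bandVec ω hω e a) n 0) F⟫_ℂ) (s : ℂ) := by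
    simp only [inner_self_eq_ofReal]
    exact Complex.hasSum_ofReal.2 hs
  have h2 := hasSum_band_of_hasSum_frame hω e h1
  simp only [inner_self_eq_ofReal] at h2
  exact Complex.hasSum_ofReal.1 h2

/-- The frame bound in the one boson space. -/
theorem summable_bandVec {ω : X → ℝ} (hω : Measurable ω) (hpos : ∀ᵐ x ∂μ, 0 ≤ ω x)
    (e : HilbertBasis ι ℂ (Lp ℂ 2 μ)) {u v : Lp ℂ 2 μ}
    (hv : v =ᵐ[μ] fun x => (Real.sqrt (ω x) : ℂ) • u x) :
    Summable (fun a => ‖⟪bandVec ω hω e a, u⟫_ℂ‖ ^ 2) ∧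
      ∑' a, ‖⟪bandVec ω hω e a, u⟫_ℂ‖ ^ 2 ≤ ‖v‖ ^ 2 := by
  have h1 : ∀ a, ⟪bandVec ω hω e a, u⟫_ℂ = ⟪e a.2, (band ω hω a.1).op ℂ μ u⟫_ℂ := fun a =>
    Multiplier.inner_op_left _ _ _
  have hle : ∀ s : Finset (ℕ × ι), ∑ a ∈ s, ‖⟪bandVec ω hω e a, u⟫_ℂ‖ ^ 2 ≤ ‖v‖ ^ 2 := by
    classical
    intro s
    -- A finite set of indices lies in a rectangle of bands times basis vectors. Bessel's inequality
    -- handles each band, and the bands are then summed.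
    set R := s.sup Prod.fst + 1
    calc ∑ a ∈ s, ‖⟪bandVec ω hω e a, u⟫_ℂ‖ ^ 2
        ≤ ∑ a ∈ Finset.range R ×ˢ s.image Prod.snd, ‖⟪bandVec ω hω e a, u⟫_ℂ‖ ^ 2 := by
          refine Finset.sum_le_sum_of_subset_of_nonneg (fun a ha => ?_) fun _ _ _ => sq_nonneg _
          rw [Finset.mem_product, Finset.mem_range]
          exact ⟨Nat.lt_succ_of_le (Finset.le_sup (f := Prod.fst) ha),
            Finset.mem_image_of_mem _ ha⟩
      _ = ∑ k ∈ Finset.range R, ∑ l ∈ s.image Prod.snd,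
            ‖⟪e l, (band ω hω k).op ℂ μ u⟫_ℂ‖ ^ 2 := by
          rw [Finset.sum_product]; simp only [h1]
      _ ≤ ∑ k ∈ Finset.range R, ‖(band ω hω k).op ℂ μ u‖ ^ 2 :=
          Finset.sum_le_sum fun k _ => e.orthonormal.sum_inner_products_le _
      _ ≤ ‖v‖ ^ 2 := sum_norm_sq_band_le hω hpos hv R
  have hs := summable_of_sum_le (fun _ => sq_nonneg _) hle
  exact ⟨hs, hs.tsum_le_of_sum_le hle⟩

end Frame

/-! ### Interchange of summations in a Hilbert sum of Hilbert sums -/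

section Interchange

variable {α : Type*} {E : ℕ → Type*} [∀ n, NormedAddCommGroup (E n)]

theorem lp_lp_summable (t : lp (fun _ : α => lp E 2) 2) :
    Summable fun p : ℕ × α => ‖t p.2 p.1‖ ^ 2 := by
  have h : Summable fun p : α × ℕ => ‖t p.1 p.2‖ ^ 2 := by
    rw [summable_prod_of_nonneg (fun _ => sq_nonneg _)]
    refine ⟨fun a => (lp_hasSum_norm_sq (t a)).summable, ?_⟩
    exact (lp_hasSum_norm_sq t).summable.congr fun a => (lp_hasSum_norm_sq (t a)).tsum_eq.symm
  exact h.prod_symm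

theorem lp_lp_summable_apply (t : lp (fun _ : α => lp E 2) 2) (n : ℕ) :
    Summable fun a => ‖t a n‖ ^ 2 :=
  (lp_lp_summable t).comp_injective (i := fun a => (n, a)) fun _ _ h => (Prod.ext_iff.1 h).2

/-- The norms are nonnegative and summable over all pairs, so the sum over `a` and the sum over the
boson number may be interchanged. -/
theorem lp_lp_hasSum (t : lp (fun _ : α => lp E 2) 2) :
    HasSum (fun n => ∑' a, ‖t a n‖ ^ 2) (‖t‖ ^ 2) := by
  have hs := lp_lp_summable t
  have h1 := hs.hasSum.prod_fiberwise fun n => (lp_lp_summable_apply t n).hasSum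
  have h2 : HasSum (fun p : α × ℕ => ‖t p.1 p.2‖ ^ 2) (∑' p : ℕ × α, ‖t p.2 p.1‖ ^ 2) :=
    (Equiv.prodComm ℕ α).hasSum_iff (f := fun p : α × ℕ => ‖t p.1 p.2‖ ^ 2) |>.1 hs.hasSum
  have h3 := h2.prod_fiberwise fun a => lp_hasSum_norm_sq (t a)
  rwa [h3.unique (lp_hasSum_norm_sq t)] at h1

variable [∀ n, InnerProductSpace ℂ (E n)]

theorem lp_lp_summable_inner (s t : lp (fun _ : α => lp E 2) 2) :
    Summable fun p : ℕ × α => ⟪s p.2 p.1, t p.2 p.1⟫_ℂ := by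
  refine Summable.of_norm_bounded ((lp_lp_summable s).add (lp_lp_summable t)) fun p => ?_
  refine (norm_inner_le_norm (𝕜 := ℂ) (s p.2 p.1) (t p.2 p.1)).trans ?_
  nlinarith [sq_nonneg (‖s p.2 p.1‖ - ‖t p.2 p.1‖), sq_nonneg ‖s p.2 p.1‖, sq_nonneg ‖t p.2 p.1‖]

theorem lp_lp_summable_inner_apply (s t : lp (fun _ : α => lp E 2) 2) (n : ℕ) :
    Summable fun a => ⟪s a n, t a n⟫_ℂ :=
  (lp_lp_summable_inner s t).comp_injective (i := fun a => (n, a))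
    fun _ _ h => (Prod.ext_iff.1 h).2

theorem lp_lp_hasSum_inner (s t : lp (fun _ : α => lp E 2) 2) :
    HasSum (fun n => ∑' a, ⟪s a n, t a n⟫_ℂ) (∑' a, ⟪s a, t a⟫_ℂ) := by
  have hs := lp_lp_summable_inner s t
  have h1 := hs.hasSum.prod_fiberwise fun n => (lp_lp_summable_inner_apply s t n).hasSum
  have h2 : HasSum (fun p : α × ℕ => ⟪s p.1 p.2, t p.1 p.2⟫_ℂ)
      (∑' p : ℕ × α, ⟪s p.2 p.1, t p.2 p.1⟫_ℂ) :=
    (Equiv.prodComm ℕ α).hasSum_iff (f := fun p : α × ℕ => ⟪s p.1 p.2, t p.1 p.2⟫_ℂ) |>.1 hs.hasSum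
  have h3 := h2.prod_fiberwise fun a => lp.hasSum_inner (𝕜 := ℂ) (s a) (t a)
  rw [h3.tsum_eq]
  exact h1

end Interchange

/-! ### Number bound on the form domain -/

section NumberBound

variable {X : Type*} [MeasurableSpace X] {μ : Measure X} [SigmaFinite μ] {d N : ℕ} {α ι : Type*}

/-- The vector with `(â(h) Ψ)^(n) = ⟨h, ·⟩`, the scalar product being taken in the first
variable. -/
def frameVec (B : Fin N → Matrix (Fin d) (Fin d) ℂ) (g : Fin N → Lp ℂ 2 μ) (Ψ : Formal μ d) (n : ℕ) :
    Lp (Spin d) 2 (powMeasure μ (n + 1)) :=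
  (Real.sqrt (n + 1) : ℂ) • (Ψ (n + 1) : Lp (Spin d) 2 (powMeasure μ (n + 1)))
    + ∑ j, insertAt (g j) n 0 (matSector (B j) n (Ψ n) : Lp (Spin d) 2 (powMeasure μ n))

/-- `⟨h, gⱼ⟩ Bⱼ Ψ` is the contraction with `h` of `gⱼ ⊗ Bⱼ Ψ`. Thus both parts of `â(h)` contract
one function that does not depend on `h`, to which the frame identities apply. -/
theorem coe_annHat_apply (B : Fin N → Matrix (Fin d) (Fin d) ℂ) (g : Fin N → Lp ℂ 2 μ)
    (h : Lp ℂ 2 μ) (Ψ : Formal μ d) (n : ℕ) :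
    (annHat B g h Ψ n : Lp (Spin d) 2 (powMeasure μ n))
      = ContinuousLinearMap.adjoint (insertAt h n 0) (frameVec B g Ψ n) := by
  rw [annHat_apply, frameVec, map_add, map_smul, map_sum]
  simp only [adjoint_insertAt_insertAt]
  rw [Submodule.coe_add, coe_annSector]
  congr 1
  exact (map_sum (Sector μ d n).subtype _ _)

theorem hasSum_frame_annHat (B : Fin N → Matrix (Fin d) (Fin d) ℂ) (g : Fin N → Lp ℂ 2 μ)
    (h : α → Lp ℂ 2 μ) (Ψ Φ : Formal μ d) (n : ℕ) (a : α) :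
    ⟪annHat B g (h a) Ψ n, annHat B g (h a) Φ n⟫_ℂ
      = ⟪ContinuousLinearMap.adjoint (insertAt (h a) n 0) (frameVec B g Ψ n),
        ContinuousLinearMap.adjoint (insertAt (h a) n 0) (frameVec B g Φ n)⟫_ℂ := by
  rw [← coe_annHat_apply, ← coe_annHat_apply]; rfl

variable {B : Fin N → Matrix (Fin d) (Fin d) ℂ} {M M' : Matrix (Fin d) (Fin d) ℂ}
  {g : Fin N → Lp ℂ 2 μ} {ω : X → ℝ} {hω : Measurable ω} {m : ℝ}

/-- Solve the definition of `frameVec` for the `(n + 1)`-boson component and use `(p + q)² ≤ 2 p² +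
2 q²`. -/
theorem norm_frameVec_ge (Ψ : Formal μ d) (n : ℕ) :
    (n + 1) * ‖Ψ (n + 1)‖ ^ 2 ≤ 2 * ‖frameVec B g Ψ n‖ ^ 2 + 2 * expNorm B g ^ 2 * ‖Ψ n‖ ^ 2 := by
  have h1 : ‖∑ j, insertAt (g j) n 0 (matSector (B j) n (Ψ n) : Lp (Spin d) 2 (powMeasure μ n))‖
      ≤ expNorm B g * ‖Ψ n‖ := by
    unfold expNorm; rw [Finset.sum_mul]
    refine (norm_sum_le _ _).trans (Finset.sum_le_sum fun j _ => ?_)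
    rw [norm_insertAt]
    calc ‖g j‖ * ‖(matSector (B j) n (Ψ n) : Lp (Spin d) 2 (powMeasure μ n))‖
        ≤ ‖g j‖ * (matNorm (B j) * ‖Ψ n‖) :=
          mul_le_mul_of_nonneg_left (norm_matSector_le (B j) n (Ψ n)) (norm_nonneg _)
      _ = matNorm (B j) * ‖g j‖ * ‖Ψ n‖ := by ring
  have h2 : ‖(Real.sqrt (n + 1) : ℂ) • (Ψ (n + 1) : Lp (Spin d) 2 (powMeasure μ (n + 1)))‖
      ≤ ‖frameVec B g Ψ n‖ + expNorm B g * ‖Ψ n‖ := by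
    refine le_trans ?_ (add_le_add_right h1 ‖frameVec B g Ψ n‖)
    have : (Real.sqrt (n + 1) : ℂ) • (Ψ (n + 1) : Lp (Spin d) 2 (powMeasure μ (n + 1)))
      = frameVec B g Ψ n - ∑ j, insertAt (g j) n 0
        (matSector (B j) n (Ψ n) : Lp (Spin d) 2 (powMeasure μ n)) := by
      rw [frameVec, add_sub_cancel_right]
    rw [this]
    exact norm_sub_le _ _
  have h3 : ‖(Real.sqrt (n + 1) : ℂ) • (Ψ (n + 1) : Lp (Spin d) 2 (powMeasure μ (n + 1)))‖ ^ 2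
      = (n + 1) * ‖Ψ (n + 1)‖ ^ 2 := by
    rw [norm_smul, mul_pow, Complex.norm_real, Real.norm_eq_abs, sq_abs,
      Real.sq_sqrt (by positivity)]
    rfl
  rw [← h3]
  have h4 := pow_le_pow_left₀ (norm_nonneg _) h2 2
  nlinarith [sq_nonneg (‖frameVec B g Ψ n‖ - expNorm B g * ‖Ψ n‖)]

/-- The boson number is bounded by the form. -/
theorem sum_number_le (hm : 0 < m) (hpos : ∀ᵐ x ∂μ, m ≤ ω x) (e : HilbertBasis ι ℂ (Lp ℂ 2 μ))
    (x : FormDom B M' (bandVec ω hω e) g) (R : ℕ) :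
    ∑ n ∈ Finset.range R, n * ‖formEmb B M' (bandVec ω hω e) g x n‖ ^ 2
      ≤ (2 / m + 2 * expNorm B g ^ 2 * matNorm M' ^ 2) * ‖x‖ ^ 2 := by
  set Ψ := formEmb B M' (bandVec ω hω e) g x with hΨ
  set t := x.snd
  have h1 : ∀ n, ((n + 1 : ℕ) : ℝ) * ‖Ψ (n + 1)‖ ^ 2
      ≤ 2 / m * (∑' a, ‖t a n‖ ^ 2) + 2 * expNorm B g ^ 2 * ‖Ψ n‖ ^ 2 := fun n => by
    have h2 : m * ‖frameVec B g Ψ n‖ ^ 2 ≤ ∑' a, ‖t a n‖ ^ 2 := by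
      refine norm_sq_le_tsum_frame hω hm.le hpos e ?_
      have h3 := (lp_lp_summable_apply t n).hasSum
      refine h3.congr_fun fun a => ?_
      rw [← coe_annHat_apply, hΨ, ← x.coe_snd]
      rfl
    have h4 := norm_frameVec_ge (B := B) (g := g) Ψ n
    have h5 : ‖frameVec B g Ψ n‖ ^ 2 ≤ 1 / m * ∑' a, ‖t a n‖ ^ 2 := by
      rw [one_div, inv_mul_eq_div, le_div_iff₀ hm, mul_comm]; exact h2
    push_cast
    calc _ ≤ _ := h4
      _ ≤ 2 * (1 / m * ∑' a, ‖t a n‖ ^ 2) + 2 * expNorm B g ^ 2 * ‖Ψ n‖ ^ 2 := by gcongr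
      _ = _ := by ring
  have h6 : ∑ n ∈ Finset.range R, n * ‖Ψ n‖ ^ 2
      ≤ ∑ n ∈ Finset.range R, (2 / m * (∑' a, ‖t a n‖ ^ 2) + 2 * expNorm B g ^ 2 * ‖Ψ n‖ ^ 2) := by
    cases R with
    | zero => simp
    | succ R =>
      rw [Finset.sum_range_succ']
      simp only [Nat.cast_zero, zero_mul, add_zero]
      refine (Finset.sum_le_sum fun n _ => h1 n).trans ?_
      refine Finset.sum_le_sum_of_subset_of_nonneg (Finset.range_subset_range.2 R.le_succ)
        fun n _ _ => ?_
      have : 0 ≤ ∑' a, ‖t a n‖ ^ 2 := tsum_nonneg fun _ => sq_nonneg _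
      positivity
  refine h6.trans ?_
  rw [Finset.sum_add_distrib, ← Finset.mul_sum, ← Finset.mul_sum, add_mul]
  have h7 : ∑ n ∈ Finset.range R, ∑' a, ‖t a n‖ ^ 2 ≤ ‖x‖ ^ 2 :=
    (sum_le_hasSum _ (fun n _ => tsum_nonneg fun _ => sq_nonneg _) (lp_lp_hasSum t)).trans
      (pow_le_pow_left₀ (norm_nonneg _) (x.norm_snd_le) 2)
  have h8 : ∑ n ∈ Finset.range R, ‖Ψ n‖ ^ 2 ≤ (matNorm M' * ‖x‖) ^ 2 :=
    (lp_sum_norm_sq_le Ψ _).trans (pow_le_pow_left₀ (norm_nonneg _) (norm_formEmb_apply_le x) 2)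
  rw [mul_pow] at h8
  refine add_le_add (mul_le_mul_of_nonneg_left h7 (by positivity)) ?_
  rw [mul_assoc (2 * expNorm B g ^ 2)]
  exact mul_le_mul_of_nonneg_left h8 (by positivity)

end NumberBound

/-! ### Transport between form domains, and convergence -/

section Transport

variable {X : Type*} [MeasurableSpace X] {μ : Measure X} [SigmaFinite μ] {d N : ℕ} {α ι : Type*}

/-- The bounded operator `e^{C} r^{n}` on the Fock space. -/
def dressL (B : Fin N → Matrix (Fin d) (Fin d) ℂ) (c : Fin N → Lp ℂ 2 μ) {r : ℝ}
    (hr : r ∈ Set.Ioo (0 : ℝ) 1) : Fock μ d →L[ℂ] Fock μ d :=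
  fockOp (dressPow B c r) (fockBounded_dressPow B c hr)

theorem coe_dressL (B : Fin N → Matrix (Fin d) (Fin d) ℂ) (c : Fin N → Lp ℂ 2 μ) {r : ℝ}
    (hr : r ∈ Set.Ioo (0 : ℝ) 1) (Ψ : Fock μ d) :
    (dressL B c hr Ψ : Formal μ d) = dressPow B c r Ψ := coe_fockOp _ _

theorem norm_dressL_apply_le (B : Fin N → Matrix (Fin d) (Fin d) ℂ) (c : Fin N → Lp ℂ 2 μ) {r : ℝ}
    (hr : r ∈ Set.Ioo (0 : ℝ) 1) (Ψ : Fock μ d) :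
    ‖dressL B c hr Ψ‖ ≤ (1 + dressBound (expNorm B c) r) * ‖Ψ‖ :=
  (fockBounded_dressPow B c hr).norm_le (coe_dressL B c hr Ψ)

/-- The bounded operator `r^{n}` on the Fock space. -/
def numL {r : ℝ} (hr : r ∈ Set.Ioo (0 : ℝ) 1) : Fock μ d →L[ℂ] Fock μ d :=
  fockOp (numPow r) (fockBounded_numPow hr)

theorem coe_numL {r : ℝ} (hr : r ∈ Set.Ioo (0 : ℝ) 1) (Ψ : Fock μ d) :
    (numL hr Ψ : Formal μ d) = numPow r Ψ := coe_fockOp _ _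

theorem norm_numL_apply_le {r : ℝ} (hr : r ∈ Set.Ioo (0 : ℝ) 1) (Ψ : Fock μ d) :
    ‖numL hr Ψ‖ ≤ ‖Ψ‖ := by
  simpa using (fockBounded_numPow hr).norm_le (coe_numL hr Ψ)

theorem norm_dressL_sub_numL_le (B : Fin N → Matrix (Fin d) (Fin d) ℂ) (c : Fin N → Lp ℂ 2 μ)
    {r : ℝ} (hr : r ∈ Set.Ioo (0 : ℝ) 1) (Ψ : Fock μ d) :
    ‖dressL B c hr Ψ - numL hr Ψ‖ ≤ dressBound (expNorm B c) r * ‖Ψ‖ := by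
  refine (fockBounded_dressPow_sub B c hr).norm_le ?_
  have : ((dressL B c hr Ψ - numL hr Ψ : Fock μ d) : Formal μ d)
      = (dressL B c hr Ψ : Formal μ d) - (numL hr Ψ : Formal μ d) := rfl
  rw [this, coe_dressL, coe_numL]; rfl

theorem matL_numL {r : ℝ} (hr : r ∈ Set.Ioo (0 : ℝ) 1) (M : Matrix (Fin d) (Fin d) ℂ)
    (Ψ : Fock μ d) : matL M (numL hr Ψ) = numL hr (matL M Ψ) := by
  refine lp.ext ?_
  rw [coe_matL, coe_numL, coe_numL, coe_matL, mat_numPow]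

variable {B : Fin N → Matrix (Fin d) (Fin d) ℂ} {M M' : Matrix (Fin d) (Fin d) ℂ}
  {h : α → Lp ℂ 2 μ}

/-- The dressing maps one form domain into another one. -/
theorem exists_transport (hB : ∀ j j', Commute (B j) (B j')) (hM' : M' * M = 1)
    (g g' : Fin N → Lp ℂ 2 μ) {r : ℝ} (hr : r ∈ Set.Ioo (0 : ℝ) 1) (x : FormDom B M' h g) :
    ∃ y : FormDom B M' h g',
      formEmb B M' h g' y = dressL B (g' - (r : ℂ) • g) hr (formEmb B M' h g x) ∧
      y.fst = matL M (dressL B (g' - (r : ℂ) • g) hr (formEmb B M' h g x)) ∧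
      ∀ a, y.snd a = (r : ℂ) • dressL B (g' - (r : ℂ) • g) hr (x.snd a) := by
  set U := dressL B (g' - (r : ℂ) • g) hr with hU
  have ht : ∀ a, (((r : ℂ) • U (x.snd a) : Fock μ d) : Formal μ d)
      = annHat B g' (h a) (U (formEmb B M' h g x) : Fock μ d) := fun a => by
    change (r : ℂ) • (U (x.snd a) : Formal μ d) = _
    rw [hU, coe_dressL, coe_dressL, annHat_dressPow hB, x.coe_snd]
  have hs : Summable fun a => ‖((r : ℂ) • U (x.snd a) : Fock μ d)‖ ^ 2 := by
    refine Summable.of_nonneg_of_le (fun _ => sq_nonneg _) (fun a => ?_)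
      ((lp_hasSum_norm_sq x.snd).summable.mul_left (‖U‖ ^ 2))
    rw [norm_smul, Complex.norm_real, Real.norm_eq_abs, abs_of_pos hr.1, ← mul_pow]
    refine pow_le_pow_left₀ (mul_nonneg hr.1.le (norm_nonneg _)) ?_ 2
    exact (mul_le_of_le_one_left (norm_nonneg _) hr.2.le).trans (U.le_opNorm _)
  exact exists_formDom_of_summable hM' _ ht hs

/-- `M` commutes with `r^N` but in general not with the dressing. Hence the first component is split
as `M (U - r^N) Ψ + r^N M Ψ`, which costs the factor `‖M‖ ‖M'‖`. The second component only needs `‖r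
U‖ ≤ 1 + δ`. -/
theorem norm_transport_le (hM : M * M' = 1) {g g' : Fin N → Lp ℂ 2 μ} {r : ℝ}
    (hr : r ∈ Set.Ioo (0 : ℝ) 1) {x : FormDom B M' h g} {y : FormDom B M' h g'}
    (h1 : y.fst = matL M (dressL B (g' - (r : ℂ) • g) hr (formEmb B M' h g x)))
    (h2 : ∀ a, y.snd a = (r : ℂ) • dressL B (g' - (r : ℂ) • g) hr (x.snd a)) :
    ‖y‖ ≤ (1 + dressBound (expNorm B (g' - (r : ℂ) • g)) r * (1 + matNorm M * matNorm M')) * ‖x‖ := by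
  set U := dressL B (g' - (r : ℂ) • g) hr with hU
  set δ := dressBound (expNorm B (g' - (r : ℂ) • g)) r with hδ
  have hδ0 : 0 ≤ δ := dressBound_nonneg _ _
  have hM0 := matNorm_nonneg M
  have hM0' := matNorm_nonneg M'
  set Ψ := formEmb B M' h g x with hΨ
  set A := 1 + δ * (1 + matNorm M * matNorm M')
  have hA : 0 ≤ A := by positivity
  have hΨn : ‖Ψ‖ ≤ matNorm M' * ‖x.fst‖ := by
    rw [hΨ, formEmb_apply]; exact norm_matL_le _ _
  have hfst : ‖y.fst‖ ≤ A * ‖x.fst‖ := by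
    have e1 : y.fst = matL M (U Ψ - numL hr Ψ) + numL hr x.fst := by
      rw [h1, x.fst_eq hM, ← matL_numL, map_sub]; abel
    rw [e1]
    calc _ ≤ ‖matL M (U Ψ - numL hr Ψ)‖ + ‖numL hr x.fst‖ := norm_add_le _ _
      _ ≤ matNorm M * (δ * (matNorm M' * ‖x.fst‖)) + ‖x.fst‖ := by
        refine add_le_add ((norm_matL_le _ _).trans ?_) (norm_numL_apply_le hr _)
        refine mul_le_mul_of_nonneg_left ((norm_dressL_sub_numL_le _ _ hr Ψ).trans ?_) hM0
        exact mul_le_mul_of_nonneg_left hΨn hδ0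
      _ ≤ A * ‖x.fst‖ := by
        have : A * ‖x.fst‖ = matNorm M * (δ * (matNorm M' * ‖x.fst‖)) + ‖x.fst‖
          + δ * ‖x.fst‖ := by simp only [A]; ring
        rw [this]
        have : 0 ≤ δ * ‖x.fst‖ := by positivity
        linarith
  have hsnd : ‖y.snd‖ ≤ A * ‖x.snd‖ := by
    refine lp_norm_le_of_sum_le _ (by positivity) fun s => ?_
    calc ∑ a ∈ s, ‖y.snd a‖ ^ 2 ≤ ∑ a ∈ s, A ^ 2 * ‖x.snd a‖ ^ 2 := by
          refine Finset.sum_le_sum fun a _ => ?_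
          rw [← mul_pow]
          refine pow_le_pow_left₀ (norm_nonneg _) ?_ 2
          rw [h2, norm_smul, Complex.norm_real, Real.norm_eq_abs, abs_of_pos hr.1]
          refine (mul_le_of_le_one_left (norm_nonneg _) hr.2.le).trans ?_
          refine (norm_dressL_apply_le _ _ hr _).trans ?_
          refine mul_le_mul_of_nonneg_right ?_ (norm_nonneg _)
          have : 0 ≤ δ * (matNorm M * matNorm M') := by positivity
          simp only [A]; linarith
      _ ≤ (A * ‖x.snd‖) ^ 2 := by
          rw [← Finset.mul_sum, mul_pow]
          exact mul_le_mul_of_nonneg_left (lp_sum_norm_sq_le _ _) (sq_nonneg _)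
  refine (sq_le_sq₀ (norm_nonneg _) (by positivity)).1 ?_
  rw [y.norm_sq, mul_pow, x.norm_sq, mul_add, ← mul_pow, ← mul_pow]
  exact add_le_add (pow_le_pow_left₀ (norm_nonneg _) hfst 2)
    (pow_le_pow_left₀ (norm_nonneg _) hsnd 2)

/-- Since `0 ≤ 1 - (1 - s)^n ≤ 1`, its square is at most itself, hence at most `s n` by Bernoulli's
inequality. -/
theorem norm_numL_sub_le {s : ℝ} (hr : 1 - s ∈ Set.Ioo (0 : ℝ) 1) {Ψ : Fock μ d} {C : ℝ}
    (hC : 0 ≤ C) (h : ∀ R, ∑ n ∈ Finset.range R, n * ‖Ψ n‖ ^ 2 ≤ C ^ 2) :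
    ‖numL hr Ψ - Ψ‖ ≤ Real.sqrt s * C := by
  have hs0 : 0 ≤ s := by linarith [hr.2]
  refine lp_norm_le_of_sum_le _ (by positivity) fun S => ?_
  rw [mul_pow, Real.sq_sqrt hs0]
  obtain ⟨R, hR⟩ : ∃ R, S ⊆ Finset.range R := S.exists_nat_subset_range
  refine (Finset.sum_le_sum_of_subset_of_nonneg hR fun _ _ _ => sq_nonneg _).trans ?_
  refine le_trans ?_ (mul_le_mul_of_nonneg_left (h R) hs0)
  rw [Finset.mul_sum]
  refine Finset.sum_le_sum fun n _ => ?_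
  have e1 : (numL hr Ψ - Ψ : Fock μ d) n = (((1 - s : ℝ) : ℂ) ^ n - 1) • Ψ n := by
    have : (numL hr Ψ - Ψ : Fock μ d) n = (numL hr Ψ : Formal μ d) n - Ψ n := rfl
    rw [this, coe_numL, numPow_apply, sub_smul, one_smul]
  have e2 : ‖(((1 - s : ℝ) : ℂ) ^ n - 1)‖ = 1 - (1 - s) ^ n := by
    rw [← Complex.ofReal_pow, ← Complex.ofReal_one, ← Complex.ofReal_sub, Complex.norm_real,
      Real.norm_eq_abs, abs_sub_comm, abs_of_nonneg]
    linarith [pow_le_one₀ (n := n) hr.1.le hr.2.le]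
  rw [e1, sector_norm_smul, e2, mul_pow, ← mul_assoc]
  refine mul_le_mul_of_nonneg_right ?_ (sq_nonneg _)
  have e3 : 1 - (1 - s) ^ n ≤ s * n := by
    have := one_add_mul_le_pow (a := -s) (by linarith [hr.1]) n
    rw [← sub_eq_add_neg] at this
    linarith
  have e4 : 0 ≤ (1 - s) ^ n := pow_nonneg hr.1.le n
  have e5 : (1 - s) ^ n ≤ 1 := pow_le_one₀ hr.1.le hr.2.le
  nlinarith

/-- For `s ≤ 1/2` the prefactor `(1 - s)⁻²` is at most `4`, and `1 - (1 - s)² = 2 s - s² ≥ s`. So `σ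
= O(s)` makes the exponent `O(s)`. -/
theorem dressBound_le {σ κ s : ℝ} (hs : 0 < s) (hs' : s ≤ 1 / 2) (hσ : 0 ≤ σ) (hσκ : σ ≤ s * κ) :
    dressBound σ (1 - s) ≤ Real.sqrt (4 * (Real.exp (s * κ ^ 2) - 1)) := by
  unfold dressBound
  refine Real.sqrt_le_sqrt ?_
  have h1 : (1 - s)⁻¹ ^ 2 ≤ 4 := by
    have : (1 - s)⁻¹ ≤ 2 := by
      rw [inv_le_comm₀ (by linarith) (by norm_num)]; linarith
    have h0 : 0 ≤ (1 - s)⁻¹ := inv_nonneg.2 (by linarith)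
    nlinarith
  have h3 : s ≤ 1 - (1 - s) ^ 2 := by nlinarith
  have h2 : σ ^ 2 / (1 - (1 - s) ^ 2) ≤ s * κ ^ 2 := by
    rw [div_le_iff₀ (by linarith)]
    calc σ ^ 2 ≤ (s * κ) ^ 2 := pow_le_pow_left₀ hσ hσκ 2
      _ = s * κ ^ 2 * s := by ring
      _ ≤ _ := mul_le_mul_of_nonneg_left h3 (by positivity)
  have h4 : 0 ≤ Real.exp (σ ^ 2 / (1 - (1 - s) ^ 2)) - 1 := by
    have : 0 ≤ σ ^ 2 / (1 - (1 - s) ^ 2) := div_nonneg (sq_nonneg _) (by linarith)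
    linarith [Real.one_le_exp this]
  exact mul_le_mul h1 (by linarith [Real.exp_le_exp.2 h2]) h4 (by norm_num)

variable {ω : X → ℝ} {hω : Measurable ω} {m : ℝ}

/-- From `g' - (1 - s) g = (g' - g) + s g`: taking `1 - r` of the same order as `‖g' - g‖` makes the
exponent in the transport of order `s`. -/
theorem expNorm_sub_smul_le (B : Fin N → Matrix (Fin d) (Fin d) ℂ) (g g' : Fin N → Lp ℂ 2 μ) {s : ℝ}
    (hs : 0 ≤ s) (hg : ∀ j, ‖g' j - g j‖ ≤ s) {κ : ℝ} (hκ : ∑ j, matNorm (B j) * (1 + ‖g j‖) ≤ κ) :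
    expNorm B (g' - ((1 - s : ℝ) : ℂ) • g) ≤ s * κ := by
  refine le_trans ?_ (mul_le_mul_of_nonneg_left hκ hs)
  rw [expNorm, Finset.mul_sum]
  refine Finset.sum_le_sum fun j _ => ?_
  have h1 : (g' - ((1 - s : ℝ) : ℂ) • g) j = (g' j - g j) + (s : ℂ) • g j := by
    rw [Pi.sub_apply, Pi.smul_apply, Complex.ofReal_sub, Complex.ofReal_one, sub_smul, one_smul]
    abel
  have h2 : ‖(g' - ((1 - s : ℝ) : ℂ) • g) j‖ ≤ s * (1 + ‖g j‖) := by
    rw [h1]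
    refine (norm_add_le _ _).trans ?_
    rw [norm_smul, Complex.norm_real, Real.norm_eq_abs, abs_of_nonneg hs, mul_add, mul_one]
    exact add_le_add_left (hg j) _
  calc _ ≤ matNorm (B j) * (s * (1 + ‖g j‖)) := mul_le_mul_of_nonneg_left h2 (matNorm_nonneg _)
    _ = _ := by ring

/-- The error in the comparison of two form domains. -/
def transportError (M M' : Matrix (Fin d) (Fin d) ℂ) (m κ s : ℝ) : ℝ :=
  Real.sqrt (4 * (Real.exp (s * κ ^ 2) - 1)) * (1 + matNorm M * matNorm M' + matNorm M')
    + Real.sqrt s * Real.sqrt (2 / m + 2 * κ ^ 2 * matNorm M' ^ 2)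

theorem transportError_nonneg (M M' : Matrix (Fin d) (Fin d) ℂ) (m κ s : ℝ) :
    0 ≤ transportError M M' m κ s := by
  have h1 := matNorm_nonneg M
  have h2 := matNorm_nonneg M'
  unfold transportError; positivity

theorem tendsto_transportError (M M' : Matrix (Fin d) (Fin d) ℂ) (m κ : ℝ) :
    Tendsto (transportError M M' m κ) (𝓝 0) (𝓝 0) := by
  have : Continuous (transportError M M' m κ) := by unfold transportError; fun_prop
  have h := this.tendsto 0
  simpa [transportError] using h

theorem exists_close (hB : ∀ j j', Commute (B j) (B j')) (hM : M * M' = 1) (hM' : M' * M = 1)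
    (hm : 0 < m) (hpos : ∀ᵐ x ∂μ, m ≤ ω x) (e : HilbertBasis ι ℂ (Lp ℂ 2 μ))
    (g g' : Fin N → Lp ℂ 2 μ) {s κ : ℝ} (hs : 0 < s) (hs' : s ≤ 1 / 2)
    (hg : ∀ j, ‖g' j - g j‖ ≤ s) (hκ : ∑ j, matNorm (B j) * (1 + ‖g j‖) ≤ κ)
    (x : FormDom B M' (bandVec ω hω e) g) :
    ∃ y : FormDom B M' (bandVec ω hω e) g', ‖y‖ ≤ (1 + transportError M M' m κ s) * ‖x‖ ∧
      ‖formEmb B M' (bandVec ω hω e) g x - formEmb B M' (bandVec ω hω e) g' y‖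
        ≤ transportError M M' m κ s * ‖x‖ := by
  have hr : 1 - s ∈ Set.Ioo (0 : ℝ) 1 := ⟨by linarith, by linarith⟩
  obtain ⟨y, h1, h2, h3⟩ := exists_transport hB hM' g g' hr x
  set c := g' - ((1 - s : ℝ) : ℂ) • g
  set δ := dressBound (expNorm B c) (1 - s)
  set δ' := Real.sqrt (4 * (Real.exp (s * κ ^ 2) - 1))
  have hδ : δ ≤ δ' := dressBound_le hs hs' (expNorm_nonneg _ _) (expNorm_sub_smul_le B g g' hs.le hg hκ)
  have hM0 := matNorm_nonneg M
  have hM0' := matNorm_nonneg M'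
  have hδ0 : 0 ≤ δ' := Real.sqrt_nonneg _
  have hκg : expNorm B g ≤ κ := by
    unfold expNorm
    refine le_trans (Finset.sum_le_sum fun j _ => ?_) hκ
    exact mul_le_mul_of_nonneg_left (by linarith) (matNorm_nonneg _)
  set D := Real.sqrt (2 / m + 2 * κ ^ 2 * matNorm M' ^ 2)
  have hD : 0 ≤ D := Real.sqrt_nonneg _
  refine ⟨y, (norm_transport_le hM hr h2 h3).trans
    (mul_le_mul_of_nonneg_right ?_ (norm_nonneg _)), ?_⟩
  · have e1 : δ * (1 + matNorm M * matNorm M') ≤ δ' * (1 + matNorm M * matNorm M') :=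
      mul_le_mul_of_nonneg_right hδ (by positivity)
    have e2 : 0 ≤ δ' * matNorm M' + Real.sqrt s * D := by positivity
    have e3 : transportError M M' m κ s
      = δ' * (1 + matNorm M * matNorm M') + (δ' * matNorm M' + Real.sqrt s * D) := by
      simp only [transportError, δ', D]; ring
    rw [e3]; linarith
  · set Ψ := formEmb B M' (bandVec ω hω e) g x with hΨ
    have hn : ‖numL hr Ψ - Ψ‖ ≤ Real.sqrt s * (D * ‖x‖) := by
      refine norm_numL_sub_le hr (by positivity) fun R => ?_
      refine (sum_number_le hm hpos e x R).trans ?_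
      rw [mul_pow, Real.sq_sqrt (by positivity)]
      refine mul_le_mul_of_nonneg_right ?_ (sq_nonneg _)
      have := pow_le_pow_left₀ (expNorm_nonneg B g) hκg 2
      gcongr
    have hd : ‖dressL B c hr Ψ - numL hr Ψ‖ ≤ δ' * (matNorm M' * ‖x‖) :=
      (norm_dressL_sub_numL_le B c hr Ψ).trans
        (mul_le_mul hδ (norm_formEmb_apply_le x) (norm_nonneg _) hδ0)
    rw [h1, norm_sub_rev]
    calc _ = ‖(dressL B c hr Ψ - numL hr Ψ) + (numL hr Ψ - Ψ)‖ := by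
          rw [sub_add_sub_cancel]
      _ ≤ δ' * (matNorm M' * ‖x‖) + Real.sqrt s * (D * ‖x‖) := (norm_add_le _ _).trans (add_le_add hd hn)
      _ = (transportError M M' m κ s - δ' * (1 + matNorm M * matNorm M')) * ‖x‖ := by
          simp only [transportError, δ', D]; ring
      _ ≤ _ := by
          refine mul_le_mul_of_nonneg_right ?_ (norm_nonneg _)
          have : 0 ≤ δ' * (1 + matNorm M * matNorm M') := by positivity
          linarith

/-- The resolvents depend continuously, in operator norm, on the form factors divided by `ω`. -/
theorem tendsto_formResolvent (hB : ∀ j j', Commute (B j) (B j')) (hM : M * M' = 1)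
    (hM' : M' * M = 1) (hm : 0 < m) (hpos : ∀ᵐ x ∂μ, m ≤ ω x) (e : HilbertBasis ι ℂ (Lp ℂ 2 μ))
    {g : Fin N → Lp ℂ 2 μ} {gΛ : ℕ → Fin N → Lp ℂ 2 μ}
    (hg : ∀ j, Tendsto (fun Λ => gΛ Λ j) atTop (𝓝 (g j))) :
    Tendsto (fun Λ => formResolvent (formEmb B M' (bandVec ω hω e) (gΛ Λ))) atTop
      (𝓝 (formResolvent (formEmb B M' (bandVec ω hω e) g))) := by
  set P := matNorm M'
  -- The extra `1` lets the same `κ` serve for `gΛ`, whose distance from `g` will be at most `1/2`,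
  -- so that transport is controlled in both directions.
  set κ := ∑ j, matNorm (B j) * (1 + (‖g j‖ + 1)) with hκ
  rw [tendsto_iff_norm_sub_tendsto_zero]
  have hlim : Tendsto (fun s => 2 * P * (P + 1) * transportError M M' m κ s) (𝓝[>] 0) (𝓝 0) := by
    have := ((tendsto_transportError M M' m κ).const_mul (2 * P * (P + 1)))
    rw [mul_zero] at this
    exact this.mono_left nhdsWithin_le_nhds
  rw [Metric.tendsto_atTop']
  intro ε hε
  have h1 : ∀ᶠ s in 𝓝[>] (0 : ℝ), 2 * P * (P + 1) * transportError M M' m κ s < ε :=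
    hlim.eventually (gt_mem_nhds hε)
  have h2 : ∀ᶠ s in 𝓝[>] (0 : ℝ), s ≤ 1 / 2 ∧ 0 < s := by
    filter_upwards [nhdsWithin_le_nhds (Iic_mem_nhds (show (0 : ℝ) < 1 / 2 by norm_num)),
      self_mem_nhdsWithin] with s h h' using ⟨h, h'⟩
  -- First `s` is fixed so that the error is below `ε`; only then is the cut-off taken large enough
  -- for the form factors to be `s`-close.
  obtain ⟨s, h3, h4, h5⟩ := (h1.and h2).exists
  have h6 : ∀ᶠ Λ in atTop, ∀ j, ‖gΛ Λ j - g j‖ ≤ s := by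
    rw [eventually_all]
    intro j
    have := (tendsto_iff_norm_sub_tendsto_zero.1 (hg j)).eventually (gt_mem_nhds h5)
    exact this.mono fun _ h => le_of_lt h
  obtain ⟨n, hn⟩ := eventually_atTop.1 h6
  refine ⟨n, fun Λ hΛ => ?_⟩
  have h7 := hn Λ hΛ.le
  rw [dist_zero_right, norm_norm]
  refine lt_of_le_of_lt ?_ h3
  refine norm_formResolvent_sub_le (transportError_nonneg _ _ _ _ _) norm_formEmb_le norm_formEmb_le
    (fun x => ?_) (fun y => ?_)
  · refine exists_close hB hM hM' hm hpos e _ _ h5 h4 (fun j => ?_) ?_ x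
    · rw [norm_sub_rev]; exact h7 j
    · refine Finset.sum_le_sum fun j _ => mul_le_mul_of_nonneg_left ?_ (matNorm_nonneg _)
      have : ‖gΛ Λ j‖ ≤ ‖gΛ Λ j - g j‖ + ‖g j‖ := norm_le_norm_sub_add _ _
      linarith [h7 j]
  · refine exists_close hB hM hM' hm hpos e _ _ h5 h4 h7 ?_ y
    exact Finset.sum_le_sum fun j _ => mul_le_mul_of_nonneg_left (by linarith) (matNorm_nonneg _)

end Transport

/-! ### Vectors with a fixed number of bosons -/

section Singles

variable {X : Type*} [MeasurableSpace X] {μ : Measure X} [SigmaFinite μ] {d N : ℕ} {α ι : Type*}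

/-- A vector with exactly `n` bosons. -/
def fockSingle (n : ℕ) (φ : Sector μ d n) : Fock μ d := lp.single 2 n φ

theorem coe_fockSingle (n : ℕ) (φ : Sector μ d n) :
    (fockSingle n φ : Formal μ d) = Pi.single n φ := lp.coeFn_single _ _ _

theorem norm_fockSingle (n : ℕ) (φ : Sector μ d n) : ‖fockSingle n φ‖ = ‖φ‖ := by
  unfold fockSingle
  exact lp.norm_single (E := fun n => Sector μ d n) (p := 2) (by simp) n φ

theorem inner_fockSingle_left (n : ℕ) (φ : Sector μ d n) (Ψ : Fock μ d) :
    ⟪fockSingle n φ, Ψ⟫_ℂ = ⟪φ, Ψ n⟫_ℂ := by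
  unfold fockSingle
  exact lp.inner_single_left (G := fun n => Sector μ d n) (𝕜 := ℂ) n φ Ψ

theorem fockSingle_add (n : ℕ) (φ φ' : Sector μ d n) :
    fockSingle n (φ + φ') = fockSingle n φ + fockSingle n φ' := by
  refine lp.ext ?_
  change (fockSingle n (φ + φ') : Formal μ d)
    = (fockSingle n φ : Formal μ d) + (fockSingle n φ' : Formal μ d)
  rw [coe_fockSingle, coe_fockSingle, coe_fockSingle, Pi.single_add]

theorem fockSingle_smul (n : ℕ) (c : ℂ) (φ : Sector μ d n) :
    fockSingle n (c • φ) = c • fockSingle n φ := by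
  refine lp.ext ?_
  change (fockSingle n (c • φ) : Formal μ d) = c • (fockSingle n φ : Formal μ d)
  rw [coe_fockSingle, coe_fockSingle, Pi.single_smul]

theorem cre_single (u : Lp ℂ 2 μ) (n : ℕ) (φ : Sector μ d n) :
    cre u (Pi.single n φ : Formal μ d) = Pi.single (n + 1) (creSector u n φ) := by
  funext k
  cases k with
  | zero => rw [cre_apply_zero, Pi.single_eq_of_ne (by omega)]
  | succ k =>
    rw [cre_apply_succ]
    by_cases h : k = n
    · subst h; rw [Pi.single_eq_same, Pi.single_eq_same]
    · rw [Pi.single_eq_of_ne h, Pi.single_eq_of_ne (by omega), map_zero]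

theorem ann_single_zero (h : Lp ℂ 2 μ) (φ : Sector μ d 0) :
    ann h (Pi.single 0 φ : Formal μ d) = 0 := by
  funext k
  rw [ann_apply, Pi.single_eq_of_ne (by omega), map_zero]; rfl

theorem ann_single_succ (h : Lp ℂ 2 μ) (n : ℕ) (φ : Sector μ d (n + 1)) :
    ann h (Pi.single (n + 1) φ : Formal μ d) = Pi.single n (annSector h n φ) := by
  funext k
  rw [ann_apply]
  by_cases h : k = n
  · subst h; rw [Pi.single_eq_same, Pi.single_eq_same]
  · rw [Pi.single_eq_of_ne h, Pi.single_eq_of_ne (by omega), map_zero]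

/-- The vector `a(h) φ` for a vector `φ` with exactly `n` bosons. -/
def annSingle (h : Lp ℂ 2 μ) : ∀ n, Sector μ d n → Fock μ d
  | 0, _ => 0
  | n + 1, φ => fockSingle n (annSector h n φ)

theorem coe_annSingle (h : Lp ℂ 2 μ) (n : ℕ) (φ : Sector μ d n) :
    (annSingle h n φ : Formal μ d) = ann h (fockSingle n φ : Fock μ d) := by
  rw [coe_fockSingle]
  cases n with
  | zero => rw [ann_single_zero]; rfl
  | succ n => rw [ann_single_succ]; exact coe_fockSingle _ _

theorem creSector_comm (f f' : Lp ℂ 2 μ) (n : ℕ) (ψ : Sector μ d n) :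
    creSector f (n + 1) (creSector f' n ψ) = creSector f' (n + 1) (creSector f n ψ) := by
  have h := congrFun (cre_comm f f' (Pi.single n ψ : Formal μ d)) (n + 1 + 1)
  simp only [cre_single, Pi.single_eq_same] at h
  exact h

/-- The commutation relations write `a(h) a^*(u) ψ` as `⟨h, u⟩ ψ + a^*(u) a(h) ψ`. Here `a(h) ψ` has
`n - 1` bosons, so `a^*(u)` costs only `√n`. -/
theorem norm_annSingle_creSector_le (h u : Lp ℂ 2 μ) (n : ℕ) (ψ : Sector μ d n) :
    ‖annSingle h (n + 1) (creSector u n ψ)‖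
      ≤ ‖⟪h, u⟫_ℂ‖ * ‖ψ‖ + Real.sqrt n * ‖u‖ * ‖annSingle h n ψ‖ := by
  have h1 : annSingle h (n + 1) (creSector u n ψ)
      = fockSingle n (annSector h n (creSector u n ψ)) := rfl
  have h2 := congrFun (ann_cre h u (Pi.single n ψ : Formal μ d)) n
  rw [cre_single, ann_single_succ, Pi.single_eq_same, Pi.add_apply, Pi.smul_apply,
    Pi.single_eq_same] at h2
  rw [h1, norm_fockSingle, h2]
  refine (norm_add_le _ _).trans (add_le_add (sector_norm_smul _ _).le ?_)
  cases n with
  | zero =>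
    rw [cre_apply_zero, norm_zero]
    positivity
  | succ n =>
    rw [ann_single_succ, cre_apply_succ, Pi.single_eq_same]
    refine (norm_creSector_le u n _).trans (le_of_eq ?_)
    have h3 : annSingle h (n + 1) ψ = fockSingle n (annSector h n ψ) := rfl
    rw [h3, norm_fockSingle]
    push_cast; rfl

/-- The vectors `a^*(u₁) ⋯ a^*(uₙ) v` with all `uᵢ ∈ U`. -/
def prodSet (U : Set (Lp ℂ 2 μ)) : ∀ n, Set (Sector μ d n)
  | 0 => Set.univ
  | n + 1 => {φ | ∃ u ∈ U, ∃ ψ ∈ prodSet U n, φ = creSector u n ψ}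

theorem prodSet_mono {U V : Set (Lp ℂ 2 μ)} (h : U ⊆ V) (n : ℕ) :
    prodSet (d := d) U n ⊆ prodSet V n := by
  induction n with
  | zero => exact fun _ _ => trivial
  | succ n ih =>
    rintro φ ⟨u, hu, ψ, hψ, rfl⟩
    exact ⟨u, h hu, ψ, ih hψ, rfl⟩

/-- Products of one boson vectors are total. -/
theorem eq_zero_of_inner_prodSet {n : ℕ} {η : Sector μ d n}
    (h : ∀ φ ∈ prodSet (Set.univ : Set (Lp ℂ 2 μ)) n, ⟪φ, η⟫_ℂ = 0) : η = 0 := by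
  induction n with
  | zero => exact inner_self_eq_zero.1 (h η trivial)
  | succ n ih =>
    refine eq_zero_of_annSector fun u => ih fun ψ hψ => ?_
    rw [annSector, ContinuousLinearMap.adjoint_inner_right]
    exact h _ ⟨u, trivial, ψ, hψ, rfl⟩

/-- The vectors `a^*(u₁) ⋯ a^*(uₙ) v`, where the first `k` factors are in `U` and all others
in `V`. -/
def mixedSet (U V : Set (Lp ℂ 2 μ)) : ℕ → ∀ n, Set (Sector μ d n)
  | 0, n => prodSet V n
  | _ + 1, 0 => Set.univ
  | k + 1, n + 1 => {φ | ∃ u ∈ U, ∃ ψ ∈ mixedSet U V k n, φ = creSector u n ψ}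

theorem mem_mixedSet_zero (U V : Set (Lp ℂ 2 μ)) (k : ℕ) (φ : Sector μ d 0) :
    φ ∈ mixedSet U V k 0 := by
  cases k <;> trivial

/-- Creation operators commute, so a factor from `V` can be moved past the leading factors from `U`.
This allows one factor at a time to be changed. -/
theorem creSector_mem_mixedSet {U V : Set (Lp ℂ 2 μ)} (hVU : V ⊆ U) {v : Lp ℂ 2 μ} (hv : v ∈ V)
    {k n : ℕ} {ψ : Sector μ d n} (hψ : ψ ∈ mixedSet U V k n) :
    creSector v n ψ ∈ mixedSet U V k (n + 1) := by
  induction k generalizing n with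
  | zero => exact ⟨v, hv, ψ, hψ, rfl⟩
  | succ k ih =>
    cases n with
    | zero => exact ⟨v, hVU hv, ψ, mem_mixedSet_zero _ _ _ _, rfl⟩
    | succ n =>
      obtain ⟨u, hu, ψ', hψ', rfl⟩ := hψ
      exact ⟨u, hu, _, ih hψ', creSector_comm _ _ _ _⟩

theorem prodSet_subset_mixedSet (U V : Set (Lp ℂ 2 μ)) (n : ℕ) :
    prodSet (d := d) U n ⊆ mixedSet U V n n := by
  induction n with
  | zero => exact fun φ _ => mem_mixedSet_zero _ _ _ _
  | succ n ih =>
    rintro φ ⟨u, hu, ψ, hψ, rfl⟩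
    exact ⟨u, hu, ψ, ih hψ, rfl⟩

theorem mixedSet_subset_prodSet {U V : Set (Lp ℂ 2 μ)} (hVU : V ⊆ U) (k n : ℕ) :
    mixedSet (d := d) U V k n ⊆ prodSet U n := by
  induction k generalizing n with
  | zero => exact prodSet_mono hVU n
  | succ k ih =>
    cases n with
    | zero => exact fun _ _ => trivial
    | succ n =>
      rintro φ ⟨u, hu, ψ, hψ, rfl⟩
      exact ⟨u, hu, ψ, ih n hψ, rfl⟩

/-! ### Vectors with a fixed number of bosons in the form domain -/

/-- A vector with exactly `n` bosons lies in the form domain of `∑ₐ a(hₐ)^* a(hₐ)`. -/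
def InForm (h : α → Lp ℂ 2 μ) (n : ℕ) (φ : Sector μ d n) : Prop :=
  Summable fun a => ‖annSingle (h a) n φ‖ ^ 2

theorem inForm_creSector {h : α → Lp ℂ 2 μ} {n : ℕ} {ψ : Sector μ d n} (hψ : InForm h n ψ)
    {u : Lp ℂ 2 μ} (hu : Summable fun a => ‖⟪h a, u⟫_ℂ‖ ^ 2) :
    InForm h (n + 1) (creSector u n ψ) ∧
      ∑' a, ‖annSingle (h a) (n + 1) (creSector u n ψ)‖ ^ 2
        ≤ 2 * ‖ψ‖ ^ 2 * ∑' a, ‖⟪h a, u⟫_ℂ‖ ^ 2 + 2 * n * ‖u‖ ^ 2 * ∑' a, ‖annSingle (h a) n ψ‖ ^ 2 := by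
  have hle : ∀ a, ‖annSingle (h a) (n + 1) (creSector u n ψ)‖ ^ 2
      ≤ 2 * ‖ψ‖ ^ 2 * ‖⟪h a, u⟫_ℂ‖ ^ 2 + 2 * n * ‖u‖ ^ 2 * ‖annSingle (h a) n ψ‖ ^ 2 := fun a => by
    refine (pow_le_pow_left₀ (norm_nonneg _) (norm_annSingle_creSector_le (h a) u n ψ) 2).trans ?_
    have hn : Real.sqrt n ^ 2 = n := Real.sq_sqrt n.cast_nonneg
    have key : ∀ p q : ℝ, (p + q) ^ 2 ≤ 2 * p ^ 2 + 2 * q ^ 2 := fun p q => by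
      nlinarith [sq_nonneg (p - q)]
    refine (key _ _).trans (le_of_eq ?_)
    rw [mul_pow, mul_pow, mul_pow, hn]; ring
  have hs := (hu.mul_left (2 * ‖ψ‖ ^ 2)).add (hψ.mul_left (2 * n * ‖u‖ ^ 2))
  have h1 : InForm h (n + 1) (creSector u n ψ) := Summable.of_nonneg_of_le (fun _ => sq_nonneg _) hle hs
  refine ⟨h1, (h1.tsum_le_tsum hle hs).trans (le_of_eq ?_)⟩
  rw [(hu.mul_left (2 * ‖ψ‖ ^ 2)).tsum_add (hψ.mul_left (2 * n * ‖u‖ ^ 2)), tsum_mul_left,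
    tsum_mul_left]

theorem inForm_zero (h : α → Lp ℂ 2 μ) (φ : Sector μ d 0) : InForm h 0 φ := by
  have : (fun a => ‖annSingle (h a) 0 φ‖ ^ 2) = fun _ => 0 := by
    funext a
    have : annSingle (h a) 0 φ = 0 := rfl
    rw [this, norm_zero]; simp
  rw [InForm, this]
  exact summable_zero

theorem inForm_of_mem_prodSet {h : α → Lp ℂ 2 μ} {U : Set (Lp ℂ 2 μ)}
    (hU : ∀ u ∈ U, Summable fun a => ‖⟪h a, u⟫_ℂ‖ ^ 2) {n : ℕ} {φ : Sector μ d n}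
    (hφ : φ ∈ prodSet U n) : InForm h n φ := by
  induction n with
  | zero => exact inForm_zero h φ
  | succ n ih =>
    obtain ⟨u, hu, ψ, hψ, rfl⟩ := hφ
    exact (inForm_creSector (ih hψ) (hU u hu)).1

variable {B : Fin N → Matrix (Fin d) (Fin d) ℂ} {M M' : Matrix (Fin d) (Fin d) ℂ}
  {h : α → Lp ℂ 2 μ} {g : Fin N → Lp ℂ 2 μ}

theorem shift_single (B : Fin N → Matrix (Fin d) (Fin d) ℂ) (g : Fin N → Lp ℂ 2 μ) (h : Lp ℂ 2 μ)
    (n : ℕ) (φ : Sector μ d n) : shift B g h (Pi.single n φ : Formal μ d)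
      = Pi.single n (∑ j, ⟪h, g j⟫_ℂ • matSector (B j) n φ) := by
  funext k
  have h1 : shift B g h (Pi.single n φ : Formal μ d) k
      = ∑ j, ⟪h, g j⟫_ℂ • matSector (B j) k ((Pi.single n φ : Formal μ d) k) := by
    rw [shift_apply, Finset.sum_apply]; rfl
  rw [h1]
  by_cases hk : k = n
  · subst hk; rw [Pi.single_eq_same, Pi.single_eq_same]
  · rw [Pi.single_eq_of_ne hk, Pi.single_eq_of_ne hk]
    simp only [map_zero, smul_zero, Finset.sum_const_zero]

/-- With `φ` in the free form domain, the displacement adds terms `⟨hₐ, gⱼ⟩ Bⱼ φ`, which are square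
summable in `a` when the `gⱼ` are in the form domain of `ω`. -/
theorem exists_formDom_single (hM' : M' * M = 1)
    (hg : ∀ j, Summable fun a => ‖⟪h a, g j⟫_ℂ‖ ^ 2) {n : ℕ} {φ : Sector μ d n} (hφ : InForm h n φ) :
    ∃ x : FormDom B M' h g, formEmb B M' h g x = fockSingle n φ := by
  set t : α → Fock μ d := fun a => annSingle (h a) n φ
    + fockSingle n (∑ j, ⟪h a, g j⟫_ℂ • matSector (B j) n φ) with ht
  have h1 : ∀ a, (t a : Formal μ d) = annHat B g (h a) (fockSingle n φ : Fock μ d) := fun a => by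
    change (annSingle (h a) n φ : Formal μ d)
      + (fockSingle n (∑ j, ⟪h a, g j⟫_ℂ • matSector (B j) n φ) : Formal μ d) = _
    rw [annHat_eq, coe_annSingle, coe_fockSingle, coe_fockSingle, shift_single]
  set C : Fin N → ℝ := fun j => ‖matSector (B j) n φ‖
  have h2 : Summable fun a => ‖t a‖ ^ 2 := by
    have hs : Summable fun a => 2 * ‖annSingle (h a) n φ‖ ^ 2
        + 2 * (N * ∑ j, C j ^ 2 * ‖⟪h a, g j⟫_ℂ‖ ^ 2) :=
      (hφ.mul_left 2).add ((((summable_sum fun j _ => (hg j).mul_left (C j ^ 2))).mul_left _).mul_left 2)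
    refine Summable.of_nonneg_of_le (fun _ => sq_nonneg _) (fun a => ?_) hs
    have h3 : ‖fockSingle n (∑ j, ⟪h a, g j⟫_ℂ • matSector (B j) n φ)‖
        ≤ ∑ j, ‖⟪h a, g j⟫_ℂ‖ * C j := by
      rw [norm_fockSingle]
      refine (norm_sum_le _ _).trans (Finset.sum_le_sum fun j _ => ?_)
      exact (sector_norm_smul _ _).le
    have h4 : (∑ j, ‖⟪h a, g j⟫_ℂ‖ * C j) ^ 2 ≤ N * ∑ j, C j ^ 2 * ‖⟪h a, g j⟫_ℂ‖ ^ 2 := by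
      refine (sq_sum_le_card_mul_sum_sq).trans (le_of_eq ?_)
      rw [Finset.card_univ, Fintype.card_fin]
      congr 1
      exact Finset.sum_congr rfl fun j _ => by ring
    have key : ∀ p q : ℝ, (p + q) ^ 2 ≤ 2 * p ^ 2 + 2 * q ^ 2 := fun p q => by
      nlinarith [sq_nonneg (p - q)]
    refine (pow_le_pow_left₀ (norm_nonneg _) ((norm_add_le _ _).trans (add_le_add_right h3 _)) 2).trans ?_
    refine (key _ _).trans (add_le_add_right ?_ _)
    exact mul_le_mul_of_nonneg_left h4 zero_le_two
  obtain ⟨x, hx, -⟩ := exists_formDom_of_summable hM' t h1 h2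
  exact ⟨x, hx⟩

theorem annHat_zero (B : Fin N → Matrix (Fin d) (Fin d) ℂ) (h : Lp ℂ 2 μ) (Ψ : Formal μ d) :
    annHat B 0 h Ψ = ann h Ψ := by
  rw [annHat_eq, shift_apply]
  simp

/-- The form norm of `a^*(u) ψ` is controlled by the form norm of `u`. -/
theorem exists_formDom_creSector (hM' : M' * M = 1) {n : ℕ} {ψ : Sector μ d n} (hψ : InForm h n ψ) :
    ∃ C : ℝ, 0 ≤ C ∧ ∀ u : Lp ℂ 2 μ, (Summable fun a => ‖⟪h a, u⟫_ℂ‖ ^ 2) →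
      ∃ x : FormDom B M' h 0, formEmb B M' h 0 x = fockSingle (n + 1) (creSector u n ψ) ∧
        ‖x‖ ^ 2 ≤ C * (‖u‖ ^ 2 + ∑' a, ‖⟪h a, u⟫_ℂ‖ ^ 2) := by
  have hM0 := matNorm_nonneg M
  set S := ∑' a, ‖annSingle (h a) n ψ‖ ^ 2
  have hS : 0 ≤ S := tsum_nonneg fun _ => sq_nonneg _
  refine ⟨(matNorm M * (Real.sqrt (n + 1) * ‖ψ‖)) ^ 2 + 2 * ‖ψ‖ ^ 2 + 2 * n * S, by positivity,
    fun u hu => ?_⟩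
  obtain ⟨h1, h2⟩ := inForm_creSector hψ hu
  have ht : ∀ a, (annSingle (h a) (n + 1) (creSector u n ψ) : Formal μ d)
      = annHat B 0 (h a) (fockSingle (n + 1) (creSector u n ψ) : Fock μ d) := fun a => by
    rw [annHat_zero, coe_annSingle]
  obtain ⟨x, hx1, hx2, hx3⟩ := exists_formDom_of_summable (M := M) hM' _ ht h1
  refine ⟨x, hx1, ?_⟩
  set T := ∑' a, ‖⟪h a, u⟫_ℂ‖ ^ 2
  have hT : 0 ≤ T := tsum_nonneg fun _ => sq_nonneg _
  have h3 : ‖x.fst‖ ^ 2 ≤ (matNorm M * (Real.sqrt (n + 1) * ‖ψ‖)) ^ 2 * ‖u‖ ^ 2 := by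
    rw [← mul_pow]
    refine pow_le_pow_left₀ (norm_nonneg _) ?_ 2
    rw [hx2, mul_assoc]
    refine (norm_matL_le _ _).trans (mul_le_mul_of_nonneg_left ?_ hM0)
    rw [norm_fockSingle]
    refine (norm_creSector_le u n ψ).trans (le_of_eq (by ring))
  have h4 : ‖x.snd‖ ^ 2 ≤ 2 * ‖ψ‖ ^ 2 * T + 2 * n * ‖u‖ ^ 2 * S := by
    rw [← (lp_hasSum_norm_sq x.snd).tsum_eq]
    simp only [hx3]
    exact h2
  rw [x.norm_sq]
  have e1 : 0 ≤ (matNorm M * (Real.sqrt (n + 1) * ‖ψ‖)) ^ 2 := sq_nonneg _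
  have e2 : 0 ≤ ‖u‖ ^ 2 := sq_nonneg _
  have e3 : 0 ≤ ‖ψ‖ ^ 2 := sq_nonneg _
  have e4 : 0 ≤ n * S := by positivity
  nlinarith [mul_nonneg e1 hT, mul_nonneg e3 e2, mul_nonneg e4 hT]

end Singles

/-! ### Cut-offs in all variables -/

section Cutoff

variable {X : Type*} [MeasurableSpace X] {μ : Measure X} [SigmaFinite μ] {d : ℕ}

/-- `H` is the product of the function `W` and `F`. -/
def MulBy {α E : Type*} [MeasurableSpace α] [NormedAddCommGroup E] [InnerProductSpace ℂ E]
    {ν : Measure α} (W : α → ℝ) (F H : Lp E 2 ν) : Prop := H =ᵐ[ν] fun x => (W x : ℂ) • F x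

section MulBy

variable {α E : Type*} [MeasurableSpace α] [NormedAddCommGroup E] [InnerProductSpace ℂ E]
  {ν : Measure α} {W : α → ℝ}

theorem MulBy.add {F F' H H' : Lp E 2 ν} (h : MulBy W F H) (h' : MulBy W F' H') :
    MulBy W (F + F') (H + H') := by
  refine (Lp.coeFn_add H H').trans ?_
  filter_upwards [h, h', Lp.coeFn_add F F'] with x h1 h2 h3
  rw [Pi.add_apply, h1, h2, h3, Pi.add_apply, smul_add]

theorem MulBy.smul {F H : Lp E 2 ν} (h : MulBy W F H) (c : ℂ) : MulBy W (c • F) (c • H) := by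
  refine (Lp.coeFn_smul c H).trans ?_
  filter_upwards [h, Lp.coeFn_smul c F] with x h1 h2
  rw [Pi.smul_apply, h1, h2, Pi.smul_apply, smul_comm]

theorem MulBy.zero : MulBy W (0 : Lp E 2 ν) 0 := by
  unfold MulBy
  filter_upwards [Lp.coeFn_zero E 2 ν] with x hx
  rw [hx, Pi.zero_apply, smul_zero]

theorem MulBy.sum {J : Type*} (s : Finset J) {F H : J → Lp E 2 ν} (h : ∀ j, MulBy W (F j) (H j)) :
    MulBy W (∑ j ∈ s, F j) (∑ j ∈ s, H j) := by
  classical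
  induction s using Finset.induction_on with
  | empty => simpa using MulBy.zero
  | insert j s hj ih => rw [Finset.sum_insert hj, Finset.sum_insert hj]; exact (h j).add ih

theorem MulBy.inner_comm {F H F' H' : Lp E 2 ν} (h : MulBy W F H) (h' : MulBy W F' H') :
    ⟪H, F'⟫_ℂ = ⟪F, H'⟫_ℂ := by
  rw [L2.inner_def, L2.inner_def]
  refine integral_congr_ae ?_
  filter_upwards [h, h'] with x h1 h2
  rw [h1, h2, inner_smul_left, inner_smul_right, Complex.conj_ofReal]

end MulBy

theorem MulBy.insertAt {ω : X → ℝ} {g f : Lp ℂ 2 μ} (h : MulBy ω g f) (n : ℕ) (i : Fin (n + 1))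
    (χ : Lp (Spin d) 2 (powMeasure μ n)) :
    MulBy (fun k => ω (k i)) (insertAt g n i χ) (insertAt f n i χ) := by
  refine (coeFn_insertAt f n i χ).trans ?_
  filter_upwards [coeFn_insertAt g n i χ, ae_coord h n i] with k h1 h2
  rw [h1, h2, smul_smul]; rfl

theorem Multiplier.op_mem_sector {n : ℕ} (w : Multiplier (Fin n → X))
    (hw : ∀ (σ : Equiv.Perm (Fin n)) k, w (k ∘ σ) = w k) (φ : Sector μ d n) :
    w.op _ _ (φ : Lp (Spin d) 2 (powMeasure μ n)) ∈ Sector μ d n := by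
  intro σ
  have hσ := measurePreserving_perm μ n σ
  refine Lp.ext ((Lp.coeFn_compMeasurePreserving _ hσ).trans ?_)
  have h1 := hσ.quasiMeasurePreserving.ae_eq_comp
    (w.coeFn_op (φ : Lp (Spin d) 2 (powMeasure μ n)))
  have h3 := Lp.coeFn_compMeasurePreserving (φ : Lp (Spin d) 2 (powMeasure μ n)) hσ
  rw [sector_perm_eq φ σ] at h3
  refine h1.trans ?_
  filter_upwards [h3, w.coeFn_op (φ : Lp (Spin d) 2 (powMeasure μ n))] with k h4 h5
  rw [h5, h4]
  simp only [Function.comp_apply]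
  rw [hw]

open Classical in
/-- The indicator function of the set where `ω < R` in all variables. -/
def cutAll (ω : X → ℝ) (hω : Measurable ω) (R n : ℕ) : Multiplier (Fin n → X) where
  toFun k := if ∀ i, ω (k i) < R then 1 else 0
  measurable' := Measurable.ite (measurableSet_setOf.2 (Measurable.forall fun i =>
    measurableSet_setOf.1 (measurableSet_lt (hω.comp (measurable_pi_apply i)) measurable_const)))
    measurable_const measurable_const
  bound := 1
  abs_le' k := by split_ifs <;> simp

open Classical in
/-- The sum of `ω` over all variables, restricted to the set where `0 ≤ ω < R` in all variables. -/
def sumCut (ω : X → ℝ) (hω : Measurable ω) (R n : ℕ) : Multiplier (Fin n → X) where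
  toFun k := if ∀ i, 0 ≤ ω (k i) ∧ ω (k i) < R then ∑ i, ω (k i) else 0
  measurable' := Measurable.ite (measurableSet_setOf.2 (Measurable.forall fun i =>
    measurableSet_setOf.1 ((measurableSet_le measurable_const
      (hω.comp (measurable_pi_apply i))).inter
        (measurableSet_lt (hω.comp (measurable_pi_apply i)) measurable_const))))
    (Finset.measurable_sum _ fun i _ => hω.comp (measurable_pi_apply i)) measurable_const
  bound := n * R
  abs_le' k := by
    split_ifs with h
    · rw [abs_of_nonneg (Finset.sum_nonneg fun i _ => (h i).1)]
      refine (Finset.sum_le_card_nsmul _ _ (R : ℝ) fun i _ => (h i).2.le).trans ?_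
      simp
    · rw [abs_zero]; positivity

variable {ω : X → ℝ} (hω : Measurable ω)

theorem cutAll_apply_of_forall {R n : ℕ} {k : Fin n → X} (h : ∀ i, ω (k i) < R) :
    cutAll ω hω R n k = 1 := if_pos h

theorem cutAll_apply_of_not {R n : ℕ} {k : Fin n → X} (h : ¬ ∀ i, ω (k i) < R) :
    cutAll ω hω R n k = 0 := if_neg h

theorem cutAll_perm (R n : ℕ) (σ : Equiv.Perm (Fin n)) (k : Fin n → X) :
    cutAll ω hω R n (k ∘ σ) = cutAll ω hω R n k := by
  by_cases h : ∀ i, ω (k i) < R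
  · rw [cutAll_apply_of_forall hω h, cutAll_apply_of_forall hω (k := k ∘ σ) fun i => h (σ i)]
  · rw [cutAll_apply_of_not hω h, cutAll_apply_of_not hω (k := k ∘ σ) fun h' => h fun i => by
      simpa using h' (σ.symm i)]

theorem sumCut_eq {R n : ℕ} {k : Fin n → X} (h0 : ∀ i, 0 ≤ ω (k i)) :
    sumCut ω hω R n k = (∑ i, ω (k i)) * cutAll ω hω R n k := by
  by_cases h : ∀ i, ω (k i) < R
  · rw [cutAll_apply_of_forall hω h, mul_one]
    exact if_pos fun i => ⟨h0 i, h i⟩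
  · rw [cutAll_apply_of_not hω h, mul_zero]
    exact if_neg fun h' => h fun i => (h' i).2

open Classical in
theorem sumCut_perm (R n : ℕ) (σ : Equiv.Perm (Fin n)) (k : Fin n → X) :
    sumCut ω hω R n (k ∘ σ) = sumCut ω hω R n k := by
  change (if ∀ i, 0 ≤ ω (k (σ i)) ∧ ω (k (σ i)) < R then ∑ i, ω (k (σ i)) else 0)
    = (if ∀ i, 0 ≤ ω (k i) ∧ ω (k i) < R then ∑ i, ω (k i) else 0)
  have h1 : ∑ i, ω (k (σ i)) = ∑ i, ω (k i) := Equiv.sum_comp σ fun i => ω (k i)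
  have h2 : (∀ i, 0 ≤ ω (k (σ i)) ∧ ω (k (σ i)) < R) ↔ ∀ i, 0 ≤ ω (k i) ∧ ω (k i) < R :=
    ⟨fun h i => by simpa using h (σ.symm i), fun h i => h (σ i)⟩
  rw [h1, if_congr h2 rfl rfl]

theorem cutAll_succ (R n : ℕ) (i : Fin (n + 1)) (k : Fin (n + 1) → X) :
    cutAll ω hω R (n + 1) k = cut ω hω R (k i) * cutAll ω hω R n (i.removeNth k) := by
  have hiff : (∀ j, ω (k j) < R) ↔ ω (k i) < R ∧ ∀ j, ω (i.removeNth k j) < R :=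
    Fin.forall_iff_succAbove i
  by_cases h1 : ω (k i) < R
  · have h3 : cut ω hω R (k i) = 1 := if_pos h1
    rw [h3, one_mul]
    by_cases h2 : ∀ j, ω (i.removeNth k j) < R
    · rw [cutAll_apply_of_forall hω (hiff.2 ⟨h1, h2⟩), cutAll_apply_of_forall hω h2]
    · rw [cutAll_apply_of_not hω (fun h => h2 (hiff.1 h).2), cutAll_apply_of_not hω h2]
  · have h3 : cut ω hω R (k i) = 0 := if_neg h1
    rw [h3, zero_mul, cutAll_apply_of_not hω (fun h => h1 (hiff.1 h).1)]

theorem insertAt_cut (R n : ℕ) (i : Fin (n + 1)) (u : Lp ℂ 2 μ)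
    (ψ : Lp (Spin d) 2 (powMeasure μ n)) :
    insertAt ((cut ω hω R).op ℂ μ u) n i ((cutAll ω hω R n).op _ _ ψ)
      = (cutAll ω hω R (n + 1)).op _ _ (insertAt u n i ψ) := by
  symm
  refine Multiplier.op_eq_of_ae _ _ _ ((coeFn_insertAt _ n i _).trans ?_)
  have h2 := (Measure.quasiMeasurePreserving_snd.comp
    (measurePreserving_removeNth (μ := μ) n i).quasiMeasurePreserving).ae
      ((cutAll ω hω R n).coeFn_op ψ)
  filter_upwards [coeFn_insertAt u n i ψ, ae_coord ((cut ω hω R).coeFn_op u) n i, h2]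
    with k h3 h4 h5
  simp only [Function.comp_apply] at h5
  rw [h3, h4, h5, cutAll_succ hω R n i k, smul_eq_mul, smul_smul, smul_smul]
  push_cast
  congr 1
  ring

theorem creSector_cut (R n : ℕ) (u : Lp ℂ 2 μ) (ψ φ : Sector μ d n)
    (h : (φ : Lp (Spin d) 2 (powMeasure μ n)) = (cutAll ω hω R n).op _ _ ψ) :
    (creSector ((cut ω hω R).op ℂ μ u) n φ : Lp (Spin d) 2 (powMeasure μ (n + 1)))
      = (cutAll ω hω R (n + 1)).op _ _ (creSector u n ψ) := by
  rw [coe_creSector, coe_creSector, map_smul, map_sum, h]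
  simp only [insertAt_cut]

/-- Cutting off a product amounts to cutting off its factors. -/
theorem exists_mem_prodSet_cut (R : ℕ) {n : ℕ} {φ : Sector μ d n}
    (hφ : φ ∈ prodSet (Set.univ : Set (Lp ℂ 2 μ)) n) :
    ∃ φ' ∈ prodSet (d := d) (Set.range ((cut ω hω R).op ℂ μ)) n,
      (φ' : Lp (Spin d) 2 (powMeasure μ n)) = (cutAll ω hω R n).op _ _ φ := by
  induction n with
  | zero =>
    refine ⟨φ, trivial, ?_⟩
    symm
    refine Multiplier.op_eq_of_ae _ _ _ (.of_forall fun k => ?_)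
    beta_reduce
    rw [cutAll_apply_of_forall hω (fun i => i.elim0)]; simp
  | succ n ih =>
    obtain ⟨u, -, ψ, hψ, rfl⟩ := hφ
    obtain ⟨ψ', h1, h2⟩ := ih hψ
    exact ⟨_, ⟨_, ⟨u, rfl⟩, ψ', h1, rfl⟩, creSector_cut hω R n u ψ ψ' h2⟩

theorem ae_forall_coord {p : X → Prop} (hp : ∀ᵐ x ∂μ, p x) (n : ℕ) :
    ∀ᵐ k ∂powMeasure μ n, ∀ i, p (k i) := by
  rw [ae_all_iff]
  cases n with
  | zero => exact fun i => i.elim0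
  | succ n => exact fun i => ae_coord hp n i

theorem mulBy_sumCut (hpos : ∀ᵐ x ∂μ, 0 ≤ ω x) (R n : ℕ) (F : Lp (Spin d) 2 (powMeasure μ n)) :
    MulBy (fun k => ∑ i, ω (k i)) ((cutAll ω hω R n).op _ _ F) ((sumCut ω hω R n).op _ _ F) := by
  refine ((sumCut ω hω R n).coeFn_op F).trans ?_
  filter_upwards [(cutAll ω hω R n).coeFn_op F, ae_forall_coord hpos n] with k h1 h2
  rw [h1, sumCut_eq hω h2, smul_smul]; push_cast; rfl

theorem mulBy_cutMul (hpos : ∀ᵐ x ∂μ, 0 ≤ ω x) (R n : ℕ) (i : Fin (n + 1))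
    (F : Lp (Spin d) 2 (powMeasure μ (n + 1))) :
    MulBy (fun k => ω (k i)) ((cutAll ω hω R (n + 1)).op _ _ F)
      ((cutMul (fun k : Fin (n + 1) → X => ω (k i)) (hω.comp (measurable_pi_apply i)) R).op _ _
        ((cutAll ω hω R (n + 1)).op _ _ F)) := by
  refine (Multiplier.coeFn_op _ _).trans ?_
  filter_upwards [(cutAll ω hω R (n + 1)).coeFn_op F, ae_coord hpos n i] with k h1 h2
  rw [h1, cutMul_eq (W := fun k : Fin (n + 1) → X => ω (k i)) _ R h2, smul_smul, smul_smul, cutAll_succ hω R n i k]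
  have h3 : cut (fun k : Fin (n + 1) → X => ω (k i)) (hω.comp (measurable_pi_apply i)) R k
      = cut ω hω R (k i) := rfl
  have h4 := congrArg (fun t : ℝ => (t : ℂ)) (cut_mul_self hω R (k i))
  simp only [Complex.ofReal_mul] at h4
  rw [h3]
  push_cast
  congr 1
  linear_combination (ω (k i) : ℂ) * (cutAll ω hω R n (i.removeNth k) : ℂ) * h4

/-- If `ψ` is tested with products cut off in all variables, it is determined as a multiplication
by `∑ᵢ ω(kᵢ)`. -/
theorem mulBy_of_forall_cut (hpos : ∀ᵐ x ∂μ, 0 ≤ ω x) {n : ℕ} {ψ ζ : Sector μ d n}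
    (h : ∀ R, ∀ φ ∈ prodSet (Set.range ((cut ω hω R).op ℂ μ)) n,
      ∀ φ₀ : Sector μ d n, (φ : Lp (Spin d) 2 (powMeasure μ n)) = (cutAll ω hω R n).op _ _ φ₀ →
        ⟪(sumCut ω hω R n).op _ _ (φ₀ : Lp (Spin d) 2 (powMeasure μ n)),
          (ψ : Lp (Spin d) 2 (powMeasure μ n))⟫_ℂ = ⟪φ, ζ⟫_ℂ) :
    MulBy (fun k => ∑ i, ω (k i)) (ψ : Lp (Spin d) 2 (powMeasure μ n)) ζ := by
  have key : ∀ R, (sumCut ω hω R n).op _ _ (ψ : Lp (Spin d) 2 (powMeasure μ n))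
      = (cutAll ω hω R n).op _ _ (ζ : Lp (Spin d) 2 (powMeasure μ n)) := fun R => by
    -- Both cut-off multipliers are symmetric, so the two sides stay in the sector. Arbitrary
    -- products suffice for testing, since the cut-off can be moved onto the factors.
    set A : Sector μ d n := ⟨_, (sumCut ω hω R n).op_mem_sector (sumCut_perm hω R n) ψ⟩ with hA
    set C : Sector μ d n := ⟨_, (cutAll ω hω R n).op_mem_sector (cutAll_perm hω R n) ζ⟩ with hC
    have h0 : A - C = 0 := eq_zero_of_inner_prodSet fun φ₀ hφ₀ => by
      obtain ⟨φ, h1, h2⟩ := exists_mem_prodSet_cut hω R hφ₀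
      have h3 := h R φ h1 φ₀ h2
      rw [inner_sub_right, sub_eq_zero]
      rw [Multiplier.inner_op_left] at h3
      refine (h3.trans ?_)
      rw [Submodule.coe_inner, h2, Multiplier.inner_op_left]
      rfl
    exact congrArg Subtype.val (sub_eq_zero.1 h0)
  have h1 : ∀ᵐ k ∂powMeasure μ n, ∀ R : ℕ,
      (sumCut ω hω R n k : ℂ) • (ψ : Lp (Spin d) 2 (powMeasure μ n)) k
        = (cutAll ω hω R n k : ℂ) • (ζ : Lp (Spin d) 2 (powMeasure μ n)) k := by
    rw [ae_all_iff]
    intro R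
    have h2 := (sumCut ω hω R n).coeFn_op (ψ : Lp (Spin d) 2 (powMeasure μ n))
    rw [key R] at h2
    exact h2.symm.trans ((cutAll ω hω R n).coeFn_op _)
  unfold MulBy
  filter_upwards [h1, ae_forall_coord hpos n] with k h2 h3
  -- As all `ω (k i)` are nonnegative, a bound for their sum bounds each of them, and no cut-off is
  -- active at this point.
  obtain ⟨R, hR⟩ := exists_nat_gt (∑ i, ω (k i))
  have h4 : ∀ i, ω (k i) < R := fun i =>
    (Finset.single_le_sum (f := fun i => ω (k i)) (fun j _ => h3 j) (Finset.mem_univ i)).trans_lt hR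
  have h5 := h2 R
  rw [sumCut_eq hω h3, cutAll_apply_of_forall hω h4, mul_one, Complex.ofReal_one, one_smul] at h5
  exact h5.symm

/-- By symmetry, multiplication by `∑ᵢ ω(kᵢ)` has the same matrix elements as multiplication by
`(n + 1) ω(k₀)`. -/
theorem inner_mulBy_sum {n : ℕ} {φ ψ : Sector μ d (n + 1)}
    {F W : Lp (Spin d) 2 (powMeasure μ (n + 1))}
    (hF : MulBy (fun k => ω (k 0)) (φ : Lp (Spin d) 2 (powMeasure μ (n + 1))) F)
    (hW : MulBy (fun k => ∑ i, ω (k i)) (φ : Lp (Spin d) 2 (powMeasure μ (n + 1))) W) :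
    ⟪W, (ψ : Lp (Spin d) 2 (powMeasure μ (n + 1)))⟫_ℂ
      = ((n : ℂ) + 1) * ⟪F, (ψ : Lp (Spin d) 2 (powMeasure μ (n + 1)))⟫_ℂ := by
  -- Exchanging the variables `0` and `i` turns multiplication by `ω(k₀)` into multiplication by
  -- `ω(kᵢ)` and leaves the symmetric `φ` and `ψ` unchanged.
  set σ : Fin (n + 1) → Equiv.Perm (Fin (n + 1)) := fun i => Equiv.swap 0 i
  set G : Fin (n + 1) → Lp (Spin d) 2 (powMeasure μ (n + 1)) := fun i =>
    Lp.compMeasurePreserving (fun k => k ∘ σ i) (measurePreserving_perm μ (n + 1) (σ i)) F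
  have hG : ∀ i, MulBy (fun k => ω (k i)) (φ : Lp (Spin d) 2 (powMeasure μ (n + 1))) (G i) := by
    intro i
    have hσ := measurePreserving_perm μ (n + 1) (σ i)
    refine (Lp.coeFn_compMeasurePreserving _ hσ).trans ?_
    have h1 := hσ.quasiMeasurePreserving.ae_eq_comp hF
    have h3 := Lp.coeFn_compMeasurePreserving (φ : Lp (Spin d) 2 (powMeasure μ (n + 1))) hσ
    rw [sector_perm_eq φ (σ i)] at h3
    refine h1.trans ?_
    filter_upwards [h3] with k h4
    rw [h4]
    simp only [Function.comp_apply]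
    have : σ i 0 = i := Equiv.swap_apply_left 0 i
    rw [this]
  have hGi : ∀ i, ⟪G i, (ψ : Lp (Spin d) 2 (powMeasure μ (n + 1)))⟫_ℂ
      = ⟪F, (ψ : Lp (Spin d) 2 (powMeasure μ (n + 1)))⟫_ℂ := fun i => by
    have h := inner_compMeasurePreserving (measurePreserving_perm μ (n + 1) (σ i)) F
      (ψ : Lp (Spin d) 2 (powMeasure μ (n + 1)))
    rwa [sector_perm_eq ψ (σ i)] at h
  have hsum : W = ∑ i, G i := by
    have h1 : ∀ s : Finset (Fin (n + 1)),
        MulBy (fun k => ∑ i ∈ s, ω (k i)) (φ : Lp (Spin d) 2 (powMeasure μ (n + 1)))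
          (∑ i ∈ s, G i) := by
      classical
      intro s
      induction s using Finset.induction_on with
      | empty =>
        unfold MulBy
        filter_upwards [Lp.coeFn_zero (Spin d) 2 (powMeasure μ (n + 1))] with k hk
        rw [Finset.sum_empty, hk]; simp
      | insert j s hj ih =>
        rw [Finset.sum_insert hj]
        refine (Lp.coeFn_add _ _).trans ?_
        filter_upwards [hG j, ih] with k h2 h3
        rw [Pi.add_apply, h2, h3, Finset.sum_insert hj, Complex.ofReal_add, add_smul]
    exact Lp.ext (EventuallyEq.trans hW (EventuallyEq.symm (h1 Finset.univ)))
  rw [hsum, sum_inner]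
  simp only [hGi]
  rw [Finset.sum_const, Finset.card_univ, Fintype.card_fin, nsmul_eq_mul]
  push_cast; rfl

open Classical in
/-- Vectors cut off in `ω` lie in the form domain of `ω`. -/
theorem summable_bandVec_cut {ι : Type*} (hpos : ∀ᵐ x ∂μ, 0 ≤ ω x) (e : HilbertBasis ι ℂ (Lp ℂ 2 μ))
    {R : ℕ} {u : Lp ℂ 2 μ} (hu : u ∈ Set.range ((cut ω hω R).op ℂ μ)) :
    Summable fun a => ‖⟪bandVec ω hω e a, u⟫_ℂ‖ ^ 2 := by
  obtain ⟨v, rfl⟩ := hu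
  set w : Multiplier X := ⟨fun x => if ω x < R then Real.sqrt (ω x) else 0,
    Measurable.ite (measurableSet_lt hω measurable_const) hω.sqrt measurable_const,
    Real.sqrt R, fun x => by
      split_ifs with h
      · rw [abs_of_nonneg (Real.sqrt_nonneg _)]; exact Real.sqrt_le_sqrt h.le
      · simp⟩ with hw
  refine (summable_bandVec hω hpos e (v := w.op ℂ μ v) ?_).1
  filter_upwards [w.coeFn_op v, (cut ω hω R).coeFn_op v] with x h1 h2
  rw [h1, h2, smul_smul]
  by_cases h : ω x < R
  · have h3 : w x = Real.sqrt (ω x) := if_pos h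
    have h4 : cut ω hω R x = 1 := if_pos h
    rw [h3, h4]; simp
  · have h3 : w x = 0 := if_neg h
    have h4 : cut ω hω R x = 0 := if_neg h
    rw [h3, h4]; simp

end Cutoff

/-! ### The form of the regular Hamiltonian -/

section RegularForm

variable {X : Type*} [MeasurableSpace X] {μ : Measure X} [SigmaFinite μ] {d N : ℕ} {ι : Type*}

/-- The formal vector `∑ⱼ Bⱼ a^*(fⱼ) Ψ`. -/
def creSum (B : Fin N → Matrix (Fin d) (Fin d) ℂ) (f : Fin N → Lp ℂ 2 μ) (Ψ : Formal μ d) :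
    Formal μ d := ∑ j, mat (B j) (cre (f j) Ψ)

/-- The formal vector `∑ⱼ Bⱼ^* a(fⱼ) Ψ`. -/
def annSum (B : Fin N → Matrix (Fin d) (Fin d) ℂ) (f : Fin N → Lp ℂ 2 μ) (Ψ : Formal μ d) :
    Formal μ d := ∑ j, mat (B j).conjTranspose (ann (f j) Ψ)

theorem creSum_apply_zero (B : Fin N → Matrix (Fin d) (Fin d) ℂ) (f : Fin N → Lp ℂ 2 μ)
    (Ψ : Formal μ d) : creSum B f Ψ 0 = 0 := by
  rw [creSum, Finset.sum_apply]
  exact Finset.sum_eq_zero fun j _ => by rw [mat_apply, cre_apply_zero, map_zero]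

theorem creSum_apply_succ (B : Fin N → Matrix (Fin d) (Fin d) ℂ) (f : Fin N → Lp ℂ 2 μ)
    (Ψ : Formal μ d) (n : ℕ) :
    creSum B f Ψ (n + 1) = ∑ j, creSector (f j) n (matSector (B j) n (Ψ n)) := by
  rw [creSum, Finset.sum_apply]
  exact Finset.sum_congr rfl fun j _ => by rw [mat_apply, cre_apply_succ, matSector_creSector]

theorem annSum_apply (B : Fin N → Matrix (Fin d) (Fin d) ℂ) (f : Fin N → Lp ℂ 2 μ)
    (Ψ : Formal μ d) (n : ℕ) :
    annSum B f Ψ n = ∑ j, matSector (B j).conjTranspose n (annSector (f j) n (Ψ (n + 1))) := by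
  rw [annSum, Finset.sum_apply]
  exact Finset.sum_congr rfl fun j _ => by rw [mat_apply, ann_apply]

/-- `∑_{j,j'} ⟨fⱼ, gⱼ'⟩ Bⱼ^* Bⱼ'`. -/
def crossMatrix (B : Fin N → Matrix (Fin d) (Fin d) ℂ) (f g : Fin N → Lp ℂ 2 μ) :
    Matrix (Fin d) (Fin d) ℂ :=
  ∑ j, ∑ j', ⟪f j, g j'⟫_ℂ • ((B j).conjTranspose * B j')

theorem matSector_sum {J : Type*} (s : Finset J) (M : J → Matrix (Fin d) (Fin d) ℂ) (n : ℕ)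
    (ψ : Sector μ d n) : matSector (∑ j ∈ s, M j) n ψ = ∑ j ∈ s, matSector (M j) n ψ := by
  classical
  induction s using Finset.induction_on with
  | empty =>
    have h := matSector_smul (0 : ℂ) (0 : Matrix (Fin d) (Fin d) ℂ) n ψ
    rw [zero_smul, zero_smul] at h
    rw [Finset.sum_empty, Finset.sum_empty, h]
  | insert j s hj ih => rw [Finset.sum_insert hj, Finset.sum_insert hj, matSector_add, ih]

theorem inner_crossMatrix (B : Fin N → Matrix (Fin d) (Fin d) ℂ) (f g : Fin N → Lp ℂ 2 μ) (n : ℕ)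
    (φ ψ : Sector μ d n) : ⟪φ, matSector (crossMatrix B f g) n ψ⟫_ℂ
      = ∑ j, ∑ j', ⟪f j, g j'⟫_ℂ * ⟪matSector (B j) n φ, matSector (B j') n ψ⟫_ℂ := by
  rw [crossMatrix, matSector_sum, inner_sum]
  refine Finset.sum_congr rfl fun j _ => ?_
  rw [matSector_sum, inner_sum]
  refine Finset.sum_congr rfl fun j' _ => ?_
  rw [matSector_smul, sector_inner_smul_right, matSector_mul, inner_matSector_left]

theorem inner_creSector_right (f : Lp ℂ 2 μ) (n : ℕ) (ψ : Sector μ d n) (Φ : Sector μ d (n + 1)) :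
    ⟪Φ, creSector f n ψ⟫_ℂ = (Real.sqrt (n + 1) : ℂ) *
      ⟪(Φ : Lp (Spin d) 2 (powMeasure μ (n + 1))),
        insertAt f n 0 (ψ : Lp (Spin d) 2 (powMeasure μ n))⟫_ℂ := by
  rw [← inner_conj_symm, inner_creSector_left, map_mul, Complex.conj_ofReal, inner_conj_symm]

variable {B : Fin N → Matrix (Fin d) (Fin d) ℂ} {g f : Fin N → Lp ℂ 2 μ} {ω : X → ℝ}

/-- The contribution of a fixed number of bosons to the form. -/
theorem inner_frameVec (hgf : ∀ j, MulBy ω (g j) (f j)) (Φ Ψ : Formal μ d) (n : ℕ)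
    {F W : Lp (Spin d) 2 (powMeasure μ (n + 1))}
    (hF : MulBy (fun k => ω (k 0)) (Φ (n + 1) : Lp (Spin d) 2 (powMeasure μ (n + 1))) F)
    (hW : MulBy (fun k => ∑ i, ω (k i)) (Φ (n + 1) : Lp (Spin d) 2 (powMeasure μ (n + 1))) W) :
    ⟪(Real.sqrt (n + 1) : ℂ) • F + ∑ j, insertAt (f j) n 0
        (matSector (B j) n (Φ n) : Lp (Spin d) 2 (powMeasure μ n)), frameVec B g Ψ n⟫_ℂ
      = (⟪W, (Ψ (n + 1) : Lp (Spin d) 2 (powMeasure μ (n + 1)))⟫_ℂ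
          + ⟪Φ (n + 1), creSum B f Ψ (n + 1)⟫_ℂ)
        + (⟪Φ n, annSum B f Ψ n⟫_ℂ + ⟪Φ n, mat (crossMatrix B f g) Ψ n⟫_ℂ) := by
  have e1 : ⟪W, (Ψ (n + 1) : Lp (Spin d) 2 (powMeasure μ (n + 1)))⟫_ℂ
      = ⟪(Real.sqrt (n + 1) : ℂ) • F,
        (Real.sqrt (n + 1) : ℂ) • (Ψ (n + 1) : Lp (Spin d) 2 (powMeasure μ (n + 1)))⟫_ℂ := by
    rw [inner_mulBy_sum hF hW, inner_smul_left, inner_smul_right, Complex.conj_ofReal, ← mul_assoc,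
      sqrt_succ_mul_self]
  -- The weight `ω(k₀)` in `F` is moved onto the inserted function, where it turns `gⱼ` into `fⱼ`.
  have e2 : ⟪Φ (n + 1), creSum B f Ψ (n + 1)⟫_ℂ
      = ⟪(Real.sqrt (n + 1) : ℂ) • F, ∑ j, insertAt (g j) n 0
        (matSector (B j) n (Ψ n) : Lp (Spin d) 2 (powMeasure μ n))⟫_ℂ := by
    rw [creSum_apply_succ, inner_sum, inner_sum]
    refine Finset.sum_congr rfl fun j _ => ?_
    rw [inner_creSector_right, inner_smul_left, Complex.conj_ofReal,
      hF.inner_comm ((hgf j).insertAt n 0 _)]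
  have e3 : ⟪Φ n, annSum B f Ψ n⟫_ℂ
      = ⟪∑ j, insertAt (f j) n 0 (matSector (B j) n (Φ n) : Lp (Spin d) 2 (powMeasure μ n)),
        (Real.sqrt (n + 1) : ℂ) • (Ψ (n + 1) : Lp (Spin d) 2 (powMeasure μ (n + 1)))⟫_ℂ := by
    rw [annSum_apply, inner_sum, sum_inner]
    refine Finset.sum_congr rfl fun j _ => ?_
    rw [← inner_matSector_left, annSector, ContinuousLinearMap.adjoint_inner_right,
      inner_creSector_left, inner_smul_right]
  have e4 : ⟪Φ n, mat (crossMatrix B f g) Ψ n⟫_ℂ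
      = ⟪∑ j, insertAt (f j) n 0 (matSector (B j) n (Φ n) : Lp (Spin d) 2 (powMeasure μ n)),
        ∑ j, insertAt (g j) n 0 (matSector (B j) n (Ψ n) : Lp (Spin d) 2 (powMeasure μ n))⟫_ℂ := by
    rw [mat_apply, inner_crossMatrix, sum_inner]
    refine Finset.sum_congr rfl fun j _ => ?_
    rw [inner_sum]
    refine Finset.sum_congr rfl fun j' _ => ?_
    rw [inner_insertAt]; rfl
  rw [frameVec, inner_add_left, inner_add_right, inner_add_right, e1, e2, e3, e4]

theorem mulBy_frameVec (hgf : ∀ j, MulBy ω (g j) (f j)) (Φ : Formal μ d) (n : ℕ)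
    {F : Lp (Spin d) 2 (powMeasure μ (n + 1))}
    (hF : MulBy (fun k => ω (k 0)) (Φ (n + 1) : Lp (Spin d) 2 (powMeasure μ (n + 1))) F) :
    MulBy (fun k => ω (k 0)) (frameVec B g Φ n) ((Real.sqrt (n + 1) : ℂ) • F
      + ∑ j, insertAt (f j) n 0
        (matSector (B j) n (Φ n) : Lp (Spin d) 2 (powMeasure μ n))) :=
  (hF.smul _).add (MulBy.sum _ fun j => (hgf j).insertAt n 0 _)

variable {M M' : Matrix (Fin d) (Fin d) ℂ} {hω : Measurable ω}

/-- Membership of both arguments in the form domain supplies the summability for the frame identity,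
so only `y` is required to lie in the domain of `ω(k₀)`. -/
theorem tsum_inner_snd (e : HilbertBasis ι ℂ (Lp ℂ 2 μ)) (hpos : ∀ᵐ x ∂μ, 0 ≤ ω x)
    (y x : FormDom B M' (bandVec ω hω e) g) (n : ℕ) {H : Lp (Spin d) 2 (powMeasure μ (n + 1))}
    (hH : MulBy (fun k => ω (k 0))
      (frameVec B g (formEmb B M' (bandVec ω hω e) g y : Fock μ d) n) H) :
    ∑' a, ⟪y.snd a n, x.snd a n⟫_ℂ
      = ⟪H, frameVec B g (formEmb B M' (bandVec ω hω e) g x : Fock μ d) n⟫_ℂ := by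
  have h1 : ∀ a, ⟪y.snd a n, x.snd a n⟫_ℂ
      = ⟪ContinuousLinearMap.adjoint (insertAt (bandVec ω hω e a) n 0)
          (frameVec B g (formEmb B M' (bandVec ω hω e) g y : Fock μ d) n),
        ContinuousLinearMap.adjoint (insertAt (bandVec ω hω e a) n 0)
          (frameVec B g (formEmb B M' (bandVec ω hω e) g x : Fock μ d) n)⟫_ℂ := fun a => by
    rw [← hasSum_frame_annHat B g (bandVec ω hω e), ← y.coe_snd, ← x.coe_snd]
  have h2 := lp_lp_summable_inner_apply (E := fun n => Sector μ d n) y.snd x.snd n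
  have h3 := h2.congr fun a => h1 a
  rw [tsum_congr h1]
  exact tsum_frame hω hpos e hH h3

/-- The form of the regular Hamiltonian, tested with a vector with a fixed number of bosons. -/
theorem inner_formDom_single (e : HilbertBasis ι ℂ (Lp ℂ 2 μ)) (hpos : ∀ᵐ x ∂μ, 0 ≤ ω x)
    (hM : M * M' = 1) (hgf : ∀ j, MulBy ω (g j) (f j)) {n : ℕ} {φ : Sector μ d n}
    {W : Lp (Spin d) 2 (powMeasure μ n)}
    (hF : ∀ k : ℕ, n = k + 1 → ∃ F : Lp (Spin d) 2 (powMeasure μ (k + 1)),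
      MulBy (fun p => ω (p 0)) ((Pi.single n φ : Formal μ d) (k + 1) :
        Lp (Spin d) 2 (powMeasure μ (k + 1))) F)
    (hW : MulBy (fun k => ∑ i, ω (k i)) (φ : Lp (Spin d) 2 (powMeasure μ n)) W)
    {y : FormDom B M' (bandVec ω hω e) g} (hy : formEmb B M' (bandVec ω hω e) g y = fockSingle n φ)
    (x : FormDom B M' (bandVec ω hω e) g) {Ψ : Formal μ d}
    (hx : (formEmb B M' (bandVec ω hω e) g x : Fock μ d) = Ψ) :
    ⟪y, x⟫_ℂ = ⟪φ, mat (M.conjTranspose * M) Ψ n⟫_ℂ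
      + ((⟪W, (Ψ n : Lp (Spin d) 2 (powMeasure μ n))⟫_ℂ + ⟪φ, creSum B f Ψ n⟫_ℂ)
        + (⟪φ, annSum B f Ψ n⟫_ℂ + ⟪φ, mat (crossMatrix B f g) Ψ n⟫_ℂ)) := by
  set Φ : Formal μ d := Pi.single n φ with hΦ
  have hyΦ : (formEmb B M' (bandVec ω hω e) g y : Formal μ d) = Φ := by rw [hy, coe_fockSingle]
  have hfst : ⟪y.fst, x.fst⟫_ℂ = ⟪φ, mat (M.conjTranspose * M) Ψ n⟫_ℂ := by
    rw [y.fst_eq hM, x.fst_eq hM, inner_matL_left, hy, inner_fockSingle_left]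
    congr 1
    rw [coe_matL, coe_matL, ← mat_mul, hx]
  set w : ∀ m, Lp (Spin d) 2 (powMeasure μ m) := Pi.single n W with hw
  have hwm : ∀ m, MulBy (fun k => ∑ i, ω (k i)) (Φ m : Lp (Spin d) 2 (powMeasure μ m)) (w m) := by
    intro m
    by_cases hm : m = n
    · subst hm
      rw [hΦ, hw, Pi.single_eq_same, Pi.single_eq_same]; exact hW
    · rw [hΦ, hw, Pi.single_eq_of_ne hm, Pi.single_eq_of_ne hm]; exact MulBy.zero
  have hFm : ∀ m, ∃ F : Lp (Spin d) 2 (powMeasure μ (m + 1)),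
      MulBy (fun k => ω (k 0)) (Φ (m + 1) : Lp (Spin d) 2 (powMeasure μ (m + 1))) F := by
    intro m
    by_cases hm : m + 1 = n
    · exact hF m hm.symm
    · refine ⟨0, ?_⟩
      rw [hΦ, Pi.single_eq_of_ne hm]; exact MulBy.zero
  obtain ⟨u, hu⟩ : ∃ u : ℕ → ℂ, u = fun m => ⟪w m, (Ψ m : Lp (Spin d) 2 (powMeasure μ m))⟫_ℂ
    + ⟪Φ m, creSum B f Ψ m⟫_ℂ := ⟨_, rfl⟩
  obtain ⟨v, hv⟩ : ∃ v : ℕ → ℂ, v = fun m => ⟪Φ m, annSum B f Ψ m⟫_ℂ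
    + ⟪Φ m, mat (crossMatrix B f g) Ψ m⟫_ℂ := ⟨_, rfl⟩
  have hS : ∀ m, ∑' a, ⟪y.snd a m, x.snd a m⟫_ℂ = u (m + 1) + v m := fun m => by
    obtain ⟨F, hF⟩ := hFm m
    have h1 := mulBy_frameVec (B := B) hgf Φ m hF
    rw [← hyΦ] at h1
    rw [tsum_inner_snd e hpos y x m h1, hx, hyΦ, inner_frameVec hgf Φ Ψ m hF (hwm (m + 1)), hu, hv]
  have hun : ∀ m, m ≠ n → u m = 0 := fun m hm => by
    simp only [hu, hw, hΦ, Pi.single_eq_of_ne hm, inner_zero_left, add_zero]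
  have hvn : ∀ m, m ≠ n → v m = 0 := fun m hm => by
    simp only [hv, hΦ, Pi.single_eq_of_ne hm, inner_zero_left, add_zero]
  -- Without bosons the sum of the `ω(kᵢ)` is empty and nothing can have been created.
  have hu0 : u 0 = 0 := by
    have h1 : w 0 = 0 := by
      refine Lp.ext ?_
      refine EventuallyEq.trans (hwm 0) ?_
      filter_upwards [Lp.coeFn_zero (Spin d) 2 (powMeasure μ 0)] with k hk
      rw [hk]; simp
    simp only [hu, h1, creSum_apply_zero, inner_zero_left, inner_zero_right, add_zero]
  -- The frame sum at boson number `m` contributes `u (m + 1) + v m`. Since `u 0 = 0`, the shift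
  -- loses nothing, and only the terms `u n` and `v n` survive.
  have hsu : HasSum (fun m => u (m + 1)) (u n) := by
    have h1 := (hasSum_nat_add_iff' 1).2 (hasSum_single n hun)
    simpa [hu0] using h1
  have hsum := lp_lp_hasSum_inner (E := fun n => Sector μ d n) y.snd x.snd
  simp only [hS] at hsum
  rw [FormDom.inner_def, hfst, hsum.unique (hsu.add (hasSum_single n hvn))]
  simp only [hu, hv, hw, hΦ, Pi.single_eq_same]

end RegularForm

/-! ### The regular Hamiltonian -/

section Graphs

variable {E : Type*} [NormedAddCommGroup E] [InnerProductSpace ℂ E]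

theorem mem_graph_add {f g : E →ₗ.[ℂ] E} {x a b : E} (ha : (x, a) ∈ f.graph)
    (hb : (x, b) ∈ g.graph) : (x, a + b) ∈ (f + g).graph := by
  obtain ⟨y, rfl, rfl⟩ := (LinearPMap.mem_graph_iff f).1 ha
  obtain ⟨⟨z, hz⟩, h, rfl⟩ := (LinearPMap.mem_graph_iff g).1 hb
  obtain rfl : z = y := h
  exact (LinearPMap.mem_graph_iff _).2 ⟨⟨y, y.2, hz⟩, rfl, rfl⟩

theorem mem_graph_sub {f g : E →ₗ.[ℂ] E} {x a b : E} (ha : (x, a) ∈ f.graph)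
    (hb : (x, b) ∈ g.graph) : (x, a - b) ∈ (f - g).graph := by
  obtain ⟨y, rfl, rfl⟩ := (LinearPMap.mem_graph_iff f).1 ha
  obtain ⟨⟨z, hz⟩, h, rfl⟩ := (LinearPMap.mem_graph_iff g).1 hb
  obtain rfl : z = y := h
  exact (LinearPMap.mem_graph_iff _).2 ⟨⟨y, y.2, hz⟩, rfl, rfl⟩

theorem mem_graph_sum {J : Type*} (s : Finset J) {f : J → E →ₗ.[ℂ] E} {x : E} {a : J → E}
    (h : ∀ j, (x, a j) ∈ (f j).graph) : (x, ∑ j ∈ s, a j) ∈ (∑ j ∈ s, f j).graph := by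
  classical
  induction s using Finset.induction_on with
  | empty =>
    rw [Finset.sum_empty, Finset.sum_empty]
    exact (LinearPMap.mem_graph_iff _).2 ⟨⟨x, trivial⟩, rfl, rfl⟩
  | insert j s hj ih =>
    rw [Finset.sum_insert hj, Finset.sum_insert hj]
    exact mem_graph_add (h j) ih

theorem isFormalAdjoint_add {f f' g g' : E →ₗ.[ℂ] E} (h : f.IsFormalAdjoint f')
    (h' : g.IsFormalAdjoint g') : (f + g).IsFormalAdjoint (f' + g') := fun x y => by
  have h1 := h ⟨x, x.2.1⟩ ⟨y, y.2.1⟩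
  have h2 := h' ⟨x, x.2.2⟩ ⟨y, y.2.2⟩
  change ⟪(f ⟨x, x.2.1⟩ + g ⟨x, x.2.2⟩ : E), (y : E)⟫_ℂ
    = ⟪(x : E), f' ⟨y, y.2.1⟩ + g' ⟨y, y.2.2⟩⟫_ℂ
  rw [inner_add_left, inner_add_right]
  exact congrArg₂ _ h1 h2

theorem isFormalAdjoint_sub {f f' g g' : E →ₗ.[ℂ] E} (h : f.IsFormalAdjoint f')
    (h' : g.IsFormalAdjoint g') : (f - g).IsFormalAdjoint (f' - g') := fun x y => by
  have h1 := h ⟨x, x.2.1⟩ ⟨y, y.2.1⟩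
  have h2 := h' ⟨x, x.2.2⟩ ⟨y, y.2.2⟩
  change ⟪(f ⟨x, x.2.1⟩ - g ⟨x, x.2.2⟩ : E), (y : E)⟫_ℂ
    = ⟪(x : E), f' ⟨y, y.2.1⟩ - g' ⟨y, y.2.2⟩⟫_ℂ
  rw [inner_sub_left, inner_sub_right]
  exact congrArg₂ _ h1 h2

theorem isFormalAdjoint_sum {J : Type*} (s : Finset J) {f f' : J → E →ₗ.[ℂ] E}
    (h : ∀ j, (f j).IsFormalAdjoint (f' j)) :
    (∑ j ∈ s, f j).IsFormalAdjoint (∑ j ∈ s, f' j) := by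
  classical
  induction s using Finset.induction_on with
  | empty =>
    rw [Finset.sum_empty, Finset.sum_empty]
    intro x y
    change ⟪(0 : E), (y : E)⟫_ℂ = ⟪(x : E), (0 : E)⟫_ℂ
    rw [inner_zero_left, inner_zero_right]
  | insert j s hj ih =>
    rw [Finset.sum_insert hj, Finset.sum_insert hj]
    exact isFormalAdjoint_add (h j) ih

/-- A symmetric operator `A` such that `(A + c) R = 1` is equal to `R⁻¹ - c`. -/
theorem hasShiftedInverse_of_isFormalAdjoint {A : E →ₗ.[ℂ] E} (hA : A.IsFormalAdjoint A) {c : ℝ}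
    {R : E →L[ℂ] E} (hR : ∀ η, (R η, η - (c : ℂ) • R η) ∈ A.graph) : HasShiftedInverse A c R := by
  intro ψ η
  constructor
  · intro h
    -- The difference `δ` satisfies `(A + c) δ = 0`. By symmetry of `A`, pairing with `R δ` gives `0
    -- = ⟨δ, (A + c) R δ⟩ = ⟨δ, δ⟩`.
    have h1 := A.graph.sub_mem h (hR (η + (c : ℂ) • ψ))
    obtain ⟨δ, hδ⟩ : ∃ δ, δ = ψ - R (η + (c : ℂ) • ψ) := ⟨_, rfl⟩
    have h2 : (δ, -((c : ℂ) • δ)) ∈ A.graph := by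
      convert h1 using 1
      refine Prod.ext hδ ?_
      change -((c : ℂ) • δ) = η - (η + (c : ℂ) • ψ - (c : ℂ) • R (η + (c : ℂ) • ψ))
      rw [hδ, smul_sub]; abel
    obtain ⟨y, hy1, hy2⟩ := (LinearPMap.mem_graph_iff A).1 h2
    obtain ⟨z, hz1, hz2⟩ := (LinearPMap.mem_graph_iff A).1 (hR δ)
    have h3 := hA y z
    simp only at hy1 hy2 hz1 hz2
    rw [hy1, hy2, hz1, hz2, inner_neg_left, inner_smul_left, Complex.conj_ofReal, inner_sub_right,
      inner_smul_right] at h3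
    have h4 : ⟪δ, δ⟫_ℂ = 0 := by linear_combination -h3
    exact sub_eq_zero.1 (hδ.symm.trans (inner_self_eq_zero.1 h4))
  · intro h
    have h1 := hR (η + (c : ℂ) • ψ)
    rw [← h] at h1
    convert h1 using 2
    abel

end Graphs

/-! ### Symmetry and shifted inverse of the cut-off Hamiltonian -/

section Regular

variable {X : Type*} [MeasurableSpace X] {μ : Measure X} [SigmaFinite μ] {d N : ℕ} {ι : Type*}

theorem mem_graph_maxOp {L : Formal μ d →ₗ[ℂ] Formal μ d} {ψ η : Fock μ d}
    (h : (η : Formal μ d) = L ψ) : (ψ, η) ∈ (maxOp L).graph :=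
  (LinearPMap.mem_graph_iff _).2 ⟨⟨ψ, by
    change Memℓp (L (ψ : Formal μ d)) 2
    rw [← h]; exact lp.memℓp η⟩, rfl, lp.ext h.symm⟩

theorem isFormalAdjoint_maxOp_mat {K : Matrix (Fin d) (Fin d) ℂ} (hK : K.IsHermitian) :
    (maxOp (mat (μ := μ) K)).IsFormalAdjoint (maxOp (mat K)) := fun x y => by
  have h : ∀ z : (maxOp (mat (μ := μ) K)).domain, maxOp (mat K) z = matL K z := fun z =>
    lp.ext (coe_matL K z.1).symm
  rw [h, h, inner_matL_left, hK.eq]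

theorem isFormalAdjoint_dGamma (ω : X → ℝ) :
    (dGamma μ d ω).IsFormalAdjoint (dGamma μ d ω) := fun x y => by
  have hx := (mem_dGamma_graph ω _).1 (LinearPMap.mem_graph (dGamma μ d ω) x)
  have hy := (mem_dGamma_graph ω _).1 (LinearPMap.mem_graph (dGamma μ d ω) y)
  rw [lp.inner_eq_tsum, lp.inner_eq_tsum]
  refine tsum_congr fun n => ?_
  rw [Submodule.coe_inner, Submodule.coe_inner]
  exact MulBy.inner_comm (W := fun k : Fin n → X => ∑ i, ω (k i)) (hx n) (hy n)

/-- Sector by sector the two operators are adjoint. The created vector has no zero-boson component,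
so the sum may be shifted by one. -/
theorem isFormalAdjoint_mat_cre (M : Matrix (Fin d) (Fin d) ℂ) (f : Lp ℂ 2 μ) :
    (maxOp (mat M ∘ₗ cre f)).IsFormalAdjoint (maxOp (mat M.conjTranspose ∘ₗ ann f)) := fun x y => by
  obtain ⟨u, hu⟩ : ∃ u : Fock μ d, u = maxOp (mat M ∘ₗ cre f) x := ⟨_, rfl⟩
  obtain ⟨v, hv⟩ : ∃ v : Fock μ d, v = maxOp (mat M.conjTranspose ∘ₗ ann f) y := ⟨_, rfl⟩
  have hu' : (u : Formal μ d) = mat M (cre f (x : Fock μ d)) := by rw [hu]; rfl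
  have hv' : (v : Formal μ d) = mat M.conjTranspose (ann f (y : Fock μ d)) := by rw [hv]; rfl
  rw [← hu, ← hv]
  have h1 := lp.hasSum_inner (𝕜 := ℂ) (G := fun n => Sector μ d n) u y
  have h2 := lp.hasSum_inner (𝕜 := ℂ) (G := fun n => Sector μ d n) x v
  have h0 : ⟪u 0, (y : Fock μ d) 0⟫_ℂ = 0 := by
    rw [hu', mat_apply, cre_apply_zero, map_zero, inner_zero_left]
  have h3 : HasSum (fun n => ⟪u (n + 1), (y : Fock μ d) (n + 1)⟫_ℂ) ⟪u, (y : Fock μ d)⟫_ℂ := by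
    have := (hasSum_nat_add_iff' 1).2 h1
    rwa [Finset.sum_range_one, h0, sub_zero] at this
  refine h3.unique (h2.congr_fun fun n => ?_)
  rw [hu', hv', mat_apply, cre_apply_succ, mat_apply, ann_apply, inner_matSector_left,
    matSector_annSector, annSector, ContinuousLinearMap.adjoint_inner_right]

theorem summable_succ_mul_norm_sq {Ψ : Fock μ d} (h : Summable fun n : ℕ => n * ‖Ψ n‖ ^ 2) :
    Summable fun n : ℕ => ((n : ℝ) + 1) * ‖Ψ n‖ ^ 2 := by
  refine (h.add (lp_hasSum_norm_sq (E := fun n => Sector μ d n) Ψ).summable).congr fun n => ?_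
  ring

/-- A vector with finite expected boson number is in the domain of every creation operator, as
`‖a^*(f) ψ‖² ≤ (n + 1) ‖f‖² ‖ψ‖²` on `n`-boson vectors. -/
theorem memℓp_mat_cre (M : Matrix (Fin d) (Fin d) ℂ) (f : Lp ℂ 2 μ) {Ψ : Fock μ d}
    (h : Summable fun n : ℕ => n * ‖Ψ n‖ ^ 2) : Memℓp (mat M (cre f Ψ)) 2 := by
  refine (memℓp_two_iff (E := fun n => Sector μ d n)).2 ((summable_nat_add_iff 1).1 ?_)
  refine Summable.of_nonneg_of_le (fun n => sq_nonneg _) (fun n => ?_)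
    ((summable_succ_mul_norm_sq h).mul_left ((matNorm M * ‖f‖) ^ 2))
  have h1 : ‖mat M (cre f Ψ) (n + 1)‖ ≤ matNorm M * (Real.sqrt (n + 1) * ‖f‖ * ‖Ψ n‖) := by
    rw [mat_apply, cre_apply_succ]
    exact (norm_matSector_le M _ _).trans
      (mul_le_mul_of_nonneg_left (norm_creSector_le f n _) (matNorm_nonneg M))
  refine (pow_le_pow_left₀ (norm_nonneg _) h1 2).trans (le_of_eq ?_)
  have h2 : Real.sqrt (n + 1) ^ 2 = (n : ℝ) + 1 := Real.sq_sqrt (by positivity)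
  linear_combination (matNorm M * ‖f‖ * ‖Ψ n‖) ^ 2 * h2

theorem memℓp_mat_ann (M : Matrix (Fin d) (Fin d) ℂ) (f : Lp ℂ 2 μ) {Ψ : Fock μ d}
    (h : Summable fun n : ℕ => n * ‖Ψ n‖ ^ 2) : Memℓp (mat M (ann f Ψ)) 2 := by
  refine (memℓp_two_iff (E := fun n => Sector μ d n)).2 ?_
  refine Summable.of_nonneg_of_le (fun n => sq_nonneg _) (fun n => ?_)
    (((summable_nat_add_iff 1).2 h).mul_left ((matNorm M * ‖f‖) ^ 2))
  have h1 : ‖mat M (ann f Ψ) n‖ ≤ matNorm M * (Real.sqrt (n + 1) * ‖f‖ * ‖Ψ (n + 1)‖) := by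
    rw [mat_apply, ann_apply]
    exact (norm_matSector_le M _ _).trans
      (mul_le_mul_of_nonneg_left (norm_annSector_le f n _) (matNorm_nonneg M))
  refine (pow_le_pow_left₀ (norm_nonneg _) h1 2).trans (le_of_eq ?_)
  have h2 : Real.sqrt (n + 1) ^ 2 = (n : ℝ) + 1 := Real.sq_sqrt (by positivity)
  push_cast
  linear_combination (matNorm M * ‖f‖ * ‖Ψ (n + 1)‖) ^ 2 * h2

variable {B : Fin N → Matrix (Fin d) (Fin d) ℂ} {g f : Fin N → Lp ℂ 2 μ} {ω : X → ℝ} {m : ℝ}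

/-- The integral of `conj(fⱼ) fⱼ' / ω` is `⟨fⱼ, gⱼ'⟩`. So subtracting the self-energy supplies
exactly the term that completes the square. -/
theorem selfEnergy_eq (hm : 0 < m) (hpos : ∀ᵐ x ∂μ, m ≤ ω x) (hgf : ∀ j, MulBy ω (g j) (f j)) :
    selfEnergy ω B f = -crossMatrix B f g := by
  rw [selfEnergy, crossMatrix]
  congr 1
  refine Finset.sum_congr rfl fun j _ => Finset.sum_congr rfl fun j' _ => ?_
  congr 1
  rw [L2.inner_def]
  refine integral_congr_ae ?_
  filter_upwards [hpos, hgf j'] with k h1 h2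
  have h3 : (ω k : ℂ) ≠ 0 := Complex.ofReal_ne_zero.2 (hm.trans_le h1).ne'
  rw [h2, RCLike.inner_apply, smul_eq_mul]
  field_simp

theorem isHermitian_crossMatrix (hgf : ∀ j, MulBy ω (g j) (f j)) :
    (crossMatrix B f g).IsHermitian := by
  rw [Matrix.IsHermitian, crossMatrix, Matrix.conjTranspose_sum, Finset.sum_comm]
  simp only [Matrix.conjTranspose_sum]
  rw [Finset.sum_comm, Finset.sum_comm]
  refine Finset.sum_congr rfl fun j _ => Finset.sum_congr rfl fun j' _ => ?_
  rw [Matrix.conjTranspose_smul, Matrix.conjTranspose_mul, Matrix.conjTranspose_conjTranspose]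
  congr 1
  rw [(hgf j').inner_comm (hgf j)]
  exact inner_conj_symm _ _

theorem isFormalAdjoint_regularHamiltonian {K : Matrix (Fin d) (Fin d) ℂ} (hK : K.IsHermitian)
    (hm : 0 < m) (hpos : ∀ᵐ x ∂μ, m ≤ ω x) (hgf : ∀ j, MulBy ω (g j) (f j)) :
    (regularHamiltonian ω K B f - maxOp (mat (selfEnergy ω B f))).IsFormalAdjoint
      (regularHamiltonian ω K B f - maxOp (mat (selfEnergy ω B f))) := by
  refine isFormalAdjoint_sub (isFormalAdjoint_add (isFormalAdjoint_add
    (isFormalAdjoint_maxOp_mat hK) (isFormalAdjoint_dGamma ω))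
    (isFormalAdjoint_sum _ fun j => ?_)) (isFormalAdjoint_maxOp_mat ?_)
  · have h := isFormalAdjoint_mat_cre (B j) (f j)
    have h1 := isFormalAdjoint_add h h.symm
    rwa [add_comm (maxOp (mat (B j).conjTranspose ∘ₗ ann (f j)))] at h1
  · rw [selfEnergy_eq hm hpos hgf]
    exact (isHermitian_crossMatrix hgf).neg

theorem memLp_sqrt_smul_of_mulBy (hω : Measurable ω) (hm : 0 < m) (hpos : ∀ᵐ x ∂μ, m ≤ ω x)
    {u v : Lp ℂ 2 μ} (h : MulBy ω u v) : MemLp (fun x => (Real.sqrt (ω x) : ℂ) • u x) 2 μ := by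
  have hmeas : AEStronglyMeasurable (fun x => (Real.sqrt (ω x) : ℂ) • u x) μ :=
    (Complex.measurable_ofReal.comp hω.sqrt).aestronglyMeasurable.smul (Lp.aestronglyMeasurable u)
  refine (Lp.memLp v).of_le_mul (c := (Real.sqrt m)⁻¹) hmeas ?_
  filter_upwards [h, hpos] with x h1 h2
  have h3 : 0 ≤ ω x := hm.le.trans h2
  have h4 : 0 < Real.sqrt m := Real.sqrt_pos.2 hm
  have h5 : Real.sqrt m ≤ Real.sqrt (ω x) := Real.sqrt_le_sqrt h2
  rw [h1, norm_smul, norm_smul, Complex.norm_real, Complex.norm_real,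
    Real.norm_of_nonneg (Real.sqrt_nonneg _), Real.norm_of_nonneg h3, ← mul_assoc]
  refine mul_le_mul_of_nonneg_right ?_ (norm_nonneg _)
  rw [le_inv_mul_iff₀ h4]
  calc Real.sqrt m * Real.sqrt (ω x) ≤ Real.sqrt (ω x) * Real.sqrt (ω x) :=
        mul_le_mul_of_nonneg_right h5 (Real.sqrt_nonneg _)
    _ = ω x := Real.mul_self_sqrt h3

/-- `u` is in the form domain of `ω` if `ω u` is square integrable. -/
theorem summable_bandVec_of_mulBy (hω : Measurable ω) (hm : 0 < m) (hpos : ∀ᵐ x ∂μ, m ≤ ω x)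
    (e : HilbertBasis ι ℂ (Lp ℂ 2 μ)) {u v : Lp ℂ 2 μ} (h : MulBy ω u v) :
    Summable fun a => ‖⟪bandVec ω hω e a, u⟫_ℂ‖ ^ 2 :=
  (summable_bandVec hω (hpos.mono fun _ hx => hm.le.trans hx) e
    (memLp_sqrt_smul_of_mulBy hω hm hpos h).coeFn_toLp).1

variable {M M' : Matrix (Fin d) (Fin d) ℂ} {hω : Measurable ω}

/-- The weak equation satisfied by the resolvent of the form, sector by sector. -/
theorem mulBy_of_inner_formDom (hm : 0 < m) (hpos : ∀ᵐ x ∂μ, m ≤ ω x)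
    (e : HilbertBasis ι ℂ (Lp ℂ 2 μ)) (hM : M * M' = 1) (hM' : M' * M = 1)
    (hgf : ∀ j, MulBy ω (g j) (f j)) (x : FormDom B M' (bandVec ω hω e) g) {n : ℕ}
    {ψ : Formal μ d} (hψ : (formEmb B M' (bandVec ω hω e) g x : Fock μ d) = ψ) {η ζ : Sector μ d n}
    (hx : ∀ (y : FormDom B M' (bandVec ω hω e) g) (R : ℕ),
      ∀ φ ∈ prodSet (Set.range ((cut ω hω R).op ℂ μ)) n,
      formEmb B M' (bandVec ω hω e) g y = fockSingle n φ → ⟪y, x⟫_ℂ = ⟪φ, η⟫_ℂ)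
    (hζ : ζ = η - mat (M.conjTranspose * M) ψ n - creSum B f ψ n - annSum B f ψ n
      - mat (crossMatrix B f g) ψ n) :
    MulBy (fun k => ∑ i, ω (k i)) (ψ n : Lp (Spin d) 2 (powMeasure μ n)) ζ := by
  have hpos' : ∀ᵐ x ∂μ, 0 ≤ ω x := hpos.mono fun x hx => hm.le.trans hx
  refine mulBy_of_forall_cut hω hpos' fun R φ hφ φ₀ hφ₀ => ?_
  obtain ⟨y, hy⟩ := exists_formDom_single (B := B) (g := g) hM'
    (fun j => summable_bandVec_of_mulBy hω hm hpos e (hgf j))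
    (inForm_of_mem_prodSet (fun u hu => summable_bandVec_cut hω hpos' e hu) hφ)
  -- Because the test vector is cut off, both its product with `∑ᵢ ω(kᵢ)` and its product with
  -- `ω(k₀)` are square integrable, so the form can be evaluated on it.
  have hW := mulBy_sumCut hω hpos' R n (φ₀ : Lp (Spin d) 2 (powMeasure μ n))
  rw [← hφ₀] at hW
  have h1 := inner_formDom_single e hpos' hM hgf (fun k hk => by
    subst hk
    rw [Pi.single_eq_same, hφ₀]
    exact ⟨_, mulBy_cutMul hω hpos' R k 0 _⟩) hW hy x hψ
  have h2 := (hx y R φ hφ hy).symm.trans h1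
  rw [hζ, inner_sub_right, inner_sub_right, inner_sub_right, inner_sub_right]
  linear_combination -h2

/-- The operator is symmetric, so it is enough that `A + c` maps `π π^* η` back to `η`. The weak
form equation gives this sector by sector, and the number bound ensures that each summand of `A` is
separately defined on `π π^* η`. -/
theorem hasShiftedInverse_regularHamiltonian {K : Matrix (Fin d) (Fin d) ℂ} (hK : K.IsHermitian)
    {c : ℝ} (hm : 0 < m) (hpos : ∀ᵐ x ∂μ, m ≤ ω x) (e : HilbertBasis ι ℂ (Lp ℂ 2 μ))
    (hM : M * M' = 1) (hM' : M' * M = 1) (hMK : M.conjTranspose * M = K + (c : ℂ) • 1)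
    (hgf : ∀ j, MulBy ω (g j) (f j)) :
    HasShiftedInverse (regularHamiltonian ω K B f - maxOp (mat (selfEnergy ω B f))) c
      (formResolvent (formEmb B M' (bandVec ω hω e) g)) := by
  refine hasShiftedInverse_of_isFormalAdjoint
    (isFormalAdjoint_regularHamiltonian hK hm hpos hgf) fun η => ?_
  obtain ⟨x, hx⟩ : ∃ x, x = ContinuousLinearMap.adjoint (formEmb B M' (bandVec ω hω e) g) η :=
    ⟨_, rfl⟩
  obtain ⟨ψ, hψ⟩ : ∃ ψ, ψ = formEmb B M' (bandVec ω hω e) g x := ⟨_, rfl⟩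
  have hR : formResolvent (formEmb B M' (bandVec ω hω e) g) η = ψ := by
    rw [hψ, hx]; rfl
  rw [hR]
  -- The positive boson mass enters here through `sum_number_le`.
  have hnum : Summable fun n : ℕ => n * ‖ψ n‖ ^ 2 := by
    rw [hψ]
    exact summable_of_sum_range_le (fun n => by positivity) (sum_number_le hm hpos e x)
  obtain ⟨b, hb⟩ : ∃ b : Fin N → Fock μ d, ∀ j, (b j : Formal μ d) = mat (B j) (cre (f j) ψ) :=
    ⟨fun j => ⟨_, memℓp_mat_cre (B j) (f j) hnum⟩, fun j => rfl⟩
  obtain ⟨a, ha⟩ : ∃ a : Fin N → Fock μ d, ∀ j,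
      (a j : Formal μ d) = mat (B j).conjTranspose (ann (f j) ψ) :=
    ⟨fun j => ⟨_, memℓp_mat_ann (B j).conjTranspose (f j) hnum⟩, fun j => rfl⟩
  -- What `dΓ(ω) ψ` has to be. It is a Fock vector by construction, so the sectorwise identity
  -- places `ψ` in the domain of `dΓ(ω)`.
  obtain ⟨ζ, hζ⟩ : ∃ ζ : Fock μ d, ζ = η - matL (M.conjTranspose * M) ψ - ∑ j, b j - ∑ j, a j
    - matL (crossMatrix B f g) ψ := ⟨_, rfl⟩
  have hb' : ∀ n, (∑ j, b j : Fock μ d) n = creSum B f ψ n := fun n => by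
    rw [lp.coeFn_sum, creSum]
    simp only [hb]
  have ha' : ∀ n, (∑ j, a j : Fock μ d) n = annSum B f ψ n := fun n => by
    rw [lp.coeFn_sum, annSum]
    simp only [ha]
  have hdG : (ψ, ζ) ∈ (dGamma μ d ω).graph := by
    refine (mem_dGamma_graph ω _).2 fun n => ?_
    refine mulBy_of_inner_formDom hm hpos e hM hM' hgf x (ψ := ψ) (by rw [hψ]) (η := η n)
      (fun y R φ _ hy => ?_) ?_
    · rw [hx, ContinuousLinearMap.adjoint_inner_right, hy, inner_fockSingle_left]
    · rw [← hb', ← ha', ← coe_matL, ← coe_matL, hζ]; rfl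
  have hmain := mem_graph_sub (mem_graph_add (mem_graph_add
    (mem_graph_maxOp (coe_matL K ψ)) hdG) (mem_graph_sum Finset.univ fun j =>
      mem_graph_add (mem_graph_maxOp (L := mat (B j) ∘ₗ cre (f j)) (hb j))
        (mem_graph_maxOp (L := mat (B j).conjTranspose ∘ₗ ann (f j)) (ha j))))
    (mem_graph_maxOp (coe_matL (selfEnergy ω B f) ψ))
  have hE : matL (selfEnergy ω B f) ψ = -matL (crossMatrix B f g) ψ := by
    refine lp.ext ?_
    change (matL (selfEnergy ω B f) ψ : Formal μ d) = -(matL (crossMatrix B f g) ψ : Formal μ d)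
    rw [coe_matL, coe_matL, selfEnergy_eq hm hpos hgf, ← neg_one_smul ℂ, mat_smul, neg_one_smul]
  have hKc : matL (M.conjTranspose * M) ψ = matL K ψ + (c : ℂ) • ψ := by
    refine lp.ext ?_
    change (matL (M.conjTranspose * M) ψ : Formal μ d)
      = (matL K ψ : Formal μ d) + (c : ℂ) • (ψ : Formal μ d)
    rw [coe_matL, coe_matL, hMK, mat_add, mat_smul, mat_one]
  have hfin : η - (c : ℂ) • ψ = matL K ψ + ζ + ∑ j, (b j + a j) - matL (selfEnergy ω B f) ψ := by
    rw [hE, hζ, hKc, Finset.sum_add_distrib]; abel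
  rw [hfin]
  exact hmain

end Regular

/-! ### The test domain -/

section TestDomain

variable {X : Type*} [MeasurableSpace X] {μ : Measure X} [SigmaFinite μ] {d N : ℕ} {ι : Type*}

/-- The span of the dressed test vectors, as formal vectors. -/
def formalDomain (e : ι → Lp ℂ 2 μ) (B : Fin N → Matrix (Fin d) (Fin d) ℂ)
    (g : Fin N → Lp ℂ 2 μ) : Submodule ℂ (Formal μ d) :=
  Submodule.span ℂ {Ψ | ∃ (l : List ι) (v : Spin d), Ψ = testVector e B g l v}

theorem numPow_single (r : ℝ) (n : ℕ) (φ : Sector μ d n) :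
    numPow r (Pi.single n φ : Formal μ d) = (r : ℂ) ^ n • (Pi.single n φ : Formal μ d) := by
  funext k
  rw [numPow_apply, Pi.smul_apply]
  by_cases h : k = n
  · subst h; rfl
  · rw [Pi.single_eq_of_ne h, smul_zero, smul_zero]

/-- On a fixed number of bosons `r^N` is the scalar `r^n`. Hence the unbounded dressing of such a
vector is a multiple of its image under a bounded operator. -/
theorem exists_coe_dressing_single (B : Fin N → Matrix (Fin d) (Fin d) ℂ) (g : Fin N → Lp ℂ 2 μ)
    (n : ℕ) (φ : Sector μ d n) {r : ℝ} (hr : r ∈ Set.Ioo (0 : ℝ) 1) :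
    (((r : ℂ) ^ n)⁻¹ • dressL B g hr (fockSingle n φ) : Fock μ d)
      = dressing B g (Pi.single n φ : Formal μ d) := by
  change ((r : ℂ) ^ n)⁻¹ • (dressL B g hr (fockSingle n φ) : Formal μ d) = _
  rw [coe_dressL, dressPow_apply, coe_fockSingle, numPow_single, map_smul, smul_smul,
    inv_mul_cancel₀ (pow_ne_zero _ (Complex.ofReal_ne_zero.2 hr.1.ne')), one_smul]

theorem memℓp_dressing_single (B : Fin N → Matrix (Fin d) (Fin d) ℂ) (g : Fin N → Lp ℂ 2 μ)
    (n : ℕ) (φ : Sector μ d n) : Memℓp (dressing B g (Pi.single n φ : Formal μ d)) 2 := by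
  rw [← exists_coe_dressing_single B g n φ (r := 1 / 2) (by norm_num)]
  exact lp.memℓp _

/-- The `a^*(e i)` commute with the dressing, so a test vector is `T` applied to an ordinary
product. -/
theorem exists_testVector_eq (e : ι → Lp ℂ 2 μ) (B : Fin N → Matrix (Fin d) (Fin d) ℂ)
    (g : Fin N → Lp ℂ 2 μ) (l : List ι) (v : Spin d) :
    ∃ φ : Sector μ d l.length,
      testVector e B g l v = dressing B g (Pi.single l.length φ : Formal μ d) := by
  induction l with
  | nil => exact ⟨_, rfl⟩
  | cons i l ih =>
    obtain ⟨φ, h⟩ := ih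
    refine ⟨creSector (e i) l.length φ, ?_⟩
    change cre (e i) (testVector e B g l v) = _
    rw [h, cre_dressing, cre_single]; rfl

/-- `X^0` is a single point, so every zero-boson vector is constant. -/
theorem exists_vacuum_eq (φ : Sector μ d 0) : ∃ v, vacuum μ d v = Pi.single 0 φ := by
  obtain ⟨f, hf⟩ : ∃ f : (Fin 0 → X) → Spin d, f = (φ : Lp (Spin d) 2 (powMeasure μ 0)) := ⟨_, rfl⟩
  refine ⟨f (fun i => i.elim0), ?_⟩
  rw [vacuum]
  congr 1
  refine Subtype.ext (Lp.ext ?_)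
  have hfin : IsFiniteMeasure (powMeasure μ 0) := by
    rw [powMeasure, Measure.pi_of_empty]; infer_instance
  refine EventuallyEq.trans (MemLp.coeFn_toLp (memLp_const (f fun i => i.elim0))) ?_
  rw [← hf]
  refine .of_forall fun k => ?_
  rw [Subsingleton.elim k (fun i => i.elim0)]

theorem dressing_single_mem_formalDomain (e : ι → Lp ℂ 2 μ) (B : Fin N → Matrix (Fin d) (Fin d) ℂ)
    (g : Fin N → Lp ℂ 2 μ) {n : ℕ} {φ : Sector μ d n} (hφ : φ ∈ prodSet (Set.range e) n) :
    dressing B g (Pi.single n φ : Formal μ d) ∈ formalDomain e B g := by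
  suffices h : ∃ (l : List ι) (v : Spin d),
      dressing B g (Pi.single n φ : Formal μ d) = testVector e B g l v from Submodule.subset_span h
  induction n with
  | zero =>
    obtain ⟨v, hv⟩ := exists_vacuum_eq φ
    exact ⟨[], v, by rw [← hv]; rfl⟩
  | succ n ih =>
    obtain ⟨_, ⟨i, rfl⟩, ψ, hψ, rfl⟩ := hφ
    obtain ⟨l, v, h⟩ := ih hψ
    refine ⟨i :: l, v, ?_⟩
    change _ = cre (e i) (testVector e B g l v)
    rw [← h, cre_dressing, cre_single]

theorem memℓp_testVector (e : ι → Lp ℂ 2 μ) (B : Fin N → Matrix (Fin d) (Fin d) ℂ)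
    (g : Fin N → Lp ℂ 2 μ) (l : List ι) (v : Spin d) : Memℓp (testVector e B g l v) 2 := by
  obtain ⟨φ, h⟩ := exists_testVector_eq e B g l v
  rw [h]
  exact memℓp_dressing_single B g _ φ

/-- `2^N` only rescales the form factors of the dressing. Test vectors therefore decay exponentially
in the boson number, which gives the moment needed to apply creation operators to them. -/
theorem exists_coe_numPow_of_mem_formalDomain {e : ι → Lp ℂ 2 μ}
    {B : Fin N → Matrix (Fin d) (Fin d) ℂ} {g : Fin N → Lp ℂ 2 μ} {Ψ : Formal μ d}
    (h : Ψ ∈ formalDomain e B g) : ∃ Φ : Fock μ d, (Φ : Formal μ d) = numPow 2 Ψ := by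
  induction h using Submodule.span_induction with
  | mem Ψ h =>
    obtain ⟨l, v, rfl⟩ := h
    obtain ⟨φ, h⟩ := exists_testVector_eq e B g l v
    rw [h, numPow_dressing, numPow_single, map_smul]
    exact ⟨(((2 : ℝ) : ℂ) ^ l.length) • ⟨_, memℓp_dressing_single B _ _ φ⟩, rfl⟩
  | zero => exact ⟨0, (map_zero _).symm⟩
  | add Ψ Ψ' _ _ h h' =>
    obtain ⟨Φ, hΦ⟩ := h
    obtain ⟨Φ', hΦ'⟩ := h'
    refine ⟨Φ + Φ', ?_⟩
    change (Φ : Formal μ d) + (Φ' : Formal μ d) = _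
    rw [hΦ, hΦ', map_add]
  | smul c Ψ _ h =>
    obtain ⟨Φ, hΦ⟩ := h
    refine ⟨c • Φ, ?_⟩
    change c • (Φ : Formal μ d) = _
    rw [hΦ, map_smul]

theorem exists_coe_of_mem_formalDomain {e : ι → Lp ℂ 2 μ}
    {B : Fin N → Matrix (Fin d) (Fin d) ℂ} {g : Fin N → Lp ℂ 2 μ} {Ψ : Formal μ d}
    (h : Ψ ∈ formalDomain e B g) :
    ∃ Φ : Fock μ d, (Φ : Formal μ d) = Ψ ∧ Summable fun n : ℕ => n * ‖Φ n‖ ^ 2 := by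
  obtain ⟨Φ, hΦ⟩ := exists_coe_numPow_of_mem_formalDomain h
  have hn : ∀ n : ℕ, ‖Φ n‖ ^ 2 = 4 ^ n * ‖Ψ n‖ ^ 2 := fun n => by
    rw [hΦ, numPow_apply, sector_norm_smul, mul_pow, norm_pow, Complex.norm_real,
      Real.norm_of_nonneg zero_le_two, ← pow_mul, mul_comm n, pow_mul]
    norm_num
  have hs := (lp_hasSum_norm_sq (E := fun n => Sector μ d n) Φ).summable
  have h1 : Memℓp Ψ 2 := by
    refine (memℓp_two_iff (E := fun n => Sector μ d n)).2
      (hs.of_nonneg_of_le (fun _ => sq_nonneg _) fun n => ?_)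
    rw [hn]
    exact le_mul_of_one_le_left (sq_nonneg _) (one_le_pow₀ (by norm_num))
  refine ⟨⟨Ψ, h1⟩, rfl, hs.of_nonneg_of_le (fun _ => by positivity) fun n => ?_⟩
  rw [hn]
  refine mul_le_mul_of_nonneg_right ?_ (sq_nonneg _)
  exact_mod_cast (Nat.lt_pow_self (by norm_num : 1 < 4)).le

/-- All test vectors are square summable, so no generator is lost on restricting to the Hilbert
space. -/
theorem mem_testDomain_iff {e : ι → Lp ℂ 2 μ} {B : Fin N → Matrix (Fin d) (Fin d) ℂ}
    {g : Fin N → Lp ℂ 2 μ} {Ψ : Fock μ d} :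
    Ψ ∈ testDomain e B g ↔ (Ψ : Formal μ d) ∈ formalDomain e B g := by
  constructor
  · intro h
    induction h using Submodule.span_induction with
    | mem Ψ h => exact Submodule.subset_span h
    | zero => exact Submodule.zero_mem _
    | add Ψ Ψ' _ _ h h' => exact Submodule.add_mem _ h h'
    | smul c Ψ _ h => exact Submodule.smul_mem _ c h
  · intro h
    suffices h' : ∀ Φ ∈ formalDomain e B g, ∃ Ψ ∈ testDomain e B g, (Ψ : Formal μ d) = Φ by
      obtain ⟨Ψ', h1, h2⟩ := h' _ h
      obtain rfl : Ψ' = Ψ := lp.ext h2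
      exact h1
    intro Φ hΦ
    induction hΦ using Submodule.span_induction with
    | mem Φ h =>
      obtain ⟨l, v, rfl⟩ := h
      exact ⟨⟨_, memℓp_testVector e B g l v⟩, Submodule.subset_span ⟨l, v, rfl⟩, rfl⟩
    | zero => exact ⟨0, Submodule.zero_mem _, rfl⟩
    | add Φ Φ' _ _ h h' =>
      obtain ⟨Ψ, h1, h2⟩ := h
      obtain ⟨Ψ', h1', h2'⟩ := h'
      exact ⟨Ψ + Ψ', Submodule.add_mem _ h1 h1', by rw [← h2, ← h2']; rfl⟩
    | smul c Φ _ h =>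
      obtain ⟨Ψ, h1, h2⟩ := h
      exact ⟨c • Ψ, Submodule.smul_mem _ c h1, by rw [← h2]; rfl⟩

variable {e : ι → Lp ℂ 2 μ} {B : Fin N → Matrix (Fin d) (Fin d) ℂ} {g : Fin N → Lp ℂ 2 μ}

theorem cre_mem_formalDomain (i : ι) {Ψ : Formal μ d} (h : Ψ ∈ formalDomain e B g) :
    cre (e i) Ψ ∈ formalDomain e B g := by
  induction h using Submodule.span_induction with
  | mem Ψ h =>
    obtain ⟨l, v, rfl⟩ := h
    exact Submodule.subset_span ⟨i :: l, v, rfl⟩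
  | zero => rw [map_zero]; exact Submodule.zero_mem _
  | add Ψ Ψ' _ _ h h' => rw [map_add]; exact Submodule.add_mem _ h h'
  | smul c Ψ _ h => rw [map_smul]; exact Submodule.smul_mem _ c h

theorem annHat_cre (h u : Lp ℂ 2 μ) (Ψ : Formal μ d) :
    annHat B g h (cre u Ψ) = ⟪h, u⟫_ℂ • Ψ + cre u (annHat B g h Ψ) := by
  rw [annHat_eq, annHat_eq, ann_cre, map_add, shift_apply, shift_apply, map_sum, add_assoc]
  simp only [mat_cre, map_smul]

/-- The intertwining relation from form factor `0` to `g` with `r = 1`: `â(h) T = T a(h)`, and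
`a(h)` kills the vacuum. -/
theorem annHat_dressing_single_zero (hB : ∀ j j', Commute (B j) (B j')) (h : Lp ℂ 2 μ)
    (φ : Sector μ d 0) : annHat B g h (dressing B g (Pi.single 0 φ : Formal μ d)) = 0 := by
  have h1 := annHat_dressPow hB 0 g 1 h (Pi.single 0 φ : Formal μ d)
  rw [smul_zero, sub_zero, dressPow_apply, numPow_single, pow_zero, one_smul, annHat_zero,
    ann_single_zero, map_zero, smul_zero] at h1
  exact h1

/-- Only finitely many of the `â(e_ℓ)` act nontrivially on a vector in the test domain. -/
theorem exists_annHat_eq_sum (hB : ∀ j j', Commute (B j) (B j')) {Ψ : Formal μ d}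
    (h : Ψ ∈ formalDomain e B g) : ∃ t : ι →₀ Formal μ d, (∀ q, t q ∈ formalDomain e B g) ∧
      ∀ u, annHat B g u Ψ = t.sum fun q Φ => ⟪u, e q⟫_ℂ • Φ := by
  classical
  induction h using Submodule.span_induction with
  | mem Ψ h =>
    obtain ⟨l, v, rfl⟩ := h
    induction l with
    | nil =>
      refine ⟨0, fun q => Submodule.zero_mem _, fun u => ?_⟩
      rw [Finsupp.sum_zero_index]
      exact annHat_dressing_single_zero hB u _
    | cons i l ih =>
      obtain ⟨t, h1, h2⟩ := ih
      refine ⟨Finsupp.single i (testVector e B g l v) + t.mapRange (cre (e i)) (map_zero _),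
        fun q => ?_, fun u => ?_⟩
      · rw [Finsupp.add_apply, Finsupp.mapRange_apply]
        refine Submodule.add_mem _ ?_ (cre_mem_formalDomain i (h1 q))
        rw [Finsupp.single_apply]
        split_ifs
        · exact Submodule.subset_span ⟨l, v, rfl⟩
        · exact Submodule.zero_mem _
      · change annHat B g u (cre (e i) (testVector e B g l v)) = _
        have h3 := Finsupp.sum_single_index (a := i) (b := testVector e B g l v)
          (h := fun q Φ => ⟪u, e q⟫_ℂ • Φ) (smul_zero _)
        have h4 := Finsupp.sum_mapRange_index (f := cre (e i)) (hf := map_zero _) (g := t)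
          (h := fun q Φ => ⟪u, e q⟫_ℂ • Φ) (fun _ => smul_zero _)
        rw [annHat_cre, h2, Finsupp.sum_add_index' (h := fun q Φ => ⟪u, e q⟫_ℂ • Φ)
          (fun _ => smul_zero _) (fun _ _ _ => smul_add _ _ _), h3, h4, Finsupp.sum, Finsupp.sum,
          map_sum]
        simp only [map_smul]
  | zero => exact ⟨0, fun q => Submodule.zero_mem _, fun u => by
      rw [Finsupp.sum_zero_index, map_zero]⟩
  | add Ψ Ψ' _ _ h h' =>
    obtain ⟨t, h1, h2⟩ := h
    obtain ⟨t', h1', h2'⟩ := h'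
    refine ⟨t + t', fun q => Submodule.add_mem _ (h1 q) (h1' q), fun u => ?_⟩
    rw [Finsupp.sum_add_index' (fun _ => smul_zero _) (fun _ _ _ => smul_add _ _ _), ← h2, ← h2',
      map_add]
  | smul c Ψ _ h =>
    obtain ⟨t, h1, h2⟩ := h
    refine ⟨c • t, fun q => Submodule.smul_mem _ c (h1 q), fun u => ?_⟩
    rw [Finsupp.sum_smul_index' (fun _ => smul_zero _), map_smul, h2, Finsupp.sum, Finsupp.sum,
      Finset.smul_sum]
    exact Finset.sum_congr rfl fun q _ => smul_comm _ _ _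

/-- `h ↦ a^*(h) Ψ` is bounded. -/
theorem exists_creL {Ψ : Fock μ d} (hΨ : Summable fun n : ℕ => n * ‖Ψ n‖ ^ 2) :
    ∃ L : Lp ℂ 2 μ →L[ℂ] Fock μ d, ∀ h, (L h : Formal μ d) = cre h Ψ := by
  have hm : ∀ h : Lp ℂ 2 μ, Memℓp (cre h (Ψ : Formal μ d)) 2 := fun h => by
    have := memℓp_mat_cre 1 h hΨ
    rwa [mat_one] at this
  have hs := summable_succ_mul_norm_sq hΨ
  refine ⟨LinearMap.mkContinuous
    { toFun := fun h => (⟨_, hm h⟩ : Fock μ d)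
      map_add' := fun h h' => lp.ext (cre_add h h' (Ψ : Formal μ d))
      map_smul' := fun c h => lp.ext (cre_smul c h (Ψ : Formal μ d)) }
    (Real.sqrt (∑' n : ℕ, ((n : ℝ) + 1) * ‖Ψ n‖ ^ 2)) fun h => ?_, fun h => rfl⟩
  refine (sq_le_sq₀ (norm_nonneg _) (by positivity)).1 ?_
  rw [mul_pow, Real.sq_sqrt (tsum_nonneg fun n => by positivity), mul_comm]
  have h1 := lp_hasSum_norm_sq (E := fun n => Sector μ d n) (⟨_, hm h⟩ : Fock μ d)
  have h2 := (hasSum_nat_add_iff' 1).2 h1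
  have h0 : ‖(⟨_, hm h⟩ : Fock μ d) 0‖ ^ 2 = 0 := by
    change ‖cre h (Ψ : Formal μ d) 0‖ ^ 2 = 0
    rw [cre_apply_zero, norm_zero]; norm_num
  rw [Finset.sum_range_one, h0, sub_zero] at h2
  refine hasSum_le (fun n => ?_) h2 (hs.hasSum.mul_left (‖h‖ ^ 2))
  change ‖cre h (Ψ : Formal μ d) (n + 1)‖ ^ 2 ≤ _
  rw [cre_apply_succ]
  refine (pow_le_pow_left₀ (norm_nonneg _) (norm_creSector_le h n _) 2).trans (le_of_eq ?_)
  have h3 : Real.sqrt (n + 1) ^ 2 = (n : ℝ) + 1 := Real.sq_sqrt (by positivity)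
  linear_combination (‖h‖ * ‖Ψ n‖) ^ 2 * h3

variable (B g) in
theorem exists_creHatL {Ψ : Fock μ d} (hΨ : Summable fun n : ℕ => n * ‖Ψ n‖ ^ 2) :
    ∃ L : Lp ℂ 2 μ →L[ℂ] Fock μ d, ∀ h, (L h : Formal μ d) = creHat B g h Ψ := by
  obtain ⟨L, hL⟩ := exists_creL hΨ
  refine ⟨L + ∑ j, (innerSL ℂ (g j)).smulRight (matL (B j).conjTranspose Ψ), fun h => ?_⟩
  have h1 : (∑ j, (innerSL ℂ (g j)).smulRight (matL (B j).conjTranspose Ψ)) h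
      = ∑ j, ⟪g j, h⟫_ℂ • matL (B j).conjTranspose Ψ := by
    rw [FunLike.coe_sum, Finset.sum_apply]; rfl
  rw [FunLike.coe_add, Pi.add_apply, h1]
  change (L h : Formal μ d) + ((∑ j, ⟪g j, h⟫_ℂ • matL (B j).conjTranspose Ψ : Fock μ d) : Formal μ d) = _
  rw [hL, lp.coeFn_sum, creHat, LinearMap.add_apply, LinearMap.sum_apply]
  congr 1
  refine Finset.sum_congr rfl fun j _ => ?_
  change ⟪g j, h⟫_ℂ • (matL (B j).conjTranspose Ψ : Formal μ d) = _
  rw [coe_matL]; rfl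

/-- Two series that differ only by the index shift of `p` have equal sums when `p 0 = 0`;
summability of `p` is deduced, not assumed. -/
theorem eq_of_hasSum_shift {a b p q : ℕ → ℂ} {A C D : ℂ} (ha : HasSum a A) (hb : HasSum b C)
    (hq : HasSum q D) (h : ∀ n, a n = p (n + 1) + q n) (h' : ∀ n, b n = p n + q n)
    (h0 : p 0 = 0) : A = C := by
  have h1 : HasSum p (C - D) := (hb.sub hq).congr_fun fun n => by rw [h', add_sub_cancel_right]
  have h2 : HasSum (fun n => p (n + 1)) (A - D) :=
    (ha.sub hq).congr_fun fun n => by rw [h, add_sub_cancel_right]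
  have h3 := (hasSum_nat_add_iff' 1).2 h1
  rw [Finset.sum_range_one, h0, sub_zero] at h3
  exact sub_left_injective (h2.unique h3)

/-- The displacements are adjoint in each sector, and `a(h)`, `a^*(h)` match after an index shift.
The undisplaced parts need not be handled separately as Fock vectors. -/
theorem inner_annHat {h : Lp ℂ 2 μ} {Ψ Φ Ψ' Φ' : Fock μ d}
    (hΨ : (Ψ' : Formal μ d) = annHat B g h Ψ) (hΦ : (Φ' : Formal μ d) = creHat B g h Φ) :
    ⟪Ψ', Φ⟫_ℂ = ⟪Ψ, Φ'⟫_ℂ := by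
  obtain ⟨Θ, hΘ⟩ : ∃ Θ : Fock μ d, Θ = ∑ j, ⟪g j, h⟫_ℂ • matL (B j).conjTranspose Φ := ⟨_, rfl⟩
  have hΘn : ∀ n, Θ n = ∑ j, ⟪g j, h⟫_ℂ • matSector (B j).conjTranspose n (Φ n) := fun n => by
    rw [hΘ, lp.coeFn_sum, Finset.sum_apply]
    refine Finset.sum_congr rfl fun j _ => ?_
    change ⟪g j, h⟫_ℂ • (matL (B j).conjTranspose Φ : Formal μ d) n = _
    rw [coe_matL]; rfl
  have hΦn : ∀ n, Φ' n = cre h Φ n + Θ n := fun n => by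
    rw [hΘn, hΦ, creHat, LinearMap.add_apply, LinearMap.sum_apply, Pi.add_apply, Finset.sum_apply]
    rfl
  have h1 := lp.hasSum_inner (𝕜 := ℂ) (G := fun n => Sector μ d n) Ψ' Φ
  have h2 := lp.hasSum_inner (𝕜 := ℂ) (G := fun n => Sector μ d n) Ψ Φ'
  have h3 := lp.hasSum_inner (𝕜 := ℂ) (G := fun n => Sector μ d n) Ψ Θ
  have h4 : ∀ n, ⟪Ψ' n, Φ n⟫_ℂ = ⟪Ψ (n + 1), cre h Φ (n + 1)⟫_ℂ + ⟪Ψ n, Θ n⟫_ℂ := fun n => by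
    rw [hΨ, annHat_apply, inner_add_left, cre_apply_succ, annSector,
      ContinuousLinearMap.adjoint_inner_left, hΘn, sum_inner, inner_sum]
    congr 1
    refine Finset.sum_congr rfl fun j _ => ?_
    rw [sector_inner_smul_left, sector_inner_smul_right, inner_matSector_left, inner_conj_symm]
  have h5 : ∀ n, ⟪Ψ n, Φ' n⟫_ℂ = ⟪Ψ n, cre h Φ n⟫_ℂ + ⟪Ψ n, Θ n⟫_ℂ := fun n => by
    rw [hΦn, inner_add_right]
  refine eq_of_hasSum_shift (p := fun n => ⟪Ψ n, cre h Φ n⟫_ℂ) (q := fun n => ⟪Ψ n, Θ n⟫_ℂ)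
    h1 h2 h3 h4 h5 ?_
  rw [cre_apply_zero, inner_zero_right]

end TestDomain

/-! ### The test Hamiltonian -/

section TestHamiltonian

variable {X : Type*} [MeasurableSpace X] {μ : Measure X} [SigmaFinite μ] {d N : ℕ} {ι : Type*}

/-- Parseval's identity on each band, then summation over the bands, with `u` in the domain of `ω`
and `v` arbitrary. -/
theorem tsum_inner_bandVec {ω : X → ℝ} (hω : Measurable ω) (hpos : ∀ᵐ x ∂μ, 0 ≤ ω x)
    (e : HilbertBasis ι ℂ (Lp ℂ 2 μ)) {u u' v : Lp ℂ 2 μ} (hu : MulBy ω u u')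
    (hs : Summable fun a => ⟪u, bandVec ω hω e a⟫_ℂ * ⟪bandVec ω hω e a, v⟫_ℂ) :
    ∑' a, ⟪u, bandVec ω hω e a⟫_ℂ * ⟪bandVec ω hω e a, v⟫_ℂ = ⟪u', v⟫_ℂ := by
  refine eq_inner_of_hasSum_band hω hpos hu (hs.hasSum.prod_fiberwise fun k => ?_)
  refine (e.hasSum_inner_mul_inner ((band ω hω k).op ℂ μ u) ((band ω hω k).op ℂ μ v)).congr_fun
    fun i => ?_
  rw [Multiplier.inner_op_left, ← Multiplier.inner_op_left (band ω hω k) (e i) v]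
  rfl

variable {B : Fin N → Matrix (Fin d) (Fin d) ℂ} {g : Fin N → Lp ℂ 2 μ} {ω : X → ℝ} {m : ℝ}

/-- The vectors `â(e_ℓ) Ψ` and the operators `h ↦ â(h)^* â(e_ℓ) Ψ` for `Ψ` in the test domain. -/
theorem exists_annHat_creHat (hB : ∀ j j', Commute (B j) (B j')) (e : HilbertBasis ι ℂ (Lp ℂ 2 μ))
    {Ψ : Fock μ d} (hΨ : Ψ ∈ testDomain e B g) :
    ∃ (s : Finset ι) (t : ι → Fock μ d) (L : ι → Lp ℂ 2 μ →L[ℂ] Fock μ d),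
      (∀ q ∉ s, t q = 0) ∧ (∀ q, (t q : Formal μ d) = annHat B g (e q) Ψ) ∧
      (∀ h, annHat B g h Ψ = ((∑ q ∈ s, ⟪h, e q⟫_ℂ • t q : Fock μ d) : Formal μ d)) ∧
      ∀ q h, (L q h : Formal μ d) = creHat B g h (t q) := by
  classical
  obtain ⟨T, h1, h2⟩ := exists_annHat_eq_sum hB (mem_testDomain_iff.1 hΨ)
  choose t ht hs using fun q => exists_coe_of_mem_formalDomain (h1 q)
  choose L hL using fun q => exists_creHatL B g (hs q)
  have h3 : ∀ h, annHat B g h Ψ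
      = ((∑ q ∈ T.support, ⟪h, e q⟫_ℂ • t q : Fock μ d) : Formal μ d) := fun h => by
    rw [h2, Finsupp.sum, lp.coeFn_sum]
    refine Finset.sum_congr rfl fun q _ => ?_
    change _ = ⟪h, e q⟫_ℂ • (t q : Formal μ d)
    rw [ht]
  have h0 : ∀ q ∉ T.support, t q = 0 := fun q hq => by
    refine lp.ext ?_
    rw [ht, Finsupp.notMem_support_iff.1 hq]; rfl
  refine ⟨T.support, t, L, h0, fun q => ?_, h3, hL⟩
  rw [h3]
  congr 1
  -- Orthonormality: evaluating the finite sum at `h = e q` isolates the term `t q`.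
  have h4 : ∀ p, ⟪e q, e p⟫_ℂ • t p = if q = p then t p else 0 := fun p => by
    rw [orthonormal_iff_ite.1 e.orthonormal]
    split_ifs <;> simp
  simp only [h4]
  rw [Finset.sum_ite_eq]
  split_ifs with h
  · rfl
  · exact h0 q h

theorem hasSum_prod_of_finset {E : Type*} [NormedAddCommGroup E] {t : ι × ι → E} {s : Finset ι}
    {S : ι → E} (h0 : ∀ q ∉ s, ∀ p, t (p, q) = 0) (h : ∀ q, HasSum (fun p => t (p, q)) (S q)) :
    HasSum t (∑ q ∈ s, S q) := by
  classical
  have h1 : ∀ q, HasSum (fun p : ι × ι => if p.2 = q then t p else 0) (S q) := fun q => by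
    have hinj : Function.Injective fun p : ι => (p, q) := fun p p' h => congrArg Prod.fst h
    refine (hinj.hasSum_iff (f := fun p : ι × ι => if p.2 = q then t p else 0) ?_).1
      ((h q).congr_fun fun p => if_pos rfl)
    rintro ⟨p, q'⟩ hp
    refine if_neg fun h => hp ⟨p, ?_⟩
    exact Prod.ext rfl h.symm
  refine (hasSum_sum fun q _ => h1 q).congr_fun fun p => ?_
  rw [Finset.sum_ite_eq]
  split_ifs with hp
  · rfl
  · exact h0 p.2 hp p.1

/-- The test Hamiltonian, evaluated on a vector in the test domain. -/
theorem mem_testHamiltonianGraph (e : HilbertBasis ι ℂ (Lp ℂ 2 μ)) {w : ι → Lp ℂ 2 μ}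
    (hw : ∀ i, MulBy ω (e i) (w i)) (K : Matrix (Fin d) (Fin d) ℂ) {Ψ : Fock μ d}
    (hΨ : Ψ ∈ testDomain e B g) {s : Finset ι} {t : ι → Fock μ d}
    {L : ι → Lp ℂ 2 μ →L[ℂ] Fock μ d} (h0 : ∀ q ∉ s, t q = 0)
    (ht : ∀ q, (t q : Formal μ d) = annHat B g (e q) Ψ)
    (hL : ∀ q h, (L q h : Formal μ d) = creHat B g h (t q)) :
    (Ψ, ∑ q ∈ s, L q (w q) + matL K Ψ) ∈ testHamiltonianGraph e ω K B g := by
  -- Only finitely many second indices `ℓ'` contribute. For each of them, summing over `ℓ` expands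
  -- `ω e_ℓ'` in the basis under the bounded map `L ℓ'`, so the double series converges
  -- unconditionally.
  refine ⟨hΨ, fun q => ⟪e q.1, w q.2⟫_ℂ • L q.2 (e q.1), ∑ q ∈ s, L q (w q), fun q => ?_, ?_, ?_⟩
  · change ⟪e q.1, w q.2⟫_ℂ • (L q.2 (e q.1) : Formal μ d) = _
    rw [hL, ht]
    congr 1
    rw [L2.inner_def]
    refine integral_congr_ae ?_
    filter_upwards [hw q.2] with k hk
    rw [hk, RCLike.inner_apply, smul_eq_mul, mul_comm]
  · refine hasSum_prod_of_finset (fun q hq p => ?_) fun q => ?_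
    · have h1 : L q (e p) = 0 := by
        refine lp.ext ?_
        rw [hL, h0 q hq]
        exact map_zero (creHat B g (e p))
      simp only [h1, smul_zero]
    · refine ((e.hasSum_repr (w q)).mapL (L q)).congr_fun fun p => ?_
      rw [map_smul, HilbertBasis.repr_apply_apply]
  · change ((∑ q ∈ s, L q (w q) : Fock μ d) : Formal μ d) + (matL K Ψ : Formal μ d) = _
    rw [coe_matL]

theorem testHamiltonian_domain (hB : ∀ j j', Commute (B j) (B j'))
    (e : HilbertBasis ι ℂ (Lp ℂ 2 μ)) {w : ι → Lp ℂ 2 μ} (hw : ∀ i, MulBy ω (e i) (w i))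
    (K : Matrix (Fin d) (Fin d) ℂ) :
    (testHamiltonian e ω K B g).domain = testDomain e B g := by
  ext Ψ
  constructor
  · intro h
    exact ((mem_testHamiltonian_graph e ω K B g _).1
      (LinearPMap.mem_graph (testHamiltonian e ω K B g) ⟨Ψ, h⟩)).1
  · intro h
    obtain ⟨s, t, L, h0, ht, -, hL⟩ := exists_annHat_creHat hB e h
    exact LinearPMap.mem_domain_of_mem_graph ((mem_testHamiltonian_graph e ω K B g _).2
      (mem_testHamiltonianGraph e hw K h h0 ht hL))

variable {M M' : Matrix (Fin d) (Fin d) ℂ} {hω : Measurable ω}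

/-- `â(hₐ) Ψ` is a finite combination of fixed vectors with coefficients `⟨hₐ, e_ℓ⟩`, which are
square summable in `a` because the `e_ℓ` lie in the domain of `ω`. -/
theorem exists_formDom_testDomain (hB : ∀ j j', Commute (B j) (B j')) (hM' : M' * M = 1)
    (hm : 0 < m) (hpos : ∀ᵐ x ∂μ, m ≤ ω x) (e : HilbertBasis ι ℂ (Lp ℂ 2 μ)) {w : ι → Lp ℂ 2 μ}
    (hw : ∀ i, MulBy ω (e i) (w i)) {Ψ : Fock μ d} (hΨ : Ψ ∈ testDomain e B g) :
    ∃ x : FormDom B M' (bandVec ω hω e) g, formEmb B M' (bandVec ω hω e) g x = Ψ := by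
  obtain ⟨s, t, L, h0, ht, hh, hL⟩ := exists_annHat_creHat hB e hΨ
  obtain ⟨x, hx, -⟩ := exists_formDom_of_summable (B := B) (g := g) (h := bandVec ω hω e) hM'
    (Ψ := Ψ) (fun a => ∑ q ∈ s, ⟪bandVec ω hω e a, e q⟫_ℂ • t q) (fun a => (hh _).symm) (by
      have h1 : ∀ a, ‖∑ q ∈ s, ⟪bandVec ω hω e a, e q⟫_ℂ • t q‖ ^ 2
          ≤ (∑ q ∈ s, ‖t q‖ ^ 2) * ∑ q ∈ s, ‖⟪bandVec ω hω e a, e q⟫_ℂ‖ ^ 2 := fun a => by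
        refine (pow_le_pow_left₀ (norm_nonneg _) (norm_sum_le _ _) 2).trans ?_
        simp only [norm_smul]
        rw [mul_comm]
        exact Finset.sum_mul_sq_le_sq_mul_sq _ _ _
      refine Summable.of_nonneg_of_le (fun _ => sq_nonneg _) h1 (Summable.mul_left _ ?_)
      exact summable_sum fun q _ => summable_bandVec_of_mulBy hω hm hpos e (hw q))
  exact ⟨x, hx⟩

/-- The form agrees with the form of the test Hamiltonian. -/
theorem inner_formDom_testHamiltonian (hB : ∀ j j', Commute (B j) (B j')) (hM : M * M' = 1)
    (hm : 0 < m) (hpos : ∀ᵐ x ∂μ, m ≤ ω x) (e : HilbertBasis ι ℂ (Lp ℂ 2 μ)) {w : ι → Lp ℂ 2 μ}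
    (hw : ∀ i, MulBy ω (e i) (w i)) {K : Matrix (Fin d) (Fin d) ℂ} {c : ℝ}
    (hMK : M.conjTranspose * M = K + (c : ℂ) • 1) (x y : FormDom B M' (bandVec ω hω e) g)
    (Ψ : (testHamiltonian e ω K B g).domain)
    (hy : formEmb B M' (bandVec ω hω e) g y = Ψ) :
    ⟪x, y⟫_ℂ = ⟪formEmb B M' (bandVec ω hω e) g x,
      testHamiltonian e ω K B g Ψ + (c : ℂ) • (Ψ : Fock μ d)⟫_ℂ := by
  have hΨ : (Ψ : Fock μ d) ∈ testDomain e B g := by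
    rw [← testHamiltonian_domain hB e hw K]; exact Ψ.2
  obtain ⟨Φ, hΦ⟩ : ∃ Φ : Fock μ d, Φ = Ψ := ⟨_, rfl⟩
  obtain ⟨s, t, L, h0, ht, hh, hL⟩ := exists_annHat_creHat hB e hΨ
  have hval : testHamiltonian e ω K B g Ψ = ∑ q ∈ s, L q (w q) + matL K Ψ := by
    refine LinearPMap.mem_graph_snd_inj _ (LinearPMap.mem_graph (testHamiltonian e ω K B g) Ψ)
      ((mem_testHamiltonian_graph e ω K B g _).2
        (mem_testHamiltonianGraph e hw K hΨ h0 ht hL)) rfl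
  obtain ⟨ψ, hψ⟩ : ∃ ψ, ψ = formEmb B M' (bandVec ω hω e) g x := ⟨_, rfl⟩
  have hpos' : ∀ᵐ x ∂μ, 0 ≤ ω x := hpos.mono fun x hx => hm.le.trans hx
  rw [hval, ← hψ, ← hΦ]
  rw [← hΦ] at hy ht hh
  have hKc : matL (M.conjTranspose * M) Φ = matL K Φ + (c : ℂ) • Φ := by
    refine lp.ext ?_
    change (matL (M.conjTranspose * M) Φ : Formal μ d)
      = (matL K Φ : Formal μ d) + (c : ℂ) • (Φ : Formal μ d)
    rw [coe_matL, coe_matL, hMK, mat_add, mat_smul, mat_one]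
  have hMM : matL M.conjTranspose (matL M Φ) = matL (M.conjTranspose * M) Φ := by
    refine lp.ext ?_
    rw [coe_matL, coe_matL, coe_matL, mat_mul]
  have hfst : ⟪y.fst, x.fst⟫_ℂ = ⟪matL K Φ + (c : ℂ) • Φ, ψ⟫_ℂ := by
    rw [y.fst_eq hM, x.fst_eq hM, hy, ← hψ, ← hKc, ← hMM, inner_matL_left,
      inner_matL_left M.conjTranspose, Matrix.conjTranspose_conjTranspose, ← inner_matL_left]
  have hsnd : ∀ a, y.snd a = ∑ q ∈ s, ⟪bandVec ω hω e a, e q⟫_ℂ • t q := fun a => by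
    refine lp.ext ?_
    rw [y.coe_snd, hy, hh]
  -- `x.snd a` is `â(hₐ) ψ`. Moving `â(hₐ)` to the other side yields `â(hₐ)^* t q`, which is `L q`
  -- at `hₐ`; all dependence on `a` then sits in one vector of `L²(X)`.
  have hadj : ∀ q a, ⟪t q, x.snd a⟫_ℂ
      = ⟪bandVec ω hω e a, ContinuousLinearMap.adjoint (L q) ψ⟫_ℂ := fun q a => by
    rw [ContinuousLinearMap.adjoint_inner_right, ← inner_conj_symm,
      ← inner_conj_symm (L q (bandVec ω hω e a))]
    congr 1
    refine inner_annHat ?_ (hL q _)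
    rw [x.coe_snd, hψ]
  have hterm : ∀ a, ⟪y.snd a, x.snd a⟫_ℂ = ∑ q ∈ s, ⟪e q, bandVec ω hω e a⟫_ℂ
      * ⟪bandVec ω hω e a, ContinuousLinearMap.adjoint (L q) ψ⟫_ℂ := fun a => by
    rw [hsnd, sum_inner]
    refine Finset.sum_congr rfl fun q _ => ?_
    rw [inner_smul_left, inner_conj_symm, hadj]
  -- `L q^* ψ` need not be in the form domain of `ω`; its coefficients are nevertheless square
  -- summable, being dominated by `‖t q‖ ‖x.snd a‖`.
  have hsum : ∀ q, Summable fun a => ⟪e q, bandVec ω hω e a⟫_ℂ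
      * ⟪bandVec ω hω e a, ContinuousLinearMap.adjoint (L q) ψ⟫_ℂ := fun q => by
    have h1 := summable_bandVec_of_mulBy hω hm hpos e (hw q)
    have h2 := (lp_hasSum_norm_sq (E := fun _ => Fock μ d) x.snd).summable.mul_left (‖t q‖ ^ 2)
    refine Summable.of_norm_bounded (h1.add h2) fun a => ?_
    rw [norm_mul, ← hadj, ← mul_pow]
    have h3 : ‖⟪t q, x.snd a⟫_ℂ‖ ≤ ‖t q‖ * ‖x.snd a‖ := norm_inner_le_norm _ _
    have h4 : ‖⟪e q, bandVec ω hω e a⟫_ℂ‖ = ‖⟪bandVec ω hω e a, e q⟫_ℂ‖ := norm_inner_symm _ _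
    rw [h4]
    nlinarith [norm_nonneg ⟪bandVec ω hω e a, e q⟫_ℂ, norm_nonneg ⟪t q, x.snd a⟫_ℂ,
      sq_nonneg (‖⟪bandVec ω hω e a, e q⟫_ℂ‖ - ‖t q‖ * ‖x.snd a‖)]
  have hmain : ⟪y, x⟫_ℂ = ⟪∑ q ∈ s, L q (w q) + matL K Φ + (c : ℂ) • Φ, ψ⟫_ℂ := by
    rw [FormDom.inner_def, hfst, add_assoc, inner_add_left (∑ q ∈ s, L q (w q)), add_comm]
    congr 1
    rw [tsum_congr hterm, Summable.tsum_finsetSum fun q _ => hsum q, sum_inner]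
    refine Finset.sum_congr rfl fun q _ => ?_
    rw [tsum_inner_bandVec hω hpos' e (hw q) (hsum q), ContinuousLinearMap.adjoint_inner_right]
  rw [← inner_conj_symm, hmain, inner_conj_symm]

end TestHamiltonian

/-! ### Density of the test domain -/

section Density

variable {X : Type*} [MeasurableSpace X] {μ : Measure X} [SigmaFinite μ] {d N : ℕ} {ι α : Type*}

theorem denseRange_of_inner_eq_zero {F V : Type*} [AddCommGroup F] [Module ℂ F]
    [NormedAddCommGroup V] [InnerProductSpace ℂ V] [CompleteSpace V] (Θ : F →ₗ[ℂ] V)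
    (h : ∀ η : V, (∀ y, ⟪Θ y, η⟫_ℂ = 0) → η = 0) : DenseRange Θ := by
  have h1 : (LinearMap.range Θ)ᗮ = ⊥ := by
    rw [Submodule.eq_bot_iff]
    exact fun η hη => h η fun y => (Submodule.mem_orthogonal _ _).1 hη _ ⟨y, rfl⟩
  have h2 := (Submodule.topologicalClosure_eq_top_iff (K := LinearMap.range Θ)).2 h1
  exact Submodule.dense_iff_topologicalClosure_eq_top.2 h2

theorem exists_creSectorL (n : ℕ) (ψ : Sector μ d n) :
    ∃ L : Lp ℂ 2 μ →L[ℂ] Sector μ d (n + 1), ∀ u, L u = creSector u n ψ :=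
  ⟨LinearMap.mkContinuous
    { toFun := fun u => creSector u n ψ
      map_add' := fun u u' => creSector_add u u' n ψ
      map_smul' := fun c u => creSector_smul c u n ψ } (Real.sqrt (n + 1) * ‖ψ‖) fun u =>
    (norm_creSector_le u n ψ).trans (le_of_eq (by ring)), fun _ => rfl⟩

/-- Products of vectors from a total set are total. -/
theorem eq_zero_of_inner_prodSet_of_total {U : Set (Lp ℂ 2 μ)}
    (hU : ∀ v : Lp ℂ 2 μ, (∀ u ∈ U, ⟪u, v⟫_ℂ = 0) → v = 0) {n : ℕ} {η : Sector μ d n}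
    (h : ∀ φ ∈ prodSet U n, ⟪φ, η⟫_ℂ = 0) : η = 0 := by
  induction n with
  | zero => exact inner_self_eq_zero.1 (h η trivial)
  | succ n ih =>
    refine eq_zero_of_annSector fun u => ih fun ψ hψ => ?_
    rw [annSector, ContinuousLinearMap.adjoint_inner_right]
    obtain ⟨L, hL⟩ := exists_creSectorL n ψ
    have h1 : ContinuousLinearMap.adjoint L η = 0 := hU _ fun u hu => by
      rw [ContinuousLinearMap.adjoint_inner_right, hL]
      exact h _ ⟨u, hu, ψ, hψ, rfl⟩
    rw [← hL, ← ContinuousLinearMap.adjoint_inner_right, h1, inner_zero_right]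

theorem eq_zero_of_inner_hilbertBasis (e : HilbertBasis ι ℂ (Lp ℂ 2 μ)) (v : Lp ℂ 2 μ)
    (h : ∀ u ∈ Set.range e, ⟪u, v⟫_ℂ = 0) : v = 0 := by
  refine e.repr.injective (lp.ext (funext fun i => ?_))
  rw [HilbertBasis.repr_apply_apply, h _ ⟨i, rfl⟩, map_zero]; rfl

theorem dressL_dressL (B : Fin N → Matrix (Fin d) (Fin d) ℂ) (hB : ∀ j j', Commute (B j) (B j'))
    {c c' c'' : Fin N → Lp ℂ 2 μ} {r r' : ℝ} (hr : r ∈ Set.Ioo (0 : ℝ) 1)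
    (hr' : r' ∈ Set.Ioo (0 : ℝ) 1) (hrr : r * r = r') (hc : c'' = c + (r : ℂ) • c') (Ψ : Fock μ d) :
    dressL B c hr (dressL B c' hr Ψ) = dressL B c'' hr' Ψ := by
  refine lp.ext ?_
  rw [coe_dressL, coe_dressL, coe_dressL, dressPow_comp hB, hc, hrr]

/-- `⟨r^N u, u⟩` dominates the contribution of each sector. -/
theorem pow_mul_norm_sq_le_re_inner_numL {r : ℝ} (hr : r ∈ Set.Ioo (0 : ℝ) 1) (u : Fock μ d)
    (n : ℕ) : r ^ n * ‖u n‖ ^ 2 ≤ (⟪numL hr u, u⟫_ℂ).re := by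
  have h1 := lp.hasSum_inner (𝕜 := ℂ) (G := fun n => Sector μ d n) (numL hr u) u
  have h2 : ∀ k, ⟪numL hr u k, u k⟫_ℂ = ((r ^ k * ‖u k‖ ^ 2 : ℝ) : ℂ) := fun k => by
    rw [coe_numL, numPow_apply, sector_inner_smul_left, inner_self_eq_ofReal]
    push_cast
    rw [map_pow, Complex.conj_ofReal]
  have h3 : HasSum (fun k => r ^ k * ‖u k‖ ^ 2) (⟪numL hr u, u⟫_ℂ).re :=
    (Complex.hasSum_re h1).congr_fun fun k => by rw [h2, Complex.ofReal_re]
  exact le_hasSum h3 n fun k _ => mul_nonneg (pow_nonneg hr.1.le k) (sq_nonneg _)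

/-- A bound of the error in replacing the dressing operator by a function of the number operator. -/
def dressError (B : Fin N → Matrix (Fin d) (Fin d) ℂ) (g : Fin N → Lp ℂ 2 μ) (s : ℝ) : ℝ :=
  Real.sqrt (4 * (Real.exp (s * (∑ j, matNorm (B j) * (1 + ‖g j‖)) ^ 2) - 1))

theorem dressError_nonneg (B : Fin N → Matrix (Fin d) (Fin d) ℂ) (g : Fin N → Lp ℂ 2 μ) (s : ℝ) :
    0 ≤ dressError B g s := Real.sqrt_nonneg _

theorem tendsto_dressError (B : Fin N → Matrix (Fin d) (Fin d) ℂ) (g : Fin N → Lp ℂ 2 μ) :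
    Tendsto (dressError B g) (𝓝 0) (𝓝 0) := by
  have : Continuous (dressError B g) := by unfold dressError; fun_prop
  have h := this.tendsto 0
  simpa [dressError] using h

theorem norm_dressL_sub_numL_le_dressError (B : Fin N → Matrix (Fin d) (Fin d) ℂ)
    (g : Fin N → Lp ℂ 2 μ) {s : ℝ} (hs : 0 < s) (hs' : s ≤ 1 / 2)
    (hr : 1 - s ∈ Set.Ioo (0 : ℝ) 1) (u : Fock μ d) :
    ‖dressL B (g - ((1 - s : ℝ) : ℂ) • g) hr u - numL hr u‖ ≤ dressError B g s * ‖u‖ := by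
  refine (norm_dressL_sub_numL_le B _ hr u).trans (mul_le_mul_of_nonneg_right ?_ (norm_nonneg _))
  refine dressBound_le hs hs' (expNorm_nonneg _ _)
    (expNorm_sub_smul_le B g g hs.le (fun j => ?_) le_rfl)
  rw [sub_self, norm_zero]; exact hs.le

/-- Positivity of `r^N` survives approximately for the dressing, up to its distance from `r^N`. This
lower bound replaces strong convergence in the density arguments. -/
theorem pow_mul_norm_sq_le_re_inner_dressL (B : Fin N → Matrix (Fin d) (Fin d) ℂ)
    (g : Fin N → Lp ℂ 2 μ) {s : ℝ} (hs : 0 < s) (hs' : s ≤ 1 / 2)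
    (hr : 1 - s ∈ Set.Ioo (0 : ℝ) 1) (u : Fock μ d) (n : ℕ) :
    (1 - s) ^ n * ‖u n‖ ^ 2 ≤ (⟪dressL B (g - ((1 - s : ℝ) : ℂ) • g) hr u, u⟫_ℂ).re
      + dressError B g s * ‖u‖ ^ 2 := by
  have h1 := pow_mul_norm_sq_le_re_inner_numL hr u n
  have h2 : |(⟪dressL B (g - ((1 - s : ℝ) : ℂ) • g) hr u - numL hr u, u⟫_ℂ).re|
      ≤ dressError B g s * ‖u‖ * ‖u‖ :=
    (Complex.abs_re_le_norm _).trans ((norm_inner_le_norm _ _).trans (mul_le_mul_of_nonneg_right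
      (norm_dressL_sub_numL_le_dressError B g hs hs' hr u) (norm_nonneg _)))
  rw [inner_sub_left, Complex.sub_re, abs_le] at h2
  nlinarith [h2.1]

/-- Let `s` tend to zero at fixed boson number `n`. -/
theorem eq_zero_of_forall_pow_mul_le {b C : ℝ} (B : Fin N → Matrix (Fin d) (Fin d) ℂ)
    (g : Fin N → Lp ℂ 2 μ) (n : ℕ) (hb : ∀ s : ℝ, 0 < s → s ≤ 1 / 2 →
      (1 - s) ^ n * b ^ 2 ≤ C * dressError B g s) : b = 0 := by
  have h1 : Tendsto (fun s : ℝ => (1 - s) ^ n * b ^ 2) (𝓝[>] 0) (𝓝 (b ^ 2)) := by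
    have : Continuous fun s : ℝ => (1 - s) ^ n * b ^ 2 := by fun_prop
    have h2 := this.tendsto 0
    simp only [sub_zero, one_pow, one_mul] at h2
    exact h2.mono_left nhdsWithin_le_nhds
  have h2 : Tendsto (fun s => C * dressError B g s) (𝓝[>] 0) (𝓝 0) := by
    have := (tendsto_dressError B g).const_mul C
    rw [mul_zero] at this
    exact this.mono_left nhdsWithin_le_nhds
  have h3 : b ^ 2 ≤ 0 := by
    refine le_of_tendsto_of_tendsto h1 h2 ?_
    filter_upwards [nhdsWithin_le_nhds (Iic_mem_nhds (show (0 : ℝ) < 1 / 2 by norm_num)),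
      self_mem_nhdsWithin] with s h h' using hb s h' h
  exact pow_eq_zero_iff two_ne_zero |>.1 (le_antisymm h3 (sq_nonneg b))

theorem sqrt_one_sub_mem {s : ℝ} (hs : 0 < s) (hs' : s ≤ 1 / 2) :
    Real.sqrt (1 - s) ∈ Set.Ioo (0 : ℝ) 1 :=
  ⟨Real.sqrt_pos.2 (by linarith), by
    rw [Real.sqrt_lt' one_pos]; linarith⟩

/-- With `r = √(1 - s)`, this is the exponent obtained by transporting from `g` to `0` and back,
each time with parameter `r`. The product is `e^{B(s g)} (1 - s)^N`, which is close to `(1 - s)^N`.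
-/
theorem sqrt_smul_sqrt_smul {s : ℝ} (hs' : s ≤ 1 / 2) (g : Fin N → Lp ℂ 2 μ) :
    g - ((1 - s : ℝ) : ℂ) • g = (g - (Real.sqrt (1 - s) : ℂ) • (0 : Fin N → Lp ℂ 2 μ))
      + (Real.sqrt (1 - s) : ℂ) • ((0 : Fin N → Lp ℂ 2 μ) - (Real.sqrt (1 - s) : ℂ) • g) := by
  rw [smul_zero, sub_zero, zero_sub, smul_neg, smul_smul, ← Complex.ofReal_mul,
    Real.mul_self_sqrt (by linarith), sub_eq_add_neg]

variable {B : Fin N → Matrix (Fin d) (Fin d) ℂ} {M M' : Matrix (Fin d) (Fin d) ℂ}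
  {h : α → Lp ℂ 2 μ}

/-- The vectors `T φ`, where `φ` is a product of vectors from a total set, are total. -/
theorem eq_zero_of_inner_dressing (hB : ∀ j j', Commute (B j) (B j')) (g : Fin N → Lp ℂ 2 μ)
    {U : Set (Lp ℂ 2 μ)} (hU : ∀ v : Lp ℂ 2 μ, (∀ u ∈ U, ⟪u, v⟫_ℂ = 0) → v = 0) {η : Fock μ d}
    (hη : ∀ n, ∀ φ ∈ prodSet U n, ∀ Ψ : Fock μ d,
      (Ψ : Formal μ d) = dressing B g (Pi.single n φ : Formal μ d) → ⟪Ψ, η⟫_ℂ = 0) : η = 0 := by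
  -- The range of `e^{B(g)} r^N` is spanned, up to closure, by the vectors `T φ`, because `r^N` acts
  -- on `φ` as a scalar.
  have h0 : ∀ r (hr : r ∈ Set.Ioo (0 : ℝ) 1), ContinuousLinearMap.adjoint (dressL B g hr) η = 0 := by
    intro r hr
    refine lp.ext (funext fun n => ?_)
    refine eq_zero_of_inner_prodSet_of_total hU fun φ hφ => ?_
    rw [← inner_fockSingle_left, ContinuousLinearMap.adjoint_inner_right]
    have h1 := hη n φ hφ _ (exists_coe_dressing_single B g n φ hr)
    rw [inner_smul_left] at h1
    refine (mul_eq_zero.1 h1).resolve_left ?_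
    exact (map_ne_zero _).2 (inv_ne_zero (pow_ne_zero _ (Complex.ofReal_ne_zero.2 hr.1.ne')))
  refine lp.ext (funext fun n => norm_eq_zero.1 ?_)
  refine eq_zero_of_forall_pow_mul_le B g n (C := ‖η‖ ^ 2) fun s hs hs' => ?_
  have hr : 1 - s ∈ Set.Ioo (0 : ℝ) 1 := ⟨by linarith, by linarith⟩
  have h1 := pow_mul_norm_sq_le_re_inner_dressL B g hs hs' hr η n
  rw [← dressL_dressL B hB (sqrt_one_sub_mem hs hs') hr (Real.mul_self_sqrt hr.1.le)
    (sqrt_smul_sqrt_smul hs' g)] at h1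
  simp only [smul_zero, sub_zero] at h1
  rw [← ContinuousLinearMap.adjoint_inner_right, h0, inner_zero_right, Complex.zero_re, zero_add,
    mul_comm (dressError B g s)] at h1
  exact h1

/-- The dressing as a bounded operator between form domains. -/
theorem exists_transportL (hB : ∀ j j', Commute (B j) (B j')) (hM : M * M' = 1) (hM' : M' * M = 1)
    (g g' : Fin N → Lp ℂ 2 μ) {r : ℝ} (hr : r ∈ Set.Ioo (0 : ℝ) 1) :
    ∃ J : FormDom B M' h g →L[ℂ] FormDom B M' h g', ∀ x,
      formEmb B M' h g' (J x) = dressL B (g' - (r : ℂ) • g) hr (formEmb B M' h g x) := by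
  choose J h1 h2 h3 using exists_transport (h := h) hB hM' g g' hr
  refine ⟨LinearMap.mkContinuous
    { toFun := J
      map_add' := fun x y => FormDom.ext_formEmb hM (by
        rw [map_add, h1, h1, h1, map_add, map_add])
      map_smul' := fun c x => FormDom.ext_formEmb hM (by
        rw [RingHom.id_apply, map_smul, h1, h1, map_smul, map_smul]) } _
      fun x => norm_transport_le hM hr (h2 x) (h3 x), h1⟩

theorem hasSum_re_inner_snd {g : Fin N → Lp ℂ 2 μ} (x y : FormDom B M' h g) :
    HasSum (fun a => (⟪x.snd a, y.snd a⟫_ℂ).re) (⟪x, y⟫_ℂ - ⟪x.fst, y.fst⟫_ℂ).re := by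
  have h1 := lp.hasSum_inner (𝕜 := ℂ) (G := fun _ : α => Fock μ d) x.snd y.snd
  have h2 : ⟪x, y⟫_ℂ - ⟪x.fst, y.fst⟫_ℂ = ⟪x.snd, y.snd⟫_ℂ := by
    rw [FormDom.inner_def, add_sub_cancel_left]
    exact (lp.inner_eq_tsum _ _).symm
  rw [h2]
  exact Complex.hasSum_re h1

theorem hasSum_norm_snd_sq {g : Fin N → Lp ℂ 2 μ} (x : FormDom B M' h g) :
    HasSum (fun a => ‖x.snd a‖ ^ 2) (‖x.snd‖ ^ 2) :=
  lp_hasSum_norm_sq (E := fun _ : α => Fock μ d) x.snd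

/-- Transporting a set of vectors which is total in the form domain without interaction. -/
theorem eq_zero_of_inner_transport (hB : ∀ j j', Commute (B j) (B j')) (hM : M * M' = 1)
    (hM' : M' * M = 1) {S : Set (FormDom B M' h 0)} (g : Fin N → Lp ℂ 2 μ)
    (hS : ∀ x : FormDom B M' h 0, (∀ y ∈ S, ⟪y, x⟫_ℂ = 0) → x = 0) {x : FormDom B M' h g}
    (hx : ∀ y ∈ S, ∀ (r : ℝ) (hr : r ∈ Set.Ioo (0 : ℝ) 1), ∀ z : FormDom B M' h g,
      formEmb B M' h g z = dressL B g hr (formEmb B M' h 0 y) → ⟪z, x⟫_ℂ = 0) : x = 0 := by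
  obtain ⟨ψ, hψ⟩ : ∃ ψ, ψ = formEmb B M' h g x := ⟨_, rfl⟩
  -- The first component determines `x`, and it is enough to show that each of its sectors vanishes.
  have hfst : x.fst = 0 := by
    refine lp.ext (funext fun n => norm_eq_zero.1 ?_)
    refine eq_zero_of_forall_pow_mul_le B g n
      (C := matNorm M * ‖ψ‖ * ‖x.fst‖ + ‖x.snd‖ ^ 2) fun s hs hs' => ?_
    have hr : 1 - s ∈ Set.Ioo (0 : ℝ) 1 := ⟨by linarith, by linarith⟩
    have hq := sqrt_one_sub_mem hs hs'
    obtain ⟨J₁, hJ₁⟩ := exists_transportL (h := h) hB hM hM' 0 g hq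
    obtain ⟨J₂, hJ₂⟩ := exists_transportL (h := h) hB hM hM' g 0 hq
    have h1 : ContinuousLinearMap.adjoint J₁ x = 0 := hS _ fun y hy => by
      rw [ContinuousLinearMap.adjoint_inner_right]
      refine hx y hy _ hq _ ?_
      have h2 := hJ₁ y
      simp only [smul_zero, sub_zero] at h2
      exact h2
    -- `z` is `x` transported from `g` to `0` and back. Its last transport starts from the free form
    -- domain, where `S` is total, so `z` is orthogonal to `x`.
    obtain ⟨z, hz1, hz2, hz3⟩ := exists_transport (h := h) hB hM' g g hr x
    have hz : z = J₁ (J₂ x) := FormDom.ext_formEmb hM (by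
      rw [hz1, hJ₁, hJ₂, dressL_dressL B hB hq hr (Real.mul_self_sqrt hr.1.le)
        (sqrt_smul_sqrt_smul hs' g)])
    have h0 : ⟪z, x⟫_ℂ = 0 := by
      rw [hz, ← ContinuousLinearMap.adjoint_inner_right, h1, inner_zero_right]
    obtain ⟨δ, hδ⟩ : ∃ δ, δ = dressError B g s := ⟨_, rfl⟩
    have hδ0 : 0 ≤ δ := hδ ▸ dressError_nonneg B g s
    have h2 := hasSum_re_inner_snd z x
    rw [h0, zero_sub] at h2
    -- For the second components only approximate nonnegativity is needed; the positive contribution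
    -- of a sector is discarded.
    have h3 : ∀ a, -δ * ‖x.snd a‖ ^ 2 ≤ (⟪z.snd a, x.snd a⟫_ℂ).re := fun a => by
      have h4 := pow_mul_norm_sq_le_re_inner_dressL B g hs hs' hr (x.snd a) 0
      have h5 : (⟪z.snd a, x.snd a⟫_ℂ).re
          = (1 - s) * (⟪dressL B (g - ((1 - s : ℝ) : ℂ) • g) hr (x.snd a), x.snd a⟫_ℂ).re := by
        rw [hz3, inner_smul_left, Complex.conj_ofReal, Complex.re_ofReal_mul]
      rw [← hδ, pow_zero, one_mul] at h4
      rw [h5]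
      have h6 : 0 ≤ δ * ‖x.snd a‖ ^ 2 := by positivity
      nlinarith [sq_nonneg ‖(x.snd a) 0‖, hr.1, hr.2]
    have h4 : -δ * ‖x.snd‖ ^ 2 ≤ (-⟪z.fst, x.fst⟫_ℂ).re :=
      hasSum_le h3 ((hasSum_norm_snd_sq x).mul_left (-δ)) h2
    have h5 := pow_mul_norm_sq_le_re_inner_numL hr x.fst n
    have h6 : z.fst - numL hr x.fst
        = matL M (dressL B (g - ((1 - s : ℝ) : ℂ) • g) hr ψ - numL hr ψ) := by
      rw [hz2, x.fst_eq hM, ← matL_numL, map_sub, hψ]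
    have h7 : |(⟪z.fst - numL hr x.fst, x.fst⟫_ℂ).re| ≤ matNorm M * (δ * ‖ψ‖) * ‖x.fst‖ := by
      refine (Complex.abs_re_le_norm _).trans ((norm_inner_le_norm _ _).trans
        (mul_le_mul_of_nonneg_right ?_ (norm_nonneg _)))
      rw [h6]
      refine (norm_matL_le _ _).trans (mul_le_mul_of_nonneg_left ?_ (matNorm_nonneg M))
      rw [hδ]
      exact norm_dressL_sub_numL_le_dressError B g hs hs' hr ψ
    rw [inner_sub_left, Complex.sub_re, abs_le] at h7
    rw [Complex.neg_re] at h4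
    rw [← hδ]
    nlinarith [h7.1]
  refine FormDom.ext_formEmb hM ?_
  rw [formEmb_apply, hfst, map_zero, map_zero]

end Density

/-! ### Products of basis vectors form a core without interaction -/

section FreeCore

variable {X : Type*} [MeasurableSpace X] {μ : Measure X} [SigmaFinite μ] {d N : ℕ} {ι : Type*}
variable {ω : X → ℝ} {m : ℝ}

theorem mulBy_cut (hω : Measurable ω) (hpos : ∀ᵐ x ∂μ, 0 ≤ ω x) (R : ℕ) (u : Lp ℂ 2 μ) :
    MulBy ω ((cut ω hω R).op ℂ μ u) ((cutMul ω hω R).op ℂ μ u) := by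
  refine ((cutMul ω hω R).coeFn_op u).trans ?_
  filter_upwards [(cut ω hω R).coeFn_op u, hpos] with x h1 h2
  rw [h1, cutMul_eq hω R h2, smul_smul]
  push_cast
  rw [mul_comm]

/-- The form norm of a one boson vector. -/
theorem norm_sq_add_tsum_bandVec_le (hω : Measurable ω) (hm : 0 < m) (hpos : ∀ᵐ x ∂μ, m ≤ ω x)
    (e : HilbertBasis ι ℂ (Lp ℂ 2 μ)) {u : Lp ℂ 2 μ}
    (hu : MemLp (fun x => (Real.sqrt (ω x) : ℂ) • u x) 2 μ) :
    ‖u‖ ^ 2 + ∑' a, ‖⟪bandVec ω hω e a, u⟫_ℂ‖ ^ 2 ≤ (m⁻¹ + 1) * ‖hu.toLp‖ ^ 2 := by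
  have h1 := (summable_bandVec hω (hpos.mono fun _ hx => hm.le.trans hx) e hu.coeFn_toLp).2
  have h2 : ‖u‖ ≤ (Real.sqrt m)⁻¹ * ‖hu.toLp‖ := by
    refine Lp.norm_le_mul_norm_of_ae_le_mul ?_
    filter_upwards [hu.coeFn_toLp, hpos] with x h3 h4
    have h5 : 0 < Real.sqrt m := Real.sqrt_pos.2 hm
    rw [h3, norm_smul, Complex.norm_real, Real.norm_of_nonneg (Real.sqrt_nonneg _),
      le_inv_mul_iff₀ h5]
    exact mul_le_mul_of_nonneg_right (Real.sqrt_le_sqrt h4) (norm_nonneg _)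
  have h3 := pow_le_pow_left₀ (norm_nonneg _) h2 2
  rw [mul_pow, inv_pow, Real.sq_sqrt hm.le] at h3
  rw [add_mul, one_mul]
  exact add_le_add h3 h1

theorem IsFormCore.exists_approx {e : ι → Lp ℂ 2 μ} (hcore : IsFormCore e ω) (hω : Measurable ω)
    {u : Lp ℂ 2 μ} (hu : MemLp (fun x => (Real.sqrt (ω x) : ℂ) • u x) 2 μ) {ε : ℝ} (hε : 0 < ε) :
    ∃ χ ∈ Submodule.span ℂ (Set.range e),
      ∃ h : MemLp (fun x => (Real.sqrt (ω x) : ℂ) • (u - χ : Lp ℂ 2 μ) x) 2 μ, ‖h.toLp‖ ≤ ε := by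
  obtain ⟨χ, hχ, hlt⟩ := hcore u hu ε hε
  have hae : (fun x => (Real.sqrt (ω x) : ℂ) • (u - χ : Lp ℂ 2 μ) x)
      =ᵐ[μ] fun x => (Real.sqrt (ω x) : ℂ) * (u x - χ x) := by
    filter_upwards [Lp.coeFn_sub u χ] with x hx
    rw [hx]; rfl
  rw [← eLpNorm_congr_ae hae] at hlt
  have hmeas : AEStronglyMeasurable (fun x => (Real.sqrt (ω x) : ℂ) • (u - χ : Lp ℂ 2 μ) x) μ :=
    (Complex.measurable_ofReal.comp hω.sqrt).aestronglyMeasurable.smul (Lp.aestronglyMeasurable _)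
  have hL : MemLp (fun x => (Real.sqrt (ω x) : ℂ) • (u - χ : Lp ℂ 2 μ) x) 2 μ :=
    ⟨hmeas, hlt.trans ENNReal.ofReal_lt_top⟩
  refine ⟨χ, hχ, hL, ?_⟩
  rw [Lp.norm_toLp]
  exact ENNReal.toReal_le_of_le_ofReal hε.le hlt.le

theorem eq_zero_of_forall_sq_le {A b : ℝ} (hA : 0 ≤ A) (hb : 0 ≤ b)
    (h : ∀ ε : ℝ, 0 < ε → b ^ 2 ≤ A * ε ^ 2) : b = 0 := by
  by_contra hne
  have hb' : 0 < b := lt_of_le_of_ne hb (Ne.symm hne)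
  -- This choice of `ε` contradicts `b > 0` because `A < (A + 1)²`.
  have h1 := h (b / (A + 1)) (by positivity)
  rw [div_pow, ← mul_div_assoc, le_div_iff₀ (by positivity)] at h1
  have h2 : 0 < b ^ 2 := by positivity
  nlinarith [mul_nonneg hA h2.le, mul_nonneg (mul_nonneg hA hA) h2.le]

variable {B : Fin N → Matrix (Fin d) (Fin d) ℂ} {M M' : Matrix (Fin d) (Fin d) ℂ}
  {hω : Measurable ω}

/-- The factors of a product may be varied in the form domain of `ω` one after another. -/
theorem inner_eq_zero_of_mem_mixedSet (hm : 0 < m) (hpos : ∀ᵐ x ∂μ, m ≤ ω x)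
    (e : HilbertBasis ι ℂ (Lp ℂ 2 μ)) (hM : M * M' = 1) (hM' : M' * M = 1)
    (hcore : IsFormCore e ω)
    (he : ∀ i, MemLp (fun x => (Real.sqrt (ω x) : ℂ) • e i x) 2 μ)
    {x : FormDom B M' (bandVec ω hω e) 0}
    (hx : ∀ n, ∀ φ ∈ prodSet (Set.range e) n, ∀ y : FormDom B M' (bandVec ω hω e) 0,
      formEmb B M' (bandVec ω hω e) 0 y = fockSingle n φ → ⟪y, x⟫_ℂ = 0) (k n : ℕ) :
    ∀ φ ∈ mixedSet {u : Lp ℂ 2 μ | MemLp (fun x => (Real.sqrt (ω x) : ℂ) • u x) 2 μ}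
      (Set.range e) k n, ∀ y : FormDom B M' (bandVec ω hω e) 0,
      formEmb B M' (bandVec ω hω e) 0 y = fockSingle n φ → ⟪y, x⟫_ℂ = 0 := by
  have hVU : Set.range e ⊆ {u : Lp ℂ 2 μ | MemLp (fun x => (Real.sqrt (ω x) : ℂ) • u x) 2 μ} := by
    rintro _ ⟨i, rfl⟩; exact he i
  have hpos' : ∀ᵐ x ∂μ, 0 ≤ ω x := hpos.mono fun _ hx => hm.le.trans hx
  have hsU : ∀ u ∈ {u : Lp ℂ 2 μ | MemLp (fun x => (Real.sqrt (ω x) : ℂ) • u x) 2 μ},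
      Summable fun a => ‖⟪bandVec ω hω e a, u⟫_ℂ‖ ^ 2 := fun u hu =>
    (summable_bandVec hω hpos' e (MemLp.coeFn_toLp hu)).1
  induction k generalizing n with
  | zero => exact hx n
  | succ k ih =>
    cases n with
    | zero => exact fun φ _ => hx 0 φ trivial
    | succ n =>
      rintro φ ⟨u, hu, ψ, hψ, rfl⟩ y hy
      obtain ⟨C, hC, hbd⟩ := exists_formDom_creSector (B := B) hM'
        (inForm_of_mem_prodSet hsU (mixedSet_subset_prodSet hVU k n hψ))
      -- For a basis vector `χ` the product has only `k` unrestricted factors, so the induction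
      -- hypothesis applies; the statement is linear in `χ`.
      have hspan : ∀ χ ∈ Submodule.span ℂ (Set.range e), ∃ z : FormDom B M' (bandVec ω hω e) 0,
          formEmb B M' (bandVec ω hω e) 0 z = fockSingle (n + 1) (creSector χ n ψ)
            ∧ ⟪z, x⟫_ℂ = 0 := by
        intro χ hχ
        induction hχ using Submodule.span_induction with
        | mem χ h =>
          obtain ⟨z, hz, -⟩ := hbd χ (hsU χ (hVU h))
          exact ⟨z, hz, ih (n + 1) _ (creSector_mem_mixedSet hVU h hψ) z hz⟩
        | zero =>
          refine ⟨0, ?_, inner_zero_left _⟩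
          have h1 := creSector_smul (0 : ℂ) (0 : Lp ℂ 2 μ) n ψ
          rw [zero_smul, zero_smul] at h1
          have h2 := fockSingle_smul (μ := μ) (d := d) (n + 1) 0 0
          rw [zero_smul, zero_smul] at h2
          rw [h1, h2, map_zero]
        | add χ χ' _ _ h h' =>
          obtain ⟨z, hz, h0⟩ := h
          obtain ⟨z', hz', h0'⟩ := h'
          exact ⟨z + z', by rw [map_add, hz, hz', creSector_add, fockSingle_add], by
            rw [inner_add_left, h0, h0', add_zero]⟩
        | smul c χ _ h =>
          obtain ⟨z, hz, h0⟩ := h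
          exact ⟨c • z, by rw [map_smul, hz, creSector_smul, fockSingle_smul], by
            rw [inner_smul_left, h0, mul_zero]⟩
      -- Replace `u` by `χ` in the span, which contributes nothing. The error `a^*(u - χ) ψ` is
      -- small in form norm, since it is controlled by the form norm of `u - χ`.
      refine norm_eq_zero.1 (eq_zero_of_forall_sq_le (A := C * (m⁻¹ + 1) * ‖x‖ ^ 2)
        (by positivity) (norm_nonneg _) fun ε hε => ?_)
      obtain ⟨χ, hχ, hw, hwε⟩ := hcore.exists_approx hω hu hε
      obtain ⟨z, hz, hz0⟩ := hspan χ hχ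
      obtain ⟨z', hz', hb⟩ := hbd (u - χ) (hsU _ hw)
      have hyz : y = z' + z := FormDom.ext_formEmb hM (by
        rw [map_add, hy, hz, hz', ← fockSingle_add, ← creSector_add, sub_add_cancel])
      have h1 := norm_sq_add_tsum_bandVec_le hω hm hpos e hw
      have h2 : ‖z'‖ ^ 2 ≤ C * ((m⁻¹ + 1) * ε ^ 2) := by
        refine hb.trans (mul_le_mul_of_nonneg_left (h1.trans ?_) hC)
        exact mul_le_mul_of_nonneg_left (pow_le_pow_left₀ (norm_nonneg _) hwε 2) (by positivity)
      rw [hyz, inner_add_left, hz0, add_zero]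
      calc ‖⟪z', x⟫_ℂ‖ ^ 2 ≤ (‖z'‖ * ‖x‖) ^ 2 :=
            pow_le_pow_left₀ (norm_nonneg _) (norm_inner_le_norm _ _) 2
        _ = ‖z'‖ ^ 2 * ‖x‖ ^ 2 := mul_pow _ _ _
        _ ≤ C * ((m⁻¹ + 1) * ε ^ 2) * ‖x‖ ^ 2 := mul_le_mul_of_nonneg_right h2 (sq_nonneg _)
        _ = _ := by ring

theorem MulBy.re_inner_nonneg {α E : Type*} [MeasurableSpace α] [NormedAddCommGroup E]
    [InnerProductSpace ℂ E] {ν : Measure α} {W : α → ℝ} {F H : Lp E 2 ν} (h : MulBy W F H)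
    (hW : ∀ᵐ x ∂ν, 0 ≤ W x) : 0 ≤ (⟪H, F⟫_ℂ).re := by
  have h1 : ⟪H, F⟫_ℂ = ((∫ x, W x * ‖F x‖ ^ 2 ∂ν : ℝ) : ℂ) := by
    rw [L2.inner_def, ← integral_complex_ofReal]
    refine integral_congr_ae ?_
    filter_upwards [h] with x h1
    rw [h1, inner_smul_left, Complex.conj_ofReal, inner_self_eq_ofReal]
    push_cast; rfl
  rw [h1, Complex.ofReal_re]
  exact integral_nonneg_of_ae (hW.mono fun x hx => mul_nonneg hx (sq_nonneg _))

theorem crossMatrix_zero : crossMatrix B (0 : Fin N → Lp ℂ 2 μ) 0 = 0 := by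
  rw [crossMatrix]
  exact Finset.sum_eq_zero fun j _ => Finset.sum_eq_zero fun j' _ => by
    rw [Pi.zero_apply, inner_zero_left, zero_smul]

theorem creSum_zero (Ψ : Formal μ d) : creSum B 0 Ψ = 0 := by
  rw [creSum]
  refine Finset.sum_eq_zero fun j _ => ?_
  have h := cre_smul (0 : ℂ) (0 : Lp ℂ 2 μ) Ψ
  rw [zero_smul, zero_smul] at h
  rw [Pi.zero_apply, h, map_zero]

theorem annSum_zero (Ψ : Formal μ d) : annSum B 0 Ψ = 0 := by
  rw [annSum]
  refine Finset.sum_eq_zero fun j _ => ?_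
  have h := ann_smul (0 : ℂ) (0 : Lp ℂ 2 μ) Ψ
  rw [zero_smul, map_zero, zero_smul] at h
  rw [Pi.zero_apply, h, map_zero]

/-- Products of basis vectors are total in the form domain without interaction. -/
theorem eq_zero_of_inner_basis_products (hm : 0 < m) (hpos : ∀ᵐ x ∂μ, m ≤ ω x)
    (e : HilbertBasis ι ℂ (Lp ℂ 2 μ)) (hM : M * M' = 1) (hM' : M' * M = 1)
    (hcore : IsFormCore e ω)
    (he : ∀ i, MemLp (fun x => (Real.sqrt (ω x) : ℂ) • e i x) 2 μ)
    {x : FormDom B M' (bandVec ω hω e) 0}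
    (hx : ∀ n, ∀ φ ∈ prodSet (Set.range e) n, ∀ y : FormDom B M' (bandVec ω hω e) 0,
      formEmb B M' (bandVec ω hω e) 0 y = fockSingle n φ → ⟪y, x⟫_ℂ = 0) : x = 0 := by
  have hpos' : ∀ᵐ x ∂μ, 0 ≤ ω x := hpos.mono fun _ hx => hm.le.trans hx
  obtain ⟨ψ, hψ⟩ : ∃ ψ, ψ = formEmb B M' (bandVec ω hω e) 0 x := ⟨_, rfl⟩
  -- Orthogonality to all cut-off products is the weak equation with right-hand side zero and no
  -- interaction: `∑ᵢ ω(kᵢ) ψ = -M^* M ψ` in each sector.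
  have hψn : ∀ n, matSector M n (ψ n) = 0 := fun n => by
    have h1 : MulBy (fun k => ∑ i, ω (k i)) (ψ n : Lp (Spin d) 2 (powMeasure μ n))
        ((-mat (M.conjTranspose * M) ψ n : Sector μ d n) : Lp (Spin d) 2 (powMeasure μ n)) := by
      refine mulBy_of_inner_formDom (hω := hω) (M := M) hm hpos e hM hM' (f := 0) (g := 0)
        (fun j => MulBy.zero) x (ψ := ψ) (by rw [hψ]) (η := 0) (fun y R φ hφ hy => ?_) ?_
      · rw [inner_zero_right]
        refine inner_eq_zero_of_mem_mixedSet hm hpos e hM hM' hcore he hx n n φ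
          (prodSet_subset_mixedSet _ _ n (prodSet_mono ?_ n hφ)) y hy
        rintro _ ⟨u, rfl⟩
        exact memLp_sqrt_smul_of_mulBy hω hm hpos (mulBy_cut hω hpos' R u)
      · have h2 := mat_smul (μ := μ) (0 : ℂ) (0 : Matrix (Fin d) (Fin d) ℂ) ψ
        rw [zero_smul, zero_smul] at h2
        rw [crossMatrix_zero, creSum_zero, annSum_zero, h2]
        simp only [Pi.zero_apply, sub_zero, zero_sub]
    -- Paired with `ψ`, the left side is nonnegative and the right side is `-‖M ψ‖²`.
    have h2 := h1.re_inner_nonneg ((ae_forall_coord hpos' n).mono fun k hk =>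
      Finset.sum_nonneg fun i _ => hk i)
    rw [← Submodule.coe_inner, inner_neg_left, mat_apply, matSector_mul, ← inner_conj_symm,
      ← inner_matSector_left, inner_self_eq_ofReal, Complex.conj_ofReal, Complex.neg_re,
      Complex.ofReal_re] at h2
    exact norm_eq_zero.1 (pow_eq_zero_iff two_ne_zero |>.1
      (le_antisymm (by linarith) (sq_nonneg _)))
  have h0 : ψ = 0 := by
    refine lp.ext (funext fun n => ?_)
    have h1 := congrArg (matSector M' n) (hψn n)
    rw [map_zero, ← matSector_mul, hM', matSector_one] at h1
    exact h1
  exact FormDom.ext_formEmb hM (by rw [← hψ, h0, map_zero])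

end FreeCore

/-! ### The renormalized Hamiltonian -/

section Renormalized

variable {X : Type*} [MeasurableSpace X] {μ : Measure X} [SigmaFinite μ] {d N : ℕ} {ι : Type*}

/-- A Hermitian matrix has a shift of the form `M^* M` with `M` invertible. -/
theorem exists_shift_eq_conjTranspose_mul_self {K : Matrix (Fin d) (Fin d) ℂ} (hK : K.IsHermitian) :
    ∃ (c : ℝ) (M M' : Matrix (Fin d) (Fin d) ℂ), M * M' = 1 ∧ M' * M = 1 ∧
      M.conjTranspose * M = K + (c : ℂ) • 1 := by
  obtain ⟨U, hU⟩ : ∃ U : Matrix (Fin d) (Fin d) ℂ, U = hK.eigenvectorUnitary := ⟨_, rfl⟩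
  have hU1 : star U * U = 1 := by rw [hU]; exact Unitary.coe_star_mul_self _
  have hU2 : U * star U = 1 := by rw [hU]; exact Unitary.coe_mul_star_self _
  have hspec : K = U * Matrix.diagonal (fun i => (hK.eigenvalues i : ℂ)) * star U := by
    have h := hK.spectral_theorem
    rw [Unitary.conjStarAlgAut_apply, ← hU] at h
    exact h
  -- Any `c` exceeding all `-λᵢ` would do; the summand `1` makes the shifted eigenvalues strictly
  -- positive.
  obtain ⟨c, hc⟩ : ∃ c : ℝ, c = 1 + ∑ i, |hK.eigenvalues i| := ⟨_, rfl⟩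
  have hpos : ∀ i, 0 < hK.eigenvalues i + c := fun i => by
    have h1 := Finset.single_le_sum (f := fun i => |hK.eigenvalues i|) (fun j _ => abs_nonneg _)
      (Finset.mem_univ i)
    have h2 := neg_abs_le (hK.eigenvalues i)
    rw [hc]
    linarith
  obtain ⟨q, hq⟩ : ∃ q : Fin d → ℝ, q = fun i => Real.sqrt (hK.eigenvalues i + c) := ⟨_, rfl⟩
  have hq0 : ∀ i, (q i : ℂ) ≠ 0 := fun i => by
    rw [hq]; exact Complex.ofReal_ne_zero.2 (Real.sqrt_pos.2 (hpos i)).ne'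
  have hqq : ∀ i, (q i : ℂ) * q i = hK.eigenvalues i + c := fun i => by
    rw [hq, ← Complex.ofReal_mul, Real.mul_self_sqrt (hpos i).le, Complex.ofReal_add]
  have hd : Matrix.diagonal (fun i => (q i : ℂ)) * Matrix.diagonal (fun i => (q i : ℂ)⁻¹) = 1 := by
    rw [Matrix.diagonal_mul_diagonal, ← Matrix.diagonal_one]
    congr 1
    funext i
    exact mul_inv_cancel₀ (hq0 i)
  have hd' : Matrix.diagonal (fun i => (q i : ℂ)⁻¹) * Matrix.diagonal (fun i => (q i : ℂ)) = 1 := by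
    rw [Matrix.diagonal_mul_diagonal, ← Matrix.diagonal_one]
    congr 1
    funext i
    exact inv_mul_cancel₀ (hq0 i)
  refine ⟨c, Matrix.diagonal (fun i => (q i : ℂ)) * star U,
    U * Matrix.diagonal (fun i => (q i : ℂ)⁻¹), ?_, ?_, ?_⟩
  · rw [Matrix.mul_assoc, ← Matrix.mul_assoc (star U), hU1, Matrix.one_mul, hd]
  · rw [Matrix.mul_assoc, ← Matrix.mul_assoc (Matrix.diagonal fun i => (q i : ℂ)⁻¹), hd',
      Matrix.one_mul, hU2]
  · have h1 : (Matrix.diagonal (fun i => (q i : ℂ))).conjTranspose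
        = Matrix.diagonal (fun i => (q i : ℂ)) := by
      rw [Matrix.diagonal_conjTranspose]
      congr 1
      funext i
      exact Complex.conj_ofReal _
    have h2 : Matrix.diagonal (fun i => (q i : ℂ)) * Matrix.diagonal (fun i => (q i : ℂ))
        = Matrix.diagonal (fun i => (hK.eigenvalues i : ℂ)) + (c : ℂ) • 1 := by
      rw [Matrix.diagonal_mul_diagonal, Matrix.smul_one_eq_diagonal, Matrix.diagonal_add]
      congr 1
      funext i
      exact hqq i
    rw [Matrix.conjTranspose_mul, ← Matrix.star_eq_conjTranspose (star U), star_star, h1,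
      Matrix.mul_assoc, ← Matrix.mul_assoc (Matrix.diagonal fun i => (q i : ℂ)), h2,
      Matrix.add_mul, Matrix.mul_add, ← Matrix.mul_assoc, ← hspec, Matrix.smul_mul,
      Matrix.one_mul, Matrix.mul_smul, hU2]

variable {ω : X → ℝ} {m : ℝ}

theorem memLp_div (hω : Measurable ω) (hm : 0 < m) (hpos : ∀ᵐ x ∂μ, m ≤ ω x)
    (f : Lp ℂ 2 μ) : MemLp (fun k => f k / (ω k : ℂ)) 2 μ := by
  refine (Lp.memLp f).of_le_mul (c := m⁻¹) ?_ ?_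
  · exact ((Lp.aestronglyMeasurable f).aemeasurable.div
      (Complex.measurable_ofReal.comp hω).aemeasurable).aestronglyMeasurable
  · filter_upwards [hpos] with x hx
    rw [norm_div, Complex.norm_real, Real.norm_of_nonneg (hm.le.trans hx), div_eq_inv_mul]
    exact mul_le_mul_of_nonneg_right (inv_anti₀ hm hx) (norm_nonneg _)

theorem mulBy_div (hm : 0 < m) (hpos : ∀ᵐ x ∂μ, m ≤ ω x) (f : Lp ℂ 2 μ)
    (hf : MemLp (fun k => f k / (ω k : ℂ)) 2 μ) : MulBy ω hf.toLp f := by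
  unfold MulBy
  filter_upwards [hf.coeFn_toLp, hpos] with x h1 h2
  have h3 : (ω x : ℂ) ≠ 0 := Complex.ofReal_ne_zero.2 (hm.trans_le h2).ne'
  rw [h1, smul_eq_mul, mul_div_cancel₀ _ h3]

variable {B : Fin N → Matrix (Fin d) (Fin d) ℂ} {M M' : Matrix (Fin d) (Fin d) ℂ}
  {hω : Measurable ω}

/-- The range contains the test domain, which is already dense in Fock space by
`eq_zero_of_inner_dressing`. No square integrability of `ω g` is required. -/
theorem denseRange_formEmb (hB : ∀ j j', Commute (B j) (B j')) (hm : 0 < m)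
    (hpos : ∀ᵐ x ∂μ, m ≤ ω x) (hM' : M' * M = 1) (e : HilbertBasis ι ℂ (Lp ℂ 2 μ))
    {w : ι → Lp ℂ 2 μ} (hw : ∀ i, MulBy ω (e i) (w i)) (g : Fin N → Lp ℂ 2 μ) :
    DenseRange (formEmb B M' (bandVec ω hω e) g) := by
  refine denseRange_of_inner_eq_zero (formEmb B M' (bandVec ω hω e) g).toLinearMap fun η hη => ?_
  refine eq_zero_of_inner_dressing hB g (eq_zero_of_inner_hilbertBasis e) fun n φ hφ Ψ hΨ => ?_
  obtain ⟨x, rfl⟩ := exists_formDom_testDomain (M := M) (M' := M') (hω := hω) (g := g) hB hM' hm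
    hpos e hw (Ψ := Ψ) (mem_testDomain_iff.2 (by
      rw [hΨ]; exact dressing_single_mem_formalDomain e B g hφ))
  exact hη x

/-- The closed form restricts on the test domain to the form of the test Hamiltonian, so the
remaining point is form density of the test domain. -/
theorem isFriedrichsExtension_testHamiltonian (hB : ∀ j j', Commute (B j) (B j')) (hm : 0 < m)
    (hpos : ∀ᵐ x ∂μ, m ≤ ω x) {K : Matrix (Fin d) (Fin d) ℂ} {c : ℝ} (hM : M * M' = 1)
    (hM' : M' * M = 1) (hMK : M.conjTranspose * M = K + (c : ℂ) • 1)
    (e : HilbertBasis ι ℂ (Lp ℂ 2 μ)) (hcore : IsFormCore e ω) {w : ι → Lp ℂ 2 μ}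
    (hw : ∀ i, MulBy ω (e i) (w i)) (g : Fin N → Lp ℂ 2 μ) {A : Fock μ d →ₗ.[ℂ] Fock μ d}
    (hA : HasShiftedInverse A c (formResolvent (formEmb B M' (bandVec ω hω e) g))) :
    IsFriedrichsExtension (testHamiltonian e ω K B g) A := by
  have hdom := testHamiltonian_domain (g := g) hB e hw K
  have hex : ∀ Ψ : (testHamiltonian e ω K B g).domain,
      ∃ x : FormDom B M' (bandVec ω hω e) g, formEmb B M' (bandVec ω hω e) g x = Ψ := fun Ψ =>
    exists_formDom_testDomain hB hM' hm hpos e hw (by rw [← hdom]; exact Ψ.2)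
  choose T hT using hex
  obtain ⟨Θ, hΘ⟩ : ∃ Θ : (testHamiltonian e ω K B g).domain →ₗ[ℂ] FormDom B M' (bandVec ω hω e) g,
      ∀ Ψ, formEmb B M' (bandVec ω hω e) g (Θ Ψ) = Ψ :=
    ⟨{ toFun := T
       map_add' := fun Ψ Φ => FormDom.ext_formEmb hM (by rw [map_add, hT, hT, hT]; rfl)
       map_smul' := fun c Ψ => FormDom.ext_formEmb hM (by
        rw [RingHom.id_apply, map_smul, hT, hT]; rfl) }, hT⟩
  refine isFriedrichsExtension_of_form Θ hΘ
    (fun x Ψ => inner_formDom_testHamiltonian hB hM hm hpos e hw hMK x (Θ Ψ) Ψ (hΘ Ψ)) ?_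
    (denseRange_formEmb hB hm hpos hM' e hw g) hA
  refine denseRange_of_inner_eq_zero Θ fun x hx => ?_
  -- Basis products are total in the free form domain by the form core hypothesis, and transport
  -- carries this to `g`.
  refine eq_zero_of_inner_transport hB hM hM'
    (S := {y | ∃ n, ∃ φ ∈ prodSet (Set.range e) n,
      formEmb B M' (bandVec ω hω e) 0 y = fockSingle n φ}) g (fun x₀ hx₀ => ?_) ?_
  · exact eq_zero_of_inner_basis_products hm hpos e hM hM' hcore
      (fun i => memLp_sqrt_smul_of_mulBy hω hm hpos (hw i))
      fun n φ hφ y hy => hx₀ y ⟨n, φ, hφ, hy⟩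
  · rintro y ⟨n, φ, hφ, hy⟩ r hr z hz
    -- A transported basis product is `r^n` times a dressed test vector, hence still in the test
    -- domain.
    have hmem : formEmb B M' (bandVec ω hω e) g z ∈ testDomain e B g := by
      rw [mem_testDomain_iff, hz, hy, coe_dressL, dressPow_apply, coe_fockSingle, numPow_single,
        map_smul]
      exact Submodule.smul_mem _ _ (dressing_single_mem_formalDomain e B g hφ)
    rw [← hdom] at hmem
    have hzΘ : z = Θ ⟨_, hmem⟩ := FormDom.ext_formEmb hM (hΘ ⟨_, hmem⟩).symm
    rw [hzΘ]
    exact hx _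

end Renormalized

end SpinBoson

end

/-! ### Self-adjointness and norm resolvent convergence -/

theorem theorem2p6 {X : Type*} [MeasurableSpace X] (μ : Measure X) [SigmaFinite μ] (d N : ℕ)
    -- the dispersion relation, with a positive boson mass
    (ω : X → ℝ) (hω : Measurable ω) (m : ℝ) (hm : 0 < m) (hωm : ∀ᵐ k ∂μ, m ≤ ω k)
    -- the spin matrices
    (K : Matrix (Fin d) (Fin d) ℂ) (hK : K.IsHermitian)
    (B : Fin N → Matrix (Fin d) (Fin d) ℂ) (hB : ∀ j j', Commute (B j) (B j'))
    -- the form factors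
    (f : Fin N → X → ℂ) (hf : ∀ j, Measurable (f j))
    (hfω : ∀ j, MemLp (fun k => f j k / (ω k : ℂ)) 2 μ)
    -- the cut-off form factors
    (fΛ : ℕ → Fin N → Lp ℂ 2 μ)
    (hΛ : ∀ j, Tendsto (fun Λ =>
      eLpNorm (fun k => fΛ Λ j k / (ω k : ℂ) - f j k / (ω k : ℂ)) 2 μ) atTop (𝓝 0))
    -- the orthonormal basis, contained in the domain of `ω`
    {ι : Type*} (e : HilbertBasis ι ℂ (Lp ℂ 2 μ))
    (he : ∀ i, MemLp (fun k => (ω k : ℂ) * e i k) 2 μ) (hcore : IsFormCore e ω) :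
    -- the dressed test vectors are well defined
    (∀ (l : List ι) (v : Spin d),
      Memℓp (testVector e B (fun j => (hfω j).toLp) l v) 2) ∧
    -- the renormalized Hamiltonian is well defined on the test domain
    (testHamiltonian e ω K B (fun j => (hfω j).toLp)).domain =
      testDomain (d := d) e B (fun j => (hfω j).toLp) ∧
    -- the cut-off Hamiltonians are self-adjoint
    (∀ Λ, IsSelfAdjoint
      (regularHamiltonian ω K B (fΛ Λ) - maxOp (mat (selfEnergy ω B (fΛ Λ))))) ∧
    -- the renormalized Hamiltonian and convergence to it
    ∃ H : Fock μ d →ₗ.[ℂ] Fock μ d,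
      IsFriedrichsExtension (testHamiltonian e ω K B (fun j => (hfω j).toLp)) H ∧
      IsSelfAdjoint H ∧
      NormResolventTendsto (fun Λ =>
        regularHamiltonian ω K B (fΛ Λ) - maxOp (mat (selfEnergy ω B (fΛ Λ)))) H := by
  -- `K` does not depend on the cut-off, so one shift and one factorization serve for all the
  -- operators and for the limit.
  obtain ⟨c, M, M', hM, hM', hMK⟩ := exists_shift_eq_conjTranspose_mul_self hK
  have hw : ∀ i, MulBy ω (e i) (he i).toLp := fun i => (he i).coeFn_toLp
  have hgf : ∀ Λ j, MulBy ω (memLp_div hω hm hωm (fΛ Λ j)).toLp (fΛ Λ j) := fun Λ j =>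
    mulBy_div hm hωm (fΛ Λ j) _
  have hinv : ∀ Λ, HasShiftedInverse
      (regularHamiltonian ω K B (fΛ Λ) - maxOp (mat (selfEnergy ω B (fΛ Λ)))) c
      (formResolvent (formEmb B M' (bandVec ω hω e)
        fun j => (memLp_div hω hm hωm (fΛ Λ j)).toLp)) := fun Λ =>
    hasShiftedInverse_regularHamiltonian hK hm hωm e hM hM' hMK (hgf Λ)
  have hdense : ∀ g : Fin N → Lp ℂ 2 μ, DenseRange (formEmb B M' (bandVec ω hω e) g) :=
    denseRange_formEmb hB hm hωm hM' e hw
  -- The renormalized Hamiltonian is obtained as the operator of the closed form for `g = f / ω`,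
  -- and is then recognised as the Friedrichs extension.
  have hH := hasShiftedInverse_ofShiftedInverse
    (formResolvent_injective (hdense fun j => (hfω j).toLp)) c
  refine ⟨memℓp_testVector e B _, testHamiltonian_domain hB e hw K, fun Λ =>
    (hinv Λ).isSelfAdjoint (formResolvent_isSelfAdjoint _) (formResolvent_injective (hdense _)),
    _, isFriedrichsExtension_testHamiltonian hB hm hωm hM hM' hMK e hcore hw _ hH,
    hH.isSelfAdjoint (formResolvent_isSelfAdjoint _) (formResolvent_injective (hdense _)),
    normResolventTendsto_of_hasShiftedInverse hinv hH (fun Λ => formResolvent_isSelfAdjoint _)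
      (formResolvent_isSelfAdjoint _) (tendsto_formResolvent hB hM hM' hm hωm e fun j => ?_)⟩
  exact (Lp.tendsto_Lp_iff_tendsto_eLpNorm'' _ (fun Λ => memLp_div hω hm hωm (fΛ Λ j)) _
    (hfω j)).2 (hΛ j)
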